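/- **Setting.** Let $k,d$ be positive integers whose ratio $\alpha=d/k$ satisfies $(2^{k-1}-2)\log 2\le\alpha\le 2^{k-1}\log 2$, let $\lambda\in[0,1]$ and $T\in\{1,2,\dots\}\cup\{\infty\}$. *Messages.* A message is an isomorphism class of rooted trees with some edges labelled $0$ or $1$. Write $0,1$ for a single labelled edge, $\square$ for a single unlabelled edge, and $\mathsf{join}$ for identifying the roots of a tuple of trees and attaching a new root edge. The free messages are generated as follows: $\dot\Omega_{\mathtt f}$ consists of the joins of $d-1$ elements of $\hat\Omega_{\mathtt f}$; $\hat\Omega_{\mathtt f}$ consists of $\square$ and of the joins of $k-1$ elements of $\{x\}\cup\dot\Omega_{\mathtt f}$ ($x\in\{0,1\}$) that are not all equal to $x$. For a tuple in $\{0,1\}\cup\dot\Omega_{\mathtt f}$ let $\hat{\mathtt T}$ of it be $0$ if all entries are $1$; $1$ if all entries are $0$; $\square$ if both $0$ and $1$ occur; and the join otherwise. Put $\dot m(x)=\hat m(x)=x$ for $x\in\{0,1\}$, $\hat m(\square)=\frac12$, $\hat z(\square)=2$, and recursively, for a join $\dot\tau$ of $\hat\tau_1,\dots,\hat\tau_{d-1}$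 and a join $\hat\tau$ of $\dot\tau_1,\dots,\dot\tau_{k-1}$, $$\dot z(\dot\tau)=\prod_i\hat m(\hat\tau_i)+\prod_i(1-\hat m(\hat\tau_i)),\quad \dot m(\dot\tau)=\frac{\prod_i\hat m(\hat\tau_i)}{\dot z(\dot\tau)},\quad \hat z(\hat\tau)=2-\prod_i\dot m(\dot\tau_i)-\prod_i(1-\dot m(\dot\tau_i)),\quad \hat m(\hat\tau)=\frac{1-\prod_i\dot m(\dot\tau_i)}{\hat z(\hat\tau)}.$$ *Colors.* Let $\dot\Omega=\{\mathtt r_0,\mathtt r_1,\mathtt b_0,\mathtt b_1\}\cup\dot\Omega_{\mathtt f}$, $\hat\Omega=\{\mathtt r_0,\mathtt r_1,\mathtt b_0,\mathtt b_1\}\cup\hat\Omega_{\mathtt f}$, $\Omega=\{\mathtt r_0,\mathtt r_1,\mathtt b_0,\mathtt b_1\}\cup(\dot\Omega_{\mathtt f}\times\hat\Omega_{\mathtt f})$. A color $\sigma\in\Omega$ has components $\dot\sigma,\hat\sigma$, equal to $\sigma$ itself if $\sigma$ is red ($\mathtt r=\{\mathtt r_0,\mathtt r_1\}$) or blue ($\mathtt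 b=\{\mathtt b_0,\mathtt b_1\}$). Let $|\sigma|$ be the number of free variables (variable vertices other than leaves and roots) in the two trees of $\sigma$, and $|\sigma|=0$ if $\sigma$ is red or blue. Let $\Omega_T=\{\sigma\in\Omega:|\sigma|\le T\}$, with projection $\dot\Omega_T$ to $\dot\Omega$. Put $\dot m(\mathtt r_x)=\dot m(\mathtt b_x)=x$. Adding $1$ to a spin negates its index or all its edge labels. A tuple $(\sigma_1,\dots,\sigma_d)\in\Omega^d$ is valid at a variable if, for some $x$, all $\sigma_i\in\{\mathtt r_x,\mathtt b_x\}$ with at least one equal to $\mathtt r_x$, or if all $\sigma_i$ are free with $\dot\sigma_i=\mathsf{join}(\hat\sigma_j)_{j\ne i}$ for every $i$. A tuple $(\sigma_1,\dots,\sigma_k)\in\Omega^k$ is valid at a clause if some $\sigma_i=\mathtt r_x$ and all others equal $\mathtt b_{1-x}$, or if there is no red entry, there are no $i,x$ with $\sigma_j=\mathtt b_x$ for all $j\ne i$, and every free $\sigma_i$ satisfies $\hat\sigma_i=\hat{\mathtt T}((\dot\sigma_j)_{j\ne i})$, where $\mathtt b_x$ is read as the message $x$. *Belief propagation for pairs.*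 Let $\dot w(\dot\sigma;\hat\sigma_2,\dots,\hat\sigma_d)$ be $0$ unless there is a tuple in $(\Omega_T)^d$ valid at a variable whose first entry has first component $\dot\sigma$ and whose other entries have second components $\hat\sigma_i$; in that case it is $1$ if $\dot\sigma$ is red or blue and $\dot z(\dot\sigma)^\lambda$ if it is free. Let $\hat w(\hat\sigma;\dot\sigma_2,\dots,\dot\sigma_k)$ be $0$ unless there is a tuple in $(\Omega_T)^k$ valid at a clause whose first entry has second component $\hat\sigma$ and whose other entries have first components $\dot\sigma_i$; in that case it is $1$ if $\hat\sigma$ is red, $\hat z(\hat\sigma)^\lambda$ if it is free, $(1-\prod_i\dot m(\dot\sigma_i))^\lambda$ if $\hat\sigma=\mathtt b_1$, and $(1-\prod_i(1-\dot m(\dot\sigma_i)))^\lambda$ if $\hat\sigma=\mathtt b_0$. For a probability measure $\dot q$ on $\dot\Omega^2$ let $\mathtt{BP}\,\dot q=\dot{\mathtt{BP}}(\hat{\mathtt{BP}}\,\dot q)$, where, up to normalization to probability measures, $$(\hat{\mathtt{BP}}\,\dot q)(\hat\sigma^1,\hat\sigma^2)\propto 2^{-k}\sum_{L\in\{0,1\}^k}\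 \sum_{(\dot\sigma_i)_{i\ge 2}}\ \prod_{j=1,2}\hat w\big(L_1\oplus\hat\sigma^j;(L_i\oplus\dot\sigma_i^j)_{i\ge2}\big)\prod_{i=2}^k\dot q(\dot\sigma^1_i,\dot\sigma^2_i),$$ $$(\dot{\mathtt{BP}}\,\hat q)(\dot\sigma^1,\dot\sigma^2)\propto\sum_{(\hat\sigma_i)_{i\ge2}}\ \prod_{j=1,2}\dot w\big(\dot\sigma^j;(\hat\sigma_i^j)_{i\ge2}\big)\prod_{i=2}^d\hat q(\hat\sigma^1_i,\hat\sigma^2_i).$$ *The sets $\Gamma(c,\kappa)$.* Fix $C>0$. Let $\Gamma(c,\kappa)$ be the set of probability measures $q$ on $\dot\Omega^2$, supported on $(\dot\Omega_T)^2$, with $q(\dot\sigma^1,\dot\sigma^2)=q(\dot\sigma^1\oplus1,\dot\sigma^2\oplus1)$, such that, writing $\mathtt f=\dot\Omega_{\mathtt f}$ and $\mathtt r[\dot\sigma]$ for the number of red coordinates of $\dot\sigma\in\dot\Omega^2$: (a) $\sum_{\dot\sigma\notin\mathtt b\times\mathtt b}2^{-k\,\mathtt r[\dot\sigma]}q(\dot\sigma)\le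 C2^{-k}q(\mathtt b\mathtt b)$ and $|q(\mathtt b_0\mathtt b_0)-q(\mathtt b_0\mathtt b_1)|\le (k^9/2^{ck})\,q(\mathtt b\mathtt b)$; (b) $q(\mathtt r\mathtt f\cup\mathtt f\mathtt r)\le C2^{-\kappa k}q(\mathtt b\mathtt b)$ and $q(\mathtt r\mathtt r)\le C2^{(1-\kappa)k}q(\mathtt b\mathtt b)$; (c) $q(\mathtt r_x\dot\sigma)\ge(1-C2^{-k})q(\mathtt b_x\dot\sigma)$ and $q(\dot\sigma\mathtt r_x)\ge(1-C2^{-k})q(\dot\sigma\mathtt b_x)$ for all $x\in\{0,1\}$ and $\dot\sigma\in\dot\Omega$. **Proposition.** There is an absolute constant $C_0>0$ such that for every $C\ge C_0$ there are $A$ and $k_1$, depending only on $C$, with the following properties. (i) For all $k\ge k_1$, all $d$ as above, all $\lambda\in[0,1]$ and $1\le T\le\infty$, there is a unique $\dot q_\star\in\Gamma(1,1)$ with $\mathtt{BP}\,\dot q_\star=\dot q_\star$. (ii) For every $c\in(0,1]$ there is $k_0=k_0(c)\ge k_1$, depending only on $c$ and $C$, such that for all $k\ge k_0$, all $d$ as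 above, all $\lambda\in[0,1]$ and $1\le T\le\infty$: if $\dot q\in\Gamma(c,1)$, then $\mathtt{BP}\,\dot q\in\Gamma(1,1)$ and $$\|\mathtt{BP}\,\dot q-\dot q_\star\|_1\le A\,\frac{k^4}{2^k}\,\|\dot q-\dot q_\star\|_1;$$ moreover $\mathtt{BP}$ has no fixed point in $\Gamma(c,1)$ other than $\dot q_\star$. -/

import Mathlib

namespace NaeSat

noncomputable section

/-- Ordered representatives of the rooted message trees: a single edge carrying a boolean label, a
single unlabelled edge, or the join of `n` trees (their roots are identified and a new root edge is
attached). Variables and clauses alternate along the levels, so the type of the root need not be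
recorded. -/
inductive OTree : Type
  | lit (x : Bool) : OTree
  | box : OTree
  | join (n : ℕ) (s : Fin n → OTree) : OTree

/-- Isomorphism of rooted trees respecting the edge labels: the branches may be permuted. -/
inductive OTree.Iso : OTree → OTree → Prop
  | lit (x : Bool) : OTree.Iso (OTree.lit x) (OTree.lit x)
  | box : OTree.Iso OTree.box OTree.box
  | join {n : ℕ} {s t : Fin n → OTree} (e : Equiv.Perm (Fin n))
      (h : ∀ i, OTree.Iso (s i) (t (e i))) : OTree.Iso (OTree.join n s) (OTree.join n t)

theorem OTree.Iso.refl (a : OTree) : OTree.Iso a a := by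
  induction a with
  | lit x => exact .lit x
  | box => exact .box
  | join n s ih => exact .join (Equiv.refl _) ih

theorem OTree.Iso.symm {a b : OTree} (h : OTree.Iso a b) : OTree.Iso b a := by
  induction h with
  | lit x => exact .lit x
  | box => exact .box
  | @join n s t e h ih =>
    refine .join e.symm fun i => ?_
    have := ih (e.symm i)
    rwa [Equiv.apply_symm_apply] at this

theorem OTree.Iso.trans {a b c : OTree} (h : OTree.Iso a b) (h' : OTree.Iso b c) :
    OTree.Iso a c := by
  induction h generalizing c with
  | lit x => exact h'
  | box => exact h'
  | @join n s t e h ih =>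
    cases h' with
    | join e' h'' => exact .join (e.trans e') fun i => ih i (h'' (e i))

instance OTree.setoid : Setoid OTree where
  r := OTree.Iso
  iseqv := ⟨OTree.Iso.refl, OTree.Iso.symm, OTree.Iso.trans⟩

/-- Messages: isomorphism classes of rooted trees. -/
abbrev Msg : Type := Quotient OTree.setoid

namespace Msg

/-- The message `0` or `1`: a single labelled edge. -/
def lit (x : Bool) : Msg := ⟦OTree.lit x⟧

/-- The message consisting of a single unlabelled edge. -/
def box : Msg := ⟦OTree.box⟧

/-- The join of finitely many messages. -/
def join {n : ℕ} (s : Fin n → Msg) : Msg := ⟦OTree.join n fun i => (s i).out⟧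

theorem join_mk {n : ℕ} (s : Fin n → OTree) :
    join (fun i => (⟦s i⟧ : Msg)) = ⟦OTree.join n s⟧ :=
  Quotient.sound (OTree.Iso.join (Equiv.refl _) fun i => Quotient.mk_out (s i))

end Msg

/-- The tail of a directed edge: a message is sent either by a variable or by a clause. -/
inductive Side : Type
  | var : Side
  | cls : Side

/-- The probability of the value `1` encoded by a message that is sent by a variable, resp. by a
clause. (A variable never sends the unlabelled edge; the value there is irrelevant.) -/
def OTree.prob : Side → OTree → ℝ
  | _, .lit x => if x then 1 else 0
  | _, .box => 1 / 2
  | .var, .join _ s =>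
      (∏ i, OTree.prob .cls (s i)) /
        ((∏ i, OTree.prob .cls (s i)) + ∏ i, (1 - OTree.prob .cls (s i)))
  | .cls, .join _ s =>
      (1 - ∏ i, OTree.prob .var (s i)) /
        (2 - (∏ i, OTree.prob .var (s i)) - ∏ i, (1 - OTree.prob .var (s i)))

/-- The normalizing constants of the recursions for the encoded probabilities (`1` for labelled
edges). The unlabelled edge comes from a clause seeing both `0` and `1`, so both products in
`2 - ∏ - ∏` vanish and its constant is `2`. -/
def OTree.norm : Side → OTree → ℝ
  | _, .lit _ => 1
  | _, .box => 2
  | .var, .join _ s => (∏ i, OTree.prob .cls (s i)) + ∏ i, (1 - OTree.prob .cls (s i))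
  | .cls, .join _ s =>
      2 - (∏ i, OTree.prob .var (s i)) - ∏ i, (1 - OTree.prob .var (s i))

/-- The number of free variables of a message tree: the internal vertices which are variables,
the root not being counted. -/
def OTree.size : Side → OTree → ℕ
  | _, .lit _ => 0
  | _, .box => 0
  | .var, .join _ s => 1 + ∑ i, OTree.size .cls (s i)
  | .cls, .join _ s => ∑ i, OTree.size .var (s i)

/-- Negation of all edge labels of a tree. -/
def OTree.neg : OTree → OTree
  | .lit x => .lit (!x)
  | .box => .box
  | .join n s => .join n fun i => OTree.neg (s i)

theorem OTree.Iso.prob_eq {a b : OTree} (h : OTree.Iso a b) (z : Side) :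
    a.prob z = b.prob z := by
  induction h generalizing z with
  | lit x => rfl
  | box => rfl
  | @join n s t e h ih =>
    cases z <;> simp only [OTree.prob, ih]
    · rw [Equiv.prod_comp e (fun i => OTree.prob .cls (t i)),
        Equiv.prod_comp e (fun i => 1 - OTree.prob .cls (t i))]
    · rw [Equiv.prod_comp e (fun i => OTree.prob .var (t i)),
        Equiv.prod_comp e (fun i => 1 - OTree.prob .var (t i))]

theorem OTree.Iso.norm_eq {a b : OTree} (h : OTree.Iso a b) (z : Side) :
    a.norm z = b.norm z := by
  cases h with
  | lit x => rfl
  | box => rfl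
  | @join n s t e h =>
    cases z <;> simp only [OTree.norm, (h _).prob_eq]
    · rw [Equiv.prod_comp e (fun i => OTree.prob .cls (t i)),
        Equiv.prod_comp e (fun i => 1 - OTree.prob .cls (t i))]
    · rw [Equiv.prod_comp e (fun i => OTree.prob .var (t i)),
        Equiv.prod_comp e (fun i => 1 - OTree.prob .var (t i))]

theorem OTree.Iso.size_eq {a b : OTree} (h : OTree.Iso a b) (z : Side) :
    a.size z = b.size z := by
  induction h generalizing z with
  | lit x => rfl
  | box => rfl
  | @join n s t e h ih =>
    cases z <;> simp only [OTree.size, ih]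
    · rw [Equiv.sum_comp e (fun i => OTree.size .cls (t i))]
    · rw [Equiv.sum_comp e (fun i => OTree.size .var (t i))]

theorem OTree.Iso.neg_iso {a b : OTree} (h : OTree.Iso a b) : OTree.Iso a.neg b.neg := by
  induction h with
  | lit x => exact .lit _
  | box => exact .box
  | @join n s t e h ih => exact .join e ih

namespace Msg

/-- `ṁ` (for `Side.var`) and `m̂` (for `Side.cls`). -/
def prob (z : Side) (m : Msg) : ℝ :=
  Quotient.lift (OTree.prob z) (fun _ _ h => OTree.Iso.prob_eq h z) m

/-- `ż` (for `Side.var`) and `ẑ` (for `Side.cls`). -/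
def norm (z : Side) (m : Msg) : ℝ :=
  Quotient.lift (OTree.norm z) (fun _ _ h => OTree.Iso.norm_eq h z) m

/-- The number of free variables. -/
def size (z : Side) (m : Msg) : ℕ :=
  Quotient.lift (OTree.size z) (fun _ _ h => OTree.Iso.size_eq h z) m

/-- Negation of all edge labels of a message. -/
def neg (m : Msg) : Msg :=
  Quotient.map OTree.neg (fun _ _ h => OTree.Iso.neg_iso h) m

theorem neg_join {n : ℕ} (s : Fin n → Msg) : neg (join s) = join fun i => neg (s i) := by
  have h : (fun i => neg (s i)) = fun i => (⟦((s i).out).neg⟧ : Msg) := by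
    funext i
    conv_lhs => rw [← Quotient.out_eq (s i)]
    rfl
  rw [h, join_mk]
  rfl

open Classical in
/-- The clause map `T̂`, on messages none of which is undetermined. -/
def clauseMap {n : ℕ} (s : Fin n → Msg) : Msg :=
  if ∀ i, s i = lit true then lit false
  else if ∀ i, s i = lit false then lit true
  else if (∃ i, s i = lit false) ∧ ∃ i, s i = lit true then box
  else join s

end Msg

mutual

/-- The free messages from a variable to a clause. -/
inductive FreeVar (d k : ℕ) : Msg → Prop
  | join (s : Fin (d - 1) → Msg) (h : ∀ i, FreeCls d k (s i)) : FreeVar d k (Msg.join s)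

/-- The free messages from a clause to a variable. -/
inductive FreeCls (d k : ℕ) : Msg → Prop
  | box : FreeCls d k Msg.box
  | join (x : Bool) (s : Fin (k - 1) → Msg) (h : ∀ i, s i ≠ Msg.lit x → FreeVar d k (s i))
      (h' : ∃ i, s i ≠ Msg.lit x) : FreeCls d k (Msg.join s)

end

theorem Msg.neg_neg (m : Msg) : m.neg.neg = m := by
  induction m using Quotient.inductionOn with
  | h t =>
    change (⟦t.neg.neg⟧ : Msg) = ⟦t⟧
    congr 1
    induction t with
    | lit x => simp [OTree.neg]
    | box => rfl
    | join n s ih => simp only [OTree.neg, ih]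

theorem Msg.eq_lit_of_neg {m : Msg} {x : Bool} (h : m.neg = Msg.lit (!x)) : m = Msg.lit x := by
  rw [← Msg.neg_neg m, h]
  simp [Msg.lit, Msg.neg, OTree.neg]

theorem FreeVar.neg {d k : ℕ} {m : Msg} (h : FreeVar d k m) : FreeVar d k m.neg := by
  refine FreeVar.rec (motive_1 := fun m _ => FreeVar d k m.neg)
    (motive_2 := fun m _ => FreeCls d k m.neg) ?_ ?_ ?_ h
  · intro s _ ih
    rw [Msg.neg_join]
    exact .join _ ih
  · exact .box
  · rintro x s _ ⟨i, hi⟩ ih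
    rw [Msg.neg_join]
    refine .join (!x) _ (fun i hi => ih i fun hx => hi ?_) ⟨i, fun hx => hi (Msg.eq_lit_of_neg hx)⟩
    rw [hx]; rfl

theorem FreeCls.neg {d k : ℕ} {m : Msg} (h : FreeCls d k m) : FreeCls d k m.neg := by
  cases h with
  | box => exact .box
  | join x s h h' =>
    rw [Msg.neg_join]
    refine .join (!x) _ (fun i hi => FreeVar.neg (h i fun hx => hi ?_)) ?_
    · rw [hx]; rfl
    · obtain ⟨i, hi⟩ := h'
      exact ⟨i, fun hx => hi (Msg.eq_lit_of_neg hx)⟩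

/-- `Ω̇_f`. -/
abbrev VarTree (d k : ℕ) : Type := {m : Msg // FreeVar d k m}

/-- `Ω̂_f`. -/
abbrev ClsTree (d k : ℕ) : Type := {m : Msg // FreeCls d k m}

/-- Red and blue spins, together with free spins taken from `F`. -/
inductive Spin (F : Type) : Type
  | red (x : Bool) : Spin F
  | blue (x : Bool) : Spin F
  | free (t : F) : Spin F

namespace Spin

/-- Apply a map to the free spins. -/
def map {F G : Type} (f : F → G) : Spin F → Spin G
  | red x => red x
  | blue x => blue x
  | free t => free (f t)

/-- Addition of a literal, given the action of negation on free spins. -/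
def addLit {F : Type} (f : F → F) : Bool → Spin F → Spin F
  | L, red x => red (xor L x)
  | L, blue x => blue (xor L x)
  | L, free t => free (if L then f t else t)

/-- The spin is red. -/
def IsRed {F : Type} (s : Spin F) : Prop := ∃ x, s = red x

/-- The spin is blue. -/
def IsBlue {F : Type} (s : Spin F) : Prop := ∃ x, s = blue x

/-- The spin is free. -/
def IsFree {F : Type} (s : Spin F) : Prop := ∃ t, s = free t

end Spin

/-- `Ω̇`. -/
abbrev DotSpin (d k : ℕ) : Type := Spin (VarTree d k)

/-- `Ω̂`. -/
abbrev HatSpin (d k : ℕ) : Type := Spin (ClsTree d k)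

/-- `Ω`. -/
abbrev Color (d k : ℕ) : Type := Spin (VarTree d k × ClsTree d k)

/-- `L ⊕ σ̇`. -/
def DotSpin.add {d k : ℕ} (L : Bool) (s : DotSpin d k) : DotSpin d k :=
  Spin.addLit (fun t => ⟨t.1.neg, t.2.neg⟩) L s

/-- `L ⊕ σ̂`. -/
def HatSpin.add {d k : ℕ} (L : Bool) (s : HatSpin d k) : HatSpin d k :=
  Spin.addLit (fun t => ⟨t.1.neg, t.2.neg⟩) L s

/-- The message sent by a variable: `x` for blue `x`, the tree itself for free spins.
For red `x` we use `x` as well, which only serves the convention `ṁ(red x) = x`. -/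
def DotSpin.msg {d k : ℕ} : DotSpin d k → Msg
  | .red x => Msg.lit x
  | .blue x => Msg.lit x
  | .free t => t.1

namespace Color

variable {d k : ℕ}

/-- `σ ↦ σ̇`. -/
def dot (s : Color d k) : DotSpin d k := s.map Prod.fst

/-- `σ ↦ σ̂`. -/
def hat (s : Color d k) : HatSpin d k := s.map Prod.snd

/-- `|σ|`, the number of free variables encoded by a color. -/
def size : Color d k → ℕ
  | .red _ => 0
  | .blue _ => 0
  | .free t => t.1.1.size .var + t.2.1.size .cls

/-- The indicator `İ` of a valid coloring around a variable of degree `d`. -/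
def VarValid (s : Fin (d - 1 + 1) → Color d k) : Prop :=
  (∃ x, (∃ i, s i = .red x) ∧ ∀ i, s i = .red x ∨ s i = .blue x) ∨
  ∃ t : Fin (d - 1 + 1) → VarTree d k × ClsTree d k, (∀ i, s i = .free (t i)) ∧
    ∀ i, (t i).1.1 = Msg.join fun j => (t (i.succAbove j)).2.1

/-- The indicator `Î^lit` of a valid coloring around a clause of degree `k` with all literals
equal to zero. -/
def ClauseValid (s : Fin (k - 1 + 1) → Color d k) : Prop :=
  (∃ i x, s i = .red x ∧ ∀ j, j ≠ i → s j = .blue (!x)) ∨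
  ((∀ i x, s i ≠ .red x) ∧ (¬ ∃ i x, ∀ j, j ≠ i → s j = .blue x) ∧
    ∀ i t, s i = .free t →
      t.2.1 = Msg.clauseMap fun j => (s (i.succAbove j)).dot.msg)

end Color

section recursions

variable {d k : ℕ}

/-- `σ̇ ∈ Ω̇_T`: the spin `σ̇` comes from a color with at most `T` free variables. -/
def DotSpin.Trunc (T : ℕ∞) (s : DotSpin d k) : Prop :=
  ∃ c : Color d k, (c.size : ℕ∞) ≤ T ∧ c.dot = s

/-- Some valid `T`-coloring around a variable has outgoing spin `σ̇` on the first edge and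
incoming spins `σ̂_2, …, σ̂_d` on the others. -/
def VarCompat (T : ℕ∞) (s : DotSpin d k) (u : Fin (d - 1) → HatSpin d k) : Prop :=
  ∃ c : Fin (d - 1 + 1) → Color d k, Color.VarValid c ∧ (∀ i, ((c i).size : ℕ∞) ≤ T) ∧
    (c 0).dot = s ∧ ∀ j : Fin (d - 1), (c j.succ).hat = u j

/-- Some valid `T`-coloring around a clause (with all literals zero) has outgoing spin `σ̂` on the
first edge and incoming spins `σ̇_2, …, σ̇_k` on the others. -/
def ClauseCompat (T : ℕ∞) (s : HatSpin d k) (u : Fin (k - 1) → DotSpin d k) : Prop :=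
  ∃ c : Fin (k - 1 + 1) → Color d k, Color.ClauseValid c ∧ (∀ i, ((c i).size : ℕ∞) ≤ T) ∧
    (c 0).hat = s ∧ ∀ j : Fin (k - 1), (c j.succ).dot = u j

open Classical in
/-- The `λ`-tilted weight `(Φ̇ Φ̄_T)^λ` of a variable, as a function of the outgoing spin and of the
incoming spins. -/
def varWeight (lam : ℝ) (T : ℕ∞) (s : DotSpin d k) (u : Fin (d - 1) → HatSpin d k) : ℝ :=
  if VarCompat T s u then
    match s with
    | .red _ => 1
    | .blue _ => 1
    | .free t => (t.1.norm .var) ^ lam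
  else 0

open Classical in
/-- The `λ`-tilted weight `(Φ̂^lit Φ̄_T)^λ` of a clause with all literals zero, as a function of the
outgoing spin and of the incoming spins. -/
def clauseWeight (lam : ℝ) (T : ℕ∞) (s : HatSpin d k) (u : Fin (k - 1) → DotSpin d k) : ℝ :=
  if ClauseCompat T s u then
    match s with
    | .red _ => 1
    | .blue true => (1 - ∏ i, (u i).msg.prob .var) ^ lam
    | .blue false => (1 - ∏ i, (1 - (u i).msg.prob .var)) ^ lam
    | .free t => (t.1.norm .cls) ^ lam
  else 0

/-- Normalization to total mass one. -/
def normalize {α : Type} (f : α → ℝ) : α → ℝ := fun a => f a / ∑' b, f b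

/-- The variable recursion of the pair model. -/
def varBP (lam : ℝ) (T : ℕ∞) (q : HatSpin d k × HatSpin d k → ℝ) :
    DotSpin d k × DotSpin d k → ℝ :=
  normalize fun s =>
    ∑' u : Fin (d - 1) → HatSpin d k × HatSpin d k,
      varWeight lam T s.1 (fun i => (u i).1) * varWeight lam T s.2 (fun i => (u i).2) *
        ∏ i, q (u i)

/-- The clause recursion of the pair model. Both copies see the same literals, which are averaged
over. -/
def clauseBP (lam : ℝ) (T : ℕ∞) (q : DotSpin d k × DotSpin d k → ℝ) :
    HatSpin d k × HatSpin d k → ℝ :=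
  normalize fun s =>
    (∑ L : Fin (k - 1 + 1) → Bool,
      ∑' u : Fin (k - 1) → DotSpin d k × DotSpin d k,
        clauseWeight lam T (s.1.add (L 0)) (fun i => (u i).1.add (L i.succ)) *
          clauseWeight lam T (s.2.add (L 0)) (fun i => (u i).2.add (L i.succ)) *
            ∏ i, q (u i)) / 2 ^ (k - 1 + 1)

/-- The belief propagation map of the pair model. -/
def BP (lam : ℝ) (T : ℕ∞) (q : DotSpin d k × DotSpin d k → ℝ) :
    DotSpin d k × DotSpin d k → ℝ :=
  varBP lam T (clauseBP lam T q)

/-- `q^avg`. -/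
def avg (q : DotSpin d k × DotSpin d k → ℝ) : DotSpin d k × DotSpin d k → ℝ :=
  fun s => (q s + q (s.1.add true, s.2.add true)) / 2

/-- The mass that `q` gives to a set. -/
def mass {α : Type} (q : α → ℝ) (S : Set α) : ℝ := ∑' s, S.indicator q s

/-- The `ℓ¹` norm. -/
def l1norm {α : Type} (q : α → ℝ) : ℝ := ∑' s, |q s|

open Classical in
/-- The number of red coordinates of a pair spin. -/
def redCount (s : DotSpin d k × DotSpin d k) : ℕ :=
  (if s.1.IsRed then 1 else 0) + (if s.2.IsRed then 1 else 0)

/-- The set of pairs of blue spins. -/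
def blueBlue (d k : ℕ) : Set (DotSpin d k × DotSpin d k) := {s | s.1.IsBlue ∧ s.2.IsBlue}

/-- The set of pairs of red spins. -/
def redRed (d k : ℕ) : Set (DotSpin d k × DotSpin d k) := {s | s.1.IsRed ∧ s.2.IsRed}

/-- The set of pairs with one red and one free spin. -/
def redFree (d k : ℕ) : Set (DotSpin d k × DotSpin d k) :=
  {s | (s.1.IsRed ∧ s.2.IsFree) ∨ (s.1.IsFree ∧ s.2.IsRed)}

/-- The set `Γ(c, κ)` of symmetric probability measures on pairs of `T`-truncated spins; `C` is the
constant implied by each of the symbols `O(·)` in its definition. -/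
structure Gamma (d k : ℕ) (T : ℕ∞) (C c κ : ℝ) (q : DotSpin d k × DotSpin d k → ℝ) : Prop where
  nonneg : ∀ s, 0 ≤ q s
  hasSum_one : HasSum q 1
  supported : ∀ s, q s ≠ 0 → s.1.Trunc T ∧ s.2.Trunc T
  symmetric : q = avg q
  a_mass : mass (fun s => ((2 : ℝ) ^ (-(k : ℝ))) ^ redCount s * q s) (blueBlue d k)ᶜ ≤
    C * (2 : ℝ) ^ (-(k : ℝ)) * mass q (blueBlue d k)
  a_overlap : |q (.blue false, .blue false) - q (.blue false, .blue true)| ≤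
    (k : ℝ) ^ 9 / (2 : ℝ) ^ (c * k) * mass q (blueBlue d k)
  b_redFree : mass q (redFree d k) ≤ C * (2 : ℝ) ^ (-κ * k) * mass q (blueBlue d k)
  b_redRed : mass q (redRed d k) ≤ C * (2 : ℝ) ^ ((1 - κ) * k) * mass q (blueBlue d k)
  c_left : ∀ (x : Bool) (s : DotSpin d k),
    (1 - C * (2 : ℝ) ^ (-(k : ℝ))) * q (.blue x, s) ≤ q (.red x, s)
  c_right : ∀ (x : Bool) (s : DotSpin d k),
    (1 - C * (2 : ℝ) ^ (-(k : ℝ))) * q (s, .blue x) ≤ q (s, .red x)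

/-- The clause density `α = d / k` lies in `[(2^(k-1) - 2) log 2, 2^(k-1) log 2]`. -/
def Regime (d k : ℕ) : Prop :=
  ((2 : ℝ) ^ ((k : ℝ) - 1) - 2) * Real.log 2 ≤ (d : ℝ) / k ∧
    (d : ℝ) / k ≤ (2 : ℝ) ^ ((k : ℝ) - 1) * Real.log 2

end recursions

end

end NaeSat

-- Messages and the probabilities they encode

namespace NaeSat

noncomputable section

-- Write t = 2^(-k). Belief propagation sends every weight in `Gamma` close to one and the same
-- object, the weight giving equal value to all pairs of red or blue spins; the input survives only
-- as a perturbation with Lipschitz constant of order k^4 t.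
--
-- Rescale q so that the pairs without red coordinates (and within the truncation) have mass one
-- (`Gamma.balanced`). Requiring one coordinate to be "blue x or free" then leaves mass about 1/2,
-- requiring it of both coordinates leaves about 1/4. Call an incoming tuple of a clause exceptional
-- if, for some x, all entries but at most one are blue x or free. A tuple without red entries that
-- is not exceptional shows both labels at least twice. The clause may then send blue x for either
-- x, and its free message is the unlabelled edge. Each of the three tests (red or blue x; blue x;
-- the λ-th power of the probability of x on free spins) thus returns exactly 1, and all tests agree
-- to leading order (`abs_response_sub_le`). Exceptional tuples cost O(kt) when they occur in one
-- copy and O(k^2 t^2) when they occur in both.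
--
-- Two finer facts carry the argument. First, the outputs tested by two colored functions differ
-- from each other only by O(k^2 t^2): the first-order part cancels under global negation
-- (`pairing_discrepancy`). Second, any other pair of tests falls short of the colored pair by at
-- least 2t - O(k^2 t^2) (`pairing_le`). The gain of the colored test is the red spin, sent when all
-- incoming spins are the opposite blue, which has weight about 2^(-(k-1)) = 2t. Against the free
-- test one must also compare tuples with a single red or a single blue defect, and condition (c)
-- makes these nearly cancel.
--
-- At a variable the weight is controlled by products of test functions over d - 1 edges. The
-- density is such that (1 - 2t)^d is of order t, so all contributions that are not colored in both
-- copies are O(t), while the colored ones are (1 + O(k^2 t^2))^d = 1 + O(k^3 t). This puts the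
-- output in the smallest set `Gamma` (`gamma_normalize`).
--
-- For the contraction the products are telescoped. The main part of the clause output is the same
-- for all rescaled weights, so the output is Lipschitz with constant O(k^2 t), and the ratio of
-- colored outputs with constant O(k^3 t^2). Multiplying the latter by the number of edges, of order
-- k/t, gives k^4 t; the remaining terms give (k/t)·t·k^2 t = k^3 t. Since `Gamma` is closed in ℓ¹,
-- the iteration converges to a fixed point.
--
-- The exponent c enters only through (1/4 + k^9 2^(-ck) + O(t))^k, which is at most 2·4^(-k) once k
-- is large. This is why the constants do not depend on c and only the threshold for k does.

theorem OTree.prob_mem_unit (t : OTree) (z : Side) : 0 ≤ t.prob z ∧ t.prob z ≤ 1 := by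
  induction t generalizing z with
  | lit x => cases x <;> simp [OTree.prob]
  | box => simp only [OTree.prob]; norm_num
  | join n s ih =>
    cases z <;> simp only [OTree.prob]
    · have h0 : 0 ≤ ∏ i, OTree.prob .cls (s i) := Finset.prod_nonneg fun i _ => (ih i _).1
      have h1 : 0 ≤ ∏ i, (1 - OTree.prob .cls (s i)) :=
        Finset.prod_nonneg fun i _ => sub_nonneg.2 (ih i _).2
      exact ⟨by positivity, div_le_one_of_le₀ (by linarith) (by linarith)⟩
    · have h0 : ∏ i, OTree.prob .var (s i) ≤ 1 :=
        Finset.prod_le_one (fun i _ => (ih i _).1) fun i _ => (ih i _).2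
      have h1 : ∏ i, (1 - OTree.prob .var (s i)) ≤ 1 :=
        Finset.prod_le_one (fun i _ => sub_nonneg.2 (ih i _).2) fun i _ => by
          linarith [(ih i .var).1]
      exact ⟨div_nonneg (by linarith) (by linarith),
        div_le_one_of_le₀ (by linarith) (by linarith)⟩

namespace Msg

theorem prob_mem_unit (m : Msg) (z : Side) : 0 ≤ m.prob z ∧ m.prob z ≤ 1 := by
  induction m using Quotient.inductionOn with
  | h t => exact t.prob_mem_unit z

theorem prob_lit (z : Side) (x : Bool) : (lit x).prob z = if x then 1 else 0 := by
  cases z <;> rfl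

theorem prob_box (z : Side) : box.prob z = 1 / 2 := by cases z <;> rfl

theorem norm_box (z : Side) : box.norm z = 2 := by cases z <;> rfl

theorem size_box (z : Side) : box.size z = 0 := by cases z <;> rfl

theorem prob_out (z : Side) (m : Msg) : OTree.prob z m.out = m.prob z := by
  conv_rhs => rw [← Quotient.out_eq m]
  rfl

theorem size_out (z : Side) (m : Msg) : OTree.size z m.out = m.size z := by
  conv_rhs => rw [← Quotient.out_eq m]
  rfl

variable {n : ℕ} (s : Fin n → Msg)

theorem prob_var_join : (join s).prob .var = (∏ i, (s i).prob .cls) /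
    ((∏ i, (s i).prob .cls) + ∏ i, (1 - (s i).prob .cls)) := by
  change OTree.prob .var (OTree.join n _) = _
  simp only [OTree.prob, prob_out]

theorem norm_var_join : (join s).norm .var =
    (∏ i, (s i).prob .cls) + ∏ i, (1 - (s i).prob .cls) := by
  simp only [← prob_out]; rfl

theorem prob_cls_join : (join s).prob .cls = (1 - ∏ i, (s i).prob .var) /
    (2 - (∏ i, (s i).prob .var) - ∏ i, (1 - (s i).prob .var)) := by
  change OTree.prob .cls (OTree.join n _) = _
  simp only [OTree.prob, prob_out]

theorem norm_cls_join : (join s).norm .cls =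
    2 - (∏ i, (s i).prob .var) - ∏ i, (1 - (s i).prob .var) := by
  simp only [← prob_out]; rfl

theorem size_var_join : (join s).size .var = 1 + ∑ i, (s i).size .cls := by
  change OTree.size .var (OTree.join n _) = _
  simp only [OTree.size, size_out]

theorem lit_injective : Function.Injective lit := by
  intro x y h
  have h' : OTree.Iso _ _ := Quotient.exact h
  cases h'
  rfl

theorem neg_lit (x : Bool) : (lit x).neg = lit (!x) := rfl

theorem neg_box : box.neg = box := rfl

theorem neg_eq_lit_iff {m : Msg} {x : Bool} : m.neg = lit x ↔ m = lit (!x) := by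
  constructor
  · intro h
    rw [← neg_neg m, h, neg_lit]
  · rintro rfl
    simp [neg_lit]

theorem size_neg (z : Side) (m : Msg) : m.neg.size z = m.size z := by
  induction m using Quotient.inductionOn with
  | h t =>
    change t.neg.size z = t.size z
    induction t generalizing z with
    | lit x => cases z <;> rfl
    | box => rfl
    | join n s ih => cases z <;> simp [OTree.neg, OTree.size, ih]

end Msg

/-- A message encoding a nondegenerate probability, which negation of the labels complements. -/
def Msg.Fair (z : Side) (m : Msg) : Prop :=
  0 < m.prob z ∧ m.prob z < 1 ∧ m.neg.prob z = 1 - m.prob z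

theorem Msg.fair_box (z : Side) : Msg.box.Fair z := by
  refine ⟨?_, ?_, ?_⟩ <;> simp only [Msg.neg_box, Msg.prob_box] <;> norm_num

theorem Msg.fair_var_join {n : ℕ} {s : Fin n → Msg} (h : ∀ i, (s i).Fair .cls) :
    (Msg.join s).Fair .var := by
  have h0 : 0 < ∏ i, (s i).prob .cls := Finset.prod_pos fun i _ => (h i).1
  have h1 : 0 < ∏ i, (1 - (s i).prob .cls) := Finset.prod_pos fun i _ => sub_pos.2 (h i).2.1
  refine ⟨?_, ?_, ?_⟩
  · rw [Msg.prob_var_join]; positivity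
  · rw [Msg.prob_var_join, div_lt_one (by positivity)]; linarith
  · rw [Msg.neg_join, Msg.prob_var_join, Msg.prob_var_join]
    simp only [(h _).2.2, sub_sub_cancel]
    field_simp
    ring

theorem Msg.prod_prob_lt_one {n : ℕ} {s : Fin n → Msg} {z : Side} {i : Fin n}
    (h : (s i).prob z < 1) : ∏ i, (s i).prob z < 1 := by
  rw [← Finset.mul_prod_erase _ _ (Finset.mem_univ i)]
  have h1 : ∏ j ∈ Finset.univ.erase i, (s j).prob z ≤ 1 :=
    Finset.prod_le_one (fun j _ => ((s j).prob_mem_unit z).1) fun j _ => ((s j).prob_mem_unit z).2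
  exact (mul_le_of_le_one_right ((s i).prob_mem_unit z).1 h1).trans_lt h

theorem Msg.prod_one_sub_prob_lt_one {n : ℕ} {s : Fin n → Msg} {z : Side} {i : Fin n}
    (h : 0 < (s i).prob z) : ∏ i, (1 - (s i).prob z) < 1 := by
  rw [← Finset.mul_prod_erase _ _ (Finset.mem_univ i)]
  have h1 : ∏ j ∈ Finset.univ.erase i, (1 - (s j).prob z) ≤ 1 :=
    Finset.prod_le_one (fun j _ => sub_nonneg.2 ((s j).prob_mem_unit z).2)
      fun j _ => by linarith [((s j).prob_mem_unit z).1]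
  exact (mul_le_of_le_one_right (sub_nonneg.2 ((s i).prob_mem_unit z).2) h1).trans_lt (by linarith)

theorem Msg.fair_cls_join {n : ℕ} {s : Fin n → Msg}
    (h : ∀ i, (s i).neg.prob .var = 1 - (s i).prob .var) {i : Fin n} (hi : (s i).Fair .var) :
    (Msg.join s).Fair .cls := by
  have h0 := Msg.prod_prob_lt_one hi.2.1
  have h1 := Msg.prod_one_sub_prob_lt_one hi.1
  refine ⟨?_, ?_, ?_⟩
  · rw [Msg.prob_cls_join]; exact div_pos (by linarith) (by linarith)
  · rw [Msg.prob_cls_join, div_lt_one (by linarith)]; linarith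
  · rw [Msg.neg_join, Msg.prob_cls_join, Msg.prob_cls_join]
    simp only [h, sub_sub_cancel]
    rw [eq_sub_iff_add_eq, show 2 - (∏ i, (1 - (s i).prob .var)) - ∏ i, (s i).prob .var =
      2 - (∏ i, (s i).prob .var) - ∏ i, (1 - (s i).prob .var) by ring, ← add_div, div_eq_one_iff_eq]
    · ring
    · linarith

theorem Msg.neg_prob_lit (z : Side) (x : Bool) :
    (Msg.lit x).neg.prob z = 1 - (Msg.lit x).prob z := by
  cases x <;> simp [Msg.neg_lit, Msg.prob_lit]

theorem Msg.fair_cls_join_of_lit {n : ℕ} {s : Fin n → Msg} {x : Bool}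
    (h : ∀ i, s i ≠ Msg.lit x → (s i).Fair .var) (h' : ∃ i, s i ≠ Msg.lit x) :
    (Msg.join s).Fair .cls := by
  obtain ⟨i, hi⟩ := h'
  refine Msg.fair_cls_join (fun j => ?_) (h i hi)
  by_cases hj : s j = Msg.lit x
  · rw [hj, Msg.neg_prob_lit]
  · exact (h j hj).2.2

/-- Free trees bottom out at unlabelled edges, of value 1/2, and a clause join always keeps at least
one argument that is not a label, so degeneracy never arises on the way up. The complement rule is
what makes negation a symmetry of all weights. -/
theorem FreeVar.fair {d k : ℕ} {m : Msg} (h : FreeVar d k m) : m.Fair .var := by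
  refine FreeVar.rec (motive_1 := fun m _ => m.Fair .var)
    (motive_2 := fun m _ => m.Fair .cls) ?_ ?_ ?_ h
  · exact fun s _ ih => Msg.fair_var_join ih
  · exact Msg.fair_box _
  · exact fun x s _ h' ih => Msg.fair_cls_join_of_lit ih h'

theorem FreeCls.fair {d k : ℕ} {m : Msg} (h : FreeCls d k m) : m.Fair .cls := by
  cases h with
  | box => exact Msg.fair_box _
  | join x s h h' => exact Msg.fair_cls_join_of_lit (fun i hi => (h i hi).fair) h'

theorem FreeVar.norm_neg {d k : ℕ} {m : Msg} (h : FreeVar d k m) :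
    m.neg.norm .var = m.norm .var := by
  cases h with
  | join s h =>
    rw [Msg.neg_join, Msg.norm_var_join, Msg.norm_var_join]
    simp only [(h _).fair.2.2, sub_sub_cancel]
    ring

theorem FreeCls.norm_neg {d k : ℕ} {m : Msg} (h : FreeCls d k m) :
    m.neg.norm .cls = m.norm .cls := by
  cases h with
  | box => rfl
  | join x s h h' =>
    have h2 : ∀ i, (s i).neg.prob .var = 1 - (s i).prob .var := fun i => by
      by_cases hj : s i = Msg.lit x
      · rw [hj, Msg.neg_prob_lit]
      · exact (h i hj).fair.2.2
    rw [Msg.neg_join, Msg.norm_cls_join, Msg.norm_cls_join]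
    simp only [h2, sub_sub_cancel]
    ring

namespace Msg

theorem norm_cls_join_mul_prob {n : ℕ} (s : Fin n → Msg) :
    (join s).norm .cls * (join s).prob .cls ≤ 1 := by
  have h0 : 0 ≤ ∏ i, (s i).prob .var :=
    Finset.prod_nonneg fun i _ => ((s i).prob_mem_unit .var).1
  rw [norm_cls_join, prob_cls_join]
  by_cases hz : 2 - (∏ i, (s i).prob .var) - ∏ i, (1 - (s i).prob .var) = 0
  · simp [hz]
  · rw [mul_div_cancel₀ _ hz]; linarith

theorem norm_cls_join_mul_one_sub_prob {n : ℕ} (s : Fin n → Msg) :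
    (join s).norm .cls * (1 - (join s).prob .cls) ≤ 1 := by
  have h0 : 0 ≤ ∏ i, (1 - (s i).prob .var) :=
    Finset.prod_nonneg fun i _ => sub_nonneg.2 ((s i).prob_mem_unit .var).2
  rw [norm_cls_join, prob_cls_join]
  by_cases hz : 2 - (∏ i, (s i).prob .var) - ∏ i, (1 - (s i).prob .var) = 0
  · simp [hz]
  · rw [mul_sub, mul_div_cancel₀ _ hz]; linarith

theorem norm_cls_join_nonneg {n : ℕ} (s : Fin n → Msg) : 0 ≤ (join s).norm .cls := by
  have h0 : ∏ i, (s i).prob .var ≤ 1 :=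
    Finset.prod_le_one (fun i _ => ((s i).prob_mem_unit .var).1)
      fun i _ => ((s i).prob_mem_unit .var).2
  have h1 : ∏ i, (1 - (s i).prob .var) ≤ 1 :=
    Finset.prod_le_one (fun i _ => sub_nonneg.2 ((s i).prob_mem_unit .var).2) fun i _ => by
      linarith [((s i).prob_mem_unit .var).1]
  rw [norm_cls_join]; linarith

end Msg

/-- The probability that `m` gives to the value `x`. -/
def Msg.probOf (z : Side) (x : Bool) (m : Msg) : ℝ := if x then m.prob z else 1 - m.prob z

theorem Msg.probOf_mem_unit (z : Side) (x : Bool) (m : Msg) :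
    0 ≤ m.probOf z x ∧ m.probOf z x ≤ 1 := by
  have h := m.prob_mem_unit z
  cases x <;> simp only [Msg.probOf, if_true, if_false, Bool.false_eq_true]
  · exact ⟨by linarith, by linarith⟩
  · exact h

theorem FreeCls.norm_nonneg {d k : ℕ} {m : Msg} (h : FreeCls d k m) : 0 ≤ m.norm .cls := by
  cases h with
  | box => rw [Msg.norm_box]; norm_num
  | join x s h h' => exact Msg.norm_cls_join_nonneg s

/-- The normalizing constant cancels the denominator of the encoded probability and leaves one minus
a product. After taking λ-th powers this caps the free response of a clause by one. -/
theorem FreeCls.norm_mul_probOf {d k : ℕ} {m : Msg} (h : FreeCls d k m) (x : Bool) :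
    m.norm .cls * m.probOf .cls x ≤ 1 := by
  cases h with
  | box => cases x <;> norm_num [Msg.norm_box, Msg.probOf, Msg.prob_box]
  | join x s h h' =>
    rename_i y
    cases y <;> simp only [Msg.probOf, if_true, if_false, Bool.false_eq_true]
    · exact Msg.norm_cls_join_mul_one_sub_prob s
    · exact Msg.norm_cls_join_mul_prob s

theorem FreeCls.probOf_neg {d k : ℕ} {m : Msg} (h : FreeCls d k m) (x : Bool) :
    m.neg.probOf .cls x = m.probOf .cls (!x) := by
  cases x <;> simp [Msg.probOf, h.fair.2.2]

-- Integration against products of weights, and telescoping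

section sums

variable {α : Type}

theorem hasSum_pi_prod {n : ℕ} {f : Fin n → α → ℝ} {c : Fin n → ℝ}
    (h : ∀ i, HasSum (f i) (c i)) :
    HasSum (fun u : Fin n → α => ∏ i, f i (u i)) (∏ i, c i) := by
  induction n with
  | zero =>
    simp
  | succ n ih =>
    rw [← (Fin.consEquiv fun _ => α).hasSum_iff, Fin.prod_univ_succ]
    have h' := ih (fun i => h i.succ)
    have hs := summable_mul_of_summable_norm (h 0).summable.norm h'.summable.norm
    have := (h 0).mul h' hs
    refine this.congr_fun fun p => ?_
    simp [Fin.prod_univ_succ, Fin.consEquiv]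

theorem summable_pi_prod {n : ℕ} {f : Fin n → α → ℝ} (h : ∀ i, Summable (f i)) :
    Summable fun u : Fin n → α => ∏ i, f i (u i) :=
  (hasSum_pi_prod fun i => (h i).hasSum).summable

theorem tsum_pi_prod {n : ℕ} {f : Fin n → α → ℝ} (h : ∀ i, Summable (f i)) :
    ∑' u : Fin n → α, ∏ i, f i (u i) = ∏ i, ∑' a, f i a :=
  (hasSum_pi_prod fun i => (h i).hasSum).tsum_eq

/-- A bounded real function. -/
def BddFn (f : α → ℝ) : Prop := ∃ c, ∀ a, |f a| ≤ c

namespace BddFn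

variable {f g : α → ℝ}

theorem of_mem (c : ℝ) (h : ∀ a, 0 ≤ f a ∧ f a ≤ c) : BddFn f :=
  ⟨c, fun a => abs_le.2 ⟨by linarith [h a], (h a).2⟩⟩

theorem const (c : ℝ) : BddFn fun _ : α => c := ⟨|c|, fun _ => le_rfl⟩

theorem add (hf : BddFn f) (hg : BddFn g) : BddFn fun a => f a + g a := by
  obtain ⟨c, hc⟩ := hf
  obtain ⟨e, he⟩ := hg
  exact ⟨c + e, fun a => (abs_add_le _ _).trans (add_le_add (hc a) (he a))⟩

theorem mul (hf : BddFn f) (hg : BddFn g) : BddFn fun a => f a * g a := by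
  obtain ⟨c, hc⟩ := hf
  obtain ⟨e, he⟩ := hg
  refine ⟨c * e, fun a => ?_⟩
  rw [abs_mul]
  exact mul_le_mul (hc a) (he a) (abs_nonneg _) ((abs_nonneg _).trans (hc a))

theorem neg (hf : BddFn f) : BddFn fun a => -f a := by
  obtain ⟨c, hc⟩ := hf
  exact ⟨c, fun a => by rw [abs_neg]; exact hc a⟩

theorem sub (hf : BddFn f) (hg : BddFn g) : BddFn fun a => f a - g a := by
  simpa only [sub_eq_add_neg] using hf.add hg.neg

theorem comp {β : Type} (hf : BddFn f) (φ : β → α) : BddFn fun b => f (φ b) := by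
  obtain ⟨c, hc⟩ := hf
  exact ⟨c, fun b => hc _⟩

theorem sum {ι : Type} (s : Finset ι) {f : ι → α → ℝ} (hf : ∀ i, BddFn (f i)) :
    BddFn fun a => ∑ i ∈ s, f i a := by
  choose c hc using hf
  exact ⟨∑ i ∈ s, c i, fun a => (Finset.abs_sum_le_sum_abs _ _).trans
    (Finset.sum_le_sum fun i _ => hc i a)⟩

theorem prod {ι : Type} (s : Finset ι) {f : ι → α → ℝ} (hf : ∀ i, BddFn (f i)) :
    BddFn fun a => ∏ i ∈ s, f i a := by
  choose c hc using hf
  refine ⟨∏ i ∈ s, c i, fun a => ?_⟩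
  rw [Finset.abs_prod]
  exact Finset.prod_le_prod (fun i _ => abs_nonneg _) fun i _ => hc i a

theorem summable_mul (hf : BddFn f) {ν : α → ℝ} (hν : Summable ν) :
    Summable fun a => f a * ν a := by
  obtain ⟨c, hc⟩ := hf
  refine Summable.of_norm_bounded (g := fun a => c * |ν a|) (hν.abs.mul_left c) fun a => ?_
  rw [Real.norm_eq_abs, abs_mul]
  exact mul_le_mul_of_nonneg_right (hc a) (abs_nonneg _)

end BddFn

/-- A summable family of kernels `K u` integrated against `ν`. -/
theorem summable_kernel {U S : Type} {K : U → S → ℝ} {ν B : U → ℝ} (hK : ∀ u, Summable (K u))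
    (hB : ∀ u, ∑' s, |K u s| ≤ B u) (hν : Summable fun u => B u * |ν u|) :
    Summable fun p : U × S => K p.1 p.2 * ν p.1 := by
  rw [← summable_abs_iff, summable_prod_of_nonneg fun _ => abs_nonneg _]
  refine ⟨fun u => ?_, ?_⟩
  · simp only [abs_mul]
    exact (hK u).abs.mul_right _
  · refine Summable.of_nonneg_of_le (fun u => tsum_nonneg fun _ => abs_nonneg _) (fun u => ?_) hν
    simp only [abs_mul]
    rw [tsum_mul_right]
    exact mul_le_mul_of_nonneg_right (hB u) (abs_nonneg _)

theorem summable_tsum_kernel {U S : Type} {K : U → S → ℝ} {ν B : U → ℝ}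
    (hK : ∀ u, Summable (K u)) (hB : ∀ u, ∑' s, |K u s| ≤ B u)
    (hν : Summable fun u => B u * |ν u|) : Summable fun s => ∑' u, K u s * ν u :=
  ((Equiv.prodComm S U).summable_iff.2 (summable_kernel hK hB hν)).prod

theorem tsum_tsum_kernel {U S : Type} {K : U → S → ℝ} {ν B : U → ℝ}
    (hK : ∀ u, Summable (K u)) (hB : ∀ u, ∑' s, |K u s| ≤ B u)
    (hν : Summable fun u => B u * |ν u|) :
    ∑' s, ∑' u, K u s * ν u = ∑' u, (∑' s, K u s) * ν u := by
  rw [Summable.tsum_comm (f := fun u s => K u s * ν u) (summable_kernel hK hB hν)]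
  simp only [tsum_mul_right]

/-- Exchanging the sums leaves only the total outgoing weight of each incoming configuration `u`,
for which `B u` is a bound. The ℓ¹ estimates for both recursions are obtained in this way. -/
theorem tsum_abs_kernel_le {U S : Type} {K : U → S → ℝ} {ν B : U → ℝ}
    (hK : ∀ u, Summable (K u)) (hB : ∀ u, ∑' s, |K u s| ≤ B u)
    (hν : Summable fun u => B u * |ν u|) :
    ∑' s, |∑' u, K u s * ν u| ≤ ∑' u, B u * |ν u| := by
  have hK' : ∀ u, Summable fun s => |K u s| := fun u => (hK u).abs
  have hB' : ∀ u, ∑' s, |(|K u s|)| ≤ B u := by simpa only [abs_abs] using hB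
  have hν' : Summable fun u => B u * |(|ν u|)| := by simpa only [abs_abs] using hν
  have h1 : Summable fun p : U × S => |K p.1 p.2| * |ν p.1| :=
    summable_kernel (ν := fun u => |ν u|) hK' hB' hν'
  have h1' : Summable fun p : S × U => |K p.2 p.1| * |ν p.2| :=
    (Equiv.prodComm S U).summable_iff.2 h1
  have h2 : ∑' s, ∑' u, |K u s| * |ν u| = ∑' u, (∑' s, |K u s|) * |ν u| :=
    tsum_tsum_kernel (ν := fun u => |ν u|) hK' hB' hν'
  have h3 : ∀ s, |∑' u, K u s * ν u| ≤ ∑' u, |K u s| * |ν u| := fun s => by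
    have h4 : Summable fun u => |K u s| * |ν u| := h1'.prod_factor s
    have h5 : Summable fun u => ‖K u s * ν u‖ := by
      simpa only [Real.norm_eq_abs, abs_mul] using h4
    have h6 := norm_tsum_le_tsum_norm h5
    simpa only [Real.norm_eq_abs, abs_mul] using h6
  refine (Summable.tsum_le_tsum h3 (summable_tsum_kernel hK hB hν).abs h1'.prod).trans ?_
  rw [h2]
  have h7 : Summable fun u => (∑' s, |K u s|) * |ν u| := by
    simpa only [tsum_mul_right] using h1.prod
  exact Summable.tsum_le_tsum (fun u => mul_le_mul_of_nonneg_right (hB u) (abs_nonneg _)) h7 hν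

/-- The integral of a function of `n` coordinates against a product of `n` weights. -/
def integ {n : ℕ} (Φ : (Fin n → α) → ℝ) (ν : Fin n → α → ℝ) : ℝ := ∑' u, Φ u * ∏ i, ν i (u i)

section integ

variable {n : ℕ} {Φ Ψ : (Fin n → α) → ℝ} {ν : Fin n → α → ℝ}

theorem summable_integ (hΦ : BddFn Φ) (hν : ∀ i, Summable (ν i)) :
    Summable fun u => Φ u * ∏ i, ν i (u i) := hΦ.summable_mul (summable_pi_prod hν)

theorem integ_add (hΦ : BddFn Φ) (hΨ : BddFn Ψ) (hν : ∀ i, Summable (ν i)) :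
    integ (fun u => Φ u + Ψ u) ν = integ Φ ν + integ Ψ ν := by
  simp only [integ, add_mul]
  exact (summable_integ hΦ hν).tsum_add (summable_integ hΨ hν)

theorem integ_sub (hΦ : BddFn Φ) (hΨ : BddFn Ψ) (hν : ∀ i, Summable (ν i)) :
    integ (fun u => Φ u - Ψ u) ν = integ Φ ν - integ Ψ ν := by
  simp only [integ, sub_mul]
  exact (summable_integ hΦ hν).tsum_sub (summable_integ hΨ hν)

theorem integ_const_mul (c : ℝ) : integ (fun u => c * Φ u) ν = c * integ Φ ν := by
  simp only [integ, mul_assoc, tsum_mul_left]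

theorem integ_sum {ι : Type} (s : Finset ι) {Φ : ι → (Fin n → α) → ℝ} (hΦ : ∀ i, BddFn (Φ i))
    (hν : ∀ i, Summable (ν i)) :
    integ (fun u => ∑ i ∈ s, Φ i u) ν = ∑ i ∈ s, integ (Φ i) ν := by
  simp only [integ, Finset.sum_mul]
  exact Summable.tsum_finsetSum fun i _ => summable_integ (hΦ i) hν

theorem integ_mono (hΦ : BddFn Φ) (hΨ : BddFn Ψ) (hν : ∀ i, Summable (ν i))
    (h0 : ∀ i a, 0 ≤ ν i a) (h : ∀ u, Φ u ≤ Ψ u) : integ Φ ν ≤ integ Ψ ν :=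
  Summable.tsum_le_tsum (fun u => mul_le_mul_of_nonneg_right (h u)
    (Finset.prod_nonneg fun i _ => h0 i _)) (summable_integ hΦ hν) (summable_integ hΨ hν)

theorem integ_nonneg (h : ∀ u, 0 ≤ Φ u) (h0 : ∀ i a, 0 ≤ ν i a) : 0 ≤ integ Φ ν :=
  tsum_nonneg fun u => mul_nonneg (h u) (Finset.prod_nonneg fun i _ => h0 i _)

theorem abs_integ_le (hΦ : BddFn Φ) (hΨ : BddFn Ψ) (hν : ∀ i, Summable (ν i))
    (h0 : ∀ i a, 0 ≤ ν i a) (h : ∀ u, |Φ u| ≤ Ψ u) : |integ Φ ν| ≤ integ Ψ ν := by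
  rw [abs_le, ← neg_one_mul, ← integ_const_mul]
  refine ⟨integ_mono ?_ hΦ hν h0 fun u => ?_, integ_mono hΦ hΨ hν h0 fun u => ?_⟩
  · exact (BddFn.const (-1)).mul hΨ
  · have := (abs_le.1 (h u)).1
    linarith
  · exact (abs_le.1 (h u)).2

theorem integ_prod {χ : Fin n → α → ℝ} (hχ : ∀ i, BddFn (χ i)) (hν : ∀ i, Summable (ν i)) :
    integ (fun u => ∏ i, χ i (u i)) ν = ∏ i, ∑' a, χ i a * ν i a := by
  simp only [integ, ← Finset.prod_mul_distrib]
  exact tsum_pi_prod (f := fun i a => χ i a * ν i a) fun i => (hχ i).summable_mul (hν i)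

/-- The families interpolating between the constant families `p` and `q`. -/
def hybrid (p q : α → ℝ) (l j : Fin n) : α → ℝ :=
  if j < l then p else if j = l then fun a => |p a - q a| else q

/-- Telescoping: the factors are exchanged one at a time, those before `l` still coming from `a` and
those after `l` already from `b`. -/
theorem abs_prod_sub_prod_le {a b : Fin n → ℝ} (ha : ∀ i, 0 ≤ a i) (hb : ∀ i, 0 ≤ b i) :
    |∏ i, a i - ∏ i, b i| ≤
      ∑ l, ∏ j, (if j < l then a j else if j = l then |a j - b j| else b j) := by
  induction n with
  | zero => simp
  | succ n ih =>
    have h := ih (a := fun i => a i.succ) (b := fun i => b i.succ) (fun i => ha _) fun i => hb _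
    rw [Fin.sum_univ_succ]
    simp only [Fin.prod_univ_succ, Fin.succ_lt_succ_iff, Fin.succ_inj, Fin.succ_pos, if_true,
      if_false, Fin.not_lt_zero, Fin.succ_ne_zero]
    rw [← Finset.mul_sum]
    have hB : 0 ≤ ∏ i : Fin n, b i.succ := Finset.prod_nonneg fun i _ => hb _
    calc |a 0 * ∏ i : Fin n, a i.succ - b 0 * ∏ i : Fin n, b i.succ|
        = |(a 0 - b 0) * ∏ i : Fin n, b i.succ +
          a 0 * (∏ i : Fin n, a i.succ - ∏ i : Fin n, b i.succ)| := by congr 1; ring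
      _ ≤ |a 0 - b 0| * ∏ i : Fin n, b i.succ +
          a 0 * |∏ i : Fin n, a i.succ - ∏ i : Fin n, b i.succ| := by
        refine (abs_add_le _ _).trans ?_
        rw [abs_mul, abs_mul, abs_of_nonneg hB, abs_of_nonneg (ha 0)]
      _ ≤ _ := by gcongr; exact ha 0

theorem hybrid_nonneg {p q : α → ℝ} (hp : ∀ a, 0 ≤ p a) (hq : ∀ a, 0 ≤ q a) (l j : Fin n)
    (a : α) : 0 ≤ hybrid p q l j a := by
  unfold hybrid
  split_ifs
  exacts [hp a, abs_nonneg _, hq a]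

theorem hybrid_summable {p q : α → ℝ} (hp : Summable p) (hq : Summable q) (l j : Fin n) :
    Summable (hybrid p q l j) := by
  unfold hybrid
  split_ifs
  exacts [hp, (hp.sub hq).abs, hq]

theorem tsum_abs_prod_sub_le {p q : α → ℝ} (hp : Summable p) (hq : Summable q)
    (hp0 : ∀ a, 0 ≤ p a) (hq0 : ∀ a, 0 ≤ q a) (hΨ : BddFn Ψ) (h0 : ∀ u, 0 ≤ Ψ u) :
    (Summable fun u : Fin n → α => Ψ u * |∏ i, p (u i) - ∏ i, q (u i)|) ∧
    ∑' u : Fin n → α, Ψ u * |∏ i, p (u i) - ∏ i, q (u i)| ≤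
      ∑ l : Fin n, integ Ψ (hybrid p q l) := by
  have hs : ∀ l, Summable fun u : Fin n → α => Ψ u * ∏ j, hybrid p q l j (u j) := fun l =>
    summable_integ hΨ fun j => hybrid_summable hp hq l j
  have hs1 : Summable fun u : Fin n → α => Ψ u * |∏ i, p (u i) - ∏ i, q (u i)| :=
    hΨ.summable_mul ((summable_pi_prod (n := n) fun _ => hp).sub
      (summable_pi_prod fun _ => hq)).abs
  refine ⟨hs1, ?_⟩
  unfold integ
  rw [← Summable.tsum_finsetSum fun l _ => hs l]
  refine Summable.tsum_le_tsum (fun u => ?_) hs1 (summable_sum fun l _ => hs l)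
  rw [← Finset.mul_sum]
  refine mul_le_mul_of_nonneg_left ?_ (h0 u)
  refine (abs_prod_sub_prod_le (fun i => hp0 _) fun i => hq0 _).trans (le_of_eq ?_)
  refine Finset.sum_congr rfl fun l _ => Finset.prod_congr rfl fun j _ => ?_
  unfold hybrid
  split_ifs <;> rfl

theorem abs_integ_sub_integ_le {p q : α → ℝ} (hp : Summable p) (hq : Summable q)
    (hp0 : ∀ a, 0 ≤ p a) (hq0 : ∀ a, 0 ≤ q a) (hΦ : BddFn Φ) (hΨ : BddFn Ψ)
    (h : ∀ u, |Φ u| ≤ Ψ u) :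
    |integ Φ (fun _ => p) - integ Φ (fun _ => q)| ≤ ∑ l : Fin n, integ Ψ (hybrid p q l) := by
  obtain ⟨h1, h2⟩ := tsum_abs_prod_sub_le (n := n) hp hq hp0 hq0 hΨ
    fun u => (abs_nonneg _).trans (h u)
  refine le_trans ?_ h2
  have e : integ Φ (fun _ => p) - integ Φ (fun _ => q) =
      ∑' u : Fin n → α, Φ u * (∏ i, p (u i) - ∏ i, q (u i)) := by
    unfold integ
    rw [← (summable_integ hΦ fun _ => hp).tsum_sub (summable_integ hΦ fun _ => hq)]
    simp only [mul_sub]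
  rw [e]
  have h3 : ∀ u : Fin n → α, |Φ u * (∏ i, p (u i) - ∏ i, q (u i))| ≤
      Ψ u * |∏ i, p (u i) - ∏ i, q (u i)| := fun u => by
    rw [abs_mul]; exact mul_le_mul_of_nonneg_right (h u) (abs_nonneg _)
  have h4 : Summable fun u : Fin n → α => |Φ u * (∏ i, p (u i) - ∏ i, q (u i))| :=
    Summable.of_nonneg_of_le (fun _ => abs_nonneg _) h3 h1
  exact (norm_tsum_le_tsum_norm (f := fun u : Fin n → α =>
    Φ u * (∏ i, p (u i) - ∏ i, q (u i))) h4).trans (Summable.tsum_le_tsum h3 h4 h1)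

end integ

end sums

-- Compatible configurations around a clause

section clause

variable {d k : ℕ}

theorem Msg.clauseMap_of_true {n : ℕ} {s : Fin n → Msg} (h : ∀ i, s i = Msg.lit true) :
    Msg.clauseMap s = Msg.lit false := by
  rw [Msg.clauseMap, if_pos h]

theorem Msg.clauseMap_of_false {n : ℕ} {s : Fin n → Msg} (hn : 0 < n)
    (h : ∀ i, s i = Msg.lit false) : Msg.clauseMap s = Msg.lit true := by
  have h1 : ¬ ∀ i, s i = Msg.lit true := fun h' =>
    Bool.false_ne_true (Msg.lit_injective ((h ⟨0, hn⟩).symm.trans (h' ⟨0, hn⟩)))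
  rw [Msg.clauseMap, if_neg h1, if_pos h]

theorem Msg.clauseMap_eq_box {n : ℕ} {s : Fin n → Msg} (h : ∀ x, ∃ i, s i = Msg.lit x) :
    Msg.clauseMap s = Msg.box := by
  obtain ⟨i, hi⟩ := h false
  obtain ⟨j, hj⟩ := h true
  have h1 : ¬ ∀ i, s i = Msg.lit true := fun h' => by
    have := hi.symm.trans (h' i)
    exact Bool.false_ne_true (Msg.lit_injective this)
  have h2 : ¬ ∀ i, s i = Msg.lit false := fun h' => by
    have := (h' j).symm.trans hj
    exact Bool.false_ne_true (Msg.lit_injective this)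
  rw [Msg.clauseMap, if_neg h1, if_neg h2, if_pos ⟨⟨i, hi⟩, j, hj⟩]

theorem Msg.clauseMap_eq_join {n : ℕ} {s : Fin n → Msg} (h : ∀ x, ¬ ∀ i, s i = Msg.lit x)
    (h' : ¬ ∀ x, ∃ i, s i = Msg.lit x) : Msg.clauseMap s = Msg.join s := by
  rw [Msg.clauseMap, if_neg (h true), if_neg (h false), if_neg]
  rintro ⟨h0, h1⟩
  exact h' fun x => by cases x <;> assumption

/-- Negation swaps the two constant cases and preserves the other two. Nonemptiness matters: on the
empty tuple the all-`true` case takes precedence before and after negation, and the rule would fail.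
-/
theorem Msg.clauseMap_neg {n : ℕ} (hn : 0 < n) (s : Fin n → Msg) :
    Msg.clauseMap (fun i => (s i).neg) = (Msg.clauseMap s).neg := by
  by_cases ha : ∀ i, s i = Msg.lit true
  · rw [Msg.clauseMap_of_true ha, Msg.clauseMap_of_false hn fun i => by rw [ha i]; rfl]; rfl
  by_cases hb : ∀ i, s i = Msg.lit false
  · rw [Msg.clauseMap_of_false hn hb, Msg.clauseMap_of_true fun i => by rw [hb i]; rfl]; rfl
  by_cases hc : ∀ x, ∃ i, s i = Msg.lit x
  · rw [Msg.clauseMap_eq_box hc, Msg.clauseMap_eq_box]; · rfl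
    intro x
    obtain ⟨i, hi⟩ := hc (!x)
    exact ⟨i, by rw [hi]; simp [Msg.neg_lit]⟩
  · rw [Msg.clauseMap_eq_join (by rintro (_ | _) <;> assumption) hc, Msg.clauseMap_eq_join,
      Msg.neg_join]
    · rintro (_ | _) h
      · exact ha fun i => Msg.neg_eq_lit_iff.1 (h i)
      · exact hb fun i => Msg.neg_eq_lit_iff.1 (h i)
    · refine fun h => hc fun x => ?_
      obtain ⟨i, hi⟩ := h (!x)
      exact ⟨i, by simpa using Msg.neg_eq_lit_iff.1 hi⟩

namespace Spin

variable {F : Type}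

theorem addLit_false (f : F → F) (s : Spin F) : addLit f false s = s := by
  cases s <;> simp [addLit]

end Spin

theorem DotSpin.add_false (s : DotSpin d k) : s.add false = s := Spin.addLit_false _ s

theorem HatSpin.add_false (s : HatSpin d k) : s.add false = s := Spin.addLit_false _ s

theorem DotSpin.add_add (L : Bool) (s : DotSpin d k) : (s.add L).add L = s := by
  cases L
  · simp only [DotSpin.add_false]
  · cases s <;> simp [DotSpin.add, Spin.addLit, Msg.neg_neg]

theorem HatSpin.add_add (L : Bool) (s : HatSpin d k) : (s.add L).add L = s := by
  cases L
  · simp only [HatSpin.add_false]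
  · cases s <;> simp [HatSpin.add, Spin.addLit, Msg.neg_neg]

/-- Negation of a color. -/
def Color.flip (c : Color d k) : Color d k :=
  Spin.addLit (fun t => (⟨t.1.1.neg, t.1.2.neg⟩, ⟨t.2.1.neg, t.2.2.neg⟩)) true c

namespace Color

theorem flip_flip (c : Color d k) : c.flip.flip = c := by
  cases c <;> simp [flip, Spin.addLit, Msg.neg_neg]

theorem dot_flip (c : Color d k) : c.flip.dot = c.dot.add true := by
  cases c <;> rfl

theorem hat_flip (c : Color d k) : c.flip.hat = c.hat.add true := by
  cases c <;> rfl

theorem size_flip (c : Color d k) : c.flip.size = c.size := by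
  cases c <;> simp [flip, Spin.addLit, Color.size, Msg.size_neg]

theorem flip_eq_red_iff {c : Color d k} {x : Bool} : c.flip = .red x ↔ c = .red (!x) := by
  cases c <;> simp [flip, Spin.addLit]

theorem flip_eq_blue_iff {c : Color d k} {x : Bool} : c.flip = .blue x ↔ c = .blue (!x) := by
  cases c <;> simp [flip, Spin.addLit]

theorem msg_dot_flip (c : Color d k) : c.flip.dot.msg = c.dot.msg.neg := by
  cases c <;> simp [flip, Spin.addLit, dot, Spin.map, DotSpin.msg, Msg.neg_lit]

theorem ClauseValid.flip {c : Fin (k - 1 + 1) → Color d k} (hk : 1 < k) (h : ClauseValid c) :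
    ClauseValid fun i => (c i).flip := by
  rcases h with ⟨i, x, hi, hj⟩ | ⟨h1, h2, h3⟩
  · refine Or.inl ⟨i, !x, ?_, fun j hji => ?_⟩
    · simp only [hi, flip_eq_red_iff, Bool.not_not]
    · simp only [hj j hji, flip_eq_blue_iff, Bool.not_not]
  · refine Or.inr ⟨fun i x h => h1 i _ (flip_eq_red_iff.1 h), ?_, fun i t ht => ?_⟩
    · rintro ⟨i, x, h⟩
      exact h2 ⟨i, !x, fun j hj => flip_eq_blue_iff.1 (h j hj)⟩
    · simp only [msg_dot_flip]
      have ht' : c i = Color.flip (.free t) := by rw [← ht, flip_flip]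
      have h4 := h3 i _ ht'
      rw [Msg.clauseMap_neg (by omega), ← h4]
      exact (Msg.neg_neg _).symm

theorem hat_eq_red {c : Color d k} {x : Bool} (h : c.hat = .red x) : c = .red x := by
  cases c <;> simp_all [hat, Spin.map]

theorem hat_eq_blue {c : Color d k} {x : Bool} (h : c.hat = .blue x) : c = .blue x := by
  cases c <;> simp_all [hat, Spin.map]

theorem hat_eq_free {c : Color d k} {t : ClsTree d k} (h : c.hat = .free t) :
    ∃ t', c = .free (t', t) := by
  cases c with
  | red x => simp [hat, Spin.map] at h
  | blue x => simp [hat, Spin.map] at h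
  | free s =>
    refine ⟨s.1, ?_⟩
    have : s.2 = t := by simpa [hat, Spin.map] using h
    rw [← this]

theorem dot_eq_red {c : Color d k} {x : Bool} (h : c.dot = .red x) : c = .red x := by
  cases c <;> simp_all [dot, Spin.map]

theorem dot_eq_blue {c : Color d k} {x : Bool} (h : c.dot = .blue x) : c = .blue x := by
  cases c <;> simp_all [dot, Spin.map]

theorem dot_eq_free {c : Color d k} {t : VarTree d k} (h : c.dot = .free t) :
    ∃ t', c = .free (t, t') := by
  cases c with
  | red x => simp [dot, Spin.map] at h
  | blue x => simp [dot, Spin.map] at h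
  | free s =>
    refine ⟨s.2, ?_⟩
    have : s.1 = t := by simpa [dot, Spin.map] using h
    rw [← this]

end Color

theorem ClauseCompat.flip {T : ℕ∞} {s : HatSpin d k} {u : Fin (k - 1) → DotSpin d k}
    (hk : 1 < k) (h : ClauseCompat T s u) :
    ClauseCompat T (s.add true) fun i => (u i).add true := by
  obtain ⟨c, hv, hT, h0, hu⟩ := h
  refine ⟨fun i => (c i).flip, hv.flip hk, fun i => by rw [Color.size_flip]; exact hT i, ?_,
    fun j => ?_⟩
  · rw [Color.hat_flip, h0]
  · rw [Color.dot_flip, hu]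

theorem ClauseCompat.flip_iff {T : ℕ∞} {s : HatSpin d k} {u : Fin (k - 1) → DotSpin d k}
    (hk : 1 < k) : ClauseCompat T (s.add true) (fun i => (u i).add true) ↔ ClauseCompat T s u := by
  refine ⟨fun h => ?_, fun h => h.flip hk⟩
  have := h.flip hk
  simpa only [DotSpin.add_add, HatSpin.add_add] using this

theorem DotSpin.prob_msg_add (s : DotSpin d k) :
    (s.add true).msg.prob .var = 1 - s.msg.prob .var := by
  cases s with
  | red x => cases x <;> simp [DotSpin.add, Spin.addLit, DotSpin.msg, Msg.prob_lit]
  | blue x => cases x <;> simp [DotSpin.add, Spin.addLit, DotSpin.msg, Msg.prob_lit]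
  | free t => simp [DotSpin.add, Spin.addLit, DotSpin.msg, t.2.fair.2.2]

theorem clauseWeight_flip (lam : ℝ) (T : ℕ∞) (s : HatSpin d k) (u : Fin (k - 1) → DotSpin d k)
    (hk : 1 < k) :
    clauseWeight lam T (s.add true) (fun i => (u i).add true) = clauseWeight lam T s u := by
  unfold clauseWeight
  by_cases h : ClauseCompat T s u
  · rw [if_pos h, if_pos ((ClauseCompat.flip_iff hk).2 h)]
    cases s with
    | red x => rfl
    | blue x =>
      cases x <;> simp [HatSpin.add, Spin.addLit, DotSpin.prob_msg_add]
    | free t => simp [HatSpin.add, Spin.addLit, t.2.norm_neg]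
  · rw [if_neg h, if_neg (mt (ClauseCompat.flip_iff hk).1 h)]

section values

variable {lam : ℝ} {T : ℕ∞} {u : Fin (k - 1) → DotSpin d k}

/-- The spin is blue, or free and admitted by the truncation. -/
def DotSpin.Open (T : ℕ∞) : DotSpin d k → Prop
  | .red _ => False
  | .blue _ => True
  | .free t => (t.1.size .var : ℕ∞) ≤ T

theorem ClauseCompat.red_iff {x : Bool} :
    ClauseCompat T (.red x) u ↔ ∀ i, u i = .blue (!x) := by
  constructor
  · rintro ⟨c, hv, hT, h0, hu⟩ i
    have h0' := Color.hat_eq_red h0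
    rcases hv with ⟨j, y, hj, hj'⟩ | ⟨h1, -⟩
    · have hj0 : j = 0 := by
        by_contra hne
        have := h0'.symm.trans (hj' 0 fun h => hne h.symm)
        cases this
      subst hj0
      have hxy : x = y := by
        have := h0'.symm.trans hj
        cases this; rfl
      rw [← hu i, hj' _ (Fin.succ_ne_zero i), hxy]; rfl
    · exact absurd h0' (h1 0 x)
  · intro h
    refine ⟨Fin.cons (.red x) fun _ => .blue (!x), Or.inl ⟨0, x, rfl, fun j hj => ?_⟩, fun i => ?_,
      rfl, fun j => ?_⟩
    · obtain ⟨j, rfl⟩ := Fin.exists_succ_eq.2 hj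
      rfl
    · refine Fin.cases ?_ (fun j => ?_) i <;> simp [Color.size]
    · rw [h j]; rfl

/-- The no-red alternative for the incoming spins of a compatible configuration. -/
theorem ClauseCompat.open_of_forall_ne {c : Fin (k - 1 + 1) → Color d k}
    (hT : ∀ i, ((c i).size : ℕ∞) ≤ T) (hu : ∀ j : Fin (k - 1), (c j.succ).dot = u j)
    (h1 : ∀ i x, c i ≠ .red x) (i : Fin (k - 1)) : (u i).Open T := by
  have h2 := hT i.succ
  have h3 := hu i
  have h4 := h1 i.succ
  rw [← h3]
  cases hc : c i.succ with
  | red x => exact absurd hc (h4 x)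
  | blue x => trivial
  | free t =>
    rw [hc] at h2
    refine le_trans ?_ h2
    simp only [Color.size, Nat.cast_le]
    exact Nat.le_add_right _ _

theorem ClauseCompat.blue {x : Bool} (h : ClauseCompat T (.blue x) u) :
    (∃ i, u i = .red (!x) ∧ ∀ j, j ≠ i → u j = .blue x) ∨
      (∀ i, (u i).Open T) ∧ ∀ y, ¬ ∀ i, u i = .blue y := by
  obtain ⟨c, hv, hT, h0, hu⟩ := h
  have h0' := Color.hat_eq_blue h0
  rcases hv with ⟨i, y, hi, hj⟩ | ⟨h1, h2, -⟩
  · left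
    have hne : i ≠ 0 := by
      rintro rfl
      have := h0'.symm.trans hi
      cases this
    have hxy : x = !y := by
      have := h0'.symm.trans (hj 0 hne.symm)
      cases this; rfl
    subst hxy
    obtain ⟨i, rfl⟩ := Fin.exists_succ_eq.2 hne
    refine ⟨i, ?_, fun j hji => ?_⟩
    · rw [← hu i, hi]; simp [Color.dot, Spin.map]
    · rw [← hu j, hj _ fun h => hji (Fin.succ_injective _ h)]; rfl
  · right
    refine ⟨ClauseCompat.open_of_forall_ne hT hu h1, fun y h => h2 ⟨0, y, fun j hj => ?_⟩⟩
    obtain ⟨j, rfl⟩ := Fin.exists_succ_eq.2 hj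
    exact Color.dot_eq_blue ((hu j).trans (h j))

theorem ClauseCompat.free {t : ClsTree d k} (h : ClauseCompat T (.free t) u) :
    (∀ i, (u i).Open T) ∧ (∀ y, ¬ ∀ i, u i = .blue y) ∧
      t.1 = Msg.clauseMap fun i => (u i).msg := by
  obtain ⟨c, hv, hT, h0, hu⟩ := h
  obtain ⟨t', h0'⟩ := Color.hat_eq_free h0
  rcases hv with ⟨i, y, hi, hj⟩ | ⟨h1, h2, h3⟩
  · by_cases hi0 : i = 0
    · subst hi0
      have := h0'.symm.trans hi
      cases this
    · have := h0'.symm.trans (hj 0 fun h => hi0 h.symm)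
      cases this
  · refine ⟨ClauseCompat.open_of_forall_ne hT hu h1, fun y h => h2 ⟨0, y, fun j hj => ?_⟩, ?_⟩
    · obtain ⟨j, rfl⟩ := Fin.exists_succ_eq.2 hj
      exact Color.dot_eq_blue ((hu j).trans (h j))
    · have := h3 0 _ h0'
      simpa only [Fin.succAbove_zero, hu] using this

/-- The unlabelled edge as a free clause message. -/
def ClsTree.box : ClsTree d k := ⟨Msg.box, .box⟩

/-- A color with given first component, the second one being the unlabelled edge if free. -/
def DotSpin.color (s : DotSpin d k) : Color d k := s.map fun t => (t, ClsTree.box)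

theorem DotSpin.dot_color (s : DotSpin d k) : s.color.dot = s := by
  cases s <;> rfl

theorem DotSpin.Open.size_color {s : DotSpin d k} (h : s.Open T) : (s.color.size : ℕ∞) ≤ T := by
  cases s with
  | red x => exact h.elim
  | blue x => simp [color, Spin.map, Color.size]
  | free t =>
    simp only [color, Spin.map, Color.size, ClsTree.box, Msg.size_box, add_zero]
    exact h

theorem DotSpin.Open.color_ne_red {s : DotSpin d k} (h : s.Open T) (x : Bool) :
    s.color ≠ .red x := by
  cases s with
  | red x => exact h.elim
  | blue x => simp [color, Spin.map]
  | free t => simp [color, Spin.map]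

theorem DotSpin.color_eq_blue {s : DotSpin d k} {x : Bool} (h : s.color = .blue x) :
    s = .blue x := by
  rw [← s.dot_color, h]; rfl

theorem DotSpin.color_eq_free {s : DotSpin d k} {t : VarTree d k × ClsTree d k}
    (h : s.color = .free t) : t.2 = ClsTree.box := by
  cases s with
  | red x => simp [color, Spin.map] at h
  | blue x => simp [color, Spin.map] at h
  | free t' =>
    simp only [color, Spin.map, Spin.free.injEq] at h
    rw [← h]

/-- The outgoing `blue x` and the incoming `blue (!x)` at `i₁` show both labels to every free edge,
so all unknown second components can and must be the unlabelled edge, which adds nothing to the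
size. No pattern "all but one equal to a common blue" arises: for `x` it is blocked by the two
positions `i₁` and `i₂`, for `!x` by the first edge and `i₀`. -/
theorem ClauseCompat.blue_of_mixed {x : Bool} (h : ∀ i, (u i).Open T) {i₀ i₁ i₂ : Fin (k - 1)}
    (h0 : u i₀ = .blue x) (h1 : u i₁ = .blue (!x)) (h12 : i₁ ≠ i₂) (h2 : u i₂ ≠ .blue x) :
    ClauseCompat T (.blue x) u := by
  have hx : (Spin.blue x : Color d k) ≠ .blue (!x) := by simp
  refine ⟨Fin.cons (.blue x) fun i => (u i).color, Or.inr ⟨fun i y => ?_, ?_, fun i t ht => ?_⟩,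
    fun i => ?_, rfl, fun j => (u j).dot_color⟩
  · refine Fin.cases (by simp) (fun j => ?_) i
    exact (h j).color_ne_red y
  · rintro ⟨i, y, hy⟩
    by_cases hyx : y = x
    · subst hyx
      by_cases hi : i = i₁.succ
      · have := hy i₂.succ (by rw [hi]; exact fun h => h12 (Fin.succ_injective _ h).symm)
        exact h2 (DotSpin.color_eq_blue this)
      · have := DotSpin.color_eq_blue (hy i₁.succ (Ne.symm hi))
        rw [h1] at this
        simp at this
    · by_cases hi : i = 0
      · subst hi
        have := DotSpin.color_eq_blue (hy i₀.succ (Fin.succ_ne_zero _))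
        rw [h0] at this
        exact hyx (by simpa using this.symm)
      · have := hy 0 (Ne.symm hi)
        simp only [Fin.cons_zero, Spin.blue.injEq] at this
        exact hyx this.symm
  · refine Fin.cases (fun ht => ?_) (fun j ht => ?_) i ht
    · simp at ht
    · have ht' := DotSpin.color_eq_free ht
      rw [ht']
      refine (Msg.clauseMap_eq_box fun y => ?_).symm
      have hj0 : (0 : Fin (k - 1 + 1)) ≠ j.succ := (Fin.succ_ne_zero j).symm
      have hj1 : i₁.succ ≠ j.succ := fun h => by
        rw [← Fin.succ_injective _ h, Fin.cons_succ, h1] at ht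
        simp [DotSpin.color, Spin.map] at ht
      by_cases hyx : y = x
      · obtain ⟨l, hl⟩ := Fin.exists_succAbove_eq hj0
        refine ⟨l, ?_⟩
        rw [hl, hyx]; rfl
      · obtain ⟨l, hl⟩ := Fin.exists_succAbove_eq hj1
        refine ⟨l, ?_⟩
        rw [hl, Fin.cons_succ, h1]
        simp [DotSpin.color, Spin.map, Color.dot, DotSpin.msg, Bool.eq_not_of_ne hyx]
  · refine Fin.cases (by simp [Color.size]) (fun j => ?_) i
    exact (h j).size_color

/-- The join of unlabelled edges as a free variable message. -/
def VarTree.star : VarTree d k := ⟨Msg.join fun _ => Msg.box, .join _ fun _ => .box⟩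

/-- The first edge needs some variable message to complete its color. The join of unlabelled edges
has a single free variable, which fits the truncation because `1 ≤ T`. -/
theorem ClauseCompat.box_of_mixed (hT : 1 ≤ T) (h : ∀ i, (u i).Open T)
    (hm : ∀ x, ∃ i, u i = .blue x) : ClauseCompat T (.free ClsTree.box) u := by
  refine ⟨Fin.cons (.free (VarTree.star, ClsTree.box)) fun i => (u i).color,
    Or.inr ⟨fun i y => ?_, ?_, fun i t ht => ?_⟩, fun i => ?_, rfl, fun j => (u j).dot_color⟩
  · refine Fin.cases (by simp) (fun j => ?_) i
    exact (h j).color_ne_red y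
  · rintro ⟨i, y, hy⟩
    by_cases hi : i = 0
    · subst hi
      obtain ⟨j, hj⟩ := hm (!y)
      have := DotSpin.color_eq_blue (hy j.succ (Fin.succ_ne_zero _))
      rw [hj] at this
      simp at this
    · have := hy 0 (Ne.symm hi)
      simp at this
  · have ht2 : t.2 = ClsTree.box := by
      refine Fin.cases (fun ht => ?_) (fun j ht => DotSpin.color_eq_free ht) i ht
      simp only [Fin.cons_zero, Spin.free.injEq] at ht
      rw [← ht]
    rw [ht2]
    refine (Msg.clauseMap_eq_box fun y => ?_).symm
    obtain ⟨j, hj⟩ := hm y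
    have hji : j.succ ≠ i := by
      rintro rfl
      rw [Fin.cons_succ, hj] at ht
      simp [DotSpin.color, Spin.map] at ht
    obtain ⟨l, hl⟩ := Fin.exists_succAbove_eq hji
    refine ⟨l, ?_⟩
    rw [hl, Fin.cons_succ, hj]
    rfl
  · refine Fin.cases ?_ (fun j => (h j).size_color) i
    simpa [Color.size, VarTree.star, ClsTree.box, Msg.size_box, Msg.size_var_join] using hT

theorem ClauseCompat.blue_of_red {x : Bool} {i : Fin (k - 1)} (hi : u i = .red (!x))
    (hj : ∀ j, j ≠ i → u j = .blue x) : ClauseCompat T (.blue x) u := by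
  refine ⟨Fin.cons (.blue x) fun i => (u i).color, Or.inl ⟨i.succ, !x, ?_, fun j hji => ?_⟩,
    fun j => ?_, rfl, fun j => (u j).dot_color⟩
  · rw [Fin.cons_succ, hi]; rfl
  · revert hji
    refine Fin.cases (fun _ => by simp) (fun j hji => ?_) j
    rw [Fin.cons_succ, hj j fun h => hji (by rw [h])]
    simp [DotSpin.color, Spin.map]
  · refine Fin.cases (by simp [Color.size]) (fun j => ?_) j
    rw [Fin.cons_succ]
    by_cases h : j = i
    · rw [h, hi]; simp [DotSpin.color, Spin.map, Color.size]
    · rw [hj j h]; simp [DotSpin.color, Spin.map, Color.size]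

end values

end clause

-- Sums over spins

section spinSums

variable {F : Type}

/-- The decomposition of spins into red, blue and free ones. -/
def Spin.equivSum : Bool ⊕ Bool ⊕ F ≃ Spin F where
  toFun := Sum.elim Spin.red (Sum.elim Spin.blue Spin.free)
  invFun
    | .red x => .inl x
    | .blue x => .inr (.inl x)
    | .free t => .inr (.inr t)
  left_inv := by rintro (x | x | t) <;> rfl
  right_inv := by rintro (x | x | t) <;> rfl

theorem Spin.hasSum {f : Spin F → ℝ} {c : ℝ} (h : HasSum (fun t => f (.free t)) c) :
    HasSum f ((∑ x, f (.red x)) + ((∑ x, f (.blue x)) + c)) := by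
  rw [← Spin.equivSum.hasSum_iff]
  refine HasSum.sum (hasSum_fintype _) (HasSum.sum (hasSum_fintype _) h)

theorem Spin.summable {f : Spin F → ℝ} (h : Summable fun t => f (.free t)) : Summable f :=
  (Spin.hasSum h.hasSum).summable

theorem Spin.tsum {f : Spin F → ℝ} (h : Summable fun t => f (.free t)) :
    ∑' s, f s = (∑ x, f (.red x)) + ((∑ x, f (.blue x)) + ∑' t, f (.free t)) :=
  (Spin.hasSum h.hasSum).tsum_eq

/-- For a vertex the outgoing free message is determined by the incoming ones, so sums over the
infinite set of free messages have at most one nonzero term. -/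
theorem hasSum_of_support_unique {α : Type} {f : α → ℝ} {B : ℝ} (hB : 0 ≤ B)
    (h : ∀ a b, f a ≠ 0 → f b ≠ 0 → a = b) (h0 : ∀ a, 0 ≤ f a ∧ f a ≤ B) :
    Summable f ∧ 0 ≤ ∑' a, f a ∧ ∑' a, f a ≤ B ∧ (∑' a, f a ≠ 0 → ∃ a, f a ≠ 0) := by
  by_cases hf : ∃ a, f a ≠ 0
  · obtain ⟨a, ha⟩ := hf
    have := hasSum_single (f := f) a fun b hb => by
      by_contra hne
      exact hb (h b a hne ha)
    refine ⟨this.summable, ?_, ?_, fun _ => ⟨a, ha⟩⟩ <;> rw [this.tsum_eq]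
    exacts [(h0 a).1, (h0 a).2]
  · push Not at hf
    have : f = fun _ => 0 := funext hf
    subst this
    exact ⟨summable_zero, by simp, by simpa using hB, by simp⟩

end spinSums

-- Clause weights and their responses to test functions

section clause

variable {d k : ℕ} {lam : ℝ} {T : ℕ∞} {u : Fin (k - 1) → DotSpin d k}

theorem clauseWeight_red (x : Bool) (u : Fin (k - 1) → DotSpin d k)
    (h : ∀ i, u i = .blue (!x)) : clauseWeight lam T (.red x) u = 1 := by
  rw [clauseWeight.eq_def, if_pos (ClauseCompat.red_iff.2 h)]

theorem clauseWeight_red_of_not (x : Bool) (u : Fin (k - 1) → DotSpin d k)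
    (h : ¬ ∀ i, u i = .blue (!x)) : clauseWeight lam T (.red x) u = 0 := by
  rw [clauseWeight.eq_def, if_neg (mt ClauseCompat.red_iff.1 h)]

theorem DotSpin.probOf_mem_unit (x : Bool) (s : DotSpin d k) :
    0 ≤ s.msg.probOf .var x ∧ s.msg.probOf .var x ≤ 1 := Msg.probOf_mem_unit _ _ _

theorem clauseWeight_blue (x : Bool) (h : ClauseCompat T (.blue x) u) :
    clauseWeight lam T (.blue x) u = (1 - ∏ i, (u i).msg.probOf .var x) ^ lam := by
  rw [clauseWeight.eq_def, if_pos h]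
  cases x <;> rfl

theorem clauseWeight_blue_mem (hlam : 0 ≤ lam) (x : Bool) (u : Fin (k - 1) → DotSpin d k) :
    0 ≤ clauseWeight lam T (.blue x) u ∧ clauseWeight lam T (.blue x) u ≤ 1 := by
  by_cases h : ClauseCompat T (.blue x) u
  · rw [clauseWeight_blue x h]
    have h0 : 0 ≤ ∏ i, (u i).msg.probOf .var x :=
      Finset.prod_nonneg fun i _ => ((u i).probOf_mem_unit x).1
    have h1 : ∏ i, (u i).msg.probOf .var x ≤ 1 :=
      Finset.prod_le_one (fun i _ => ((u i).probOf_mem_unit x).1) fun i _ =>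
        ((u i).probOf_mem_unit x).2
    exact ⟨Real.rpow_nonneg (by linarith) _, Real.rpow_le_one (by linarith) (by linarith) hlam⟩
  · rw [clauseWeight.eq_def, if_neg h]
    exact ⟨le_rfl, zero_le_one⟩

theorem clauseWeight_blue_eq_one (x : Bool) (h : ClauseCompat T (.blue x) u) {i : Fin (k - 1)}
    (hi : u i = .red (!x) ∨ u i = .blue (!x)) : clauseWeight lam T (.blue x) u = 1 := by
  rw [clauseWeight_blue x h, Finset.prod_eq_zero (Finset.mem_univ i), sub_zero, Real.one_rpow]
  rcases hi with hi | hi <;> rw [hi] <;> cases x <;>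
    simp [DotSpin.msg, Msg.probOf, Msg.prob_lit]

theorem clauseWeight_free (t : ClsTree d k) (h : ClauseCompat T (.free t) u) :
    clauseWeight lam T (.free t) u = (t.1.norm .cls) ^ lam := by
  rw [clauseWeight.eq_def, if_pos h]

theorem clauseWeight_nonneg (hlam : 0 ≤ lam) (s : HatSpin d k) (u : Fin (k - 1) → DotSpin d k) :
    0 ≤ clauseWeight lam T s u := by
  cases s with
  | red x =>
    by_cases h : ∀ i, u i = .blue (!x)
    · rw [clauseWeight_red x u h]; exact zero_le_one
    · rw [clauseWeight_red_of_not x u h]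
  | blue x => exact (clauseWeight_blue_mem hlam x u).1
  | free t =>
    by_cases h : ClauseCompat T (.free t) u
    · rw [clauseWeight_free t h]
      exact Real.rpow_nonneg t.2.norm_nonneg _
    · rw [clauseWeight.eq_def, if_neg h]

theorem ClauseCompat.of_weight_ne {s : HatSpin d k} (h : clauseWeight lam T s u ≠ 0) :
    ClauseCompat T s u := by
  by_contra hc
  rw [clauseWeight.eq_def, if_neg hc] at h
  exact h rfl

/-- The kinds of test functions on clause-to-variable spins. -/
inductive TestKind : Type
  | colored : TestKind
  | blue : TestKind
  | free : TestKind

/-- The test functions on clause-to-variable spins: the indicators of `{red x, blue x}` and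
of `blue x`, and the `lam`-th power of the probability of `x` on free spins. -/
def test (lam : ℝ) : TestKind → Bool → HatSpin d k → ℝ
  | .colored, x, .red y => if y = x then 1 else 0
  | .colored, x, .blue y => if y = x then 1 else 0
  | .colored, _, .free _ => 0
  | .blue, _, .red _ => 0
  | .blue, x, .blue y => if y = x then 1 else 0
  | .blue, _, .free _ => 0
  | .free, _, .red _ => 0
  | .free, _, .blue _ => 0
  | .free, x, .free t => (t.1.probOf .cls x) ^ lam

theorem test_mem_unit (hlam : 0 ≤ lam) (κ : TestKind) (x : Bool) (s : HatSpin d k) :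
    0 ≤ test lam κ x s ∧ test lam κ x s ≤ 1 := by
  cases κ <;> cases s <;> simp only [test] <;> try (split_ifs <;> norm_num)
  all_goals norm_num
  exact ⟨Real.rpow_nonneg (Msg.probOf_mem_unit _ _ _).1 _,
    Real.rpow_le_one (Msg.probOf_mem_unit _ _ _).1 (Msg.probOf_mem_unit _ _ _).2 hlam⟩

/-- The expected tested weight that a clause sends, given its incoming spins. -/
def response (lam : ℝ) (T : ℕ∞) (κ : TestKind) (x : Bool) (u : Fin (k - 1) → DotSpin d k) : ℝ :=
  ∑' s, clauseWeight lam T s u * test lam κ x s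

theorem summable_clauseWeight_free (hlam : 0 ≤ lam) (u : Fin (k - 1) → DotSpin d k) :
    (Summable fun t => clauseWeight lam T (.free t) u) ∧
      ∑' t, clauseWeight lam T (.free t) u ≤ 2 ^ lam := by
  have := hasSum_of_support_unique (f := fun t => clauseWeight lam T (.free t) u) (B := 2 ^ lam)
    (by positivity) (fun a b ha hb => ?_) fun t => ⟨clauseWeight_nonneg hlam _ _, ?_⟩
  · exact ⟨this.1, this.2.2.1⟩
  · exact Subtype.ext ((ClauseCompat.of_weight_ne ha).free.2.2.trans
      (ClauseCompat.of_weight_ne hb).free.2.2.symm)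
  · by_cases h : ClauseCompat T (.free t) u
    · rw [clauseWeight_free t h]
      refine Real.rpow_le_rpow t.2.norm_nonneg ?_ hlam
      have h0 := t.2.norm_mul_probOf true
      have h1 := t.2.norm_mul_probOf false
      simp only [Msg.probOf, if_true, if_false, Bool.false_eq_true] at h0 h1
      linarith
    · rw [clauseWeight.eq_def, if_neg h]; positivity

theorem summable_clauseWeight (hlam : 0 ≤ lam) (u : Fin (k - 1) → DotSpin d k) :
    (Summable fun s => clauseWeight lam T s u) ∧
      ∑' s, clauseWeight lam T s u ≤ 4 + 2 ^ lam := by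
  have h := summable_clauseWeight_free (T := T) hlam u
  refine ⟨Spin.summable (f := fun s => clauseWeight lam T s u) h.1, ?_⟩
  rw [Spin.tsum (f := fun s => clauseWeight lam T s u) h.1, Fintype.sum_bool, Fintype.sum_bool]
  have hr : ∀ x, clauseWeight lam T (.red x) u ≤ 1 := fun x => by
    by_cases h : ∀ i, u i = .blue (!x)
    · rw [clauseWeight_red x u h]
    · rw [clauseWeight_red_of_not x u h]; exact zero_le_one
  have := (clauseWeight_blue_mem (T := T) hlam true u).2
  have := (clauseWeight_blue_mem (T := T) hlam false u).2
  linarith [hr true, hr false, h.2]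

theorem summable_response_kernel (hlam : 0 ≤ lam) (κ : TestKind) (x : Bool)
    (u : Fin (k - 1) → DotSpin d k) :
    Summable fun s => clauseWeight lam T s u * test lam κ x s := by
  refine Summable.of_nonneg_of_le (fun _ => mul_nonneg (clauseWeight_nonneg hlam _ _)
    (test_mem_unit hlam _ _ _).1) (fun s => ?_) (summable_clauseWeight (T := T) hlam u).1
  exact mul_le_of_le_one_right (clauseWeight_nonneg hlam _ _) (test_mem_unit hlam _ _ _).2

theorem response_nonneg (hlam : 0 ≤ lam) (κ : TestKind) (x : Bool)
    (u : Fin (k - 1) → DotSpin d k) : 0 ≤ response lam T κ x u :=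
  tsum_nonneg fun _ => mul_nonneg (clauseWeight_nonneg hlam _ _) (test_mem_unit hlam _ _ _).1

theorem response_colored (x : Bool) (u : Fin (k - 1) → DotSpin d k) :
    response lam T .colored x u =
      clauseWeight lam T (.red x) u + clauseWeight lam T (.blue x) u := by
  have h : Summable fun t : ClsTree d k =>
    clauseWeight lam T (.free t) u * test lam .colored x (.free t) := by
    simp only [test, mul_zero, summable_zero]
  rw [response, Spin.tsum (f := fun s => clauseWeight lam T s u * test lam .colored x s) h, Fintype.sum_bool, Fintype.sum_bool]
  cases x <;> simp [test]

theorem response_blue (x : Bool) (u : Fin (k - 1) → DotSpin d k) :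
    response lam T .blue x u = clauseWeight lam T (.blue x) u := by
  have h : Summable fun t : ClsTree d k =>
    clauseWeight lam T (.free t) u * test lam .blue x (.free t) := by
    simp only [test, mul_zero, summable_zero]
  rw [response, Spin.tsum (f := fun s => clauseWeight lam T s u * test lam .blue x s) h, Fintype.sum_bool, Fintype.sum_bool]
  cases x <;> simp [test]

theorem response_free (hlam : 0 ≤ lam) (x : Bool) (u : Fin (k - 1) → DotSpin d k) :
    response lam T .free x u =
      ∑' t : ClsTree d k, clauseWeight lam T (.free t) u * (t.1.probOf .cls x) ^ lam := by
  have h : Summable fun t : ClsTree d k =>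
      clauseWeight lam T (.free t) u * test lam .free x (.free t) :=
    (summable_response_kernel (T := T) hlam .free x u).comp_injective
      (i := Spin.free) fun a b h => by cases h; rfl
  rw [response, Spin.tsum (f := fun s => clauseWeight lam T s u * test lam .free x s) h]
  simp only [test, mul_zero, Finset.sum_const_zero, zero_add]

/-- The single free message that can be sent contributes the λ-th power of its normalizing constant
times its probability of `x`, which is at most one. -/
theorem response_free_mem (hlam : 0 ≤ lam) (x : Bool) (u : Fin (k - 1) → DotSpin d k) :
    response lam T .free x u ≤ 1 ∧ (response lam T .free x u ≠ 0 →
      (∀ i, (u i).Open T) ∧ ∀ y, ¬ ∀ i, u i = .blue y) := by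
  rw [response_free hlam]
  have := hasSum_of_support_unique
    (f := fun t : ClsTree d k => clauseWeight lam T (.free t) u * (t.1.probOf .cls x) ^ lam)
    (B := 1) zero_le_one (fun a b ha hb => ?_) fun t => ⟨?_, ?_⟩
  · refine ⟨this.2.2.1, fun hne => ?_⟩
    obtain ⟨t, ht⟩ := this.2.2.2 hne
    have h3 := (ClauseCompat.of_weight_ne (left_ne_zero_of_mul ht)).free
    exact ⟨h3.1, h3.2.1⟩
  · exact Subtype.ext ((ClauseCompat.of_weight_ne (left_ne_zero_of_mul ha)).free.2.2.trans
      (ClauseCompat.of_weight_ne (left_ne_zero_of_mul hb)).free.2.2.symm)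
  · exact mul_nonneg (clauseWeight_nonneg hlam _ _)
      (Real.rpow_nonneg (Msg.probOf_mem_unit _ _ _).1 _)
  · by_cases h : ClauseCompat T (.free t) u
    · rw [clauseWeight_free t h, ← Real.mul_rpow t.2.norm_nonneg (Msg.probOf_mem_unit _ _ _).1]
      exact Real.rpow_le_one (mul_nonneg t.2.norm_nonneg (Msg.probOf_mem_unit _ _ _).1)
        (t.2.norm_mul_probOf x) hlam
    · rw [clauseWeight.eq_def, if_neg h]; simp

/-- The spins `red x` and `blue x` exclude each other: the former needs all incoming spins equal to
`blue (!x)`, and this pattern forbids the latter. -/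
theorem response_colored_le_one (hlam : 0 ≤ lam) (x : Bool)
    (u : Fin (k - 1) → DotSpin d k) : response lam T .colored x u ≤ 1 := by
  rw [response_colored]
  have h1 := clauseWeight_blue_mem (T := T) hlam x u
  by_cases h : ∀ i, u i = .blue (!x)
  · rw [clauseWeight_red x u h]
    have : clauseWeight lam T (.blue x) u = 0 := by
      by_contra hne
      rcases (ClauseCompat.of_weight_ne hne).blue with ⟨i, hi, -⟩ | ⟨-, h3⟩
      · rw [h i] at hi; cases hi
      · exact h3 _ h
    linarith
  · rw [clauseWeight_red_of_not x u h]; linarith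

theorem response_blue_le_colored (hlam : 0 ≤ lam) (x : Bool) (u : Fin (k - 1) → DotSpin d k) :
    response lam T .blue x u ≤ response lam T .colored x u := by
  rw [response_colored, response_blue]
  linarith [clauseWeight_nonneg (T := T) hlam (.red x) u]

theorem response_le_one (hlam : 0 ≤ lam) (κ : TestKind) (x : Bool)
    (u : Fin (k - 1) → DotSpin d k) : response lam T κ x u ≤ 1 := by
  cases κ with
  | colored => exact response_colored_le_one hlam x u
  | blue => exact (response_blue_le_colored hlam x u).trans (response_colored_le_one hlam x u)
  | free => exact (response_free_mem hlam x u).1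

theorem test_flip (κ : TestKind) (x : Bool) (s : HatSpin d k) :
    test lam κ x (s.add true) = test lam κ (!x) s := by
  cases s with
  | red y => cases κ <;> cases x <;> cases y <;> simp [test, HatSpin.add, Spin.addLit]
  | blue y => cases κ <;> cases x <;> cases y <;> simp [test, HatSpin.add, Spin.addLit]
  | free t =>
    cases κ with
    | colored => rfl
    | blue => rfl
    | free =>
      simp only [test, HatSpin.add, Spin.addLit, if_true]
      rw [t.2.probOf_neg]

/-- Negation of clause-to-variable spins. -/
def HatSpin.flipEquiv : HatSpin d k ≃ HatSpin d k :=
  ⟨HatSpin.add true, HatSpin.add true, HatSpin.add_add true, HatSpin.add_add true⟩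

/-- Negation of variable-to-clause spins. -/
def DotSpin.flipEquiv : DotSpin d k ≃ DotSpin d k :=
  ⟨DotSpin.add true, DotSpin.add true, DotSpin.add_add true, DotSpin.add_add true⟩

theorem response_flip (hk : 1 < k) (κ : TestKind) (x : Bool) (u : Fin (k - 1) → DotSpin d k) :
    response lam T κ x (fun i => (u i).add true) = response lam T κ (!x) u := by
  unfold response
  rw [← HatSpin.flipEquiv.tsum_eq]
  refine tsum_congr fun s => ?_
  change clauseWeight lam T (s.add true) _ * test lam κ x (s.add true) = _
  rw [clauseWeight_flip _ _ _ _ hk, test_flip]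

end clause

-- Indicators and their products

section indicators

open Classical in
/-- The indicator of a proposition. -/
def ind (P : Prop) : ℝ := if P then 1 else 0

theorem ind_of {P : Prop} (h : P) : ind P = 1 := if_pos h

theorem ind_of_not {P : Prop} (h : ¬ P) : ind P = 0 := if_neg h

theorem ind_mem_unit (P : Prop) : 0 ≤ ind P ∧ ind P ≤ 1 := by
  unfold ind; split_ifs <;> norm_num

theorem ind_mono {P Q : Prop} (h : P → Q) : ind P ≤ ind Q := by
  by_cases hP : P
  · rw [ind_of hP, ind_of (h hP)]
  · rw [ind_of_not hP]; exact (ind_mem_unit Q).1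

theorem ind_congr {P Q : Prop} (h : P ↔ Q) : ind P = ind Q := by rw [propext h]

theorem prod_ind {n : ℕ} (P : Fin n → Prop) : ∏ i, ind (P i) = ind (∀ i, P i) := by
  by_cases h : ∀ i, P i
  · rw [ind_of h]; exact Finset.prod_eq_one fun i _ => ind_of (h i)
  · rw [ind_of_not h]
    push Not at h
    obtain ⟨i, hi⟩ := h
    exact Finset.prod_eq_zero (Finset.mem_univ i) (ind_of_not hi)

theorem prod_ite_ind {n : ℕ} (i : Fin n) (P Q : Fin n → Prop) :
    ∏ j, (if j = i then ind (P j) else ind (Q j)) = ind (P i ∧ ∀ j, j ≠ i → Q j) := by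
  have : ∀ j, (if j = i then ind (P j) else ind (Q j)) =
      ind ((j = i → P j) ∧ (j ≠ i → Q j)) := fun j => by
    split_ifs with h <;> exact ind_congr (by simp [h])
  simp only [this, prod_ind]
  refine ind_congr ⟨fun h => ⟨(h i).1 rfl, fun j => (h j).2⟩, fun h j => ⟨?_, h.2 j⟩⟩
  rintro rfl
  exact h.1

theorem prod_ite_one_ind {n : ℕ} (i : Fin n) (Q : Fin n → Prop) :
    ∏ j, (if j = i then 1 else ind (Q j)) = ind (∀ j, j ≠ i → Q j) := by
  have := prod_ite_ind i (fun _ => True) Q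
  rw [ind_of trivial] at this
  rw [this]
  exact ind_congr (by simp)

theorem bddFn_ind {α : Type} (P : α → Prop) : BddFn fun a => ind (P a) :=
  BddFn.of_mem 1 fun _ => ind_mem_unit _

end indicators

-- Exceptional incoming configurations of a clause

section clause

variable {d k : ℕ}

/-- The spin is `blue x`, or free and admitted by the truncation. -/
def DotSpin.Near (T : ℕ∞) (x : Bool) : DotSpin d k → Prop
  | .red _ => False
  | .blue y => y = x
  | .free t => (t.1.size .var : ℕ∞) ≤ T

theorem DotSpin.Near.open {T : ℕ∞} {x : Bool} {s : DotSpin d k} (h : s.Near T x) : s.Open T := by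
  cases s with
  | red x => exact h
  | blue y => trivial
  | free t => exact h

theorem DotSpin.Open.eq_blue_of_not_near {T : ℕ∞} {x : Bool} {s : DotSpin d k} (h : s.Open T)
    (h' : ¬ s.Near T x) : s = .blue (!x) := by
  cases s with
  | red x => exact h.elim
  | blue y => rw [Bool.eq_not_of_ne (show y ≠ x from h')]
  | free t => exact (h' h).elim

/-- The indicator that no spin is red (or discarded by the truncation). -/
def allOpen (T : ℕ∞) {n : ℕ} (u : Fin n → DotSpin d k) : ℝ := ∏ j, ind ((u j).Open T)

/-- The number of ways in which all spins but one are, for some `x`, free or `blue x`. -/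
def nearCount (T : ℕ∞) {n : ℕ} (u : Fin n → DotSpin d k) : ℝ :=
  ∑ x, ∑ i, ∏ j, if j = i then 1 else ind ((u j).Near T x)

/-- The number of ways in which one spin is free and all others are, for some `x`, free or
`blue x`. -/
def freeCount (T : ℕ∞) {n : ℕ} (u : Fin n → DotSpin d k) : ℝ :=
  ∑ x, ∑ i, ∏ j, if j = i then ind ((u j).IsFree ∧ (u j).Open T) else ind ((u j).Near T x)

/-- The number of ways in which one spin is `s` and all others are `blue x`. -/
def offCount {n : ℕ} (s : DotSpin d k) (x : Bool) (u : Fin n → DotSpin d k) : ℝ :=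
  ∑ i, ∏ j, if j = i then ind (u j = s) else ind (u j = .blue x)

/-- The indicator that all spins are `blue x`. -/
def allBlue {n : ℕ} (x : Bool) (u : Fin n → DotSpin d k) : ℝ := ∏ j, ind (u j = .blue x)

section bounds

variable {n : ℕ} (T : ℕ∞) (u : Fin n → DotSpin d k)

theorem allOpen_eq : allOpen T u = ind (∀ j, (u j).Open T) := prod_ind _

theorem allBlue_eq (x : Bool) : allBlue x u = ind (∀ j, u j = .blue x) := prod_ind _

theorem nearCount_eq :
    nearCount T u = ∑ x, ∑ i, ind (∀ j, j ≠ i → (u j).Near T x) := by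
  simp only [nearCount, prod_ite_one_ind]

theorem freeCount_eq :
    freeCount T u = ∑ x, ∑ i, ind (((u i).IsFree ∧ (u i).Open T) ∧
      ∀ j, j ≠ i → (u j).Near T x) := by
  simp only [freeCount]
  refine Finset.sum_congr rfl fun x _ => Finset.sum_congr rfl fun i _ => ?_
  exact prod_ite_ind i (fun j => (u j).IsFree ∧ (u j).Open T) _

theorem offCount_eq (s : DotSpin d k) (x : Bool) :
    offCount s x u = ∑ i, ind (u i = s ∧ ∀ j, j ≠ i → u j = .blue x) := by
  simp only [offCount]
  exact Finset.sum_congr rfl fun i _ => prod_ite_ind i (fun j => u j = s) _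

theorem nearCount_nonneg : 0 ≤ nearCount T u := by
  rw [nearCount_eq]
  exact Finset.sum_nonneg fun _ _ => Finset.sum_nonneg fun _ _ => (ind_mem_unit _).1

theorem freeCount_nonneg : 0 ≤ freeCount T u := by
  rw [freeCount_eq]
  exact Finset.sum_nonneg fun _ _ => Finset.sum_nonneg fun _ _ => (ind_mem_unit _).1

theorem offCount_nonneg (s : DotSpin d k) (x : Bool) : 0 ≤ offCount s x u := by
  rw [offCount_eq]
  exact Finset.sum_nonneg fun _ _ => (ind_mem_unit _).1

theorem one_le_nearCount {x : Bool} {i : Fin n} (h : ∀ j, j ≠ i → (u j).Near T x) :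
    1 ≤ nearCount T u := by
  rw [nearCount_eq, ← ind_of h]
  exact (Finset.single_le_sum (f := fun i => ind (∀ j, j ≠ i → (u j).Near T x))
    (fun _ _ => (ind_mem_unit _).1) (Finset.mem_univ i)).trans
    (Finset.single_le_sum (f := fun x => ∑ i, ind (∀ j, j ≠ i → (u j).Near T x))
    (fun _ _ => Finset.sum_nonneg fun _ _ => (ind_mem_unit _).1) (Finset.mem_univ x))

theorem one_le_freeCount {x : Bool} {i : Fin n} (hi : (u i).IsFree ∧ (u i).Open T)
    (h : ∀ j, j ≠ i → (u j).Near T x) : 1 ≤ freeCount T u := by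
  rw [freeCount_eq, ← ind_of (And.intro hi h)]
  exact (Finset.single_le_sum (f := fun i => ind (((u i).IsFree ∧ (u i).Open T) ∧
      ∀ j, j ≠ i → (u j).Near T x))
    (fun _ _ => (ind_mem_unit _).1) (Finset.mem_univ i)).trans
    (Finset.single_le_sum (f := fun x => ∑ i, ind (((u i).IsFree ∧ (u i).Open T) ∧
      ∀ j, j ≠ i → (u j).Near T x))
    (fun _ _ => Finset.sum_nonneg fun _ _ => (ind_mem_unit _).1) (Finset.mem_univ x))

theorem one_le_offCount {s : DotSpin d k} {x : Bool} {i : Fin n} (hi : u i = s)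
    (h : ∀ j, j ≠ i → u j = .blue x) : 1 ≤ offCount s x u := by
  rw [offCount_eq, ← ind_of (And.intro hi h)]
  exact Finset.single_le_sum (f := fun i => ind (u i = s ∧ ∀ j, j ≠ i → u j = .blue x))
    (fun _ _ => (ind_mem_unit _).1) (Finset.mem_univ i)

theorem allBlue_le_nearCount (hn : 0 < n) (x : Bool) : allBlue x u ≤ nearCount T u := by
  rw [allBlue_eq]
  by_cases h : ∀ j, u j = .blue x
  · rw [ind_of h]
    exact one_le_nearCount T u (x := x) (i := ⟨0, hn⟩) fun j _ => by rw [h j]; rfl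
  · rw [ind_of_not h]; exact nearCount_nonneg T u

theorem exists_of_nearCount_lt_one (h : nearCount T u < 1) (x : Bool) (i : Fin n) :
    ∃ j, j ≠ i ∧ ¬ (u j).Near T x := by
  by_contra hc
  push Not at hc
  exact absurd (one_le_nearCount T u hc) (not_le.2 h)

theorem offCount_red_of_unique {x y : Bool} {i : Fin n} (hi : u i = .red y)
    (h : ∀ j, j ≠ i → u j = .blue x) : offCount (.red y) x u = 1 := by
  rw [offCount_eq, Finset.sum_eq_single i]
  · exact ind_of ⟨hi, h⟩
  · intro j _ hj
    refine ind_of_not fun h' => ?_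
    have := h'.2 i hj.symm
    rw [hi] at this
    cases this
  · simp

end bounds

variable {lam : ℝ} {T : ℕ∞}

section values

variable (u : Fin (k - 1) → DotSpin d k)

theorem exists_mixed (hk : 1 < k) (h : nearCount T u < 1) (hA : ∀ i, (u i).Open T) (x : Bool) :
    ∃ i₁ i₂, i₁ ≠ i₂ ∧ u i₁ = .blue (!x) ∧ u i₂ = .blue (!x) := by
  obtain ⟨i₁, -, h1⟩ := exists_of_nearCount_lt_one T u h x ⟨0, by omega⟩
  obtain ⟨i₂, h12, h2⟩ := exists_of_nearCount_lt_one T u h x i₁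
  exact ⟨i₁, i₂, h12.symm, (hA i₁).eq_blue_of_not_near h1, (hA i₂).eq_blue_of_not_near h2⟩

/-- A red incoming spin is compatible only when all others are a common blue, and such tuples are
counted by `nearCount`. -/
theorem clauseWeight_eq_zero_of_not_open (h : nearCount T u < 1)
    (hA : ¬ ∀ i, (u i).Open T) (s : HatSpin d k) : clauseWeight lam T s u = 0 := by
  by_contra hne
  have hc := ClauseCompat.of_weight_ne hne
  cases s with
  | red x =>
    exact hA fun i => by rw [ClauseCompat.red_iff.1 hc i]; trivial
  | blue x =>
    rcases hc.blue with ⟨i, -, hj⟩ | ⟨h1, -⟩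
    · exact absurd (one_le_nearCount T u (x := x) (i := i) fun j hji => by rw [hj j hji]; rfl)
        (not_le.2 h)
    · exact hA h1
  | free t => exact hA hc.free.1

/-- The spin to which a test function gives its main contribution. -/
def mainSpin : TestKind → Bool → HatSpin d k
  | .colored, x => .blue x
  | .blue, x => .blue x
  | .free, _ => .free ClsTree.box

/-- Away from the exceptional configurations a clause sends the spins `blue x` and the unlabelled
edge with their full weights. -/
theorem clauseWeight_mul_test_of_open (hT : 1 ≤ T) (hk : 1 < k) (h : nearCount T u < 1)
    (hA : ∀ i, (u i).Open T) (κ : TestKind) (x : Bool) (s : HatSpin d k) :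
    clauseWeight lam T s u * test lam κ x s = ind (s = mainSpin κ x) := by
  have hm : ∀ x, ∃ i, u i = .blue x := fun x => by
    obtain ⟨i, -, -, hi, -⟩ := exists_mixed u hk h hA (!x)
    exact ⟨i, by simpa using hi⟩
  have hred : ∀ y, clauseWeight lam T (.red y) u = 0 := fun y => by
    refine clauseWeight_red_of_not y u fun hy => ?_
    obtain ⟨i, hi⟩ := hm y
    rw [hy i] at hi
    simp at hi
  have hblue : clauseWeight lam T (.blue x) u = 1 := by
    obtain ⟨i₁, i₂, h12, h1, h2⟩ := exists_mixed u hk h hA x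
    obtain ⟨i₀, h0⟩ := hm x
    exact clauseWeight_blue_eq_one x
      (ClauseCompat.blue_of_mixed hA h0 h1 h12 (by rw [h2]; simp)) (Or.inr h1)
  have hfree : ∀ t : ClsTree d k, t ≠ ClsTree.box → clauseWeight lam T (.free t) u = 0 := by
    intro t ht
    by_contra hne
    refine ht (Subtype.ext ?_)
    rw [(ClauseCompat.of_weight_ne hne).free.2.2]
    refine Msg.clauseMap_eq_box fun y => ?_
    obtain ⟨i, hi⟩ := hm y
    exact ⟨i, by rw [hi]; rfl⟩
  cases s with
  | red y =>
    rw [hred y, zero_mul, ind_of_not]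
    cases κ <;> simp [mainSpin]
  | blue y =>
    by_cases hyx : y = x
    · subst hyx
      rw [hblue, one_mul]
      cases κ <;> simp [mainSpin, test, ind]
    · cases κ <;> simp [mainSpin, test, ind, hyx]
  | free t =>
    cases κ with
    | colored => simp [mainSpin, test, ind]
    | blue => simp [mainSpin, test, ind]
    | free =>
      by_cases ht : t = ClsTree.box
      · subst ht
        rw [clauseWeight_free _ (ClauseCompat.box_of_mixed hT hA hm),
          ind_of (show (.free ClsTree.box : HatSpin d k) = mainSpin .free x from rfl)]
        have h2 : ((ClsTree.box : ClsTree d k).1).norm .cls = 2 := Msg.norm_box _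
        have h3 : ((ClsTree.box : ClsTree d k).1).probOf .cls x = 1 / 2 := by
          cases x <;> norm_num [Msg.probOf, ClsTree.box, Msg.prob_box]
        simp only [test]
        -- The unlabelled edge has weight `2 ^ lam` and is tested by `(1 / 2) ^ lam`. The product is
        -- one for every `lam`, which puts the free test on the same footing as the colored ones.
        rw [h2, h3, ← Real.mul_rpow (by norm_num) (by norm_num)]
        norm_num
      · rw [hfree t ht, zero_mul, ind_of_not]
        simp [mainSpin, ht]

theorem tsum_abs_clauseWeight_sub_le (hlam : 0 ≤ lam) (hT : 1 ≤ T) (hk : 1 < k) (κ : TestKind)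
    (x : Bool) :
    (Summable fun s => clauseWeight lam T s u * test lam κ x s -
      allOpen T u * ind (s = mainSpin κ x)) ∧
    ∑' s, |clauseWeight lam T s u * test lam κ x s - allOpen T u * ind (s = mainSpin κ x)| ≤
      2 * nearCount T u := by
  have hm : HasSum (fun s : HatSpin d k => allOpen T u * ind (s = mainSpin κ x)) (allOpen T u) := by
    have := hasSum_single (f := fun s : HatSpin d k => allOpen T u * ind (s = mainSpin κ x))
      (mainSpin κ x) fun s hs => by rw [ind_of_not hs, mul_zero]
    rwa [ind_of rfl, mul_one] at this
  have hr := summable_response_kernel (T := T) hlam κ x u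
  have hs := hr.sub hm.summable
  refine ⟨hs, ?_⟩
  by_cases h : nearCount T u < 1
  · have : ∀ s, clauseWeight lam T s u * test lam κ x s -
        allOpen T u * ind (s = mainSpin κ x) = 0 := fun s => by
      by_cases hA : ∀ i, (u i).Open T
      · rw [clauseWeight_mul_test_of_open u hT hk h hA, allOpen_eq, ind_of hA, one_mul, sub_self]
      · rw [clauseWeight_eq_zero_of_not_open u h hA, allOpen_eq, ind_of_not hA]; ring
    simp only [this, abs_zero, tsum_zero]
    linarith [nearCount_nonneg T u]
  · have hA : 0 ≤ allOpen T u ∧ allOpen T u ≤ 1 := by rw [allOpen_eq]; exact ind_mem_unit _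
    calc _ ≤ ∑' s, (clauseWeight lam T s u * test lam κ x s +
            allOpen T u * ind (s = mainSpin κ x)) := by
          refine Summable.tsum_le_tsum (fun s => ?_) hs.abs (hr.add hm.summable)
          have h1 := mul_nonneg (clauseWeight_nonneg (T := T) hlam s u)
            (test_mem_unit hlam κ x s).1
          have h2 := mul_nonneg hA.1 (ind_mem_unit (s = mainSpin κ x)).1
          exact abs_le.2 ⟨by linarith, by linarith⟩
      _ = response lam T κ x u + allOpen T u := by rw [hr.tsum_add hm.summable, hm.tsum_eq]; rfl
      _ ≤ 2 * nearCount T u := by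
          linarith [response_le_one (T := T) hlam κ x u, not_lt.1 h]

/-- Off the exceptional tuples all tests see the same value, one or zero according to whether all
spins are open. On exceptional tuples both numbers lie in `[0, 1]` while `nearCount` is at least
one. -/
theorem abs_response_sub_le (hlam : 0 ≤ lam) (hT : 1 ≤ T) (hk : 1 < k) (κ : TestKind)
    (x : Bool) : |response lam T κ x u - allOpen T u| ≤ nearCount T u := by
  by_cases h : nearCount T u < 1
  · have hsum : response lam T κ x u = allOpen T u := by
      by_cases hA : ∀ i, (u i).Open T
      · unfold response
        simp only [clauseWeight_mul_test_of_open u hT hk h hA]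
        rw [tsum_eq_single (mainSpin κ x) fun s hs => ind_of_not hs, ind_of rfl, allOpen_eq,
          ind_of hA]
      · unfold response
        simp only [clauseWeight_eq_zero_of_not_open u h hA, zero_mul, tsum_zero]
        rw [allOpen_eq, ind_of_not hA]
    rw [hsum, sub_self, abs_zero]
    exact nearCount_nonneg T u
  · have hA : 0 ≤ allOpen T u ∧ allOpen T u ≤ 1 := by rw [allOpen_eq]; exact ind_mem_unit _
    have h1 := response_le_one (T := T) hlam κ x u
    have h2 := response_nonneg (T := T) hlam κ x u
    exact (abs_le.2 ⟨by linarith, by linarith⟩ : _ ≤ (1 : ℝ)).trans (not_lt.1 h)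

theorem response_colored_sub_blue (x : Bool) :
    response lam T .colored x u - response lam T .blue x u = allBlue (!x) u := by
  rw [response_colored, response_blue, add_sub_cancel_right, allBlue_eq]
  by_cases h : ∀ i, u i = .blue (!x)
  · rw [ind_of h, clauseWeight_red x u h]
  · rw [ind_of_not h, clauseWeight_red_of_not x u h]

/-- The key comparison between colored and free responses. -/
theorem le_response_colored_sub_free (hlam : 0 ≤ lam) (x : Bool) :
    allBlue (!x) u + offCount (.red (!x)) x u - offCount (.blue (!x)) x u - freeCount T u ≤
      response lam T .colored x u - response lam T .free x u := by
  have hG := response_nonneg (T := T) hlam .colored x u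
  have hF := response_free_mem (T := T) hlam x u
  have hF0 := response_nonneg (T := T) hlam .free x u
  have hB := offCount_nonneg u (.blue (!x)) x
  have hfc := freeCount_nonneg T u
  have hoff : ∀ (s : DotSpin d k), (∀ i, ¬ (u i = s ∧ ∀ j, j ≠ i → u j = .blue x)) →
      offCount s x u = 0 := fun s hs => by
    rw [offCount_eq]
    exact Finset.sum_eq_zero fun i _ => ind_of_not (hs i)
  -- With all spins open there is no red defect, and the loss has to be charged to a blue defect or
  -- to a free spin. Otherwise the free response vanishes and only the red defect has to be
  -- recovered.
  by_cases hA : ∀ i, (u i).Open T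
  · have hR : offCount (.red (!x)) x u = 0 := hoff _ fun i hi => by
      have := hA i
      rw [hi.1] at this
      exact this
    by_cases hF1 : response lam T .free x u = 0
    · by_cases hall : ∀ i, u i = .blue (!x)
      · have : response lam T .colored x u ≥ 1 := by
          rw [response_colored, clauseWeight_red x u hall]
          linarith [(clauseWeight_blue_mem (T := T) hlam x u).1]
        rw [allBlue_eq, ind_of hall]
        linarith
      · rw [allBlue_eq, ind_of_not hall]
        linarith
    · have hnb := (hF.2 hF1).2
      rw [allBlue_eq, ind_of_not (hnb _), hR]
      -- In this pattern `blue x` is sent with full weight one, which dominates the free response.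
      by_cases hc : ∃ i₀ i₁ i₂, u i₀ = .blue x ∧ u i₁ = .blue (!x) ∧ i₁ ≠ i₂ ∧ u i₂ ≠ .blue x
      · obtain ⟨i₀, i₁, i₂, h0, h1, h12, h2⟩ := hc
        have h3 : clauseWeight lam T (.blue x) u = 1 := clauseWeight_blue_eq_one x
          (ClauseCompat.blue_of_mixed hA h0 h1 h12 h2) (Or.inr h1)
        have h4 := clauseWeight_nonneg (T := T) hlam (.red x) u
        rw [response_colored, h3]
        linarith [hF.1]
      -- What remains is a tuple with a free spin whose other entries are all near a common label,
      -- or an all-blue tuple with exactly one `blue (!x)`. The first is charged to `freeCount`, the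
      -- second to `offCount`.
      · push Not at hc
        suffices h1 : 1 ≤ offCount (.blue (!x)) x u + freeCount T u by linarith [hF.1]
        by_cases hfree : ∃ i, (u i).IsFree
        · obtain ⟨i, hi⟩ := hfree
          suffices h1 : 1 ≤ freeCount T u by linarith
          by_contra hlt
          have hex : ∀ y, ∃ j, j ≠ i ∧ u j = .blue (!y) := fun y => by
            by_contra hne
            push Not at hne
            refine hlt (one_le_freeCount T u (x := y) ⟨hi, hA i⟩ fun j hj => ?_)
            by_contra hnear
            exact hne j hj ((hA j).eq_blue_of_not_near hnear)
          obtain ⟨i₁, h1i, h1⟩ := hex x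
          obtain ⟨i₀, -, h0⟩ := hex (!x)
          rw [Bool.not_not] at h0
          have := hc i₀ i₁ i h0 h1 h1i
          obtain ⟨t, ht⟩ := hi
          rw [ht] at this
          cases this
        · suffices h1 : 1 ≤ offCount (.blue (!x)) x u by linarith
          have hblue : ∀ i, ∀ y, u i ≠ .blue y → u i = .blue (!y) := fun i y hy => by
            have := hA i
            cases hs : u i with
            | red z => rw [hs] at this; exact this.elim
            | blue z =>
              rw [Bool.eq_not_of_ne (show z ≠ y from fun h => hy (by rw [hs, h]))]
            | free t => exact absurd ⟨i, t, hs⟩ hfree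
          have h1 := hnb x
          have h0 := hnb (!x)
          push Not at h0 h1
          obtain ⟨i₁, h1⟩ := h1
          obtain ⟨i₀, h0⟩ := h0
          have h0' := hblue i₀ _ h0
          rw [Bool.not_not] at h0'
          exact one_le_offCount u (hblue i₁ _ h1) fun j hj =>
            hc i₀ i₁ j h0' (hblue i₁ _ h1) hj.symm
  · have hF1 : response lam T .free x u = 0 := by
      by_contra hne
      exact hA (hF.2 hne).1
    have hab : allBlue (!x) u = 0 := by
      rw [allBlue_eq, ind_of_not]
      exact fun h => hA fun i => by rw [h i]; trivial
    have hR : offCount (.red (!x)) x u ≤ response lam T .colored x u := by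
      by_cases hex : ∃ i, u i = .red (!x) ∧ ∀ j, j ≠ i → u j = .blue x
      · obtain ⟨i, hi, hj⟩ := hex
        rw [offCount_red_of_unique u hi hj, response_colored,
          clauseWeight_blue_eq_one x (ClauseCompat.blue_of_red hi hj) (Or.inl hi)]
        linarith [clauseWeight_nonneg (T := T) hlam (.red x) u]
      · rw [hoff _ fun i hi => hex ⟨i, hi⟩]
        exact hG
    linarith

end values

end clause

-- Product bounds with exceptional coordinates

section families

variable {α : Type} {n : ℕ}

theorem prod_le_of_exceptional {c w : Fin n → ℝ} {S : Finset (Fin n)} {K a : ℝ} {r : ℕ}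
    (hc : ∀ j, 0 ≤ c j) (hw : ∀ j, 0 ≤ w j) (hK : 1 ≤ K) (ha0 : 0 ≤ a) (ha1 : a ≤ 1)
    (hS : ∀ j ∈ S, c j ≤ w j * K) (hS' : ∀ j ∉ S, c j ≤ w j * a) (hr : S.card ≤ r) :
    ∏ j, c j ≤ (∏ j, w j) * (K ^ r * a ^ (n - r)) := by
  have h1 : ∏ j, c j ≤ ∏ j, w j * (if j ∈ S then K else a) := by
    refine Finset.prod_le_prod (fun j _ => hc j) fun j _ => ?_
    split_ifs with h
    exacts [hS j h, hS' j h]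
  refine h1.trans ?_
  rw [Finset.prod_mul_distrib]
  refine mul_le_mul_of_nonneg_left ?_ (Finset.prod_nonneg fun j _ => hw j)
  rw [Finset.prod_ite, Finset.prod_const, Finset.prod_const]
  have e1 : (Finset.univ.filter fun j => j ∈ S).card = S.card := by simp
  have e2 : (Finset.univ.filter fun j => j ∉ S).card = n - S.card := by
    rw [Finset.filter_not, Finset.card_sdiff]
    simp
  rw [e1, e2]
  refine mul_le_mul (pow_le_pow_right₀ hK hr) (pow_le_pow_of_le_one ha0 ha1 (by omega))
    (by positivity) (by positivity)

/-- A family of weights with mass at most `w j * K`, unexceptional outside of `S`. -/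
structure WeightFamily (ν : Fin n → α → ℝ) (w : Fin n → ℝ) (S : Finset (Fin n)) (K : ℝ) :
    Prop where
  nonneg : ∀ j p, 0 ≤ ν j p
  summable : ∀ j, Summable (ν j)
  weight_nonneg : ∀ j, 0 ≤ w j
  weight_eq_one : ∀ j ∉ S, w j = 1
  one_le : 1 ≤ K
  total : ∀ j, ∑' p, ν j p ≤ w j * K

theorem bddFn_of_unit {β : Type} {f : β → ℝ} (h : ∀ p, 0 ≤ f p ∧ f p ≤ 1) : BddFn f :=
  BddFn.of_mem 1 h

namespace WeightFamily

variable {ν : Fin n → α → ℝ} {w : Fin n → ℝ} {S : Finset (Fin n)} {K a : ℝ} {r : ℕ}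

theorem tsum_mul_le (h : WeightFamily ν w S K) {f : α → ℝ} (hf : ∀ p, 0 ≤ f p ∧ f p ≤ 1)
    (j : Fin n) : ∑' p, f p * ν j p ≤ w j * K :=
  (Summable.tsum_le_tsum (fun p => mul_le_of_le_one_left (h.nonneg j p) (hf p).2)
    ((bddFn_of_unit hf).summable_mul (h.summable j)) (h.summable j)).trans (h.total j)

theorem integ_prod_le (h : WeightFamily ν w S K) {χ : Fin n → α → ℝ}
    (hχ : ∀ j p, 0 ≤ χ j p ∧ χ j p ≤ 1) {S' : Finset (Fin n)} (hS : S ⊆ S') (ha0 : 0 ≤ a)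
    (ha1 : a ≤ 1) (hr : S'.card ≤ r) (ha : ∀ j ∉ S', ∑' p, χ j p * ν j p ≤ a) :
    integ (fun u => ∏ j, χ j (u j)) ν ≤ (∏ j, w j) * (K ^ r * a ^ (n - r)) := by
  rw [integ_prod (fun j => bddFn_of_unit (hχ j)) h.summable]
  refine prod_le_of_exceptional (fun j => tsum_nonneg fun p => mul_nonneg (hχ j p).1 (h.nonneg j p))
    h.weight_nonneg h.one_le ha0 ha1 (fun j _ => h.tsum_mul_le (hχ j) j) (fun j hj => ?_) hr
  rw [h.weight_eq_one j fun h' => hj (hS h'), one_mul]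
  exact ha j hj

theorem unit_ite {β : Type} {f g : β → ℝ} (hf : ∀ p, 0 ≤ f p ∧ f p ≤ 1)
    (hg : ∀ p, 0 ≤ g p ∧ g p ≤ 1) (P : Prop) [Decidable P] (p : β) :
    0 ≤ (if P then f p else g p) ∧ (if P then f p else g p) ≤ 1 := by
  split_ifs
  exacts [hf p, hg p]

theorem unit_mul {x y : ℝ} (hx : 0 ≤ x ∧ x ≤ 1) (hy : 0 ≤ y ∧ y ≤ 1) :
    0 ≤ x * y ∧ x * y ≤ 1 :=
  ⟨mul_nonneg hx.1 hy.1, mul_le_one₀ hx.2 hy.1 hy.2⟩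

/-- Each summand drops its condition at one coordinate `i`. That coordinate joins the exceptional
set and pays the full mass `K` instead of `a`, which turns `r` into `r + 1`; the prefactor counts
the choices of `x` and `i`. The two-sided version below drops one coordinate for each copy. -/
theorem integ_near_le (h : WeightFamily ν w S K) {f : α → ℝ} {g : Bool → α → ℝ}
    (hf : ∀ p, 0 ≤ f p ∧ f p ≤ 1) (hg : ∀ x p, 0 ≤ g x p ∧ g x p ≤ 1) (ha0 : 0 ≤ a) (ha1 : a ≤ 1)
    (hr : S.card ≤ r) (ha : ∀ x, ∀ j ∉ S, ∑' p, f p * g x p * ν j p ≤ a) :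
    integ (fun u => (∏ j, f (u j)) * ∑ x, ∑ i, ∏ j, if j = i then 1 else g x (u j)) ν ≤
      2 * n * ((∏ j, w j) * (K ^ (r + 1) * a ^ (n - (r + 1)))) := by
  have hχ : ∀ x (i j : Fin n) p, 0 ≤ f p * (if j = i then 1 else g x p) ∧
      f p * (if j = i then 1 else g x p) ≤ 1 := fun x i j p =>
    unit_mul (hf p) (unit_ite (f := fun _ => 1) (fun _ => ⟨zero_le_one, le_rfl⟩) (hg x) _ p)
  have hb : ∀ x (i : Fin n), BddFn fun u : Fin n → α =>
      ∏ j, f (u j) * (if j = i then 1 else g x (u j)) := fun x i =>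
    BddFn.prod _ fun j => (bddFn_of_unit (hχ x i j)).comp fun u : Fin n → α => u j
  have e : (fun u : Fin n → α => (∏ j, f (u j)) * ∑ x, ∑ i, ∏ j, if j = i then 1 else g x (u j)) =
      fun u => ∑ x, ∑ i, ∏ j, f (u j) * (if j = i then 1 else g x (u j)) := by
    funext u
    simp only [Finset.mul_sum, Finset.prod_mul_distrib]
  rw [e, integ_sum _ (fun x => BddFn.sum _ (hb x)) h.summable]
  have h1 : ∀ x i, integ (fun u => ∏ j, f (u j) * (if j = i then 1 else g x (u j))) ν ≤
      (∏ j, w j) * (K ^ (r + 1) * a ^ (n - (r + 1))) := fun x i => by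
    refine h.integ_prod_le (χ := fun j p => f p * (if j = i then 1 else g x p)) (hχ x i)
      (S' := insert i S) (Finset.subset_insert _ _) ha0 ha1
      ((Finset.card_insert_le _ _).trans (by omega)) fun j hj => ?_
    have hji : j ≠ i := fun h => hj (by rw [h]; exact Finset.mem_insert_self _ _)
    simp only [if_neg hji]
    exact ha x j fun h => hj (Finset.mem_insert_of_mem h)
  calc _ ≤ ∑ _x : Bool, ∑ _i : Fin n, (∏ j, w j) * (K ^ (r + 1) * a ^ (n - (r + 1))) := by
        refine Finset.sum_le_sum fun x _ => ?_
        rw [integ_sum _ (hb x) h.summable]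
        exact Finset.sum_le_sum fun i _ => h1 x i
    _ = _ := by simp; ring

theorem integ_near_near_le (h : WeightFamily ν w S K) {f g : Bool → α → ℝ}
    (hf : ∀ x p, 0 ≤ f x p ∧ f x p ≤ 1) (hg : ∀ x p, 0 ≤ g x p ∧ g x p ≤ 1) (ha0 : 0 ≤ a)
    (ha1 : a ≤ 1) (hr : S.card ≤ r)
    (ha : ∀ x y, ∀ j ∉ S, ∑' p, f x p * g y p * ν j p ≤ a) :
    integ (fun u => (∑ x, ∑ i, ∏ j, if j = i then 1 else f x (u j)) *
      ∑ y, ∑ i, ∏ j, if j = i then 1 else g y (u j)) ν ≤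
      4 * n ^ 2 * ((∏ j, w j) * (K ^ (r + 2) * a ^ (n - (r + 2)))) := by
  have hone : ∀ _ : α, (0 : ℝ) ≤ 1 ∧ (1 : ℝ) ≤ 1 := fun _ => ⟨zero_le_one, le_rfl⟩
  have hχ : ∀ x (i : Fin n) y (i' j : Fin n) p,
      0 ≤ (if j = i then 1 else f x p) * (if j = i' then 1 else g y p) ∧
      (if j = i then 1 else f x p) * (if j = i' then 1 else g y p) ≤ 1 := fun x i y i' j p =>
    unit_mul (unit_ite (f := fun _ => 1) hone (hf x) _ p)
      (unit_ite (f := fun _ => 1) hone (hg y) _ p)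
  have hb : ∀ x (i : Fin n) y (i' : Fin n), BddFn fun u : Fin n → α =>
      ∏ j, (if j = i then 1 else f x (u j)) * (if j = i' then 1 else g y (u j)) :=
    fun x i y i' => BddFn.prod _ fun j =>
      (bddFn_of_unit (hχ x i y i' j)).comp fun u : Fin n → α => u j
  have e : (fun u : Fin n → α => (∑ x, ∑ i, ∏ j, if j = i then 1 else f x (u j)) *
      ∑ y, ∑ i, ∏ j, if j = i then 1 else g y (u j)) =
      fun u => ∑ x, ∑ i, ∑ y, ∑ i',
        ∏ j, (if j = i then 1 else f x (u j)) * (if j = i' then 1 else g y (u j)) := by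
    funext u
    simp only [Finset.sum_mul]
    refine Finset.sum_congr rfl fun x _ => Finset.sum_congr rfl fun i _ => ?_
    simp only [Finset.mul_sum, Finset.prod_mul_distrib]
  have h1 : ∀ x i y i', integ (fun u => ∏ j, (if j = i then 1 else f x (u j)) *
      (if j = i' then 1 else g y (u j))) ν ≤
      (∏ j, w j) * (K ^ (r + 2) * a ^ (n - (r + 2))) := fun x i y i' => by
    refine h.integ_prod_le (χ := fun j p => (if j = i then 1 else f x p) *
      (if j = i' then 1 else g y p)) (hχ x i y i')
      (S' := insert i (insert i' S))
      ((Finset.subset_insert _ _).trans (Finset.subset_insert _ _)) ha0 ha1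
      ((Finset.card_insert_le _ _).trans
        ((Nat.succ_le_succ (Finset.card_insert_le _ _)).trans (by omega))) fun j hj => ?_
    simp only [Finset.mem_insert, not_or] at hj
    simp only [if_neg hj.1, if_neg hj.2.1]
    exact ha x y j hj.2.2
  rw [e]
  calc _ = ∑ x, ∑ i, ∑ y, ∑ i', integ (fun u => ∏ j, (if j = i then 1 else f x (u j)) *
        (if j = i' then 1 else g y (u j))) ν := by
        rw [integ_sum _ (fun x => BddFn.sum _ fun i => BddFn.sum _ fun y => BddFn.sum _ (hb x i y))
          h.summable]
        refine Finset.sum_congr rfl fun x _ => ?_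
        rw [integ_sum _ (fun i => BddFn.sum _ fun y => BddFn.sum _ (hb x i y)) h.summable]
        refine Finset.sum_congr rfl fun i _ => ?_
        rw [integ_sum _ (fun y => BddFn.sum _ (hb x i y)) h.summable]
        refine Finset.sum_congr rfl fun y _ => ?_
        rw [integ_sum _ (hb x i y) h.summable]
    _ ≤ ∑ _x : Bool, ∑ _i : Fin n, ∑ _y : Bool, ∑ _i' : Fin n,
        (∏ j, w j) * (K ^ (r + 2) * a ^ (n - (r + 2))) :=
        Finset.sum_le_sum fun x _ => Finset.sum_le_sum fun i _ => Finset.sum_le_sum fun y _ =>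
          Finset.sum_le_sum fun i' _ => h1 x i y i'
    _ = _ := by simp; ring

theorem integ_special_le (h : WeightFamily ν w S K) {f φ : α → ℝ} {g : Bool → α → ℝ} {τ : ℝ}
    (hf : ∀ p, 0 ≤ f p ∧ f p ≤ 1) (hφ : ∀ p, 0 ≤ φ p ∧ φ p ≤ 1)
    (hg : ∀ x p, 0 ≤ g x p ∧ g x p ≤ 1)
    (hτ : ∀ j, ∑' p, f p * φ p * ν j p ≤ τ)
    (ha : ∀ x, ∀ j, ∑' p, f p * g x p * ν j p ≤ a) :
    integ (fun u => (∏ j, f (u j)) * ∑ x, ∑ i, ∏ j, if j = i then φ (u j) else g x (u j)) ν ≤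
      2 * n * (τ * a ^ (n - 1)) := by
  have hχ : ∀ x (i j : Fin n) p, 0 ≤ f p * (if j = i then φ p else g x p) ∧
      f p * (if j = i then φ p else g x p) ≤ 1 := fun x i j p =>
    unit_mul (hf p) (unit_ite hφ (hg x) _ p)
  have hb : ∀ x (i : Fin n), BddFn fun u : Fin n → α =>
      ∏ j, f (u j) * (if j = i then φ (u j) else g x (u j)) := fun x i =>
    BddFn.prod _ fun j => (bddFn_of_unit (hχ x i j)).comp fun u : Fin n → α => u j
  have e : (fun u : Fin n → α => (∏ j, f (u j)) *
      ∑ x, ∑ i, ∏ j, if j = i then φ (u j) else g x (u j)) =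
      fun u => ∑ x, ∑ i, ∏ j, f (u j) * (if j = i then φ (u j) else g x (u j)) := by
    funext u
    simp only [Finset.mul_sum, Finset.prod_mul_distrib]
  rw [e, integ_sum _ (fun x => BddFn.sum _ (hb x)) h.summable]
  have h1 : ∀ x i, integ (fun u => ∏ j, f (u j) * (if j = i then φ (u j) else g x (u j))) ν ≤
      τ * a ^ (n - 1) := fun x i => by
    rw [integ_prod (χ := fun j p => f p * (if j = i then φ p else g x p))
      (fun j => bddFn_of_unit (hχ x i j)) h.summable, ← Finset.mul_prod_erase _ _ (Finset.mem_univ i)]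
    have h0 : ∀ j, 0 ≤ ∑' p, f p * (if j = i then φ p else g x p) * ν j p := fun j =>
      tsum_nonneg fun p => mul_nonneg (hχ x i j p).1 (h.nonneg j p)
    refine mul_le_mul ?_ ?_ (Finset.prod_nonneg fun j _ => h0 j) ((h0 i).trans ?_)
    · simpa using hτ i
    · have hcard : a ^ (n - 1) = ∏ _j ∈ Finset.univ.erase i, a := by
        simp [Finset.card_erase_of_mem]
      rw [hcard]
      refine Finset.prod_le_prod (fun j _ => h0 j) fun j hj => ?_
      simp only [if_neg (Finset.ne_of_mem_erase hj)]
      exact ha x j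
    · simpa using hτ i
  calc _ ≤ ∑ _x : Bool, ∑ _i : Fin n, τ * a ^ (n - 1) := by
        refine Finset.sum_le_sum fun x _ => ?_
        rw [integ_sum _ (hb x) h.summable]
        exact Finset.sum_le_sum fun i _ => h1 x i
    _ = _ := by simp; ring

end WeightFamily

/-- Comparison of integrals under a change of one coordinate. -/
theorem le_integ_of_exchange (e : α ≃ α) (i : Fin n) {Φ Ψ : (Fin n → α) → ℝ} {q : α → ℝ} {c : ℝ}
    (hq : Summable q) (hq0 : ∀ p, 0 ≤ q p) (hΦ : BddFn Φ) (hΨ : BddFn Ψ)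
    (h : ∀ u, c * (Ψ u * q (u i)) ≤ Φ (Function.update u i (e (u i))) * q (e (u i))) :
    c * integ Ψ (fun _ => q) ≤ integ Φ (fun _ => q) := by
  let E : (Fin n → α) ≃ (Fin n → α) :=
    Equiv.piCongrRight fun j => if j = i then e else Equiv.refl α
  have hE : ∀ u, E u = Function.update u i (e (u i)) := fun u => by
    funext j
    simp only [E, Equiv.piCongrRight_apply, Pi.map_apply, Function.update_apply]
    split_ifs with hj
    · rw [hj]
    · rfl
  have hs' : Summable fun u => Φ (E u) * ∏ i, q (E u i) :=
    (E.summable_iff (f := fun u => Φ u * ∏ i, q (u i))).2 (summable_integ hΦ fun _ : Fin n => hq)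
  rw [← integ_const_mul]
  unfold integ
  rw [← E.tsum_eq (fun u => Φ u * ∏ i, q (u i))]
  refine Summable.tsum_le_tsum (fun u => ?_)
    (summable_integ ((BddFn.const c).mul hΨ) fun _ : Fin n => hq) hs'
  rw [hE, ← Finset.mul_prod_erase _ _ (Finset.mem_univ i),
    ← Finset.mul_prod_erase _ (fun j => q (Function.update u i (e (u i)) j)) (Finset.mem_univ i)]
  have h1 : ∏ j ∈ Finset.univ.erase i, q (Function.update u i (e (u i)) j) =
      ∏ j ∈ Finset.univ.erase i, q (u j) := Finset.prod_congr rfl fun j hj => by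
    rw [Function.update_of_ne (Finset.ne_of_mem_erase hj)]
  rw [h1, Function.update_self, ← mul_assoc, ← mul_assoc]
  refine mul_le_mul_of_nonneg_right ?_ (Finset.prod_nonneg fun j _ => hq0 _)
  rw [mul_assoc]
  exact h u

end families

-- Balanced weights and the mass of exceptional tuples

section balanced

variable {d k : ℕ}

/-- Quantitative conditions on a symmetric weight on pairs of spins, normalized to give mass one
to the pairs of spins neither of which is red. -/
structure Balanced (T : ℕ∞) (K a b τ β : ℝ) (q : DotSpin d k × DotSpin d k → ℝ) : Prop where
  nonneg : ∀ p, 0 ≤ q p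
  summable : Summable q
  flip : ∀ p, q (p.1.add true, p.2.add true) = q p
  one_le : 1 ≤ K
  total : ∑' p, q p ≤ K
  a_nonneg : 0 ≤ a
  a_le : a ≤ 1
  b_nonneg : 0 ≤ b
  b_le : b ≤ 1
  tau_nonneg : 0 ≤ τ
  tau_le : τ ≤ 1
  beta_nonneg : 0 ≤ β
  openOpen : ∑' p, ind (p.1.Open T) * ind (p.2.Open T) * q p = 1
  openNear : ∀ x, ∑' p, ind (p.1.Open T) * ind (p.2.Near T x) * q p ≤ a
  nearOpen : ∀ x, ∑' p, ind (p.2.Open T) * ind (p.1.Near T x) * q p ≤ a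
  nearNear : ∀ x y, ∑' p, ind (p.1.Near T x) * ind (p.2.Near T y) * q p ≤ b
  openFree : ∑' p, ind (p.1.Open T) * ind (p.2.IsFree ∧ p.2.Open T) * q p ≤ τ
  freeOpen : ∑' p, ind (p.2.Open T) * ind (p.1.IsFree ∧ p.1.Open T) * q p ≤ τ
  blueOpen : ∀ x, β ≤ ∑' p, ind (p.1 = .blue x) * ind (p.2.Open T) * q p
  openBlue : ∀ x, β ≤ ∑' p, ind (p.2 = .blue x) * ind (p.1.Open T) * q p
  redLeft : ∀ x s, (1 - τ) * q (.blue x, s) ≤ q (.red x, s)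
  redRight : ∀ x s, (1 - τ) * q (s, .blue x) ≤ q (s, .red x)

variable {T : ℕ∞} {K a b τ β : ℝ} {q q' : DotSpin d k × DotSpin d k → ℝ}

theorem Balanced.swap (h : Balanced T K a b τ β q) : Balanced T K a b τ β fun p => q p.swap := by
  have e : ∀ F : DotSpin d k × DotSpin d k → ℝ,
      ∑' p : DotSpin d k × DotSpin d k, F p * q p.swap = ∑' p, F p.swap * q p := fun F => by
    rw [← (Equiv.prodComm (DotSpin d k) (DotSpin d k)).tsum_eq fun p => F p.swap * q p]
    rfl
  have e1 : ∑' p : DotSpin d k × DotSpin d k, q p.swap = ∑' p, q p := (Equiv.prodComm _ _).tsum_eq q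
  constructor
  · exact fun p => h.nonneg _
  · exact (Equiv.prodComm _ _).summable_iff.2 h.summable
  · exact fun p => h.flip p.swap
  · exact h.one_le
  · rw [e1]; exact h.total
  · exact h.a_nonneg
  · exact h.a_le
  · exact h.b_nonneg
  · exact h.b_le
  · exact h.tau_nonneg
  · exact h.tau_le
  · exact h.beta_nonneg
  · rw [e fun p => ind (p.1.Open T) * ind (p.2.Open T), ← h.openOpen]
    exact tsum_congr fun p => by rw [mul_comm (ind _)]; rfl
  · intro x
    rw [e fun p => ind (p.1.Open T) * ind (p.2.Near T x)]
    exact h.nearOpen x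
  · intro x
    rw [e fun p => ind (p.2.Open T) * ind (p.1.Near T x)]
    exact h.openNear x
  · intro x y
    rw [e fun p => ind (p.1.Near T x) * ind (p.2.Near T y)]
    refine le_trans (le_of_eq (tsum_congr fun p => ?_)) (h.nearNear y x)
    rw [mul_comm (ind _)]; rfl
  · rw [e fun p => ind (p.1.Open T) * ind (p.2.IsFree ∧ p.2.Open T)]
    exact h.freeOpen
  · rw [e fun p => ind (p.2.Open T) * ind (p.1.IsFree ∧ p.1.Open T)]
    exact h.openFree
  · intro x
    rw [e fun p => ind (p.1 = .blue x) * ind (p.2.Open T)]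
    exact h.openBlue x
  · intro x
    rw [e fun p => ind (p.2 = .blue x) * ind (p.1.Open T)]
    exact h.blueOpen x
  · exact h.redRight
  · exact h.redLeft

theorem Balanced.weightFamily (h : Balanced T K a b τ β q) (n : ℕ) :
    WeightFamily (fun _ : Fin n => q) (fun _ => 1) ∅ K where
  nonneg _ := h.nonneg
  summable _ := h.summable
  weight_nonneg _ := zero_le_one
  weight_eq_one _ _ := rfl
  one_le := h.one_le
  total _ := by rw [one_mul]; exact h.total

/-- Only the coordinate carrying `|q - q'|` is exceptional, and its ℓ¹ mass factors out as the
weight of that coordinate. All other coordinates carry one of the two balanced weights, so the same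
constants apply to them. -/
theorem Balanced.weightFamily_hybrid (h : Balanced T K a b τ β q) (h' : Balanced T K a b τ β q')
    {n : ℕ} (l : Fin n) :
    WeightFamily (hybrid q q' l) (fun j => if j = l then ∑' p, |q p - q' p| else 1) {l} K where
  nonneg := hybrid_nonneg h.nonneg h'.nonneg l
  summable := hybrid_summable h.summable h'.summable l
  weight_nonneg j := by
    split_ifs
    exacts [tsum_nonneg fun _ => abs_nonneg _, zero_le_one]
  weight_eq_one j hj := by simp_all
  one_le := h.one_le
  total j := by
    unfold hybrid
    by_cases h1 : j < l
    · simp only [if_pos h1, if_neg h1.ne, one_mul]; exact h.total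
    · by_cases h2 : j = l
      · subst h2
        simp only [lt_self_iff_false, if_false, if_true]
        exact le_mul_of_one_le_right (tsum_nonneg fun _ => abs_nonneg _) h.one_le
      · simp only [if_neg h1, if_neg h2, one_mul]; exact h'.total

theorem hybrid_off {α : Type} {p q : α → ℝ} {n : ℕ} {l j : Fin n} (hj : j ∉ ({l} : Finset (Fin n)))
    {P : (α → ℝ) → Prop} (hp : P p) (hq : P q) : P (hybrid p q l j) := by
  simp only [Finset.mem_singleton] at hj
  unfold hybrid
  split_ifs
  exacts [hp, hq]

/-- The bound for the joint weight of an open and a nearly constant tuple. -/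
def openBound (n : ℕ) (K a : ℝ) : ℝ := 2 * n * (K * a ^ (n - 1))

/-- The bound for the joint weight of two nearly constant tuples. -/
def nearBound (n : ℕ) (K b : ℝ) : ℝ := 4 * n ^ 2 * (K ^ 2 * b ^ (n - 2))

/-- The Lipschitz constant accompanying `openBound`. -/
def openLip (n : ℕ) (K a : ℝ) : ℝ := n * (2 * n * (K ^ 2 * a ^ (n - 2)))

/-- The Lipschitz constant accompanying `nearBound`. -/
def nearLip (n : ℕ) (K b : ℝ) : ℝ := n * (4 * n ^ 2 * (K ^ 3 * b ^ (n - 3)))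

section counts

variable {n : ℕ}

/-- Integration of a product of functions of the two coordinate tuples. -/
def pairInteg (q : DotSpin d k × DotSpin d k → ℝ) (Φ Ψ : (Fin n → DotSpin d k) → ℝ) : ℝ :=
  integ (fun u => Φ (fun j => (u j).1) * Ψ fun j => (u j).2) fun _ => q

theorem bddFn_allOpen : BddFn (allOpen T : (Fin n → DotSpin d k) → ℝ) :=
  BddFn.prod _ fun _ => bddFn_ind _

theorem bddFn_allBlue (x : Bool) : BddFn (allBlue x : (Fin n → DotSpin d k) → ℝ) :=
  BddFn.prod _ fun _ => bddFn_ind _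

theorem bddFn_nearCount : BddFn (nearCount T : (Fin n → DotSpin d k) → ℝ) := by
  have : (nearCount T : (Fin n → DotSpin d k) → ℝ) = fun u => _ := funext (nearCount_eq T)
  rw [this]
  exact BddFn.sum _ fun x => BddFn.sum _ fun i => bddFn_ind _

theorem bddFn_freeCount : BddFn (freeCount T : (Fin n → DotSpin d k) → ℝ) := by
  have : (freeCount T : (Fin n → DotSpin d k) → ℝ) = fun u => _ := funext (freeCount_eq T)
  rw [this]
  exact BddFn.sum _ fun x => BddFn.sum _ fun i => bddFn_ind _

theorem bddFn_offCount (s : DotSpin d k) (x : Bool) :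
    BddFn (offCount s x : (Fin n → DotSpin d k) → ℝ) := by
  have : (offCount s x : (Fin n → DotSpin d k) → ℝ) = fun u => _ :=
    funext fun u => offCount_eq u s x
  rw [this]
  exact BddFn.sum _ fun i => bddFn_ind _

theorem BddFn.pair {Φ Ψ : (Fin n → DotSpin d k) → ℝ} (hΦ : BddFn Φ) (hΨ : BddFn Ψ) :
    BddFn fun u : Fin n → DotSpin d k × DotSpin d k =>
      Φ (fun j => (u j).1) * Ψ fun j => (u j).2 :=
  (hΦ.comp fun (u : Fin n → DotSpin d k × DotSpin d k) j => (u j).1).mul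
    (hΨ.comp fun (u : Fin n → DotSpin d k × DotSpin d k) j => (u j).2)

theorem pairInteg_swap (Φ Ψ : (Fin n → DotSpin d k) → ℝ) :
    pairInteg (fun p => q p.swap) Φ Ψ = pairInteg q Ψ Φ := by
  unfold pairInteg integ
  rw [← (Equiv.piCongrRight fun _ : Fin n => Equiv.prodComm (DotSpin d k) (DotSpin d k)).tsum_eq
    fun u => (Φ (fun j => (u j).1) * Ψ fun j => (u j).2) * ∏ j, q (u j).swap]
  refine tsum_congr fun u => ?_
  simp [mul_comm]

variable {Φ Φ' Ψ Ψ' : (Fin n → DotSpin d k) → ℝ}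

namespace Balanced

theorem pairInteg_mono (h : Balanced T K a b τ β q) (hΦ : BddFn Φ) (hΨ : BddFn Ψ)
    (hΦ' : BddFn Φ') (hΨ' : BddFn Ψ') (hle : ∀ u v, Φ u * Ψ v ≤ Φ' u * Ψ' v) :
    pairInteg q Φ Ψ ≤ pairInteg q Φ' Ψ' :=
  integ_mono (hΦ.pair hΨ) (hΦ'.pair hΨ') (fun _ => h.summable) (fun _ => h.nonneg)
    fun _ => hle _ _

theorem pairInteg_nonneg (h : Balanced T K a b τ β q) (hΦ : ∀ u, 0 ≤ Φ u) (hΨ : ∀ u, 0 ≤ Ψ u) :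
    0 ≤ pairInteg q Φ Ψ :=
  integ_nonneg (fun _ => mul_nonneg (hΦ _) (hΨ _)) fun _ => h.nonneg

theorem pairInteg_add_left (h : Balanced T K a b τ β q) (hΦ : BddFn Φ) (hΦ' : BddFn Φ')
    (hΨ : BddFn Ψ) :
    pairInteg q (fun u => Φ u + Φ' u) Ψ = pairInteg q Φ Ψ + pairInteg q Φ' Ψ := by
  unfold pairInteg
  rw [← integ_add (hΦ.pair hΨ) (hΦ'.pair hΨ) fun _ => h.summable]
  simp only [add_mul]

theorem pairInteg_sub_left (h : Balanced T K a b τ β q) (hΦ : BddFn Φ) (hΦ' : BddFn Φ')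
    (hΨ : BddFn Ψ) :
    pairInteg q (fun u => Φ u - Φ' u) Ψ = pairInteg q Φ Ψ - pairInteg q Φ' Ψ := by
  unfold pairInteg
  rw [← integ_sub (hΦ.pair hΨ) (hΦ'.pair hΨ) fun _ => h.summable]
  simp only [sub_mul]

theorem pairInteg_add_right (h : Balanced T K a b τ β q) (hΦ : BddFn Φ) (hΨ : BddFn Ψ)
    (hΨ' : BddFn Ψ') :
    pairInteg q Φ (fun u => Ψ u + Ψ' u) = pairInteg q Φ Ψ + pairInteg q Φ Ψ' := by
  unfold pairInteg
  rw [← integ_add (hΦ.pair hΨ) (hΦ.pair hΨ') fun _ => h.summable]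
  simp only [mul_add]

theorem pairInteg_sub_right (h : Balanced T K a b τ β q) (hΦ : BddFn Φ) (hΨ : BddFn Ψ)
    (hΨ' : BddFn Ψ') :
    pairInteg q Φ (fun u => Ψ u - Ψ' u) = pairInteg q Φ Ψ - pairInteg q Φ Ψ' := by
  unfold pairInteg
  rw [← integ_sub (hΦ.pair hΨ) (hΦ.pair hΨ') fun _ => h.summable]
  simp only [mul_sub]

/-- The integral factors over the coordinates and each factor is the normalized open mass. Because
the value does not depend on the weight, main terms cancel exactly whenever two balanced weights are
compared. -/
theorem pairInteg_open_open (h : Balanced T K a b τ β q) :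
    pairInteg q (allOpen T : (Fin n → DotSpin d k) → ℝ) (allOpen T) = 1 := by
  unfold pairInteg allOpen
  simp only [← Finset.prod_mul_distrib]
  rw [integ_prod (χ := fun (_ : Fin n) (p : DotSpin d k × DotSpin d k) =>
    ind (p.1.Open T) * ind (p.2.Open T))
    (fun _ => (bddFn_ind fun p : DotSpin d k × DotSpin d k => p.1.Open T).mul
      (bddFn_ind fun p : DotSpin d k × DotSpin d k => p.2.Open T)) fun _ => h.summable]
  exact Finset.prod_eq_one fun _ _ => h.openOpen

theorem pairInteg_open_near (h : Balanced T K a b τ β q) :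
    pairInteg q (allOpen T : (Fin n → DotSpin d k) → ℝ) (nearCount T) ≤ openBound n K a := by
  refine ((h.weightFamily n).integ_near_le (r := 0) (f := fun p => ind (p.1.Open T))
    (g := fun x p => ind (p.2.Near T x)) (fun _ => ind_mem_unit _) (fun _ _ => ind_mem_unit _)
    h.a_nonneg h.a_le (by simp) fun x _ _ => h.openNear x).trans (le_of_eq ?_)
  simp [openBound]

theorem pairInteg_near_open (h : Balanced T K a b τ β q) :
    pairInteg q (nearCount T : (Fin n → DotSpin d k) → ℝ) (allOpen T) ≤ openBound n K a := by
  rw [← pairInteg_swap]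
  exact h.swap.pairInteg_open_near

theorem pairInteg_near_near (h : Balanced T K a b τ β q) :
    pairInteg q (nearCount T : (Fin n → DotSpin d k) → ℝ) (nearCount T) ≤ nearBound n K b := by
  refine ((h.weightFamily n).integ_near_near_le (r := 0) (f := fun x p => ind (p.1.Near T x))
    (g := fun x p => ind (p.2.Near T x)) (fun _ _ => ind_mem_unit _) (fun _ _ => ind_mem_unit _)
    h.b_nonneg h.b_le (by simp) fun x y _ _ => h.nearNear x y).trans (le_of_eq ?_)
  simp [nearBound]

theorem pairInteg_free_open (h : Balanced T K a b τ β q) :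
    pairInteg q (freeCount T : (Fin n → DotSpin d k) → ℝ) (allOpen T) ≤
      2 * n * (τ * a ^ (n - 1)) := by
  refine le_trans (le_of_eq ?_) ((h.weightFamily n).integ_special_le
    (f := fun p => ind (p.2.Open T)) (φ := fun p => ind (p.1.IsFree ∧ p.1.Open T))
    (g := fun x p => ind (p.1.Near T x)) (fun _ => ind_mem_unit _) (fun _ => ind_mem_unit _)
    (fun _ _ => ind_mem_unit _) (fun _ => h.freeOpen) fun x _ => h.nearOpen x)
  unfold pairInteg
  congr 1
  funext u
  rw [mul_comm]
  rfl

theorem le_pairInteg_blue_open (h : Balanced T K a b τ β q) (x : Bool) :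
    β ^ n ≤ pairInteg q (allBlue x : (Fin n → DotSpin d k) → ℝ) (allOpen T) := by
  unfold pairInteg allBlue allOpen
  simp only [← Finset.prod_mul_distrib]
  rw [integ_prod (χ := fun (_ : Fin n) (p : DotSpin d k × DotSpin d k) =>
    ind (p.1 = .blue x) * ind (p.2.Open T))
    (fun _ => (bddFn_ind fun p : DotSpin d k × DotSpin d k => p.1 = .blue x).mul
      (bddFn_ind fun p : DotSpin d k × DotSpin d k => p.2.Open T)) fun _ => h.summable]
  refine le_trans (le_of_eq ?_)
    (Finset.prod_le_prod (fun _ _ => h.beta_nonneg) fun _ _ => h.blueOpen x)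
  simp

section lipschitz

theorem prod_hybrid_weight (c : ℝ) (l : Fin n) : ∏ j : Fin n, (if j = l then c else 1) = c := by
  rw [Finset.prod_ite_eq']; simp

theorem sum_integ_open_near (h : Balanced T K a b τ β q)
    (h' : Balanced T K a b τ β q') :
    ∑ l : Fin n, integ (fun u => allOpen T (fun j => (u j).1) * nearCount T fun j => (u j).2)
      (hybrid q q' l) ≤ openLip n K a * ∑' p, |q p - q' p| := by
  have : ∀ l ∈ Finset.univ, integ (fun u : Fin n → _ =>
      allOpen T (fun j => (u j).1) * nearCount T fun j => (u j).2) (hybrid q q' l) ≤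
      2 * n * ((∑' p, |q p - q' p|) * (K ^ 2 * a ^ (n - 2))) := fun l _ => by
    have := (h.weightFamily_hybrid h' l).integ_near_le (r := 1) (f := fun p => ind (p.1.Open T))
      (g := fun x p => ind (p.2.Near T x)) (fun _ => ind_mem_unit _) (fun _ _ => ind_mem_unit _)
      h.a_nonneg h.a_le (by simp) fun x j hj => hybrid_off hj
        (P := fun ν => ∑' p : DotSpin d k × DotSpin d k, ind (p.1.Open T) * ind (p.2.Near T x) * ν p ≤ a)
        (h.openNear x) (h'.openNear x)
    rwa [prod_hybrid_weight] at this
  refine (Finset.sum_le_sum this).trans (le_of_eq ?_)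
  simp only [Finset.sum_const, Finset.card_univ, Fintype.card_fin, nsmul_eq_mul, openLip]
  ring

theorem sum_integ_near_open (h : Balanced T K a b τ β q)
    (h' : Balanced T K a b τ β q') :
    ∑ l : Fin n, integ (fun u => nearCount T (fun j => (u j).1) * allOpen T fun j => (u j).2)
      (hybrid q q' l) ≤ openLip n K a * ∑' p, |q p - q' p| := by
  have : ∀ l ∈ Finset.univ, integ (fun u : Fin n → _ =>
      nearCount T (fun j => (u j).1) * allOpen T fun j => (u j).2) (hybrid q q' l) ≤
      2 * n * ((∑' p, |q p - q' p|) * (K ^ 2 * a ^ (n - 2))) := fun l _ => by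
    have := (h.weightFamily_hybrid h' l).integ_near_le (r := 1) (f := fun p => ind (p.2.Open T))
      (g := fun x p => ind (p.1.Near T x)) (fun _ => ind_mem_unit _) (fun _ _ => ind_mem_unit _)
      h.a_nonneg h.a_le (by simp) fun x j hj => hybrid_off hj
        (P := fun ν => ∑' p : DotSpin d k × DotSpin d k, ind (p.2.Open T) * ind (p.1.Near T x) * ν p ≤ a)
        (h.nearOpen x) (h'.nearOpen x)
    rw [prod_hybrid_weight] at this
    simp only [mul_comm (nearCount T _)]
    exact this
  refine (Finset.sum_le_sum this).trans (le_of_eq ?_)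
  simp only [Finset.sum_const, Finset.card_univ, Fintype.card_fin, nsmul_eq_mul, openLip]
  ring

theorem sum_integ_near_near (h : Balanced T K a b τ β q)
    (h' : Balanced T K a b τ β q') :
    ∑ l : Fin n, integ (fun u => nearCount T (fun j => (u j).1) * nearCount T fun j => (u j).2)
      (hybrid q q' l) ≤ nearLip n K b * ∑' p, |q p - q' p| := by
  have : ∀ l ∈ Finset.univ, integ (fun u : Fin n → _ =>
      nearCount T (fun j => (u j).1) * nearCount T fun j => (u j).2) (hybrid q q' l) ≤
      4 * n ^ 2 * ((∑' p, |q p - q' p|) * (K ^ 3 * b ^ (n - 3))) := fun l _ => by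
    have := (h.weightFamily_hybrid h' l).integ_near_near_le (r := 1)
      (f := fun x p => ind (p.1.Near T x))
      (g := fun x p => ind (p.2.Near T x)) (fun _ _ => ind_mem_unit _) (fun _ _ => ind_mem_unit _)
      h.b_nonneg h.b_le (by simp) fun x y j hj => hybrid_off hj
        (P := fun ν => ∑' p : DotSpin d k × DotSpin d k, ind (p.1.Near T x) * ind (p.2.Near T y) * ν p ≤ b)
        (h.nearNear x y) (h'.nearNear x y)
    rwa [prod_hybrid_weight] at this
  refine (Finset.sum_le_sum this).trans (le_of_eq ?_)
  simp only [Finset.sum_const, Finset.card_univ, Fintype.card_fin, nsmul_eq_mul, nearLip]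
  ring

end lipschitz

end Balanced

end counts

end balanced

-- Tested clause outputs: size, gap and discrepancy

section pairing

variable {d k : ℕ} {T : ℕ∞} {K a b τ β lam : ℝ} {q q' : DotSpin d k × DotSpin d k → ℝ}

theorem bddFn_response (hlam : 0 ≤ lam) (κ : TestKind) (x : Bool) :
    BddFn (response lam T κ x : (Fin (k - 1) → DotSpin d k) → ℝ) :=
  BddFn.of_mem 1 fun u => ⟨response_nonneg hlam κ x u, response_le_one hlam κ x u⟩

theorem DotSpin.open_add {s : DotSpin d k} : (s.add true).Open T ↔ s.Open T := by
  cases s with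
  | red x => exact Iff.rfl
  | blue x => exact Iff.rfl
  | free t =>
    change ((t.1.neg.size .var : ℕ) : ℕ∞) ≤ T ↔ _
    rw [Msg.size_neg]
    exact Iff.rfl

/-- The weight that the outgoing pair of a clause gives to a pair of test functions. -/
def pairing (lam : ℝ) (T : ℕ∞) (q : DotSpin d k × DotSpin d k → ℝ) (κ : TestKind) (x : Bool)
    (κ' : TestKind) (y : Bool) : ℝ :=
  pairInteg q (n := k - 1) (response lam T κ x) (response lam T κ' y)

theorem pairing_swap (κ : TestKind) (x : Bool) (κ' : TestKind) (y : Bool) :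
    pairing lam T (fun p => q p.swap) κ x κ' y = pairing lam T q κ' y κ x := pairInteg_swap _ _

theorem allOpen_mem_unit {n : ℕ} (u : Fin n → DotSpin d k) :
    0 ≤ allOpen T u ∧ allOpen T u ≤ 1 := by rw [allOpen_eq]; exact ind_mem_unit _

theorem allBlue_mem_unit {n : ℕ} (x : Bool) (u : Fin n → DotSpin d k) :
    0 ≤ allBlue x u ∧ allBlue x u ≤ 1 := by rw [allBlue_eq]; exact ind_mem_unit _

theorem freeCount_le_nearCount {n : ℕ} (u : Fin n → DotSpin d k) :
    freeCount T u ≤ nearCount T u := by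
  rw [freeCount_eq, nearCount_eq]
  exact Finset.sum_le_sum fun x _ => Finset.sum_le_sum fun i _ => ind_mono And.right

theorem offCount_le_nearCount {n : ℕ} (s : DotSpin d k) (x : Bool) (u : Fin n → DotSpin d k) :
    offCount s x u ≤ nearCount T u := by
  rw [offCount_eq, nearCount_eq]
  refine le_trans (Finset.sum_le_sum fun i _ => ind_mono fun h j hj => ?_)
    (Finset.single_le_sum (f := fun x => ∑ i, ind (∀ j, j ≠ i → (u j).Near T x))
      (fun _ _ => Finset.sum_nonneg fun _ _ => (ind_mem_unit _).1) (Finset.mem_univ x))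
  rw [h.2 j hj]; rfl

namespace Balanced

theorem pairInteg_flip {n : ℕ} (h : Balanced T K a b τ β q) (Φ Ψ : (Fin n → DotSpin d k) → ℝ) :
    pairInteg q (fun u => Φ fun j => (u j).add true) (fun u => Ψ fun j => (u j).add true) =
      pairInteg q Φ Ψ := by
  unfold pairInteg integ
  rw [← (Equiv.piCongrRight fun _ : Fin n =>
    (DotSpin.flipEquiv (d := d) (k := k)).prodCongr DotSpin.flipEquiv).tsum_eq
    fun u => (Φ (fun j => (u j).1) * Ψ fun j => (u j).2) * ∏ j, q (u j)]
  refine tsum_congr fun u => ?_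
  congr 1
  exact Finset.prod_congr rfl fun j _ => (h.flip (u j)).symm

theorem pairing_flip (h : Balanced T K a b τ β q) (hk : 1 < k) (κ : TestKind) (x : Bool)
    (κ' : TestKind) (y : Bool) :
    pairing lam T q κ (!x) κ' (!y) = pairing lam T q κ x κ' y := by
  unfold pairing
  rw [← h.pairInteg_flip (response lam T κ x)]
  congr 1 <;> funext u <;> exact (response_flip hk _ _ u).symm

variable {Ψ : (Fin (k - 1) → DotSpin d k) → ℝ}

theorem pairInteg_near_le (h : Balanced T K a b τ β q) (hΨ : BddFn Ψ)
    (hle : ∀ u, Ψ u ≤ allOpen T u + nearCount T u) :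
    pairInteg q (nearCount T) Ψ ≤ openBound (k - 1) K a + nearBound (k - 1) K b := by
  refine (h.pairInteg_mono bddFn_nearCount hΨ bddFn_nearCount
    (bddFn_allOpen.add bddFn_nearCount) fun u v => mul_le_mul_of_nonneg_left (hle v)
      (nearCount_nonneg T u)).trans ?_
  rw [h.pairInteg_add_right bddFn_nearCount bddFn_allOpen bddFn_nearCount]
  exact add_le_add h.pairInteg_near_open h.pairInteg_near_near

/-- Against an open second tuple the coordinates factor, each contributing at least `β`. Passing
from `allOpen` to `Ψ` costs only near-near mass, since an all-blue tuple is itself nearly constant.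
-/
theorem le_pairInteg_blue (h : Balanced T K a b τ β q) (hk : 1 < k) (hΨ : BddFn Ψ)
    (hle : ∀ u, allOpen T u - nearCount T u ≤ Ψ u) (x : Bool) :
    β ^ (k - 1) - nearBound (k - 1) K b ≤ pairInteg q (allBlue x) Ψ := by
  have h1 : pairInteg q (n := k - 1) (allBlue x) (nearCount T) ≤ nearBound (k - 1) K b :=
    (h.pairInteg_mono (bddFn_allBlue x) bddFn_nearCount bddFn_nearCount bddFn_nearCount
      fun u v => mul_le_mul_of_nonneg_right (allBlue_le_nearCount T u (by omega) x)
        (nearCount_nonneg T v)).trans h.pairInteg_near_near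
  have h2 := h.le_pairInteg_blue_open (n := k - 1) x
  have h3 : pairInteg q (allBlue x) (fun u => allOpen T u - nearCount T u) ≤
      pairInteg q (allBlue x) Ψ :=
    h.pairInteg_mono (bddFn_allBlue x) (bddFn_allOpen.sub bddFn_nearCount) (bddFn_allBlue x) hΨ
      fun u v => mul_le_mul_of_nonneg_left (hle v) (allBlue_mem_unit x u).1
  rw [h.pairInteg_sub_right (bddFn_allBlue x) bddFn_allOpen bddFn_nearCount] at h3
  linarith

/-- Recoloring the distinguished coordinate from `blue (!x)` to `red (!x)` is a bijection of
configurations that, by condition (c), keeps at least the fraction `1 - τ` of the weight. -/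
theorem pairInteg_offCount (h : Balanced T K a b τ β q) (hΨ : BddFn Ψ) (h0 : ∀ u, 0 ≤ Ψ u)
    (x : Bool) :
    (1 - τ) * pairInteg q (offCount (.blue (!x)) x) Ψ ≤
      pairInteg q (offCount (.red (!x)) x) Ψ := by
  classical
  let P : DotSpin d k → Fin (k - 1) → (Fin (k - 1) → DotSpin d k) → ℝ :=
    fun s i u => ind (u i = s ∧ ∀ j, j ≠ i → u j = .blue x)
  have hP : ∀ s i, BddFn (P s i) := fun s i => bddFn_ind _
  have e : ∀ s, pairInteg q (offCount s x) Ψ = ∑ i, pairInteg q (P s i) Ψ := fun s => by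
    have h1 : (offCount s x : (Fin (k - 1) → DotSpin d k) → ℝ) = fun u => ∑ i, P s i u :=
      funext fun u => offCount_eq u s x
    have h2 := integ_sum Finset.univ (Φ := fun i (u : Fin (k - 1) → DotSpin d k × DotSpin d k) =>
      P s i (fun j => (u j).1) * Ψ fun j => (u j).2) (fun i => (hP s i).pair hΨ)
      (ν := fun _ => q) fun _ => h.summable
    rw [h1]
    unfold pairInteg
    rw [← h2]
    simp only [Finset.sum_mul]
  rw [e, e, Finset.mul_sum]
  refine Finset.sum_le_sum fun i _ => ?_
  -- The swap acts on the first spin of coordinate `i` only, so the second tuple, and with it `Ψ`,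
  -- is unchanged.
  refine le_integ_of_exchange ((Equiv.swap (.red (!x)) (.blue (!x))).prodCongr (Equiv.refl _)) i
    h.summable h.nonneg ((hP _ i).pair hΨ) ((hP _ i).pair hΨ) fun u => ?_
  have h2 : (fun j => (Function.update u i (((Equiv.swap (.red (!x)) (.blue (!x))).prodCongr
      (Equiv.refl _)) (u i)) j).2) = fun j => (u j).2 := by
    funext j
    by_cases hj : j = i
    · subst hj; simp
    · simp [hj]
  rw [h2]
  by_cases hu : (u i).1 = .blue (!x) ∧ ∀ j, j ≠ i → (u j).1 = .blue x
  · have hu' : (Function.update u i (((Equiv.swap (.red (!x)) (.blue (!x))).prodCongr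
        (Equiv.refl _)) (u i)) i).1 = .red (!x) ∧ ∀ j, j ≠ i →
        (Function.update u i (((Equiv.swap (.red (!x)) (.blue (!x))).prodCongr
        (Equiv.refl _)) (u i)) j).1 = .blue x := by
      refine ⟨by simp [hu.1], fun j hj => ?_⟩
      rw [Function.update_of_ne hj]
      exact hu.2 j hj
    simp only [P]
    rw [ind_of hu, ind_of hu', one_mul]
    have h3 := h.redLeft (!x) (u i).2
    have h4 : ((Equiv.swap (.red (!x)) (.blue (!x))).prodCongr (Equiv.refl _)) (u i) =
        (.red (!x), (u i).2) := by
      ext <;> simp [hu.1]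
    have h5 : u i = (.blue (!x), (u i).2) := Prod.ext hu.1 rfl
    rw [h4, mul_left_comm]
    refine mul_le_mul_of_nonneg_left ?_ (h0 _)
    rw [← h5] at h3
    exact h3
  · simp only [P]
    rw [ind_of_not hu]
    simp only [zero_mul, mul_zero]
    exact mul_nonneg (mul_nonneg (ind_mem_unit _).1 (h0 _)) (h.nonneg _)

/-- The error in the comparison of colored and free responses. -/
def _root_.NaeSat.gapError (n : ℕ) (K a b τ : ℝ) : ℝ :=
  2 * nearBound n K b + τ * (openBound n K a + nearBound n K b) + 2 * n * (τ * a ^ (n - 1))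

theorem pairInteg_free_le (h : Balanced T K a b τ β q) (hΨ : BddFn Ψ)
    (hle : ∀ u, Ψ u ≤ allOpen T u + nearCount T u) :
    pairInteg q (freeCount T) Ψ ≤
      2 * ((k - 1 : ℕ) : ℝ) * (τ * a ^ (k - 1 - 1)) + nearBound (k - 1) K b := by
  refine (h.pairInteg_mono bddFn_freeCount hΨ bddFn_freeCount
    (bddFn_allOpen.add bddFn_nearCount) fun u v => mul_le_mul_of_nonneg_left (hle v)
      (freeCount_nonneg T u)).trans ?_
  rw [h.pairInteg_add_right bddFn_freeCount bddFn_allOpen bddFn_nearCount]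
  refine add_le_add h.pairInteg_free_open (le_trans ?_ h.pairInteg_near_near)
  exact h.pairInteg_mono bddFn_freeCount bddFn_nearCount bddFn_nearCount bddFn_nearCount
    fun u v => mul_le_mul_of_nonneg_right (freeCount_le_nearCount u) (nearCount_nonneg T v)

/-- Integrated form of the pointwise comparison: the all-blue tuples supply the gain `β ^ (k - 1)`.
The single red and single blue defects may each have weight of order k 2^(-k), more than the gain
itself, so they must cancel; by condition (c) they do so up to the factor `τ`. A free spin costs
another factor `τ`. -/
theorem pairInteg_colored_sub_free (h : Balanced T K a b τ β q) (hlam : 0 ≤ lam) (hk : 1 < k)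
    (hΨ : BddFn Ψ) (h0 : ∀ u, 0 ≤ Ψ u) (hle : ∀ u, |Ψ u - allOpen T u| ≤ nearCount T u)
    (x : Bool) :
    β ^ (k - 1) - gapError (k - 1) K a b τ ≤
      pairInteg q (response lam T .colored x) Ψ - pairInteg q (response lam T .free x) Ψ := by
  have hle1 : ∀ u, allOpen T u - nearCount T u ≤ Ψ u := fun u => by
    linarith [(abs_le.1 (hle u)).1]
  have hle2 : ∀ u, Ψ u ≤ allOpen T u + nearCount T u := fun u => by
    linarith [(abs_le.1 (hle u)).2]
  have hB := bddFn_allBlue (d := d) (k := k) (n := k - 1) (!x)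
  have hR := bddFn_offCount (d := d) (k := k) (n := k - 1) (.red (!x)) x
  have hO := bddFn_offCount (d := d) (k := k) (n := k - 1) (.blue (!x)) x
  have hF := bddFn_freeCount (d := d) (k := k) (n := k - 1) (T := T)
  have hG := bddFn_response (d := d) (k := k) (T := T) hlam .colored x
  have hf := bddFn_response (d := d) (k := k) (T := T) hlam .free x
  have h1 : pairInteg q (fun u => allBlue (!x) u + offCount (.red (!x)) x u -
      offCount (.blue (!x)) x u - freeCount T u) Ψ ≤
      pairInteg q (fun u => response lam T .colored x u - response lam T .free x u) Ψ :=
    h.pairInteg_mono (((hB.add hR).sub hO).sub hF) hΨ (hG.sub hf) hΨ fun u v =>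
      mul_le_mul_of_nonneg_right (le_response_colored_sub_free u hlam x) (h0 v)
  rw [h.pairInteg_sub_left ((hB.add hR).sub hO) hF hΨ, h.pairInteg_sub_left (hB.add hR) hO hΨ,
    h.pairInteg_add_left hB hR hΨ, h.pairInteg_sub_left hG hf hΨ] at h1
  have h2 := h.le_pairInteg_blue hk hΨ hle1 (!x)
  have h3 := h.pairInteg_offCount hΨ h0 x
  have h4 := h.pairInteg_free_le hΨ hle2
  have h5 : pairInteg q (n := k - 1) (offCount (.blue (!x)) x) Ψ ≤
      openBound (k - 1) K a + nearBound (k - 1) K b :=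
    (h.pairInteg_mono hO hΨ bddFn_nearCount hΨ fun u v =>
      mul_le_mul_of_nonneg_right (offCount_le_nearCount _ _ u) (h0 v)).trans
      (h.pairInteg_near_le hΨ hle2)
  have h6 := mul_le_mul_of_nonneg_left h5 h.tau_nonneg
  unfold gapError
  linarith

theorem pairInteg_colored_sub_blue (h : Balanced T K a b τ β q) (hlam : 0 ≤ lam) (hk : 1 < k)
    (hΨ : BddFn Ψ) (hle : ∀ u, |Ψ u - allOpen T u| ≤ nearCount T u) (x : Bool) :
    β ^ (k - 1) - nearBound (k - 1) K b ≤
      pairInteg q (response lam T .colored x) Ψ - pairInteg q (response lam T .blue x) Ψ := by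
  rw [← h.pairInteg_sub_left (bddFn_response hlam _ _) (bddFn_response hlam _ _) hΨ]
  simp only [response_colored_sub_blue]
  exact h.le_pairInteg_blue hk hΨ (fun u => by linarith [(abs_le.1 (hle u)).1]) _

theorem pairing_mono_left (h : Balanced T K a b τ β q) (hlam : 0 ≤ lam) (x : Bool) (κ' : TestKind)
    (y : Bool) : pairing lam T q .blue x κ' y ≤ pairing lam T q .colored x κ' y :=
  h.pairInteg_mono (bddFn_response hlam _ _) (bddFn_response hlam _ _) (bddFn_response hlam _ _)
    (bddFn_response hlam _ _) fun u v =>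
      mul_le_mul_of_nonneg_right (response_blue_le_colored hlam x u) (response_nonneg hlam _ _ v)

theorem pairing_mono_right (h : Balanced T K a b τ β q) (hlam : 0 ≤ lam) (κ : TestKind) (x : Bool)
    (y : Bool) : pairing lam T q κ x .blue y ≤ pairing lam T q κ x .colored y := by
  rw [← pairing_swap (q := q), ← pairing_swap (q := q)]
  exact h.swap.pairing_mono_left hlam y κ x

theorem pairing_nonneg (h : Balanced T K a b τ β q) (hlam : 0 ≤ lam) (κ : TestKind) (x : Bool)
    (κ' : TestKind) (y : Bool) : 0 ≤ pairing lam T q κ x κ' y :=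
  h.pairInteg_nonneg (fun _ => response_nonneg hlam _ _ _) fun _ => response_nonneg hlam _ _ _

theorem nearBound_nonneg {n : ℕ} (h : Balanced T K a b τ β q) : 0 ≤ nearBound n K b := by
  have := h.b_nonneg
  unfold nearBound; positivity

theorem openBound_nonneg {n : ℕ} (h : Balanced T K a b τ β q) : 0 ≤ openBound n K a := by
  have := h.a_nonneg
  have := h.one_le
  unfold openBound; positivity

theorem nearBound_le_gapError {n : ℕ} (h : Balanced T K a b τ β q) :
    nearBound n K b ≤ gapError n K a b τ := by
  have h1 := h.nearBound_nonneg (n := n)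
  have h2 := h.openBound_nonneg (n := n)
  have := h.tau_nonneg
  have := h.a_nonneg
  have h3 : 0 ≤ τ * (openBound n K a + nearBound n K b) := by positivity
  have h4 : 0 ≤ 2 * (n : ℝ) * (τ * a ^ (n - 1)) := by positivity
  unfold gapError
  linarith

/-- All pairs of test functions other than two colored ones carry less weight. -/
theorem pairing_le (h : Balanced T K a b τ β q) (hlam : 0 ≤ lam) (hT : 1 ≤ T) (hk : 1 < k)
    {κ κ' : TestKind} (hκ : ¬ (κ = .colored ∧ κ' = .colored)) (x y : Bool) :
    pairing lam T q κ x κ' y ≤ pairing lam T q .colored x .colored y -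
      (β ^ (k - 1) - 2 * gapError (k - 1) K a b τ) := by
  have hge := h.nearBound_le_gapError (n := k - 1)
  have hg0 := h.nearBound_nonneg (n := k - 1)
  have hβ : 0 ≤ β ^ (k - 1) := pow_nonneg h.beta_nonneg _
  have hL : ∀ {q : DotSpin d k × DotSpin d k → ℝ}, Balanced T K a b τ β q → ∀ κ' x y, pairing lam T q .free x κ' y ≤
      pairing lam T q .colored x κ' y - (β ^ (k - 1) - gapError (k - 1) K a b τ) :=
    fun {q} h κ' x y => by
      have := h.pairInteg_colored_sub_free hlam hk (bddFn_response hlam κ' y)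
        (response_nonneg hlam κ' y) (fun u => abs_response_sub_le u hlam hT hk κ' y) x
      unfold pairing; linarith
  have hLb : ∀ {q : DotSpin d k × DotSpin d k → ℝ}, Balanced T K a b τ β q → ∀ κ' x y, pairing lam T q .blue x κ' y ≤
      pairing lam T q .colored x κ' y - (β ^ (k - 1) - nearBound (k - 1) K b) :=
    fun {q} h κ' x y => by
      have := h.pairInteg_colored_sub_blue hlam hk (bddFn_response hlam κ' y)
        (fun u => abs_response_sub_le u hlam hT hk κ' y) x
      unfold pairing; linarith
  have hR : ∀ κ x y, pairing lam T q κ x .free y ≤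
      pairing lam T q κ x .colored y - (β ^ (k - 1) - gapError (k - 1) K a b τ) := fun κ x y => by
    rw [← pairing_swap (q := q), ← pairing_swap (q := q)]
    exact hL h.swap κ y x
  have hRb : ∀ κ x y, pairing lam T q κ x .blue y ≤
      pairing lam T q κ x .colored y - (β ^ (k - 1) - nearBound (k - 1) K b) := fun κ x y => by
    rw [← pairing_swap (q := q), ← pairing_swap (q := q)]
    exact hLb h.swap κ y x
  have hm := h.pairing_mono_left (lam := lam) hlam x
  cases κ with
  | colored =>
    cases κ' with
    | colored => exact absurd ⟨rfl, rfl⟩ hκ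
    | blue => linarith [hRb .colored x y]
    | free => linarith [hR .colored x y]
  | blue =>
    cases κ' with
    | colored => linarith [hLb h .colored x y]
    | blue => linarith [hLb h .colored x y, h.pairing_mono_right hlam .blue x y]
    | free => linarith [hm .free y, hR .colored x y]
  | free =>
    cases κ' with
    | colored => linarith [hL h .colored x y]
    | blue => linarith [hL h .colored x y, h.pairing_mono_right hlam .free x y]
    -- Two gaps are lost here. One copy of `β ^ (k - 1)` is discarded as nonnegative, but both error
    -- terms stay, whence the factor 2 in front of `gapError`.
    | free => linarith [hL h .free x y, hR .colored x y]

/-- Each response is `allOpen` up to `nearCount`. The product of the two main parts integrates to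
exactly one, and the cross terms to the open-near, near-open and near-near bounds. -/
theorem abs_pairing_sub_one_le (h : Balanced T K a b τ β q) (hlam : 0 ≤ lam) (hT : 1 ≤ T)
    (hk : 1 < k) (κ : TestKind) (x : Bool) (κ' : TestKind) (y : Bool) :
    |pairing lam T q κ x κ' y - 1| ≤
      2 * openBound (k - 1) K a + nearBound (k - 1) K b := by
  have hA := bddFn_allOpen (d := d) (k := k) (n := k - 1) (T := T)
  have hN := bddFn_nearCount (d := d) (k := k) (n := k - 1) (T := T)
  have hR := bddFn_response (d := d) (k := k) (T := T) hlam κ x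
  have hS := bddFn_response (d := d) (k := k) (T := T) hlam κ' y
  have hΦ := ((hA.pair hN).add (hN.pair hA)).add (hN.pair hN)
  have h0 : pairing lam T q κ x κ' y - 1 = integ (fun u : Fin (k - 1) → _ =>
      response lam T κ x (fun j => (u j).1) * response lam T κ' y (fun j => (u j).2) -
        allOpen T (fun j => (u j).1) * allOpen T fun j => (u j).2) fun _ => q := by
    rw [integ_sub (hR.pair hS) (hA.pair hA) fun _ => h.summable]
    exact congrArg _ h.pairInteg_open_open.symm
  rw [h0]
  refine (abs_integ_le ((hR.pair hS).sub (hA.pair hA)) hΦ (fun _ => h.summable)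
    (fun _ => h.nonneg) fun u => ?_).trans ?_
  · have h1 := abs_response_sub_le (fun j => (u j).1) hlam hT hk κ x
    have h2 := abs_response_sub_le (fun j => (u j).2) hlam hT hk κ' y
    have a1 := (allOpen_mem_unit (T := T) fun j => (u j).1).1
    have a2 := (allOpen_mem_unit (T := T) fun j => (u j).2).1
    generalize response lam T κ x (fun j => (u j).1) = r at *
    generalize response lam T κ' y (fun j => (u j).2) = s at *
    generalize allOpen T (fun j => (u j).1) = A at *
    generalize allOpen T (fun j => (u j).2) = B at *
    rw [show r * s - A * B = A * (s - B) + (r - A) * B + (r - A) * (s - B) by ring]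
    refine (abs_add_three _ _ _).trans ?_
    rw [abs_mul, abs_mul, abs_mul, abs_of_nonneg a1, abs_of_nonneg a2]
    gcongr
    exact nearCount_nonneg _ _
  · have h1 := h.pairInteg_open_near (n := k - 1)
    have h2 := h.pairInteg_near_open (n := k - 1)
    have h3 := h.pairInteg_near_near (n := k - 1)
    have e1 := integ_add (hA.pair hN) (hN.pair hA) (ν := fun _ => q) fun _ => h.summable
    have e2 := integ_add ((hA.pair hN).add (hN.pair hA)) (hN.pair hN) (ν := fun _ => q)
      fun _ => h.summable
    rw [e2, e1]
    unfold pairInteg at h1 h2 h3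
    linarith

/-- Global negation fixes `allOpen` and exchanges the two colored responses, so `allOpen` in the
first copy integrates to zero against their difference in the second. Subtracting it makes both
factors small at once, and the discrepancy becomes second order. -/
theorem pairing_discrepancy (h : Balanced T K a b τ β q) (hlam : 0 ≤ lam) (hk : 1 < k) :
    pairing lam T q .colored false .colored false - pairing lam T q .colored false .colored true =
      pairInteg q (n := k - 1) (fun u => response lam T .colored false u - allOpen T u)
        fun u => response lam T .colored false u - response lam T .colored true u := by
  have hG := fun x => bddFn_response (d := d) (k := k) (T := T) hlam .colored x
  have hA := bddFn_allOpen (d := d) (k := k) (n := k - 1) (T := T)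
  have h1 : pairInteg q (n := k - 1) (allOpen T) (response lam T .colored false) =
      pairInteg q (allOpen T) (response lam T .colored true) := by
    rw [← h.pairInteg_flip (allOpen T)]
    congr 1 <;> funext u
    · unfold allOpen
      refine Finset.prod_congr rfl fun j _ => ind_congr ?_
      exact DotSpin.open_add
    · exact response_flip hk .colored false u
  rw [h.pairInteg_sub_left (hG _) hA ((hG _).sub (hG _)),
    h.pairInteg_sub_right (hG _) (hG _) (hG _), h.pairInteg_sub_right hA (hG _) (hG _), h1]
  unfold pairing
  ring

theorem abs_discrepancy_integrand_le (hlam : 0 ≤ lam) (hT : 1 ≤ T) (hk : 1 < k)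
    (u : Fin (k - 1) → DotSpin d k × DotSpin d k) :
    |(response lam T .colored false (fun j => (u j).1) - allOpen T fun j => (u j).1) *
      (response lam T .colored false (fun j => (u j).2) -
        response lam T .colored true fun j => (u j).2)| ≤
      2 * (nearCount T (fun j => (u j).1) * nearCount T fun j => (u j).2) := by
  have h1 := abs_response_sub_le (fun j => (u j).1) hlam hT hk .colored false
  have h2 := abs_response_sub_le (fun j => (u j).2) hlam hT hk .colored false
  have h3 := abs_response_sub_le (fun j => (u j).2) hlam hT hk .colored true
  have h4 : |response lam T .colored false (fun j => (u j).2) -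
        response lam T .colored true fun j => (u j).2| ≤ 2 * nearCount T fun j => (u j).2 := by
    rw [abs_le] at h2 h3 ⊢
    exact ⟨by linarith, by linarith⟩
  rw [abs_mul, mul_left_comm]
  exact mul_le_mul h1 h4 (abs_nonneg _) (nearCount_nonneg _ _)

theorem abs_discrepancy_le (h : Balanced T K a b τ β q) (hlam : 0 ≤ lam) (hT : 1 ≤ T)
    (hk : 1 < k) :
    |pairing lam T q .colored false .colored false -
      pairing lam T q .colored false .colored true| ≤ 2 * nearBound (k - 1) K b := by
  have hN := bddFn_nearCount (d := d) (k := k) (n := k - 1) (T := T)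
  have hG := fun x => bddFn_response (d := d) (k := k) (T := T) hlam .colored x
  rw [h.pairing_discrepancy hlam hk]
  refine (abs_integ_le (((hG _).sub bddFn_allOpen).pair ((hG _).sub (hG _)))
    ((BddFn.const 2).mul (hN.pair hN)) (fun _ => h.summable) (fun _ => h.nonneg)
    (abs_discrepancy_integrand_le hlam hT hk)).trans ?_
  rw [integ_const_mul]
  exact mul_le_mul_of_nonneg_left h.pairInteg_near_near zero_le_two

theorem abs_discrepancy_sub_le (h : Balanced T K a b τ β q) (h' : Balanced T K a b τ β q')
    (hlam : 0 ≤ lam) (hT : 1 ≤ T) (hk : 1 < k) :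
    |(pairing lam T q .colored false .colored false -
      pairing lam T q .colored false .colored true) -
      (pairing lam T q' .colored false .colored false -
      pairing lam T q' .colored false .colored true)| ≤
      2 * nearLip (k - 1) K b * ∑' p, |q p - q' p| := by
  have hN := bddFn_nearCount (d := d) (k := k) (n := k - 1) (T := T)
  have hG := fun x => bddFn_response (d := d) (k := k) (T := T) hlam .colored x
  rw [h.pairing_discrepancy hlam hk, h'.pairing_discrepancy hlam hk]
  refine (abs_integ_sub_integ_le h.summable h'.summable h.nonneg h'.nonneg
    (((hG _).sub bddFn_allOpen).pair ((hG _).sub (hG _)))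
    ((BddFn.const 2).mul (hN.pair hN)) (abs_discrepancy_integrand_le hlam hT hk)).trans ?_
  simp only [integ_const_mul]
  rw [← Finset.mul_sum, mul_assoc]
  exact mul_le_mul_of_nonneg_left (h.sum_integ_near_near h') zero_le_two

end Balanced

end pairing

-- Sums of products over pairs

section products

variable {α β : Type} {f : α → ℝ} {g : β → ℝ}

theorem summable_prod_mul (hf : Summable f) (hg : Summable g) :
    Summable fun p : α × β => f p.1 * g p.2 := summable_mul_of_summable_norm hf.norm hg.norm

theorem tsum_prod_mul (hf : Summable f) (hg : Summable g) :
    ∑' p : α × β, f p.1 * g p.2 = (∑' a, f a) * ∑' b, g b :=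
  (tsum_mul_tsum_of_summable_norm hf.norm hg.norm).symm

theorem tsum_prod_abs_mul_le (hf : Summable f) (hg : Summable g) {c e : ℝ} (hc : ∑' a, |f a| ≤ c)
    (he : ∑' b, |g b| ≤ e) : ∑' p : α × β, |f p.1 * g p.2| ≤ c * e := by
  simp only [abs_mul]
  rw [tsum_prod_mul (f := fun a => |f a|) (g := fun b => |g b|) hf.abs hg.abs]
  exact mul_le_mul hc he (tsum_nonneg fun _ => abs_nonneg _)
    ((tsum_nonneg fun _ => abs_nonneg _).trans hc)

end products

-- The clause recursion in tested ℓ¹ norms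

section clauseOut

variable {d k : ℕ} {T : ℕ∞} {K a b τ β lam : ℝ} {q q' : DotSpin d k × DotSpin d k → ℝ}

/-- The unnormalized output of the clause recursion, with the literals averaged out. -/
def clauseOut (lam : ℝ) (T : ℕ∞) (q : DotSpin d k × DotSpin d k → ℝ)
    (s : HatSpin d k × HatSpin d k) : ℝ :=
  integ (fun u : Fin (k - 1) → _ => clauseWeight lam T s.1 (fun i => (u i).1) *
    clauseWeight lam T s.2 fun i => (u i).2) fun _ => q

/-- Addition of a literal to both spins of a pair. -/
def addPair (L : Bool) : DotSpin d k × DotSpin d k ≃ DotSpin d k × DotSpin d k :=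
  ⟨fun p => (p.1.add L, p.2.add L), fun p => (p.1.add L, p.2.add L),
    fun p => by simp only [DotSpin.add_add], fun p => by simp only [DotSpin.add_add]⟩

theorem apply_addPair (hq : ∀ p, q (p.1.add true, p.2.add true) = q p) (L : Bool)
    (p : DotSpin d k × DotSpin d k) : q (addPair L p) = q p := by
  cases L
  · simp [addPair, DotSpin.add_false]
  · exact hq p

theorem integ_addPair {n : ℕ} (hq : ∀ p, q (p.1.add true, p.2.add true) = q p) (L : Fin n → Bool)
    (Φ : (Fin n → DotSpin d k × DotSpin d k) → ℝ) :
    integ (fun u => Φ fun i => addPair (L i) (u i)) (fun _ => q) = integ Φ fun _ => q := by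
  unfold integ
  rw [← (Equiv.piCongrRight fun i => addPair (L i)).tsum_eq fun u => Φ u * ∏ i, q (u i)]
  refine tsum_congr fun u => ?_
  simp only [Equiv.piCongrRight_apply, Pi.map_apply, apply_addPair hq]
  rfl

theorem clauseWeight_add (hk : 1 < k) (L : Bool) (s : HatSpin d k) (u : Fin (k - 1) → DotSpin d k) :
    clauseWeight lam T (s.add L) u = clauseWeight lam T s fun i => (u i).add L := by
  cases L
  · simp only [HatSpin.add_false, DotSpin.add_false]
  · rw [← clauseWeight_flip lam T s _ hk]
    simp only [DotSpin.add_add]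

theorem clauseOut_add (hk : 1 < k) (hq : ∀ p, q (p.1.add true, p.2.add true) = q p) (L : Bool)
    (s : HatSpin d k × HatSpin d k) :
    clauseOut lam T q (s.1.add L, s.2.add L) = clauseOut lam T q s := by
  unfold clauseOut
  rw [← integ_addPair hq (fun _ => L) fun u => clauseWeight lam T s.1 (fun i => (u i).1) *
    clauseWeight lam T s.2 fun i => (u i).2]
  simp only [clauseWeight_add hk]
  rfl

/-- As `q` is invariant under negating both spins of a pair, the literal on each incoming edge is
absorbed by a change of variables, and the outgoing literal by the symmetry of the clause weight.
All literal patterns contribute equally, so the average is trivial. -/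
theorem clauseBP_eq (hk : 1 < k) (hq : ∀ p, q (p.1.add true, p.2.add true) = q p) :
    clauseBP lam T q = normalize (clauseOut lam T q) := by
  unfold clauseBP
  congr 1
  funext s
  have h : ∀ L : Fin (k - 1 + 1) → Bool, (∑' u : Fin (k - 1) → DotSpin d k × DotSpin d k,
      clauseWeight lam T (s.1.add (L 0)) (fun i => (u i).1.add (L i.succ)) *
        clauseWeight lam T (s.2.add (L 0)) (fun i => (u i).2.add (L i.succ)) *
          ∏ i, q (u i)) = clauseOut lam T q s := fun L => by
    rw [← clauseOut_add hk hq (L 0)]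
    exact integ_addPair hq (fun i => L i.succ) fun u =>
      clauseWeight lam T (s.1.add (L 0)) (fun i => (u i).1) *
        clauseWeight lam T (s.2.add (L 0)) fun i => (u i).2
  simp only [h, Finset.sum_const, Finset.card_univ, Fintype.card_fun, Fintype.card_bool,
    Fintype.card_fin, nsmul_eq_mul]
  push_cast
  field_simp

theorem clauseOut_nonneg (hlam : 0 ≤ lam) (hq : ∀ p, 0 ≤ q p) (s : HatSpin d k × HatSpin d k) :
    0 ≤ clauseOut lam T q s :=
  integ_nonneg (fun _ => mul_nonneg (clauseWeight_nonneg hlam _ _) (clauseWeight_nonneg hlam _ _))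
    fun _ => hq

theorem summable_clauseOut (hlam : 0 ≤ lam) (hq : Summable q) :
    Summable (clauseOut lam T q) := by
  have hw := fun u : Fin (k - 1) → DotSpin d k => summable_clauseWeight (T := T) hlam u
  have hc : ∀ u : Fin (k - 1) → DotSpin d k, ∑' s, |clauseWeight lam T s u| ≤ 4 + 2 ^ lam :=
    fun u => by simpa only [abs_of_nonneg (clauseWeight_nonneg hlam _ u)] using (hw u).2
  have hK : ∀ u : Fin (k - 1) → DotSpin d k × DotSpin d k,
      Summable fun s : HatSpin d k × HatSpin d k =>
        clauseWeight lam T s.1 (fun i => (u i).1) * clauseWeight lam T s.2 fun i => (u i).2 :=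
    fun u => summable_prod_mul (f := fun s => clauseWeight lam T s fun i => (u i).1)
      (g := fun s => clauseWeight lam T s fun i => (u i).2)
      (hw fun i => (u i).1).1 (hw fun i => (u i).2).1
  have hB : ∀ u : Fin (k - 1) → DotSpin d k × DotSpin d k,
      ∑' s : HatSpin d k × HatSpin d k, |clauseWeight lam T s.1 (fun i => (u i).1) *
        clauseWeight lam T s.2 fun i => (u i).2| ≤ (4 + 2 ^ lam) * (4 + 2 ^ lam) :=
    fun u => tsum_prod_abs_mul_le (f := fun s => clauseWeight lam T s fun i => (u i).1)
      (g := fun s => clauseWeight lam T s fun i => (u i).2)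
      (hw fun i => (u i).1).1 (hw fun i => (u i).2).1 (hc fun i => (u i).1) (hc fun i => (u i).2)
  have hν : Summable fun u : Fin (k - 1) → DotSpin d k × DotSpin d k =>
      (4 + 2 ^ lam) * (4 + 2 ^ lam) * |∏ i, q (u i)| :=
    (summable_pi_prod (n := k - 1) fun _ => hq).abs.mul_left _
  exact summable_tsum_kernel hK hB hν

theorem tsum_test_clauseOut (hlam : 0 ≤ lam) (hq : Summable q) (κ : TestKind) (x : Bool)
    (κ' : TestKind) (y : Bool) :
    ∑' s : HatSpin d k × HatSpin d k, test lam κ x s.1 * test lam κ' y s.2 *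
      clauseOut lam T q s = pairing lam T q κ x κ' y := by
  have hw := fun κ x (u : Fin (k - 1) → DotSpin d k) =>
    summable_response_kernel (T := T) hlam κ x u
  have hc : ∀ κ x (u : Fin (k - 1) → DotSpin d k),
      ∑' s, |clauseWeight lam T s u * test lam κ x s| ≤ 1 := fun κ x u => by
    simp only [abs_of_nonneg (mul_nonneg (clauseWeight_nonneg hlam _ u)
      (test_mem_unit hlam κ x _).1)]
    exact response_le_one (T := T) hlam κ x u
  have h := tsum_tsum_kernel
    (K := fun u (s : HatSpin d k × HatSpin d k) =>
      (clauseWeight lam T s.1 (fun i => (u i).1) * test lam κ x s.1) *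
      (clauseWeight lam T s.2 (fun i => (u i).2) * test lam κ' y s.2))
    (ν := fun u : Fin (k - 1) → DotSpin d k × DotSpin d k => ∏ i, q (u i)) (B := fun _ => 1 * 1)
    (fun u => summable_prod_mul (hw κ x fun i => (u i).1) (hw κ' y fun i => (u i).2))
    (fun u => tsum_prod_abs_mul_le (hw κ x fun i => (u i).1) (hw κ' y fun i => (u i).2)
      (hc κ x fun i => (u i).1) (hc κ' y fun i => (u i).2))
    ((summable_pi_prod (n := k - 1) fun _ => hq).abs.mul_left _)
  calc _ = _ := tsum_congr fun s => by
        rw [clauseOut, integ, ← tsum_mul_left]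
        exact tsum_congr fun u => by ring
    _ = _ := h
    _ = _ := by
        unfold pairing pairInteg integ
        refine tsum_congr fun u => ?_
        rw [tsum_prod_mul (hw κ x fun i => (u i).1) (hw κ' y fun i => (u i).2)]
        rfl

/-- The part of the tested clause weight that is common to all but exceptional configurations. -/
def mainPart (κ : TestKind) (x : Bool) (s : HatSpin d k) : ℝ := ind (s = mainSpin κ x)

/-- The deviation of the tested clause weight from its main part. -/
def residual (lam : ℝ) (T : ℕ∞) (κ : TestKind) (x : Bool) (u : Fin (k - 1) → DotSpin d k)
    (s : HatSpin d k) : ℝ :=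
  clauseWeight lam T s u * test lam κ x s - allOpen T u * mainPart κ x s

theorem hasSum_mainPart (κ : TestKind) (x : Bool) :
    HasSum (mainPart κ x : HatSpin d k → ℝ) 1 := by
  have := hasSum_single (f := (mainPart κ x : HatSpin d k → ℝ)) (mainSpin κ x)
    fun s hs => ind_of_not hs
  rwa [show mainPart κ x (mainSpin κ x : HatSpin d k) = 1 from ind_of rfl] at this

theorem tsum_abs_mainPart_le (κ : TestKind) (x : Bool) :
    ∑' s : HatSpin d k, |mainPart κ x s| ≤ 1 := by
  have h : ∀ s : HatSpin d k, |mainPart κ x s| = mainPart κ x s := fun s =>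
    abs_of_nonneg (ind_mem_unit _).1
  simp only [h]
  exact (hasSum_mainPart κ x).tsum_eq.le

theorem residual_spec (hlam : 0 ≤ lam) (hT : 1 ≤ T) (hk : 1 < k) (κ : TestKind) (x : Bool)
    (u : Fin (k - 1) → DotSpin d k) : Summable (residual lam T κ x u) ∧
      ∑' s, |residual lam T κ x u s| ≤ 2 * nearCount T u :=
  tsum_abs_clauseWeight_sub_le u hlam hT hk κ x

theorem bddFn_residual (hlam : 0 ≤ lam) (hT : 1 ≤ T) (hk : 1 < k) (κ : TestKind) (x : Bool)
    (s : HatSpin d k) : BddFn fun u => residual lam T κ x u s := by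
  obtain ⟨c, hc⟩ := bddFn_nearCount (d := d) (k := k) (n := k - 1) (T := T)
  refine ⟨2 * c, fun u => ?_⟩
  have h := residual_spec hlam hT hk κ x u
  have h2 := (h.1.abs.le_tsum s fun _ _ => abs_nonneg _).trans h.2
  have h3 := (abs_le.1 (hc u)).2
  exact h2.trans (by linarith)

/-- The deviation of the product of two tested clause weights from its main part. -/
def residualPair (lam : ℝ) (T : ℕ∞) (κ : TestKind) (x : Bool) (κ' : TestKind) (y : Bool)
    (u v : Fin (k - 1) → DotSpin d k) (s : HatSpin d k × HatSpin d k) : ℝ :=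
  allOpen T u * (mainPart κ x s.1 * residual lam T κ' y v s.2) +
    allOpen T v * (residual lam T κ x u s.1 * mainPart κ' y s.2) +
    residual lam T κ x u s.1 * residual lam T κ' y v s.2

/-- The total deviation allowed for `residualPair`. -/
def residualBound (T : ℕ∞) {n : ℕ} (u v : Fin n → DotSpin d k) : ℝ :=
  2 * (allOpen T u * nearCount T v) + 2 * (nearCount T u * allOpen T v) +
    4 * (nearCount T u * nearCount T v)

theorem residualBound_nonneg {n : ℕ} (u v : Fin n → DotSpin d k) : 0 ≤ residualBound T u v := by
  have a1 := (allOpen_mem_unit (T := T) u).1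
  have a2 := (allOpen_mem_unit (T := T) v).1
  have n1 := nearCount_nonneg T u
  have n2 := nearCount_nonneg T v
  unfold residualBound
  positivity

theorem residualPair_spec (hlam : 0 ≤ lam) (hT : 1 ≤ T) (hk : 1 < k) (κ : TestKind) (x : Bool)
    (κ' : TestKind) (y : Bool) (u v : Fin (k - 1) → DotSpin d k) :
    Summable (residualPair lam T κ x κ' y u v) ∧
      ∑' s, |residualPair lam T κ x κ' y u v s| ≤ residualBound T u v := by
  have hu := residual_spec (lam := lam) hlam hT hk κ x u
  have hv := residual_spec (lam := lam) hlam hT hk κ' y v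
  have hm := hasSum_mainPart (d := d) (k := k) κ x
  have hm' := hasSum_mainPart (d := d) (k := k) κ' y
  have s1 := summable_prod_mul hm.summable hv.1
  have s2 := summable_prod_mul hu.1 hm'.summable
  have s3 := summable_prod_mul hu.1 hv.1
  have b1 := tsum_prod_abs_mul_le hm.summable hv.1 (tsum_abs_mainPart_le κ x) hv.2
  have b2 := tsum_prod_abs_mul_le hu.1 hm'.summable hu.2 (tsum_abs_mainPart_le κ' y)
  have b3 := tsum_prod_abs_mul_le hu.1 hv.1 hu.2 hv.2
  have a1 := (allOpen_mem_unit (T := T) u).1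
  have a2 := (allOpen_mem_unit (T := T) v).1
  have hs : Summable (residualPair lam T κ x κ' y u v) :=
    ((s1.mul_left (allOpen T u)).add (s2.mul_left (allOpen T v))).add s3
  refine ⟨hs, ?_⟩
  have t1 := s1.abs.mul_left (allOpen T u)
  have t2 := s2.abs.mul_left (allOpen T v)
  have t3 := s3.abs
  refine (Summable.tsum_le_tsum (fun s => ?_) hs.abs ((t1.add t2).add t3)).trans ?_
  · refine (abs_add_three _ _ _).trans ?_
    rw [abs_mul (allOpen T u), abs_mul (allOpen T v), abs_of_nonneg a1, abs_of_nonneg a2]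
  · rw [(t1.add t2).tsum_add t3, t1.tsum_add t2, tsum_mul_left, tsum_mul_left]
    have c1 := mul_le_mul_of_nonneg_left b1 a1
    have c2 := mul_le_mul_of_nonneg_left b2 a2
    refine (add_le_add (add_le_add c1 c2) b3).trans (le_of_eq ?_)
    unfold residualBound
    ring

theorem bddFn_residualPair (hlam : 0 ≤ lam) (hT : 1 ≤ T) (hk : 1 < k) (κ : TestKind) (x : Bool)
    (κ' : TestKind) (y : Bool) (s : HatSpin d k × HatSpin d k) :
    BddFn fun u : Fin (k - 1) → DotSpin d k × DotSpin d k =>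
      residualPair lam T κ x κ' y (fun j => (u j).1) (fun j => (u j).2) s := by
  have hA := bddFn_allOpen (d := d) (k := k) (n := k - 1) (T := T)
  have h1 := bddFn_residual (d := d) (lam := lam) hlam hT hk κ x s.1
  have h2 := bddFn_residual (d := d) (lam := lam) hlam hT hk κ' y s.2
  have c1 := (BddFn.const (mainPart κ x s.1)).mul (hA.pair h2)
  have c2 := (BddFn.const (mainPart κ' y s.2)).mul (h1.pair hA)
  obtain ⟨c, hc⟩ := (c1.add c2).add (h1.pair h2)
  refine ⟨c, fun u => le_trans (le_of_eq ?_) (hc u)⟩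
  unfold residualPair
  congr 1
  ring

/-- Expanding each tested weight into main part plus residual, the main-main term is constant in the
incoming spins up to `allOpen`, hence integrates to a value independent of `q`. All dependence on
`q` sits in the residual. -/
theorem Balanced.test_mul_clauseOut (h : Balanced T K a b τ β q) (hlam : 0 ≤ lam) (hT : 1 ≤ T)
    (hk : 1 < k) (κ : TestKind) (x : Bool) (κ' : TestKind) (y : Bool)
    (s : HatSpin d k × HatSpin d k) :
    test lam κ x s.1 * test lam κ' y s.2 * clauseOut lam T q s =
      mainPart κ x s.1 * mainPart κ' y s.2 + integ (fun u : Fin (k - 1) → _ =>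
        residualPair lam T κ x κ' y (fun j => (u j).1) (fun j => (u j).2) s) fun _ => q := by
  have hA := bddFn_allOpen (d := d) (k := k) (n := k - 1) (T := T)
  have h4 := integ_add ((BddFn.const (mainPart κ x s.1 * mainPart κ' y s.2)).mul (hA.pair hA))
    (bddFn_residualPair hlam hT hk κ x κ' y s) (ν := fun _ => q) fun _ => h.summable
  have h5 := integ_const_mul (Φ := fun u : Fin (k - 1) → DotSpin d k × DotSpin d k =>
    allOpen T (fun j => (u j).1) * allOpen T fun j => (u j).2) (ν := fun _ => q)
    (mainPart κ x s.1 * mainPart κ' y s.2)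
  have h6 := h.pairInteg_open_open (n := k - 1)
  unfold pairInteg at h6
  rw [h5, h6, mul_one] at h4
  rw [← h4, clauseOut, ← integ_const_mul]
  congr 1
  funext u
  unfold residualPair residual
  ring

theorem Balanced.sum_integ_residualBound_le (h : Balanced T K a b τ β q)
    (h' : Balanced T K a b τ β q') {n : ℕ} :
    ∑ l : Fin n, integ (fun u => residualBound T (fun j => (u j).1) fun j => (u j).2)
      (hybrid q q' l) ≤ (4 * openLip n K a + 4 * nearLip n K b) * ∑' p, |q p - q' p| := by
  have hA := bddFn_allOpen (d := d) (k := k) (n := n) (T := T)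
  have hN := bddFn_nearCount (d := d) (k := k) (n := n) (T := T)
  have e1 : ∀ l, integ (fun u => residualBound T (fun j => (u j).1) fun j => (u j).2)
      (hybrid q q' l) =
      2 * integ (fun u => allOpen T (fun j => (u j).1) * nearCount T fun j => (u j).2)
        (hybrid q q' l) +
      2 * integ (fun u => nearCount T (fun j => (u j).1) * allOpen T fun j => (u j).2)
        (hybrid q q' l) +
      4 * integ (fun u => nearCount T (fun j => (u j).1) * nearCount T fun j => (u j).2)
        (hybrid q q' l) := fun l => by
    have hs := hybrid_summable (n := n) h.summable h'.summable l
    have j1 := integ_add (((BddFn.const 2).mul (hA.pair hN)).add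
      ((BddFn.const 2).mul (hN.pair hA))) ((BddFn.const 4).mul (hN.pair hN)) hs
    have j2 := integ_add ((BddFn.const 2).mul (hA.pair hN))
      ((BddFn.const 2).mul (hN.pair hA)) hs
    rw [← integ_const_mul, ← integ_const_mul, ← integ_const_mul, ← j2, ← j1]
    rfl
  have i1 := h.sum_integ_open_near h' (n := n)
  have i2 := h.sum_integ_near_open h' (n := n)
  have i3 := h.sum_integ_near_near h' (n := n)
  simp only [e1, Finset.sum_add_distrib, ← Finset.mul_sum]
  linarith

/-- The main parts of the two outputs coincide and drop out. The residuals are telescoped coordinate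
by coordinate, each hybrid term carrying an exceptional-tuple factor. -/
theorem Balanced.tsum_abs_clauseOut_sub_le (h : Balanced T K a b τ β q)
    (h' : Balanced T K a b τ β q') (hlam : 0 ≤ lam) (hT : 1 ≤ T) (hk : 1 < k) (κ : TestKind)
    (x : Bool) (κ' : TestKind) (y : Bool) :
    ∑' s : HatSpin d k × HatSpin d k, test lam κ x s.1 * test lam κ' y s.2 *
      |clauseOut lam T q s - clauseOut lam T q' s| ≤
      (4 * openLip (k - 1) K a + 4 * nearLip (k - 1) K b) * ∑' p, |q p - q' p| := by
  have hA := bddFn_allOpen (d := d) (k := k) (n := k - 1) (T := T)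
  have hN := bddFn_nearCount (d := d) (k := k) (n := k - 1) (T := T)
  have hB : BddFn fun u : Fin (k - 1) → DotSpin d k × DotSpin d k =>
      residualBound T (fun j => (u j).1) fun j => (u j).2 :=
    (((BddFn.const 2).mul (hA.pair hN)).add
      ((BddFn.const 2).mul (hN.pair hA))).add ((BddFn.const 4).mul (hN.pair hN))
  have hν := tsum_abs_prod_sub_le h.summable h'.summable h.nonneg h'.nonneg hB
    fun u => residualBound_nonneg _ _
  have hk1 := tsum_abs_kernel_le
    (K := fun (u : Fin (k - 1) → DotSpin d k × DotSpin d k) s =>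
      residualPair lam T κ x κ' y (fun j => (u j).1) (fun j => (u j).2) s)
    (ν := fun u => ∏ i, q (u i) - ∏ i, q' (u i))
    (fun u => (residualPair_spec hlam hT hk κ x κ' y _ _).1)
    (fun u => (residualPair_spec hlam hT hk κ x κ' y _ _).2) hν.1
  refine le_trans (le_of_eq (tsum_congr fun s => ?_))
    (hk1.trans (hν.2.trans (h.sum_integ_residualBound_le h')))
  have hE := bddFn_residualPair (d := d) (lam := lam) hlam hT hk κ x κ' y s
  have h0 : 0 ≤ test lam κ x s.1 * test lam κ' y s.2 :=
    mul_nonneg (test_mem_unit hlam _ _ _).1 (test_mem_unit hlam _ _ _).1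
  have h1 : test lam κ x s.1 * test lam κ' y s.2 *
      |clauseOut lam T q s - clauseOut lam T q' s| =
      |test lam κ x s.1 * test lam κ' y s.2 * (clauseOut lam T q s - clauseOut lam T q' s)| := by
    rw [abs_mul, abs_of_nonneg h0]
  rw [h1, mul_sub, h.test_mul_clauseOut hlam hT hk, h'.test_mul_clauseOut hlam hT hk]
  congr 1
  simp only [mul_sub]
  rw [(summable_integ hE fun _ => h.summable).tsum_sub (summable_integ hE fun _ => h'.summable),
    add_sub_add_left_eq_sub]
  rfl

end clauseOut

-- Variable weights in terms of test functions

section variableWeight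

variable {d k : ℕ} {lam : ℝ} {T : ℕ∞}

theorem Color.VarValid.flip {c : Fin (d - 1 + 1) → Color d k} (h : VarValid c) :
    VarValid fun i => (c i).flip := by
  rcases h with ⟨x, ⟨i, hi⟩, hx⟩ | ⟨t, ht, hj⟩
  · refine Or.inl ⟨!x, ⟨i, ?_⟩, fun i => ?_⟩
    · simp only [hi, flip_eq_red_iff, Bool.not_not]
    · simpa only [flip_eq_red_iff, flip_eq_blue_iff, Bool.not_not] using hx i
  · refine Or.inr ⟨fun i => (⟨(t i).1.1.neg, (t i).1.2.neg⟩, ⟨(t i).2.1.neg, (t i).2.2.neg⟩),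
      fun i => ?_, fun i => ?_⟩
    · simp only [ht i]; rfl
    · simp only [hj i, Msg.neg_join]

theorem VarCompat.flip {s : DotSpin d k} {u : Fin (d - 1) → HatSpin d k} (h : VarCompat T s u) :
    VarCompat T (s.add true) fun i => (u i).add true := by
  obtain ⟨c, hv, hT, h0, hu⟩ := h
  refine ⟨fun i => (c i).flip, hv.flip, fun i => by rw [Color.size_flip]; exact hT i, ?_,
    fun j => ?_⟩
  · rw [Color.dot_flip, h0]
  · rw [Color.hat_flip, hu]

theorem VarCompat.flip_iff {s : DotSpin d k} {u : Fin (d - 1) → HatSpin d k} :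
    VarCompat T (s.add true) (fun i => (u i).add true) ↔ VarCompat T s u := by
  refine ⟨fun h => ?_, fun h => h.flip⟩
  have := h.flip
  simpa only [DotSpin.add_add, HatSpin.add_add] using this

theorem varWeight_flip (s : DotSpin d k) (u : Fin (d - 1) → HatSpin d k) :
    varWeight lam T (s.add true) (fun i => (u i).add true) = varWeight lam T s u := by
  rw [varWeight.eq_def, varWeight.eq_def]
  by_cases h : VarCompat T s u
  · rw [if_pos h, if_pos (VarCompat.flip_iff.2 h)]
    cases s with
    | red x => rfl
    | blue x => rfl
    | free t =>
      change (t.1.neg.norm .var) ^ lam = _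
      rw [t.2.norm_neg]
  · rw [if_neg h, if_neg (mt VarCompat.flip_iff.1 h)]

theorem VarCompat.of_weight_ne {s : DotSpin d k} {u : Fin (d - 1) → HatSpin d k}
    (h : varWeight lam T s u ≠ 0) : VarCompat T s u := by
  by_contra hc
  rw [varWeight.eq_def, if_neg hc] at h
  exact h rfl

theorem VarCompat.trunc {s : DotSpin d k} {u : Fin (d - 1) → HatSpin d k}
    (h : VarCompat T s u) : s.Trunc T := by
  obtain ⟨c, -, hT, h0, -⟩ := h
  exact ⟨c 0, hT 0, h0⟩

/-- A color with given second component, for red and blue spins. -/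
def HatSpin.color : HatSpin d k → Color d k
  | .red x => .red x
  | .blue x => .blue x
  | .free _ => .red true

theorem VarCompat.red_iff {x : Bool} {u : Fin (d - 1) → HatSpin d k} :
    VarCompat T (.red x) u ↔ ∀ j, u j = .red x ∨ u j = .blue x := by
  constructor
  · rintro ⟨c, hv, -, h0, hu⟩ j
    have h0' := Color.dot_eq_red h0
    rcases hv with ⟨y, -, hy⟩ | ⟨t, ht, -⟩
    · have hxy : y = x := by
        rcases hy 0 with h | h <;> rw [h0'] at h <;> cases h
        rfl
      subst hxy
      rw [← hu j]
      rcases hy j.succ with h | h <;> rw [h] <;> simp [Color.hat, Spin.map]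
    · have := (ht 0).symm.trans h0'
      cases this
  · intro h
    refine ⟨Fin.cons (.red x) fun j => (u j).color, Or.inl ⟨x, ⟨0, rfl⟩, fun i => ?_⟩, fun i => ?_,
      rfl, fun j => ?_⟩
    · refine Fin.cases (Or.inl rfl) (fun j => ?_) i
      rcases h j with h | h <;> simp [h, HatSpin.color]
    · refine Fin.cases zero_le (fun j => ?_) i
      rcases h j with h | h <;> simp [h, HatSpin.color, Color.size]
    · rcases h j with h | h <;> simp [h, HatSpin.color, Color.hat, Spin.map]

theorem VarCompat.blue_iff {x : Bool} {u : Fin (d - 1) → HatSpin d k} :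
    VarCompat T (.blue x) u ↔ (∀ j, u j = .red x ∨ u j = .blue x) ∧ ∃ j, u j = .red x := by
  constructor
  · rintro ⟨c, hv, -, h0, hu⟩
    have h0' := Color.dot_eq_blue h0
    rcases hv with ⟨y, ⟨i, hi⟩, hy⟩ | ⟨t, ht, -⟩
    · have hxy : y = x := by
        rcases hy 0 with h | h <;> rw [h0'] at h <;> cases h
        rfl
      subst hxy
      refine ⟨fun j => ?_, ?_⟩
      · rw [← hu j]
        rcases hy j.succ with h | h <;> rw [h] <;> simp [Color.hat, Spin.map]
      · revert hi
        refine Fin.cases (fun hi => ?_) (fun j hj => ⟨j, ?_⟩) i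
        · rw [h0'] at hi; cases hi
        · rw [← hu j, hj]; rfl
    · have := (ht 0).symm.trans h0'
      cases this
  · rintro ⟨h, j, hj⟩
    refine ⟨Fin.cons (.blue x) fun j => (u j).color, Or.inl ⟨x, ⟨j.succ, ?_⟩, fun i => ?_⟩,
      fun i => ?_, rfl, fun j => ?_⟩
    · simp [hj, HatSpin.color]
    · refine Fin.cases (Or.inr rfl) (fun j => ?_) i
      rcases h j with h | h <;> simp [h, HatSpin.color]
    · refine Fin.cases zero_le (fun j => ?_) i
      rcases h j with h | h <;> simp [h, HatSpin.color, Color.size]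
    · rcases h j with h | h <;> simp [h, HatSpin.color, Color.hat, Spin.map]

theorem VarCompat.free {t : VarTree d k} {u : Fin (d - 1) → HatSpin d k}
    (h : VarCompat T (.free t) u) :
    ∃ r : Fin (d - 1) → ClsTree d k, (∀ j, u j = .free (r j)) ∧
      t.1 = Msg.join fun j => (r j).1 := by
  obtain ⟨c, hv, -, h0, hu⟩ := h
  obtain ⟨t', h0'⟩ := Color.dot_eq_free h0
  rcases hv with ⟨y, -, hy⟩ | ⟨r, hr, hj⟩
  · rcases hy 0 with h | h <;> rw [h0'] at h <;> cases h
  · refine ⟨fun j => (r j.succ).2, fun j => ?_, ?_⟩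
    · rw [← hu j, hr]; rfl
    · have h1 := hj 0
      rw [hr 0] at h0
      cases h0
      simpa only [Fin.succAbove_zero] using h1

theorem prod_test_colored (x : Bool) {n : ℕ} (u : Fin n → HatSpin d k) :
    ∏ j, test lam .colored x (u j) = ind (∀ j, u j = .red x ∨ u j = .blue x) := by
  rw [← prod_ind]
  refine Finset.prod_congr rfl fun j _ => ?_
  rcases u j with y | y | t <;> simp [test, ind]

theorem prod_test_blue (x : Bool) {n : ℕ} (u : Fin n → HatSpin d k) :
    ∏ j, test lam .blue x (u j) = ind (∀ j, u j = .blue x) := by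
  rw [← prod_ind]
  refine Finset.prod_congr rfl fun j _ => ?_
  rcases u j with y | y | t <;> simp [test, ind]

theorem varWeight_red (x : Bool) (u : Fin (d - 1) → HatSpin d k) :
    varWeight lam T (.red x) u = ∏ j, test lam .colored x (u j) := by
  rw [prod_test_colored, varWeight.eq_def, VarCompat.red_iff]
  rfl

/-- An outgoing `blue x` needs a `red x` among the other edges, so the tuples that are entirely
`blue x` are removed from the colored ones. -/
theorem varWeight_blue (x : Bool) (u : Fin (d - 1) → HatSpin d k) :
    varWeight lam T (.blue x) u =
      ∏ j, test lam .colored x (u j) - ∏ j, test lam .blue x (u j) := by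
  rw [prod_test_colored, prod_test_blue, varWeight.eq_def, VarCompat.blue_iff]
  by_cases h1 : ∀ j, u j = .red x ∨ u j = .blue x
  · by_cases h2 : ∀ j, u j = .blue x
    · rw [ind_of h1, ind_of h2, if_neg, sub_self]
      rintro ⟨-, j, hj⟩
      rw [h2 j] at hj
      cases hj
    · rw [ind_of h1, ind_of_not h2, if_pos, sub_zero]
      refine ⟨h1, ?_⟩
      push Not at h2
      obtain ⟨j, hj⟩ := h2
      exact ⟨j, (h1 j).resolve_right hj⟩
  · rw [if_neg fun h => h1 h.1, ind_of_not h1, ind_of_not fun h => h1 fun j => Or.inr (h j),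
      sub_self]

theorem prod_test_mem_unit (hlam : 0 ≤ lam) (κ : TestKind) (x : Bool) {n : ℕ}
    (u : Fin n → HatSpin d k) :
    0 ≤ ∏ j, test lam κ x (u j) ∧ ∏ j, test lam κ x (u j) ≤ 1 :=
  ⟨Finset.prod_nonneg fun _ _ => (test_mem_unit hlam _ _ _).1,
    Finset.prod_le_one (fun _ _ => (test_mem_unit hlam _ _ _).1) fun _ _ =>
      (test_mem_unit hlam _ _ _).2⟩

theorem FreeVar.norm_nonneg {m : Msg} (h : FreeVar d k m) : 0 ≤ m.norm .var := by
  cases h with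
  | join s h =>
    rw [Msg.norm_var_join]
    exact add_nonneg (Finset.prod_nonneg fun i _ => ((s i).prob_mem_unit .cls).1)
      (Finset.prod_nonneg fun i _ => sub_nonneg.2 ((s i).prob_mem_unit .cls).2)

theorem varWeight_nonneg (s : DotSpin d k) (u : Fin (d - 1) → HatSpin d k) :
    0 ≤ varWeight lam T s u := by
  rw [varWeight.eq_def]
  split_ifs
  · rcases s with x | x | t
    · exact zero_le_one
    · exact zero_le_one
    · exact Real.rpow_nonneg t.2.norm_nonneg _
  · exact le_rfl

/-- The normalizing constant is a sum of two products, and for `lam ≤ 1` the power is subadditive.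
The bound thus splits into products of one-edge test functions, which can be integrated edge by
edge. -/
theorem varWeight_free_le (hlam : 0 ≤ lam) (hlam1 : lam ≤ 1) (t : VarTree d k)
    (u : Fin (d - 1) → HatSpin d k) :
    varWeight lam T (.free t) u ≤
      ∏ j, test lam .free true (u j) + ∏ j, test lam .free false (u j) := by
  by_cases h : VarCompat T (.free t) u
  · obtain ⟨r, hr, ht⟩ := h.free
    rw [varWeight.eq_def, if_pos h]
    change (t.1.norm .var) ^ lam ≤ _
    rw [ht, Msg.norm_var_join]
    refine (Real.rpow_add_le_add_rpow (Finset.prod_nonneg fun j _ => ((r j).1.prob_mem_unit .cls).1)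
      (Finset.prod_nonneg fun j _ => sub_nonneg.2 ((r j).1.prob_mem_unit .cls).2)
      hlam hlam1).trans (le_of_eq ?_)
    rw [← Real.finsetProd_rpow _ _ fun j _ => ((r j).1.prob_mem_unit .cls).1,
      ← Real.finsetProd_rpow _ _ fun j _ => sub_nonneg.2 ((r j).1.prob_mem_unit .cls).2]
    congr 1 <;> refine Finset.prod_congr rfl fun j _ => ?_ <;> rw [hr j] <;> rfl
  · rw [varWeight.eq_def, if_neg h]
    exact add_nonneg (prod_test_mem_unit hlam _ _ u).1 (prod_test_mem_unit hlam _ _ u).1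

theorem summable_varWeight_free (hlam : 0 ≤ lam) (hlam1 : lam ≤ 1)
    (u : Fin (d - 1) → HatSpin d k) :
    (Summable fun t => varWeight lam T (.free t) u) ∧
      ∑' t, varWeight lam T (.free t) u ≤
        ∏ j, test lam .free true (u j) + ∏ j, test lam .free false (u j) := by
  have := hasSum_of_support_unique (f := fun t => varWeight lam T (.free t) u)
    (add_nonneg (prod_test_mem_unit hlam .free true u).1 (prod_test_mem_unit hlam .free false u).1)
    (fun a b ha hb => ?_) fun t => ⟨varWeight_nonneg _ _, varWeight_free_le hlam hlam1 t u⟩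
  · exact ⟨this.1, this.2.2.1⟩
  · obtain ⟨r, hr, h1⟩ := (VarCompat.of_weight_ne ha).free
    obtain ⟨r', hr', h2⟩ := (VarCompat.of_weight_ne hb).free
    have : r = r' := funext fun j => by
      exact Spin.free.inj ((hr j).symm.trans (hr' j))
    exact Subtype.ext (h1.trans (by rw [this, h2]))

/-- The indicator that a spin is `red x` or `blue x`. -/
def hue (x : Bool) (s : DotSpin d k) : ℝ := ind (s = .red x ∨ s = .blue x)

/-- The part of the variable weight carried by colored incoming spins. -/
def varMain (lam : ℝ) (s : DotSpin d k) (u : Fin (d - 1) → HatSpin d k) : ℝ :=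
  ∑ x, hue x s * ∏ j, test lam .colored x (u j)

/-- The remaining part of the variable weight. -/
def varRest (lam : ℝ) (T : ℕ∞) (s : DotSpin d k) (u : Fin (d - 1) → HatSpin d k) : ℝ :=
  varWeight lam T s u - varMain lam s u

theorem hue_red (x y : Bool) : hue x (.red y : DotSpin d k) = ind (y = x) :=
  ind_congr (by simp)

theorem hue_blue (x y : Bool) : hue x (.blue y : DotSpin d k) = ind (y = x) :=
  ind_congr (by simp)

theorem hue_free (x : Bool) (t : VarTree d k) : hue x (.free t : DotSpin d k) = 0 :=
  ind_of_not (by simp)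

theorem hasSum_hue (x : Bool) : HasSum (hue x : DotSpin d k → ℝ) 2 := by
  have h0 : HasSum (fun t => hue x (.free t : DotSpin d k)) 0 := by
    simp only [hue_free]; exact hasSum_zero
  have := Spin.hasSum (f := (hue x : DotSpin d k → ℝ)) h0
  convert this using 1
  cases x <;> norm_num [hue_red, hue_blue, ind]

theorem varRest_red (x : Bool) (u : Fin (d - 1) → HatSpin d k) : varRest lam T (.red x) u = 0 := by
  rw [varRest, varMain, varWeight_red]
  cases x <;> simp [hue_red, ind]

theorem varRest_blue (x : Bool) (u : Fin (d - 1) → HatSpin d k) :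
    varRest lam T (.blue x) u = - ∏ j, test lam .blue x (u j) := by
  rw [varRest, varMain, varWeight_blue]
  cases x <;> simp [hue_blue, ind]

theorem varRest_free (t : VarTree d k) (u : Fin (d - 1) → HatSpin d k) :
    varRest lam T (.free t) u = varWeight lam T (.free t) u := by
  rw [varRest, varMain]
  simp [hue_free]

theorem varMain_spec (hlam : 0 ≤ lam) (u : Fin (d - 1) → HatSpin d k) :
    (Summable fun s : DotSpin d k => varMain lam s u) ∧
      ∑' s : DotSpin d k, |varMain lam s u| ≤ 2 * ∑ x, ∏ j, test lam .colored x (u j) := by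
  have h : HasSum (fun s : DotSpin d k => varMain lam s u)
      (∑ x, 2 * ∏ j, test lam .colored x (u j)) :=
    hasSum_sum fun x _ => (hasSum_hue x).mul_right _
  refine ⟨h.summable, ?_⟩
  have h0 : ∀ s : DotSpin d k, |varMain lam s u| = varMain lam s u := fun s =>
    abs_of_nonneg (Finset.sum_nonneg fun x _ =>
      mul_nonneg (ind_mem_unit _).1 (prod_test_mem_unit hlam .colored x u).1)
  simp only [h0]
  rw [h.tsum_eq, Finset.mul_sum]

theorem varRest_spec (hlam : 0 ≤ lam) (hlam1 : lam ≤ 1) (u : Fin (d - 1) → HatSpin d k) :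
    (Summable fun s : DotSpin d k => varRest lam T s u) ∧
      ∑' s : DotSpin d k, |varRest lam T s u| ≤
        ∑ x, (∏ j, test lam .blue x (u j) + ∏ j, test lam .free x (u j)) := by
  have h := summable_varWeight_free (T := T) hlam hlam1 u
  have h1 : Summable fun t => varRest lam T (.free t) u := by
    simpa only [varRest_free] using h.1
  refine ⟨Spin.summable (f := fun s => varRest lam T s u) h1, ?_⟩
  rw [Spin.tsum (f := fun s => |varRest lam T s u|) h1.abs]
  simp only [varRest_red, varRest_blue, varRest_free, abs_neg, abs_zero, Finset.sum_const_zero,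
    zero_add, abs_of_nonneg (varWeight_nonneg (lam := lam) (T := T) _ u),
    abs_of_nonneg (prod_test_mem_unit hlam .blue _ u).1, Fintype.sum_bool]
  linarith [h.2]

end variableWeight

-- The variable recursion: colored main part and remainder

section variableOutput

variable {d k : ℕ} {lam : ℝ} {T : ℕ∞} {p p' : HatSpin d k × HatSpin d k → ℝ}

instance : Fintype TestKind :=
  ⟨⟨([TestKind.colored, TestKind.blue, TestKind.free] : List TestKind), by simp⟩, fun κ => by cases κ <;> simp⟩

theorem TestKind.sum_univ (f : TestKind → ℝ) : ∑ κ, f κ = f .colored + (f .blue + f .free) := by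
  change Multiset.sum (Multiset.map f ([TestKind.colored, TestKind.blue, TestKind.free] : List TestKind)) = _
  simp

/-- A pair of test functions. -/
abbrev PairKind : Type := (TestKind × Bool) × (TestKind × Bool)

open Classical in
/-- The pairs of test functions that do not consist of two colored ones. -/
def offMain : Finset PairKind :=
  Finset.univ.filter fun i => ¬ (i.1.1 = .colored ∧ i.2.1 = .colored)

theorem card_offMain_le : (offMain.card : ℝ) ≤ 36 := by
  have h : offMain.card ≤ 36 := by
    refine (Finset.card_le_univ _).trans (le_of_eq ?_)
    rw [Fintype.card_prod, Fintype.card_prod, Fintype.card_bool]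
    rfl
  exact_mod_cast h

theorem mem_offMain {i : PairKind} :
    i ∈ offMain ↔ ¬ (i.1.1 = .colored ∧ i.2.1 = .colored) := by simp [offMain]

theorem blue_mem_offMain : ((.blue, true), (.blue, true)) ∈ offMain := by simp [offMain]

theorem sum_offMain (f g : TestKind → Bool → ℝ) :
    ∑ i ∈ offMain, f i.1.1 i.1.2 * g i.2.1 i.2.2 =
      (∑ x, f .colored x) * (∑ x, (g .blue x + g .free x)) +
      (∑ x, (f .blue x + f .free x)) * (∑ x, g .colored x) +
      (∑ x, (f .blue x + f .free x)) * ∑ x, (g .blue x + g .free x) := by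
  unfold offMain
  rw [Finset.sum_filter, Fintype.sum_prod_type]
  simp only [Fintype.sum_prod_type, TestKind.sum_univ, Fintype.sum_bool]
  simp
  ring

/-- The product test function of a pair. -/
def pairTest (lam : ℝ) (i : PairKind) (s : HatSpin d k × HatSpin d k) : ℝ :=
  test lam i.1.1 i.1.2 s.1 * test lam i.2.1 i.2.2 s.2

theorem pairTest_mem_unit (hlam : 0 ≤ lam) (i : PairKind) (s : HatSpin d k × HatSpin d k) :
    0 ≤ pairTest lam i s ∧ pairTest lam i s ≤ 1 := by
  have h1 := test_mem_unit hlam i.1.1 i.1.2 s.1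
  have h2 := test_mem_unit hlam i.2.1 i.2.2 s.2
  exact ⟨mul_nonneg h1.1 h2.1, mul_le_one₀ h1.2 h2.1 h2.2⟩

theorem bddFn_pairTest (hlam : 0 ≤ lam) (i : PairKind) :
    BddFn (pairTest lam i : HatSpin d k × HatSpin d k → ℝ) :=
  BddFn.of_mem 1 fun s => pairTest_mem_unit hlam i s

/-- The weight that `p` gives to a pair of test functions. -/
def tested (lam : ℝ) (p : HatSpin d k × HatSpin d k → ℝ) (i : PairKind) : ℝ :=
  ∑' s, pairTest lam i s * p s

/-- The unnormalized output of the variable recursion. -/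
def varOut (lam : ℝ) (T : ℕ∞) (p : HatSpin d k × HatSpin d k → ℝ)
    (s : DotSpin d k × DotSpin d k) : ℝ :=
  integ (fun u : Fin (d - 1) → HatSpin d k × HatSpin d k =>
    varWeight lam T s.1 (fun i => (u i).1) * varWeight lam T s.2 fun i => (u i).2) fun _ => p

theorem varBP_eq : varBP lam T p = normalize (varOut lam T p) := rfl

/-- A combination of indicators of pairs of colors. -/
def huePair (v : Bool → Bool → ℝ) (s : DotSpin d k × DotSpin d k) : ℝ :=
  ∑ x, ∑ y, v x y * (hue x s.1 * hue y s.2)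

theorem hasSum_huePair (v : Bool → Bool → ℝ) :
    HasSum (huePair v : DotSpin d k × DotSpin d k → ℝ) (4 * ∑ x, ∑ y, v x y) := by
  have h : ∀ x y, HasSum (fun s : DotSpin d k × DotSpin d k => hue x s.1 * hue y s.2) (2 * 2) :=
    fun x y => (hasSum_hue x).mul (hasSum_hue y)
      (summable_prod_mul (hasSum_hue x).summable (hasSum_hue y).summable)
  have := hasSum_sum (s := Finset.univ) fun (x : Bool) _ =>
    hasSum_sum (s := Finset.univ) fun (y : Bool) _ => (h x y).mul_left (v x y)
  have e : 4 * ∑ x, ∑ y, v x y = ∑ x, ∑ y, v x y * (2 * 2) := by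
    simp only [Fintype.sum_bool]; ring
  rw [e]
  exact this

theorem huePair_sub (v w : Bool → Bool → ℝ) (s : DotSpin d k × DotSpin d k) :
    huePair v s - huePair w s = huePair (fun x y => v x y - w x y) s := by
  simp only [huePair, ← Finset.sum_sub_distrib, sub_mul]

theorem tsum_abs_huePair_le (v : Bool → Bool → ℝ) :
    ∑' s : DotSpin d k × DotSpin d k, |huePair v s| ≤ 4 * ∑ x, ∑ y, |v x y| := by
  rw [← (hasSum_huePair (d := d) (k := k) fun x y => |v x y|).tsum_eq]
  refine Summable.tsum_le_tsum (fun s => ?_) (hasSum_huePair v).summable.abs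
    (hasSum_huePair _).summable
  refine (Finset.abs_sum_le_sum_abs _ _).trans (Finset.sum_le_sum fun x _ =>
    (Finset.abs_sum_le_sum_abs _ _).trans (Finset.sum_le_sum fun y _ => ?_))
  rw [abs_mul, abs_of_nonneg (a := hue x s.1 * hue y s.2)
    (mul_nonneg (ind_mem_unit _).1 (ind_mem_unit _).1)]

/-- The part of the product of two variable weights not carried by colored incoming spins. -/
def varRestPair (lam : ℝ) (T : ℕ∞) (u v : Fin (d - 1) → HatSpin d k)
    (s : DotSpin d k × DotSpin d k) : ℝ :=
  varMain lam s.1 u * varRest lam T s.2 v + varRest lam T s.1 u * varMain lam s.2 v +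
    varRest lam T s.1 u * varRest lam T s.2 v

/-- The total weight allowed for `varRestPair`. -/
def varRestBound (lam : ℝ) (u : Fin (d - 1) → HatSpin d k × HatSpin d k) : ℝ :=
  ∑ i ∈ offMain, 2 * ∏ j, pairTest lam i (u j)

theorem varRestBound_nonneg (hlam : 0 ≤ lam) (u : Fin (d - 1) → HatSpin d k × HatSpin d k) :
    0 ≤ varRestBound lam u :=
  Finset.sum_nonneg fun i _ => mul_nonneg zero_le_two
    (Finset.prod_nonneg fun _ _ => (pairTest_mem_unit hlam i _).1)

theorem varRestPair_spec (hlam : 0 ≤ lam) (hlam1 : lam ≤ 1)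
    (u : Fin (d - 1) → HatSpin d k × HatSpin d k) :
    Summable (varRestPair lam T (fun j => (u j).1) fun j => (u j).2) ∧
      ∑' s, |varRestPair lam T (fun j => (u j).1) (fun j => (u j).2) s| ≤ varRestBound lam u := by
  have m1 := varMain_spec (lam := lam) hlam fun j => (u j).1
  have m2 := varMain_spec (lam := lam) hlam fun j => (u j).2
  have r1 := varRest_spec (lam := lam) (T := T) hlam hlam1 fun j => (u j).1
  have r2 := varRest_spec (lam := lam) (T := T) hlam hlam1 fun j => (u j).2
  have s1 := summable_prod_mul m1.1 r2.1
  have s2 := summable_prod_mul r1.1 m2.1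
  have s3 := summable_prod_mul r1.1 r2.1
  have b1 := tsum_prod_abs_mul_le m1.1 r2.1 m1.2 r2.2
  have b2 := tsum_prod_abs_mul_le r1.1 m2.1 r1.2 m2.2
  have b3 := tsum_prod_abs_mul_le r1.1 r2.1 r1.2 r2.2
  have hs : Summable (varRestPair lam T (fun j => (u j).1) fun j => (u j).2) := (s1.add s2).add s3
  refine ⟨hs, ?_⟩
  refine (Summable.tsum_le_tsum (fun s => abs_add_three _ _ _) hs.abs
    ((s1.abs.add s2.abs).add s3.abs)).trans ?_
  rw [(s1.abs.add s2.abs).tsum_add s3.abs, s1.abs.tsum_add s2.abs]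
  refine (add_le_add (add_le_add b1 b2) b3).trans ?_
  have e := sum_offMain (fun κ x => ∏ j, test lam κ x (u j).1)
    fun κ x => ∏ j, test lam κ x (u j).2
  unfold varRestBound pairTest
  simp only [← Finset.mul_sum, Finset.prod_mul_distrib]
  rw [e]
  -- The factor 2 in `varRestBound` is needed for the cross terms, whose main part counts both `red
  -- x` and `blue x`. The rest-rest term needs it only once, and this nonnegative surplus is
  -- dropped.
  have h0 : 0 ≤ (∑ x, (∏ j, test lam .blue x (u j).1 + ∏ j, test lam .free x (u j).1)) *
      ∑ x, (∏ j, test lam .blue x (u j).2 + ∏ j, test lam .free x (u j).2) :=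
    mul_nonneg (Finset.sum_nonneg fun x _ => add_nonneg (prod_test_mem_unit hlam .blue x _).1
        (prod_test_mem_unit hlam .free x _).1)
      (Finset.sum_nonneg fun x _ => add_nonneg (prod_test_mem_unit hlam .blue x _).1
        (prod_test_mem_unit hlam .free x _).1)
  linarith

theorem bddFn_varRestBound (hlam : 0 ≤ lam) :
    BddFn (varRestBound lam : (Fin (d - 1) → HatSpin d k × HatSpin d k) → ℝ) :=
  BddFn.sum _ fun i => (BddFn.const 2).mul
    (BddFn.prod _ fun j => (bddFn_pairTest hlam i).comp fun u : Fin (d - 1) → _ => u j)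

theorem bddFn_varRestPair (hlam : 0 ≤ lam) (hlam1 : lam ≤ 1) (s : DotSpin d k × DotSpin d k) :
    BddFn fun u : Fin (d - 1) → HatSpin d k × HatSpin d k =>
      varRestPair lam T (fun j => (u j).1) (fun j => (u j).2) s := by
  obtain ⟨c, hc⟩ := bddFn_varRestBound (d := d) (k := k) (lam := lam) hlam
  refine ⟨c, fun u => ?_⟩
  have h := varRestPair_spec (T := T) hlam hlam1 u
  exact ((h.1.abs.le_tsum s fun _ _ => abs_nonneg _).trans h.2).trans (abs_le.1 (hc u)).2

theorem integ_prod_pairTest (hlam : 0 ≤ lam) (i : PairKind) {n : ℕ}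
    {ν : Fin n → HatSpin d k × HatSpin d k → ℝ} (hν : ∀ j, Summable (ν j)) :
    integ (fun u => ∏ j, pairTest lam i (u j)) ν = ∏ j, tested lam (ν j) i :=
  integ_prod (χ := fun _ => pairTest lam i) (fun _ => bddFn_pairTest hlam i) hν

theorem integ_varRestBound (hlam : 0 ≤ lam) {ν : Fin (d - 1) → HatSpin d k × HatSpin d k → ℝ}
    (hν : ∀ j, Summable (ν j)) :
    integ (varRestBound lam) ν = ∑ i ∈ offMain, 2 * ∏ j, tested lam (ν j) i := by
  have hB : ∀ i, BddFn fun u : Fin (d - 1) → HatSpin d k × HatSpin d k =>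
      2 * ∏ j, pairTest lam i (u j) := fun i => (BddFn.const 2).mul
    (BddFn.prod _ fun j => (bddFn_pairTest hlam i).comp fun u : Fin (d - 1) → _ => u j)
  have := integ_sum offMain hB hν
  refine Eq.trans this (Finset.sum_congr rfl fun i _ => ?_)
  rw [integ_const_mul, integ_prod_pairTest hlam i hν]

/-- The values of the main part of the output of the variable recursion. -/
def mainValue (lam : ℝ) (p : HatSpin d k × HatSpin d k → ℝ) (x y : Bool) : ℝ :=
  tested lam p ((.colored, x), (.colored, y)) ^ (d - 1)

/-- The colored part of the weight is a product over the incoming edges and integrates to a (d -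
1)-st power of a tested weight, the same for red and blue outgoing spins. -/
theorem varOut_sub_huePair (hlam : 0 ≤ lam) (hlam1 : lam ≤ 1) (hp : Summable p)
    (s : DotSpin d k × DotSpin d k) :
    varOut lam T p s - huePair (mainValue lam p) s =
      integ (fun u : Fin (d - 1) → HatSpin d k × HatSpin d k =>
        varRestPair lam T (fun j => (u j).1) (fun j => (u j).2) s) fun _ => p := by
  have hB : ∀ i, BddFn fun u : Fin (d - 1) → HatSpin d k × HatSpin d k =>
      ∏ j, pairTest lam i (u j) := fun i =>
    BddFn.prod _ fun j => (bddFn_pairTest hlam i).comp fun u : Fin (d - 1) → _ => u j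
  have hB' : ∀ x y, BddFn fun u : Fin (d - 1) → HatSpin d k × HatSpin d k =>
      hue x s.1 * hue y s.2 * ∏ j, pairTest lam ((.colored, x), (.colored, y)) (u j) :=
    fun x y => (BddFn.const _).mul (hB _)
  have h1 : integ (fun u : Fin (d - 1) → HatSpin d k × HatSpin d k => ∑ x, ∑ y,
      hue x s.1 * hue y s.2 * ∏ j, pairTest lam ((.colored, x), (.colored, y)) (u j))
      (fun _ => p) = huePair (mainValue lam p) s := by
    rw [integ_sum _ (fun x => BddFn.sum _ fun y => hB' x y) fun _ => hp]
    refine Finset.sum_congr rfl fun x _ => ?_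
    rw [integ_sum _ (fun y => hB' x y) fun _ => hp]
    refine Finset.sum_congr rfl fun y _ => ?_
    rw [integ_const_mul, integ_prod_pairTest hlam _ fun _ => hp, mul_comm]
    simp [mainValue]
  have h2 := integ_add (BddFn.sum Finset.univ fun x => BddFn.sum Finset.univ fun y => hB' x y)
    (bddFn_varRestPair (T := T) hlam hlam1 s) fun _ => hp
  rw [h1] at h2
  rw [sub_eq_iff_eq_add', ← h2]
  unfold varOut
  congr 1
  funext u
  have e : ∀ x y, ∏ j, pairTest lam ((.colored, x), (.colored, y)) (u j) =
      (∏ j, test lam .colored x (u j).1) * ∏ j, test lam .colored y (u j).2 := fun x y => by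
    rw [← Finset.prod_mul_distrib]; rfl
  simp only [e, varRestPair, varRest, varMain, Fintype.sum_bool]
  ring

theorem summable_varRest_output (hlam : 0 ≤ lam) (hlam1 : lam ≤ 1) (hp : Summable p) :
    Summable fun s => varOut lam T p s - huePair (mainValue lam p) s := by
  simp only [varOut_sub_huePair hlam hlam1 hp]
  exact summable_tsum_kernel
    (K := fun (u : Fin (d - 1) → HatSpin d k × HatSpin d k) s =>
      varRestPair lam T (fun j => (u j).1) (fun j => (u j).2) s)
    (ν := fun u => ∏ j, p (u j))
    (fun u => (varRestPair_spec hlam hlam1 u).1) (fun u => (varRestPair_spec hlam hlam1 u).2)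
    ((bddFn_varRestBound hlam).summable_mul (summable_pi_prod (n := d - 1) fun _ => hp).abs)

theorem summable_varOut (hlam : 0 ≤ lam) (hlam1 : lam ≤ 1) (hp : Summable p) :
    Summable (varOut lam T p) := by
  have := (summable_varRest_output (T := T) hlam hlam1 hp).add
    (hasSum_huePair (mainValue lam p)).summable
  simpa only [sub_add_cancel] using this

theorem tested_nonneg (hlam : 0 ≤ lam) (hp0 : ∀ s, 0 ≤ p s) (i : PairKind) :
    0 ≤ tested lam p i := tsum_nonneg fun s => mul_nonneg (pairTest_mem_unit hlam i s).1 (hp0 s)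

/-- Every product in the remainder uses the same pair of tests, not both colored, on all edges, so
it integrates to at most `M ^ (d - 1)`. The constant is 2 times the crude count 36 of pairs of
tests. -/
theorem tsum_abs_varOut_sub_huePair_le (hlam : 0 ≤ lam) (hlam1 : lam ≤ 1) (hp : Summable p)
    (hp0 : ∀ s, 0 ≤ p s) {M : ℝ} (hM : ∀ i ∈ offMain, tested lam p i ≤ M) :
    ∑' s, |varOut lam T p s - huePair (mainValue lam p) s| ≤ 72 * M ^ (d - 1) := by
  simp only [varOut_sub_huePair hlam hlam1 hp]
  refine (tsum_abs_kernel_le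
    (K := fun (u : Fin (d - 1) → HatSpin d k × HatSpin d k) s =>
      varRestPair lam T (fun j => (u j).1) (fun j => (u j).2) s)
    (ν := fun u => ∏ j, p (u j))
    (fun u => (varRestPair_spec hlam hlam1 u).1) (fun u => (varRestPair_spec hlam hlam1 u).2)
    ((bddFn_varRestBound hlam).summable_mul
      (summable_pi_prod (n := d - 1) fun _ => hp).abs)).trans ?_
  have h0 : ∀ u : Fin (d - 1) → HatSpin d k × HatSpin d k, |∏ j, p (u j)| = ∏ j, p (u j) :=
    fun u => abs_of_nonneg (Finset.prod_nonneg fun j _ => hp0 _)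
  simp only [h0]
  have h1 := integ_varRestBound (lam := lam) (d := d) (k := k) hlam (ν := fun _ => p) fun _ => hp
  unfold integ at h1
  rw [h1]
  have h2 : ∀ i ∈ offMain, 2 * ∏ _j : Fin (d - 1), tested lam p i ≤ 2 * M ^ (d - 1) :=
    fun i hi => by
      rw [Finset.prod_const, Finset.card_univ, Fintype.card_fin]
      exact mul_le_mul_of_nonneg_left
        (pow_le_pow_left₀ (tested_nonneg hlam hp0 i) (hM i hi) _) zero_le_two
  have hc := card_offMain_le
  have hM0 : 0 ≤ M := (tested_nonneg hlam hp0 _).trans (hM _ blue_mem_offMain)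
  refine (Finset.sum_le_sum h2).trans ?_
  rw [Finset.sum_const, nsmul_eq_mul]
  have : 0 ≤ M ^ (d - 1) := pow_nonneg hM0 _
  nlinarith

/-- The main parts are compared through their values. In the remainder one of the d - 1 edges
carries the difference, hence `δ`, and each of the other d - 2 contributes a factor at most `M`. -/
theorem tsum_abs_varOut_sub_varOut_le (hlam : 0 ≤ lam) (hlam1 : lam ≤ 1) (hp : Summable p)
    (hp0 : ∀ s, 0 ≤ p s) (hp' : Summable p') (hp0' : ∀ s, 0 ≤ p' s) {M δ : ℝ}
    (hM : ∀ i ∈ offMain, tested lam p i ≤ M) (hM' : ∀ i ∈ offMain, tested lam p' i ≤ M)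
    (hδ : ∀ i ∈ offMain, ∑' s, pairTest lam i s * |p s - p' s| ≤ δ) :
    ∑' s, |varOut lam T p s - varOut lam T p' s| ≤
      4 * ∑ x, ∑ y, |mainValue lam p x y - mainValue lam p' x y| +
        72 * ((d - 1 : ℕ) * (M ^ (d - 1 - 1) * δ)) := by
  have hν := tsum_abs_prod_sub_le (n := d - 1) hp hp' hp0 hp0' (bddFn_varRestBound hlam)
    fun u => varRestBound_nonneg (lam := lam) hlam u
  have hk1 := tsum_abs_kernel_le
    (K := fun (u : Fin (d - 1) → HatSpin d k × HatSpin d k) s =>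
      varRestPair lam T (fun j => (u j).1) (fun j => (u j).2) s)
    (ν := fun u => ∏ j, p (u j) - ∏ j, p' (u j))
    (fun u => (varRestPair_spec hlam hlam1 u).1) (fun u => (varRestPair_spec hlam hlam1 u).2) hν.1
  have hE := fun s => bddFn_varRestPair (d := d) (k := k) (T := T) hlam hlam1 s
  have e : ∀ s, varOut lam T p s - varOut lam T p' s =
      huePair (fun x y => mainValue lam p x y - mainValue lam p' x y) s +
        ∑' u : Fin (d - 1) → HatSpin d k × HatSpin d k,
          varRestPair lam T (fun j => (u j).1) (fun j => (u j).2) s *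
            (∏ j, p (u j) - ∏ j, p' (u j)) := fun s => by
    rw [← huePair_sub]
    have h1 := varOut_sub_huePair (T := T) hlam hlam1 hp s
    have h2 := varOut_sub_huePair (T := T) hlam hlam1 hp' s
    unfold integ at h1 h2
    simp only [mul_sub]
    rw [(summable_integ (hE s) fun _ => hp).tsum_sub (summable_integ (hE s) fun _ => hp')]
    linarith
  have hS : Summable fun s => ∑' u : Fin (d - 1) → HatSpin d k × HatSpin d k,
          varRestPair lam T (fun j => (u j).1) (fun j => (u j).2) s *
            (∏ j, p (u j) - ∏ j, p' (u j)) :=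
    summable_tsum_kernel (K := fun (u : Fin (d - 1) → HatSpin d k × HatSpin d k) s =>
      varRestPair lam T (fun j => (u j).1) (fun j => (u j).2) s)
    (ν := fun u => ∏ j, p (u j) - ∏ j, p' (u j))
    (fun u => (varRestPair_spec hlam hlam1 u).1) (fun u => (varRestPair_spec hlam hlam1 u).2) hν.1
  have hH := (hasSum_huePair (d := d) (k := k)
    fun x y => mainValue lam p x y - mainValue lam p' x y).summable
  refine (Summable.tsum_le_tsum (fun s => (le_of_eq (congrArg abs (e s))).trans (abs_add_le _ _))
    ((summable_varOut hlam hlam1 hp).sub (summable_varOut hlam hlam1 hp')).abs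
    (hH.abs.add hS.abs)).trans ?_
  rw [hH.abs.tsum_add hS.abs]
  refine add_le_add (tsum_abs_huePair_le _) (hk1.trans (hν.2.trans ?_))
  have hM0 : 0 ≤ M := (tested_nonneg hlam hp0 _).trans (hM _ blue_mem_offMain)
  have hδ0 : 0 ≤ δ := (tsum_nonneg fun s => mul_nonneg (pairTest_mem_unit hlam _ s).1
    (abs_nonneg _)).trans (hδ _ blue_mem_offMain)
  have hl : ∀ l : Fin (d - 1), integ (varRestBound lam) (hybrid p p' l) ≤
      72 * (M ^ (d - 1 - 1) * δ) := fun l => by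
    rw [integ_varRestBound hlam fun j => hybrid_summable hp hp' l j]
    have h2 : ∀ i ∈ offMain, 2 * ∏ j, tested lam (hybrid p p' l j) i ≤
        2 * (M ^ (d - 1 - 1) * δ) := fun i hi => by
      refine mul_le_mul_of_nonneg_left ?_ zero_le_two
      rw [← Finset.prod_erase_mul _ _ (Finset.mem_univ l)]
      have hl : tested lam (hybrid p p' l l) i = ∑' s, pairTest lam i s * |p s - p' s| := by
        simp [tested, hybrid]
      have hj : ∀ j ∈ Finset.univ.erase l, tested lam (hybrid p p' l j) i ≤ M := fun j hj => by
        have hjl : j ≠ l := Finset.ne_of_mem_erase hj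
        unfold hybrid
        simp only [if_neg hjl]
        split_ifs
        exacts [hM i hi, hM' i hi]
      have hpos := fun j => tested_nonneg (p := hybrid p p' l j) hlam (hybrid_nonneg hp0 hp0' l j) i
      rw [hl]
      refine mul_le_mul ?_ (hδ i hi) (tsum_nonneg fun s =>
        mul_nonneg (pairTest_mem_unit hlam i s).1 (abs_nonneg _)) (pow_nonneg hM0 _)
      refine (Finset.prod_le_prod (fun j _ => hpos j) hj).trans (le_of_eq ?_)
      rw [Finset.prod_const, Finset.card_erase_of_mem (Finset.mem_univ l), Finset.card_univ,
        Fintype.card_fin]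
    refine (Finset.sum_le_sum h2).trans ?_
    rw [Finset.sum_const, nsmul_eq_mul]
    have : 0 ≤ M ^ (d - 1 - 1) * δ := mul_nonneg (pow_nonneg hM0 _) hδ0
    nlinarith [card_offMain_le]
  refine (Finset.sum_le_sum fun l _ => hl l).trans (le_of_eq ?_)
  rw [Finset.sum_const, Finset.card_univ, Fintype.card_fin, nsmul_eq_mul]
  ring

end variableOutput

-- Normalization to probability measures

section normalization

variable {α : Type} {f g : α → ℝ}

theorem normalize_mul {c : ℝ} (hc : c ≠ 0) (f : α → ℝ) :
    normalize (fun a => c * f a) = normalize f := by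
  funext a
  unfold normalize
  rw [tsum_mul_left, mul_div_mul_left _ _ hc]

theorem hasSum_normalize (hf : Summable f) (h : ∑' a, f a ≠ 0) : HasSum (normalize f) 1 := by
  have := hf.hasSum.div_const (∑' a, f a)
  rwa [div_self h] at this

theorem mass_mul (c : ℝ) (f : α → ℝ) (S : Set α) :
    mass (fun a => c * f a) S = c * mass f S := by
  unfold mass
  rw [← tsum_mul_left]
  refine tsum_congr fun a => ?_
  by_cases h : a ∈ S <;> simp [h]

theorem mass_mono {S : Set α} (hf : ∀ a ∈ S, f a ≤ g a) (h0 : ∀ a, 0 ≤ f a) (hg0 : ∀ a, 0 ≤ g a)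
    (hg : Summable g) : mass f S ≤ ∑' a, g a := by
  have h : ∀ a, S.indicator f a ≤ g a := fun a => by
    by_cases ha : a ∈ S
    · rw [Set.indicator_of_mem ha]; exact hf a ha
    · rw [Set.indicator_of_notMem ha]; exact hg0 a
  exact Summable.tsum_le_tsum h
    (Summable.of_nonneg_of_le (fun a => Set.indicator_nonneg (fun a _ => h0 a) a) h hg) hg

theorem tsum_abs_normalize_sub_le (hf : Summable f) (hg : Summable g) (hg0 : ∀ a, 0 ≤ g a)
    {m : ℝ} (hm : 0 < m) (hfm : m ≤ ∑' a, f a) (hgm : m ≤ ∑' a, g a) :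
    ∑' a, |normalize f a - normalize g a| ≤ 2 / m * ∑' a, |f a - g a| := by
  have hF : 0 < ∑' a, f a := hm.trans_le hfm
  have hG : 0 < ∑' a, g a := hm.trans_le hgm
  have hD : |(∑' a, f a) - ∑' a, g a| ≤ ∑' a, |f a - g a| := by
    rw [← hf.tsum_sub hg]
    exact norm_tsum_le_tsum_norm (f := fun a => f a - g a) (hf.sub hg).abs
  have h : ∀ a, |normalize f a - normalize g a| ≤
      m⁻¹ * |f a - g a| + m⁻¹ * (∑' a, |f a - g a|) * normalize g a := fun a => by
    have hga : 0 ≤ normalize g a := div_nonneg (hg0 a) hG.le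
    have e : normalize f a - normalize g a = (∑' a, f a)⁻¹ * (f a - g a) +
        (∑' a, f a)⁻¹ * ((∑' a, g a) - ∑' a, f a) * normalize g a := by
      unfold normalize
      field_simp
      ring
    rw [e]
    have hi : (∑' a, f a)⁻¹ ≤ m⁻¹ := inv_anti₀ hm hfm
    have hi0 : 0 ≤ (∑' a, f a)⁻¹ := inv_nonneg.2 hF.le
    refine (abs_add_le _ _).trans ?_
    rw [abs_mul, abs_mul, abs_mul, abs_of_nonneg hga, abs_of_nonneg hi0, abs_sub_comm (∑' a, g a)]
    gcongr
  have hs1 := (hf.sub hg).abs.mul_left m⁻¹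
  have hs2 := (hasSum_normalize hg hG.ne').summable.mul_left (m⁻¹ * ∑' a, |f a - g a|)
  refine (Summable.tsum_le_tsum h (Summable.of_nonneg_of_le (fun _ => abs_nonneg _) h
    (hs1.add hs2)) (hs1.add hs2)).trans (le_of_eq ?_)
  rw [hs1.tsum_add hs2, tsum_mul_left, tsum_mul_left, (hasSum_normalize hg hG.ne').tsum_eq]
  ring

end normalization

-- Membership of the output in `Gamma`

section gamma

variable {d k : ℕ} {lam : ℝ} {T : ℕ∞} {Q : DotSpin d k × DotSpin d k → ℝ}
  {p : HatSpin d k × HatSpin d k → ℝ}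

theorem varOut_mul (c : ℝ) (p : HatSpin d k × HatSpin d k → ℝ) (s : DotSpin d k × DotSpin d k) :
    varOut lam T (fun s => c * p s) s = c ^ (d - 1) * varOut lam T p s := by
  unfold varOut integ
  rw [← tsum_mul_left]
  refine tsum_congr fun u => ?_
  rw [Finset.prod_mul_distrib, Finset.prod_const, Finset.card_univ, Fintype.card_fin]
  ring

theorem varBP_mul {c : ℝ} (hc : c ≠ 0) (p : HatSpin d k × HatSpin d k → ℝ) :
    varBP lam T (fun s => c * p s) = varBP lam T p := by
  rw [varBP_eq, varBP_eq, ← normalize_mul (pow_ne_zero (d - 1) hc) (varOut lam T p)]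
  congr 1
  funext s
  exact varOut_mul c p s

theorem clauseOut_mul (c : ℝ) (q : DotSpin d k × DotSpin d k → ℝ)
    (s : HatSpin d k × HatSpin d k) :
    clauseOut lam T (fun p => c * q p) s = c ^ (k - 1) * clauseOut lam T q s := by
  unfold clauseOut integ
  rw [← tsum_mul_left]
  refine tsum_congr fun u => ?_
  rw [Finset.prod_mul_distrib, Finset.prod_const, Finset.card_univ, Fintype.card_fin]
  ring

theorem varOut_nonneg (hp : ∀ s, 0 ≤ p s) (s : DotSpin d k × DotSpin d k) :
    0 ≤ varOut lam T p s :=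
  integ_nonneg (fun _ => mul_nonneg (varWeight_nonneg _ _) (varWeight_nonneg _ _)) fun _ => hp

theorem varOut_flip (hp : ∀ s, p (s.1.add true, s.2.add true) = p s)
    (s : DotSpin d k × DotSpin d k) :
    varOut lam T p (s.1.add true, s.2.add true) = varOut lam T p s := by
  unfold varOut integ
  rw [← (Equiv.piCongrRight fun _ : Fin (d - 1) =>
    (HatSpin.flipEquiv (d := d) (k := k)).prodCongr HatSpin.flipEquiv).tsum_eq]
  refine tsum_congr fun u => ?_
  beta_reduce
  rw [← varWeight_flip s.1 fun i => (u i).1, ← varWeight_flip s.2 fun i => (u i).2]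
  congr 1
  exact Finset.prod_congr rfl fun j _ => hp (u j)

theorem varOut_supported {s : DotSpin d k × DotSpin d k} (h : varOut lam T p s ≠ 0) :
    s.1.Trunc T ∧ s.2.Trunc T := by
  by_contra hc
  refine h ?_
  unfold varOut integ
  convert tsum_zero with u
  by_contra hne
  have h1 := left_ne_zero_of_mul hne
  exact hc ⟨(VarCompat.of_weight_ne (left_ne_zero_of_mul h1)).trunc,
    (VarCompat.of_weight_ne (right_ne_zero_of_mul h1)).trunc⟩

theorem bddFn_varWeight (hlam : 0 ≤ lam) (hlam1 : lam ≤ 1) (s : DotSpin d k) :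
    BddFn fun u : Fin (d - 1) → HatSpin d k => varWeight lam T s u := by
  refine BddFn.of_mem 2 fun u => ⟨varWeight_nonneg s u, ?_⟩
  have h := fun κ x => prod_test_mem_unit (lam := lam) hlam κ x u
  cases s with
  | red x => rw [varWeight_red]; linarith [(h .colored x).2]
  | blue x => rw [varWeight_blue]; linarith [(h .colored x).2, (h .blue x).1]
  | free t =>
    linarith [varWeight_free_le (T := T) hlam hlam1 t u, (h .free true).2, (h .free false).2]

/-- A red outgoing spin admits every tuple that the blue one admits, so the output of the variable
recursion satisfies condition (c) with no loss at all. -/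
theorem varWeight_blue_le_red (hlam : 0 ≤ lam) (x : Bool) (u : Fin (d - 1) → HatSpin d k) :
    varWeight lam T (.blue x) u ≤ varWeight lam T (.red x) u := by
  rw [varWeight_red, varWeight_blue]
  linarith [(prod_test_mem_unit hlam .blue x u).1]

theorem varOut_mono (hlam : 0 ≤ lam) (hlam1 : lam ≤ 1) (hp : Summable p) (hp0 : ∀ s, 0 ≤ p s)
    {s s' : DotSpin d k × DotSpin d k}
    (h1 : ∀ u, varWeight lam T s.1 u ≤ varWeight lam T s'.1 u)
    (h2 : ∀ u, varWeight lam T s.2 u ≤ varWeight lam T s'.2 u) :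
    varOut lam T p s ≤ varOut lam T p s' := by
  have hB : ∀ s : DotSpin d k × DotSpin d k, BddFn fun u : Fin (d - 1) → HatSpin d k × HatSpin d k =>
      varWeight lam T s.1 (fun i => (u i).1) * varWeight lam T s.2 fun i => (u i).2 := fun s =>
    ((bddFn_varWeight hlam hlam1 s.1).comp
      fun (u : Fin (d - 1) → HatSpin d k × HatSpin d k) i => (u i).1).mul
    ((bddFn_varWeight hlam hlam1 s.2).comp
      fun (u : Fin (d - 1) → HatSpin d k × HatSpin d k) i => (u i).2)
  exact integ_mono (hB s) (hB s') (fun _ => hp) (fun _ => hp0) fun u =>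
    mul_le_mul (h1 _) (h2 _) (varWeight_nonneg _ _) (varWeight_nonneg _ _)

theorem varOut_blue_le_left (hlam : 0 ≤ lam) (hlam1 : lam ≤ 1) (hp : Summable p)
    (hp0 : ∀ s, 0 ≤ p s) (x : Bool) (s : DotSpin d k) :
    varOut lam T p (.blue x, s) ≤ varOut lam T p (.red x, s) :=
  varOut_mono hlam hlam1 hp hp0 (fun u => varWeight_blue_le_red hlam x u) fun _ => le_rfl

theorem varOut_blue_le_right (hlam : 0 ≤ lam) (hlam1 : lam ≤ 1) (hp : Summable p)
    (hp0 : ∀ s, 0 ≤ p s) (x : Bool) (s : DotSpin d k) :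
    varOut lam T p (s, .blue x) ≤ varOut lam T p (s, .red x) :=
  varOut_mono hlam hlam1 hp hp0 (fun _ => le_rfl) fun u => varWeight_blue_le_red hlam x u

theorem mass_blueBlue (q : DotSpin d k × DotSpin d k → ℝ) :
    mass q (blueBlue d k) = ∑ x, ∑ y, q (.blue x, .blue y) := by
  have hi : Function.Injective fun b : Bool × Bool =>
      ((.blue b.1, .blue b.2) : DotSpin d k × DotSpin d k) := by
    rintro ⟨a, b⟩ ⟨a', b'⟩ h
    simpa using h
  have hm : ∀ x y, ((.blue x, .blue y) : DotSpin d k × DotSpin d k) ∈ blueBlue d k :=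
    fun x y => ⟨⟨x, rfl⟩, ⟨y, rfl⟩⟩
  unfold mass
  rw [← hi.tsum_eq (f := (blueBlue d k).indicator q), tsum_fintype, Fintype.sum_prod_type]
  · simp only [Set.indicator_of_mem (hm _ _)]
  · intro s hs
    obtain ⟨⟨x, hx⟩, ⟨y, hy⟩⟩ : s ∈ blueBlue d k := Set.mem_of_indicator_ne_zero hs
    exact ⟨(x, y), Prod.ext hx.symm hy.symm⟩

theorem sum_blue_le_tsum {f : DotSpin d k × DotSpin d k → ℝ} (hf : Summable f)
    (h0 : ∀ s, 0 ≤ f s) : ∑ x, ∑ y, f (.blue x, .blue y) ≤ ∑' s, f s := by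
  rw [← mass_blueBlue]
  exact mass_mono (fun _ _ => le_rfl) h0 h0 hf

theorem huePair_blue (v : Bool → Bool → ℝ) (x y : Bool) :
    huePair v ((.blue x, .blue y) : DotSpin d k × DotSpin d k) = v x y := by
  cases x <;> cases y <;> simp [huePair, hue_blue, ind]

theorem huePair_nonneg {v : Bool → Bool → ℝ} (hv : ∀ x y, 0 ≤ v x y)
    (s : DotSpin d k × DotSpin d k) : 0 ≤ huePair v s :=
  Finset.sum_nonneg fun x _ => Finset.sum_nonneg fun y _ =>
    mul_nonneg (hv x y) (mul_nonneg (ind_mem_unit _).1 (ind_mem_unit _).1)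

theorem huePair_free (v : Bool → Bool → ℝ) {s : DotSpin d k × DotSpin d k}
    (h : s.1.IsFree ∨ s.2.IsFree) : huePair v s = 0 := by
  obtain ⟨s, s'⟩ := s
  rcases h with ⟨t, ht⟩ | ⟨t, ht⟩ <;> simp only at ht <;> subst ht <;> simp [huePair, hue_free]

theorem Spin.isFree_of_not {F : Type} {s : Spin F} (h : ¬ s.IsRed) (h' : ¬ s.IsBlue) :
    s.IsFree := by
  cases s with
  | red x => exact (h ⟨x, rfl⟩).elim
  | blue x => exact (h' ⟨x, rfl⟩).elim
  | free t => exact ⟨t, rfl⟩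

theorem redCount_eq_zero_iff {s : DotSpin d k × DotSpin d k} :
    redCount s = 0 ↔ ¬ s.1.IsRed ∧ ¬ s.2.IsRed := by
  unfold redCount
  split_ifs <;> simp_all

/-- A symmetric weight close to a combination of color indicators has a normalization in
`Gamma`. -/
theorem gamma_normalize {C ε δ : ℝ} {v : Bool → Bool → ℝ} (h0 : ∀ s, 0 ≤ Q s) (hQ : Summable Q)
    (hsupp : ∀ s, Q s ≠ 0 → s.1.Trunc T ∧ s.2.Trunc T)
    (hflip : ∀ s, Q (s.1.add true, s.2.add true) = Q s)
    (hl : ∀ x s, Q (.blue x, s) ≤ Q (.red x, s)) (hr : ∀ x s, Q (s, .blue x) ≤ Q (s, .red x))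
    (hv : ∀ x y, |v x y - 1| ≤ ε) (hδ : ∑' s, |Q s - huePair v s| ≤ δ) (hε : ε ≤ 1 / 4)
    (hδ1 : δ ≤ 1) (hδk : δ ≤ 300 * (2 : ℝ) ^ (-(k : ℝ)))
    (hεk : ε + δ ≤ (k : ℝ) ^ 9 / (2 : ℝ) ^ (k : ℝ)) (hC : 200 ≤ C) :
    2 ≤ ∑' s, Q s ∧ Gamma d k T C 1 1 (normalize Q) := by
  set t : ℝ := (2 : ℝ) ^ (-(k : ℝ)) with ht
  have ht0 : 0 < t := Real.rpow_pos_of_pos two_pos _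
  have ht1 : t ≤ 1 := Real.rpow_le_one_of_one_le_of_nonpos one_le_two (by simp)
  have hv0 : ∀ x y, 0 ≤ v x y := fun x y => by linarith [(abs_le.1 (hv x y)).1]
  have hv1 : ∀ x y, v x y ≤ 5 / 4 := fun x y => by linarith [(abs_le.1 (hv x y)).2]
  have hE : Summable fun s => |Q s - huePair v s| := (hQ.sub (hasSum_huePair v).summable).abs
  have hE0 : ∀ s, 0 ≤ |Q s - huePair v s| := fun s => abs_nonneg _
  have hh0 := fun s : DotSpin d k × DotSpin d k => huePair_nonneg hv0 s
  have hQle : ∀ s, Q s ≤ huePair v s + |Q s - huePair v s| := fun s => by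
    linarith [le_abs_self (Q s - huePair v s)]
  have hsv : ∑ x, ∑ y, v x y ≤ 5 := by
    simp only [Fintype.sum_bool]
    linarith [hv1 true true, hv1 true false, hv1 false true, hv1 false false]
  -- Four entries of at least 3/4 each, less a total error of at most one.
  have hbb : 2 ≤ mass Q (blueBlue d k) := by
    rw [mass_blueBlue]
    have h1 := (sum_blue_le_tsum hE hE0).trans hδ
    simp only [huePair_blue, Fintype.sum_bool] at h1 ⊢
    have h2 := fun x y => neg_abs_le (Q (.blue x, .blue y) - v x y)
    have h3 := fun x y => neg_abs_le (v x y - 1)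
    linarith [h2 true true, h2 true false, h2 false true, h2 false false, hv true true,
      hv true false, hv false true, hv false false, h3 true true, h3 true false, h3 false true,
      h3 false false]
  have hZ : 2 ≤ ∑' s, Q s := hbb.trans (mass_mono (fun _ _ => le_rfl) h0 h0 hQ)
  refine ⟨hZ, ?_⟩
  have hQtot : ∑' s, Q s ≤ 21 := by
    refine (Summable.tsum_le_tsum hQle hQ ((hasSum_huePair v).summable.add hE)).trans ?_
    rw [(hasSum_huePair v).summable.tsum_add hE, (hasSum_huePair v).tsum_eq]
    linarith
  set Z := ∑' s, Q s with hZd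
  have hZ0 : 0 < Z := by linarith
  have hN : normalize Q = fun s => Z⁻¹ * Q s := by
    funext s; unfold normalize; rw [div_eq_inv_mul]
  have hZi : 0 < Z⁻¹ := inv_pos.2 hZ0
  have hsmall : ∀ {m R : ℝ}, m ≤ R * 2 → 0 ≤ R → Z⁻¹ * m ≤ R * (Z⁻¹ * mass Q (blueBlue d k)) :=
    fun {m R} hm hR => by
      have h1 : m ≤ R * mass Q (blueBlue d k) := hm.trans (mul_le_mul_of_nonneg_left hbb hR)
      calc Z⁻¹ * m ≤ Z⁻¹ * (R * mass Q (blueBlue d k)) := mul_le_mul_of_nonneg_left h1 hZi.le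
        _ = _ := by ring
  constructor
  · exact fun s => div_nonneg (h0 s) hZ0.le
  · exact hasSum_normalize hQ hZ0.ne'
  · intro s hs
    exact hsupp s fun h => hs (by rw [normalize, h, zero_div])
  · funext s
    rw [avg, hN]
    simp only [hflip]
    ring
  · rw [hN]
    have e : (fun s => t ^ redCount s * (Z⁻¹ * Q s)) = fun s => Z⁻¹ * (t ^ redCount s * Q s) := by
      funext s; ring
    rw [e, mass_mul, mass_mul]
    refine hsmall ?_ (mul_nonneg (by linarith) ht0.le)
    have hs : Summable fun s => t * huePair v s + |Q s - huePair v s| :=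
      ((hasSum_huePair v).summable.mul_left t).add hE
    refine (mass_mono (g := fun s => t * huePair v s + |Q s - huePair v s|) (fun s hs => ?_)
      (fun s => mul_nonneg (pow_nonneg ht0.le _) (h0 s))
      (fun s => add_nonneg (mul_nonneg ht0.le (hh0 s)) (hE0 s)) hs).trans ?_
    -- Outside the blue-blue pairs there are two cases: with a red coordinate the tilt supplies a
    -- factor `t`, without one some coordinate is free and the main part vanishes, leaving the error
    -- alone.
    · rcases Nat.eq_zero_or_pos (redCount s) with hc | hc
      · rw [hc, pow_zero, one_mul]
        obtain ⟨n1, n2⟩ := redCount_eq_zero_iff.1 hc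
        have hf : s.1.IsFree ∨ s.2.IsFree := by
          by_contra hcon
          push Not at hcon
          refine hs ⟨?_, ?_⟩
          · by_contra hb; exact hcon.1 (Spin.isFree_of_not n1 hb)
          · by_contra hb; exact hcon.2 (Spin.isFree_of_not n2 hb)
        have := hQle s
        rw [huePair_free v hf] at this ⊢
        linarith
      · have h1 : t ^ redCount s ≤ t := by
          simpa using pow_le_pow_of_le_one ht0.le ht1 hc
        have h2 := mul_le_mul h1 (hQle s) (h0 s) ht0.le
        have h3 : t * |Q s - huePair v s| ≤ |Q s - huePair v s| :=
          mul_le_of_le_one_left (hE0 s) ht1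
        linarith
    · rw [((hasSum_huePair v).summable.mul_left t).tsum_add hE, tsum_mul_left,
        (hasSum_huePair v).tsum_eq]
      -- The main part has total at most 20, so the bound is `20 * t + 300 * t`, below `2 * C * t`
      -- for `C ≥ 200`.
      nlinarith
  · rw [hN, mass_mul, ← mul_sub, abs_mul, abs_of_pos hZi, one_mul]
    refine hsmall ?_ (by positivity)
    have h1 := (sum_blue_le_tsum hE hE0).trans hδ
    simp only [huePair_blue, Fintype.sum_bool] at h1
    have a1 := hE0 (.blue true, .blue true)
    have a2 := hE0 (.blue true, .blue false)
    rw [huePair_blue] at a1 a2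
    have b1 := hv false false
    have b2 := hv false true
    have c1 := abs_le.1 b1
    have c2 := abs_le.1 b2
    have d1 := neg_abs_le (Q (.blue false, .blue false) - v false false)
    have d2 := neg_abs_le (Q (.blue false, .blue true) - v false true)
    have e1 := le_abs_self (Q (.blue false, .blue false) - v false false)
    have e2 := le_abs_self (Q (.blue false, .blue true) - v false true)
    have hδ0 : 0 ≤ δ := (tsum_nonneg hE0).trans hδ
    rw [abs_le]
    constructor <;> linarith
  · rw [hN, mass_mul, mass_mul]
    have e : C * (2 : ℝ) ^ (-1 * (k : ℝ)) = C * t := by rw [neg_one_mul]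
    rw [e]
    refine hsmall ?_ (mul_nonneg (by linarith) ht0.le)
    refine (mass_mono (g := fun s => |Q s - huePair v s|) (fun s hs => ?_) h0 hE0 hE).trans ?_
    · have := hQle s
      rw [huePair_free v (hs.elim (fun h => Or.inr h.2) fun h => Or.inl h.1)] at this ⊢
      linarith
    · nlinarith
  · rw [hN, mass_mul, mass_mul, sub_self, zero_mul, Real.rpow_zero, mul_one]
    refine hsmall ?_ (by linarith)
    exact (mass_mono (fun _ _ => le_rfl) h0 h0 hQ).trans (by linarith)
  · intro x s
    simp only [normalize]
    have h1 : (1 - C * t) * Q (.blue x, s) ≤ Q (.red x, s) :=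
      (mul_le_of_le_one_left (h0 _) (by nlinarith)).trans (hl x s)
    rw [← mul_div_assoc]
    exact div_le_div_of_nonneg_right h1 hZ0.le
  · intro x s
    simp only [normalize]
    have h1 : (1 - C * t) * Q (s, .blue x) ≤ Q (s, .red x) :=
      (mul_le_of_le_one_left (h0 _) (by nlinarith)).trans (hr x s)
    rw [← mul_div_assoc]
    exact div_le_div_of_nonneg_right h1 hZ0.le

end gamma

-- From `Gamma` to balanced weights

section ofGamma

variable {d k : ℕ} {T : ℕ∞} {C c : ℝ} {q q' : DotSpin d k × DotSpin d k → ℝ}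

theorem DotSpin.Open.not_isRed {s : DotSpin d k} (h : s.Open T) : ¬ s.IsRed := by
  rintro ⟨x, rfl⟩
  exact h

/-- The mass of the pairs of open spins. -/
def openMass (T : ℕ∞) (q : DotSpin d k × DotSpin d k → ℝ) : ℝ :=
  ∑' p, ind (p.1.Open T) * ind (p.2.Open T) * q p

namespace Gamma

theorem flip (h : Gamma d k T C c 1 q) (p : DotSpin d k × DotSpin d k) :
    q (p.1.add true, p.2.add true) = q p := by
  have := congrFun h.symmetric p
  unfold avg at this
  linarith

theorem summable_tilt (h : Gamma d k T C c 1 q) :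
    Summable ((blueBlue d k)ᶜ.indicator fun s =>
      ((2 : ℝ) ^ (-(k : ℝ))) ^ redCount s * q s) := by
  have ht0 : (0 : ℝ) < (2 : ℝ) ^ (-(k : ℝ)) := Real.rpow_pos_of_pos two_pos _
  have ht1 : (2 : ℝ) ^ (-(k : ℝ)) ≤ 1 := Real.rpow_le_one_of_one_le_of_nonpos one_le_two (by simp)
  refine Summable.indicator (Summable.of_nonneg_of_le
    (fun s => mul_nonneg (pow_nonneg ht0.le _) (h.nonneg s)) (fun s => ?_) h.hasSum_one.summable) _
  exact mul_le_of_le_one_left (h.nonneg s) (pow_le_one₀ ht0.le ht1)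

/-- Pairs without red coordinates are not tilted in condition (a), so outside the blue-blue pairs
they carry at most `C * 2 ^ (-k)` of the blue-blue mass. Up to this error only four entries of `q`
count. -/
theorem tsum_le (h : Gamma d k T C c 1 q) {χ : DotSpin d k × DotSpin d k → ℝ}
    (hχ : ∀ s, 0 ≤ χ s ∧ χ s ≤ 1) (hχ0 : ∀ s, χ s ≠ 0 → ¬ s.1.IsRed ∧ ¬ s.2.IsRed) :
    ∑' s, χ s * q s ≤ (∑ x, ∑ y, χ (.blue x, .blue y) * q (.blue x, .blue y)) +
      C * (2 : ℝ) ^ (-(k : ℝ)) * mass q (blueBlue d k) := by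
  have hs : Summable fun s => χ s * q s := (bddFn_of_unit hχ).summable_mul h.hasSum_one.summable
  have hb := hs.indicator (blueBlue d k)
  rw [← mass_blueBlue fun s => χ s * q s]
  refine (Summable.tsum_le_tsum (fun s => ?_) hs (hb.add h.summable_tilt)).trans ?_
  · by_cases hbb : s ∈ blueBlue d k
    · rw [Set.indicator_of_mem hbb, Set.indicator_of_notMem (s := (blueBlue d k)ᶜ)
        (fun h => h hbb), add_zero]
    · rw [Set.indicator_of_notMem hbb, Set.indicator_of_mem (s := (blueBlue d k)ᶜ) hbb, zero_add]
      by_cases h0 : χ s = 0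
      · rw [h0, zero_mul]
        exact mul_nonneg (by positivity) (h.nonneg s)
      · rw [redCount_eq_zero_iff.2 (hχ0 s h0), pow_zero]
        exact mul_le_mul_of_nonneg_right (hχ s).2 (h.nonneg s)
  · rw [hb.tsum_add h.summable_tilt]
    exact add_le_add le_rfl h.a_mass

theorem le_tsum (h : Gamma d k T C c 1 q) {χ : DotSpin d k × DotSpin d k → ℝ}
    (hχ : ∀ s, 0 ≤ χ s ∧ χ s ≤ 1) :
    (∑ x, ∑ y, χ (.blue x, .blue y) * q (.blue x, .blue y)) ≤ ∑' s, χ s * q s :=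
  sum_blue_le_tsum ((bddFn_of_unit hχ).summable_mul h.hasSum_one.summable)
    fun s => mul_nonneg (hχ s).1 (h.nonneg s)

theorem blue_flip (h : Gamma d k T C c 1 q) (x y : Bool) :
    q (.blue (!x), .blue (!y)) = q (.blue x, .blue y) := by
  rw [← h.flip (.blue x, .blue y)]
  cases x <;> cases y <;> rfl

theorem mass_blueBlue_eq (h : Gamma d k T C c 1 q) :
    mass q (blueBlue d k) =
      2 * (q (.blue false, .blue false) + q (.blue false, .blue true)) := by
  have h1 := h.blue_flip false false
  have h2 := h.blue_flip false true
  simp only [Bool.not_false, Bool.not_true] at h1 h2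
  rw [mass_blueBlue]
  simp only [Fintype.sum_bool]
  linarith

/-- Condition (a) loses a factor `2 ^ (-k)` per red coordinate. For at most one red coordinate
undoing the tilt costs `2 ^ k`, leaving `C` times the blue-blue mass; red-red pairs are handled by
condition (b), where κ = 1 removes the power of two. -/
theorem one_le_mass (h : Gamma d k T C c 1 q) :
    1 ≤ (1 + 2 * C) * mass q (blueBlue d k) := by
  have ht0 : (0 : ℝ) < (2 : ℝ) ^ (-(k : ℝ)) := Real.rpow_pos_of_pos two_pos _
  have ht1 : (2 : ℝ) ^ (-(k : ℝ)) ≤ 1 := Real.rpow_le_one_of_one_le_of_nonpos one_le_two (by simp)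
  set t : ℝ := (2 : ℝ) ^ (-(k : ℝ))
  have hb := h.hasSum_one.summable.indicator (blueBlue d k)
  have hr := h.hasSum_one.summable.indicator (redRed d k)
  have ht := h.summable_tilt.mul_left t⁻¹
  have h1 : ∑' s, q s ≤ _ := Summable.tsum_le_tsum (fun s => ?_) h.hasSum_one.summable
    ((hb.add hr).add ht)
  · rw [h.hasSum_one.tsum_eq, (hb.add hr).tsum_add ht, hb.tsum_add hr, tsum_mul_left] at h1
    have h2 := mul_le_mul_of_nonneg_left h.a_mass (inv_nonneg.2 ht0.le)
    have h3 := h.b_redRed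
    rw [sub_self, zero_mul, Real.rpow_zero, mul_one] at h3
    have h4 : t⁻¹ * (C * t * mass q (blueBlue d k)) = C * mass q (blueBlue d k) := by
      field_simp
    change t⁻¹ * mass _ _ ≤ t⁻¹ * (C * t * mass q (blueBlue d k)) at h2
    rw [h4] at h2
    change 1 ≤ mass q (blueBlue d k) + mass q (redRed d k) + t⁻¹ * mass _ _ at h1
    linarith
  · have hq := h.nonneg s
    have hr0 : 0 ≤ (redRed d k).indicator q s := Set.indicator_nonneg (fun a _ => h.nonneg a) s
    by_cases hbb : s ∈ blueBlue d k
    · rw [Set.indicator_of_mem hbb, Set.indicator_of_notMem (s := (blueBlue d k)ᶜ)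
        (fun h => h hbb), mul_zero]
      linarith
    · rw [Set.indicator_of_notMem hbb, Set.indicator_of_mem (s := (blueBlue d k)ᶜ) hbb]
      by_cases hrr : s ∈ redRed d k
      · rw [Set.indicator_of_mem hrr]
        have : 0 ≤ t⁻¹ * (t ^ redCount s * q s) := by positivity
        linarith
      · have hc : redCount s ≤ 1 := by
          have : ¬ (s.1.IsRed ∧ s.2.IsRed) := hrr
          unfold redCount
          split_ifs <;> simp_all
        have h5 : t ≤ t ^ redCount s := by
          simpa using pow_le_pow_of_le_one ht0.le ht1 hc
        have h6 : t⁻¹ * (t * q s) ≤ t⁻¹ * (t ^ redCount s * q s) := by gcongr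
        rw [inv_mul_cancel_left₀ ht0.ne'] at h6
        linarith

theorem openMass_bounds (h : Gamma d k T C c 1 q) :
    mass q (blueBlue d k) ≤ openMass T q ∧
      openMass T q ≤ (1 + C * (2 : ℝ) ^ (-(k : ℝ))) * mass q (blueBlue d k) := by
  have hχ : ∀ s : DotSpin d k × DotSpin d k, 0 ≤ ind (s.1.Open T) * ind (s.2.Open T) ∧
      ind (s.1.Open T) * ind (s.2.Open T) ≤ 1 := fun s =>
    ⟨mul_nonneg (ind_mem_unit _).1 (ind_mem_unit _).1,
      mul_le_one₀ (ind_mem_unit _).2 (ind_mem_unit _).1 (ind_mem_unit _).2⟩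
  have h1 := h.le_tsum hχ
  have h2 := h.tsum_le hχ fun s hs => ⟨fun hr => hs ?_, fun hr => hs ?_⟩
  · have e : ∀ x, ind (DotSpin.Open T (.blue x : DotSpin d k)) = 1 := fun x => ind_of trivial
    simp only [e, one_mul] at h1 h2
    rw [← mass_blueBlue] at h1 h2
    exact ⟨h1, h2.trans (le_of_eq (by ring))⟩
  · rw [ind_of_not fun ho => ho.not_isRed hr, zero_mul]
  · rw [ind_of_not (P := s.2.Open T) fun ho => ho.not_isRed hr, mul_zero]

theorem openMass_pos (h : Gamma d k T C c 1 q) (hC : 1 ≤ C) : 0 < openMass T q := by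
  have := h.one_le_mass
  have h2 : 0 < mass q (blueBlue d k) := by
    by_contra hn
    nlinarith
  exact h2.trans_le h.openMass_bounds.1

theorem openMass_inv_le (h : Gamma d k T C c 1 q) (hC : 1 ≤ C) :
    (openMass T q)⁻¹ ≤ 1 + 2 * C := by
  have h0 := h.openMass_pos hC
  rw [inv_le_comm₀ h0 (by linarith), inv_le_iff_one_le_mul₀' (by linarith)]
  exact h.one_le_mass.trans (mul_le_mul_of_nonneg_left h.openMass_bounds.1 (by linarith))

/-- Elements of `Gamma`, rescaled so that the pairs of open spins have mass one, are balanced. -/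
theorem balanced (h : Gamma d k T C c 1 q) (hC : 1 ≤ C) (hCt : C * (2 : ℝ) ^ (-(k : ℝ)) ≤ 1 / 4)
    (hδ : (k : ℝ) ^ 9 / (2 : ℝ) ^ (c * k) ≤ 1 / 4) :
    Balanced T (1 + 2 * C) (1 / 2 + C * (2 : ℝ) ^ (-(k : ℝ)))
      (1 / 4 + ((k : ℝ) ^ 9 / (2 : ℝ) ^ (c * k) + C * (2 : ℝ) ^ (-(k : ℝ))))
      (C * (2 : ℝ) ^ (-(k : ℝ))) ((1 - C * (2 : ℝ) ^ (-(k : ℝ))) / 2)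
      fun p => (openMass T q)⁻¹ * q p := by
  have hρ := h.openMass_pos hC
  obtain ⟨hρ1, hρ2⟩ := h.openMass_bounds
  have hρ3 := h.openMass_inv_le hC
  have hτ0 : 0 ≤ C * (2 : ℝ) ^ (-(k : ℝ)) := by positivity
  have hδ0 : 0 ≤ (k : ℝ) ^ 9 / (2 : ℝ) ^ (c * k) := by positivity
  have hm := h.mass_blueBlue_eq
  have hov := h.a_overlap
  have hup := fun χ h1 h2 => h.tsum_le (χ := χ) h1 h2
  have hcl := h.c_left
  have hcr := h.c_right
  have hm0 : 0 ≤ mass q (blueBlue d k) := by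
    rw [hm]
    linarith [h.nonneg (.blue false, .blue false), h.nonneg (.blue false, .blue true)]
  set τ := C * (2 : ℝ) ^ (-(k : ℝ))
  set δ := (k : ℝ) ^ 9 / (2 : ℝ) ^ (c * k)
  set ρ := openMass T q
  set m := mass q (blueBlue d k)
  have f1 := h.blue_flip false false
  have f2 := h.blue_flip false true
  simp only [Bool.not_false, Bool.not_true] at f1 f2
  have hrow : ∀ x, ∑ y, q (.blue x, .blue y) = m / 2 := fun x => by
    rw [hm, Fintype.sum_bool]; cases x <;> linarith
  have hcol : ∀ y, ∑ x, q (.blue x, .blue y) = m / 2 := fun x => by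
    rw [hm, Fintype.sum_bool]; cases x <;> linarith
  -- By negation symmetry the blue-blue block has two distinct values, with sum `m / 2` and with
  -- difference at most `δ * m`.
  have hentry : ∀ x y, q (.blue x, .blue y) ≤ (1 / 4 + δ) * m := fun x y => by
    have := abs_le.1 hov
    have : 0 ≤ δ * m := mul_nonneg hδ0 hm0
    cases x <;> cases y <;> linarith
  have hscale : ∀ χ : DotSpin d k × DotSpin d k → ℝ, ∑' p, χ p * (ρ⁻¹ * q p) =
      ρ⁻¹ * ∑' p, χ p * q p := fun χ => by
    rw [← tsum_mul_left]; exact tsum_congr fun p => by ring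
  have hi0 : 0 ≤ ρ⁻¹ := inv_nonneg.2 hρ.le
  -- Since `ρ` is at least the blue-blue mass `m`, a bound `r * m` on the blue-blue part becomes `r`
  -- after rescaling, and everything else without red coordinates costs at most `τ`.
  have hbound : ∀ (P R : DotSpin d k → Prop) (r : ℝ), (∀ s, P s → ¬ s.IsRed) →
      (∀ s, R s → ¬ s.IsRed) → 0 ≤ r + τ →
      (∑ x, ∑ y, ind (P (.blue x)) * ind (R (.blue y)) * q (.blue x, .blue y)) ≤ r * m →
      ∑' p : DotSpin d k × DotSpin d k, ind (P p.1) * ind (R p.2) * (ρ⁻¹ * q p) ≤ r + τ :=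
    fun P R r hP hR hr hle => by
      rw [hscale fun p => ind (P p.1) * ind (R p.2), inv_mul_le_iff₀ hρ]
      have h1 := hup (fun p => ind (P p.1) * ind (R p.2)) (fun s =>
        ⟨mul_nonneg (ind_mem_unit _).1 (ind_mem_unit _).1,
          mul_le_one₀ (ind_mem_unit _).2 (ind_mem_unit _).1 (ind_mem_unit _).2⟩) fun s hs =>
        ⟨hP _ ?_, hR _ ?_⟩
      · refine h1.trans ((add_le_add hle le_rfl).trans ?_)
        have := mul_le_mul_of_nonneg_left hρ1 hr
        linarith
      · by_contra hn; exact hs (by simp only [ind_of_not hn, zero_mul])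
      · by_contra hn; exact hs (by simp only [ind_of_not hn, mul_zero])
  have hlower : ∀ (P R : DotSpin d k → Prop),
      m / 2 ≤ (∑ x, ∑ y, ind (P (.blue x)) * ind (R (.blue y)) * q (.blue x, .blue y)) →
      (1 - τ) / 2 ≤ ∑' p : DotSpin d k × DotSpin d k, ind (P p.1) * ind (R p.2) * (ρ⁻¹ * q p) :=
    fun P R hle => by
      rw [hscale fun p => ind (P p.1) * ind (R p.2), le_inv_mul_iff₀ hρ]
      have h1 := hle.trans (h.le_tsum (χ := fun p => ind (P p.1) * ind (R p.2)) fun s =>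
        ⟨mul_nonneg (ind_mem_unit _).1 (ind_mem_unit _).1,
          mul_le_one₀ (ind_mem_unit _).2 (ind_mem_unit _).1 (ind_mem_unit _).2⟩)
      refine le_trans ?_ h1
      -- Here `ρ ≤ (1 + τ) * m`, and `(1 + τ) * (1 - τ) ≤ 1`.
      have h2 := mul_le_mul_of_nonneg_right hρ2 (show 0 ≤ (1 - τ) / 2 by linarith)
      have h3 : 0 ≤ τ ^ 2 * m := by positivity
      nlinarith
  have hno : ∀ s : DotSpin d k, s.Open T → ¬ s.IsRed := fun s hs => hs.not_isRed
  have hnn : ∀ (x : Bool) (s : DotSpin d k), s.Near T x → ¬ s.IsRed :=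
    fun x s hs => hs.open.not_isRed
  have hnf : ∀ s : DotSpin d k, (s.IsFree ∧ s.Open T) → ¬ s.IsRed := fun s hs => hs.2.not_isRed
  have ib : ∀ x, ind (DotSpin.Open T (.blue x : DotSpin d k)) = 1 := fun x => ind_of trivial
  have inr : ∀ x y, ind (DotSpin.Near T x (.blue y : DotSpin d k)) = ind (y = x) := fun x y =>
    ind_congr Iff.rfl
  have ifr : ∀ x, ind ((Spin.blue x : DotSpin d k).IsFree ∧ DotSpin.Open T (.blue x : DotSpin d k))
      = 0 := fun x => ind_of_not fun h => by
    obtain ⟨⟨t, ht⟩, -⟩ := h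
    cases ht
  have ieq : ∀ x y, ind ((Spin.blue y : DotSpin d k) = .blue x) = ind (y = x) := fun x y =>
    ind_congr (by simp)
  have hsum : Summable fun p => ρ⁻¹ * q p := h.hasSum_one.summable.mul_left _
  have hswap : ∀ P R : DotSpin d k → Prop,
      ∑' p : DotSpin d k × DotSpin d k, ind (R p.2) * ind (P p.1) * (ρ⁻¹ * q p) =
        ∑' p : DotSpin d k × DotSpin d k, ind (P p.1) * ind (R p.2) * (ρ⁻¹ * q p) :=
    fun P R => tsum_congr fun p => by rw [mul_comm (ind _)]
  constructor
  · exact fun p => mul_nonneg hi0 (h.nonneg p)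
  · exact hsum
  · exact fun p => by rw [h.flip]
  · linarith
  · rw [tsum_mul_left, h.hasSum_one.tsum_eq, mul_one]; exact hρ3
  · linarith
  · linarith
  · linarith
  · linarith
  · exact hτ0
  · linarith
  · linarith
  · rw [hscale fun p => ind (p.1.Open T) * ind (p.2.Open T)]
    exact inv_mul_cancel₀ hρ.ne'
  · intro x
    refine hbound _ _ _ hno (hnn x) (by linarith) (le_of_eq ?_)
    rw [one_div, inv_mul_eq_div, ← hcol x]
    refine Finset.sum_congr rfl fun y _ => ?_
    rw [Fintype.sum_bool, ib, inr, inr]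
    cases x <;> simp [ind]
  · intro x
    rw [hswap]
    refine hbound _ _ _ (hnn x) hno (by linarith) (le_of_eq ?_)
    rw [one_div, inv_mul_eq_div, ← hrow x, Finset.sum_comm]
    refine Finset.sum_congr rfl fun y _ => ?_
    rw [Fintype.sum_bool, ib, inr, inr]
    cases x <;> simp [ind]
  · intro x y
    rw [← add_assoc]
    refine hbound _ _ _ (hnn x) (hnn y) (by linarith) ((le_of_eq ?_).trans (hentry x y))
    simp only [Fintype.sum_bool, inr]
    cases x <;> cases y <;> simp [ind]
  · have := hbound _ _ 0 hno hnf (by linarith) (by simp [ifr])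
    rwa [zero_add] at this
  · rw [hswap (fun s => s.IsFree ∧ s.Open T) fun s => s.Open T]
    have := hbound _ _ 0 hnf hno (by linarith) (by simp [ifr])
    rwa [zero_add] at this
  · intro x
    refine hlower (fun s => s = .blue x) _ (le_of_eq ?_)
    rw [← hrow x, Finset.sum_comm]
    refine Finset.sum_congr rfl fun y _ => ?_
    rw [Fintype.sum_bool, ib, ieq, ieq]
    cases x <;> simp [ind]
  · intro x
    rw [hswap (fun s => s.Open T) fun s => s = .blue x]
    refine hlower _ (fun s => s = .blue x) (le_of_eq ?_)
    rw [← hcol x]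
    refine Finset.sum_congr rfl fun y _ => ?_
    rw [Fintype.sum_bool, ib, ieq, ieq]
    cases x <;> simp [ind]
  · intro x s
    have := mul_le_mul_of_nonneg_left (hcl x s) hi0
    linarith
  · intro x s
    have := mul_le_mul_of_nonneg_left (hcr x s) hi0
    linarith

theorem tsum_abs_rescale_sub_le (h : Gamma d k T C c 1 q) (h' : Gamma d k T C c 1 q')
    (hC : 1 ≤ C) :
    ∑' p, |(openMass T q)⁻¹ * q p - (openMass T q')⁻¹ * q' p| ≤
      2 * (1 + 2 * C) ^ 2 * ∑' p, |q p - q' p| := by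
  have hρ := h.openMass_pos hC
  have hρ' := h'.openMass_pos hC
  have hi := h.openMass_inv_le hC
  have hi' := h'.openMass_inv_le hC
  have hD : Summable fun p => |q p - q' p| :=
    (h.hasSum_one.summable.sub h'.hasSum_one.summable).abs
  have hB : BddFn fun p : DotSpin d k × DotSpin d k => ind (p.1.Open T) * ind (p.2.Open T) :=
    (bddFn_ind _).mul (bddFn_ind _)
  have hdiff : |openMass T q - openMass T q'| ≤ ∑' p, |q p - q' p| := by
    have hs := hB.summable_mul (h.hasSum_one.summable.sub h'.hasSum_one.summable)
    unfold openMass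
    rw [← (hB.summable_mul h.hasSum_one.summable).tsum_sub
      (hB.summable_mul h'.hasSum_one.summable)]
    simp only [← mul_sub]
    refine (norm_tsum_le_tsum_norm (f := fun p : DotSpin d k × DotSpin d k =>
      ind (p.1.Open T) * ind (p.2.Open T) * (q p - q' p)) hs.abs).trans
      (Summable.tsum_le_tsum (fun p => ?_) hs.abs hD)
    rw [Real.norm_eq_abs, abs_mul, abs_mul, abs_of_nonneg (ind_mem_unit _).1,
      abs_of_nonneg (ind_mem_unit _).1]
    exact mul_le_of_le_one_left (abs_nonneg _)
      (mul_le_one₀ (ind_mem_unit _).2 (ind_mem_unit _).1 (ind_mem_unit _).2)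
  set ρ := openMass T q
  set ρ' := openMass T q'
  set D := ∑' p, |q p - q' p|
  have hD0 : 0 ≤ D := (abs_nonneg _).trans hdiff
  have hρi := (inv_pos.2 hρ).le
  have hρi' := (inv_pos.2 hρ').le
  have hle : ∀ p, |ρ⁻¹ * q p - ρ'⁻¹ * q' p| ≤
      (1 + 2 * C) * |q p - q' p| + (1 + 2 * C) * (1 + 2 * C) * D * q' p := fun p => by
    have e : ρ⁻¹ * q p - ρ'⁻¹ * q' p =
        ρ⁻¹ * (q p - q' p) + ρ⁻¹ * ρ'⁻¹ * (ρ' - ρ) * q' p := by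
      field_simp
      ring
    rw [e]
    refine (abs_add_le _ _).trans ?_
    rw [abs_mul, abs_mul, abs_mul, abs_mul, abs_of_nonneg (h'.nonneg p), abs_of_nonneg hρi,
      abs_of_nonneg hρi', abs_sub_comm ρ']
    have hq' := h'.nonneg p
    gcongr
  have hs1 := hD.mul_left (1 + 2 * C)
  have hs2 := h'.hasSum_one.summable.mul_left ((1 + 2 * C) * (1 + 2 * C) * D)
  refine (Summable.tsum_le_tsum hle (Summable.of_nonneg_of_le (fun _ => abs_nonneg _) hle
    (hs1.add hs2)) (hs1.add hs2)).trans ?_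
  rw [hs1.tsum_add hs2, tsum_mul_left, tsum_mul_left, h'.hasSum_one.tsum_eq]
  change (1 + 2 * C) * D + _ ≤ _
  nlinarith [mul_nonneg hD0 (show 0 ≤ (1 + 2 * C) * C by nlinarith)]

end Gamma

end ofGamma

/-- Smallness of the error terms of the clause recursion, in terms of a constant `G` and of
`t = 2 ^ (-k)`. -/
structure SmallErrors (k : ℕ) (K a b τ β G t : ℝ) : Prop where
  G_nonneg : 0 ≤ G
  t_pos : 0 < t
  k_ge : 8 ≤ (k : ℝ)
  response : 2 * openBound (k - 1) K a + nearBound (k - 1) K b ≤ G * k * t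
  discrepancy : 2 * nearBound (k - 1) K b ≤ G * k ^ 2 * t ^ 2
  gap : 2 * t - G * k ^ 2 * t ^ 2 ≤ β ^ (k - 1) - 2 * gapError (k - 1) K a b τ
  lipschitz : 4 * openLip (k - 1) K a + 4 * nearLip (k - 1) K b ≤ G * k ^ 2 * t
  discrepancy_lipschitz : 2 * nearLip (k - 1) K b ≤ G * k ^ 3 * t ^ 2
  small : G * k ^ 3 * t ≤ 1 / 16
  overlap : 2 * (G * k ^ 3) + 300 ≤ (k : ℝ) ^ 9
  t_small : 300 * t ≤ 1

namespace SmallErrors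

variable {k : ℕ} {K a b τ β G t : ℝ}

theorem small_of_pow_le (h : SmallErrors k K a b τ β G t) {m : ℕ} (hm : m ≤ 3) :
    G * k ^ m * t ≤ 1 / 16 := by
  refine le_trans ?_ h.small
  have h1 : (k : ℝ) ^ m ≤ (k : ℝ) ^ 3 := pow_le_pow_right₀ (by linarith [h.k_ge]) hm
  have := h.G_nonneg
  have := h.t_pos
  gcongr

end SmallErrors

-- The clause output relative to its colored value

section ratio

variable {d k : ℕ} {T : ℕ∞} {K a b τ β lam G t : ℝ} {q q' : DotSpin d k × DotSpin d k → ℝ}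

/-- The output of the clause recursion, normalized on pairs of distinct colors. -/
def clauseRatio (lam : ℝ) (T : ℕ∞) (q : DotSpin d k × DotSpin d k → ℝ)
    (s : HatSpin d k × HatSpin d k) : ℝ :=
  (pairing lam T q .colored false .colored true)⁻¹ * clauseOut lam T q s

theorem tested_clauseRatio (hlam : 0 ≤ lam) (hq : Summable q) (i : PairKind) :
    tested lam (clauseRatio lam T q) i = (pairing lam T q .colored false .colored true)⁻¹ *
      pairing lam T q i.1.1 i.1.2 i.2.1 i.2.2 := by
  rw [← tsum_test_clauseOut hlam hq i.1.1, ← tsum_mul_left]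
  exact tsum_congr fun s => by unfold pairTest clauseRatio; ring

namespace Balanced

theorem clauseRatio_flip (h : Balanced T K a b τ β q) (hk : 1 < k) (s : HatSpin d k × HatSpin d k) :
    clauseRatio lam T q (s.1.add true, s.2.add true) = clauseRatio lam T q s := by
  unfold clauseRatio
  rw [clauseOut_add hk h.flip true]

theorem summable_clauseRatio (h : Balanced T K a b τ β q) (hlam : 0 ≤ lam) :
    Summable (clauseRatio lam T q) := (summable_clauseOut hlam h.summable).mul_left _

theorem clauseRatio_nonneg (h : Balanced T K a b τ β q) (hlam : 0 ≤ lam)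
    (s : HatSpin d k × HatSpin d k) : 0 ≤ clauseRatio lam T q s :=
  mul_nonneg (inv_nonneg.2 (h.pairing_nonneg hlam _ _ _ _)) (clauseOut_nonneg hlam h.nonneg s)

theorem pairing_bounds (h : Balanced T K a b τ β q) (e : SmallErrors k K a b τ β G t)
    (hlam : 0 ≤ lam) (hT : 1 ≤ T) (hk : 1 < k) (i : PairKind) :
    |pairing lam T q i.1.1 i.1.2 i.2.1 i.2.2 - 1| ≤ 1 / 16 :=
  (h.abs_pairing_sub_one_le hlam hT hk _ _ _ _).trans (e.response.trans (by
    simpa using e.small_of_pow_le (m := 1) (by norm_num)))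

theorem inv_pairing_bounds (h : Balanced T K a b τ β q) (e : SmallErrors k K a b τ β G t)
    (hlam : 0 ≤ lam) (hT : 1 ≤ T) (hk : 1 < k) (i : PairKind) :
    0 < (pairing lam T q i.1.1 i.1.2 i.2.1 i.2.2)⁻¹ ∧
    1 - G * k * t ≤ (pairing lam T q i.1.1 i.1.2 i.2.1 i.2.2)⁻¹ ∧
      (pairing lam T q i.1.1 i.1.2 i.2.1 i.2.2)⁻¹ ≤ 2 := by
  have h1 := abs_le.1 (h.pairing_bounds (lam := lam) e hlam hT hk i)
  have h2 := abs_le.1 ((h.abs_pairing_sub_one_le hlam hT hk i.1.1 i.1.2 i.2.1 i.2.2).trans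
    e.response)
  have hP : 0 < pairing lam T q i.1.1 i.1.2 i.2.1 i.2.2 := by linarith
  refine ⟨inv_pos.2 hP, ?_, ?_⟩
  · have h3 := e.small_of_pow_le (m := 1) (by norm_num)
    rw [pow_one] at h3
    rw [← one_div, le_div_iff₀ hP]
    nlinarith [sq_nonneg (G * k * t)]
  · rw [inv_le_comm₀ hP two_pos]; linarith

theorem pairing_colored (h : Balanced T K a b τ β q) (hk : 1 < k) (x y : Bool) :
    pairing lam T q .colored x .colored y = pairing lam T q .colored false .colored true +
      if x = y then pairing lam T q .colored false .colored false -
        pairing lam T q .colored false .colored true else 0 := by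
  have h1 := h.pairing_flip (lam := lam) hk .colored false .colored false
  have h2 := h.pairing_flip (lam := lam) hk .colored false .colored true
  simp only [Bool.not_false, Bool.not_true] at h1 h2
  cases x <;> cases y <;> simp [h1, h2]

/-- Negation symmetry leaves two colored values, for equal and for opposite labels. Dividing by the
latter makes the opposite entries exactly one and confines the dependence on `q` to the second-order
discrepancy. Without this the errors, raised to the power d - 1, would not stay bounded. -/
theorem tested_colored (h : Balanced T K a b τ β q) (e : SmallErrors k K a b τ β G t)
    (hlam : 0 ≤ lam) (hT : 1 ≤ T) (hk : 1 < k) (x y : Bool) :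
    tested lam (clauseRatio lam T q) ((.colored, x), (.colored, y)) = 1 + if x = y then
      (pairing lam T q .colored false .colored true)⁻¹ *
        (pairing lam T q .colored false .colored false -
          pairing lam T q .colored false .colored true) else 0 := by
  have hP := (h.inv_pairing_bounds (lam := lam) e hlam hT hk
    ((.colored, false), (.colored, true))).1
  have hxy := h.pairing_colored (lam := lam) hk x y
  rw [tested_clauseRatio hlam h.summable]
  change _ * pairing lam T q .colored x .colored y = _
  rw [hxy, mul_add, inv_mul_cancel₀ (inv_pos.1 hP).ne', mul_ite, mul_zero]

theorem abs_tested_colored_sub_one_le (h : Balanced T K a b τ β q)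
    (e : SmallErrors k K a b τ β G t) (hlam : 0 ≤ lam) (hT : 1 ≤ T) (hk : 1 < k) (x y : Bool) :
    |tested lam (clauseRatio lam T q) ((.colored, x), (.colored, y)) - 1| ≤
      2 * (G * k ^ 2 * t ^ 2) := by
  have hP := h.inv_pairing_bounds (lam := lam) e hlam hT hk ((.colored, false), (.colored, true))
  have hd := (h.abs_discrepancy_le (lam := lam) hlam hT hk).trans e.discrepancy
  have h0 : 0 ≤ G * k ^ 2 * t ^ 2 := (abs_nonneg _).trans hd
  rw [h.tested_colored e hlam hT hk, add_sub_cancel_left]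
  split_ifs
  · rw [abs_mul, abs_of_pos hP.1]
    exact mul_le_mul hP.2.2 hd (abs_nonneg _) zero_le_two
  · rw [abs_zero]; linarith

theorem tested_offMain_le (h : Balanced T K a b τ β q)
    (e : SmallErrors k K a b τ β G t) (hlam : 0 ≤ lam) (hT : 1 ≤ T) (hk : 1 < k) {i : PairKind}
    (hi : i ∈ offMain) :
    tested lam (clauseRatio lam T q) i ≤ 1 - 2 * t + 5 * (G * k ^ 2 * t ^ 2) := by
  have hP := h.inv_pairing_bounds (lam := lam) e hlam hT hk ((.colored, false), (.colored, true))
  have hκ : ¬ (i.1.1 = .colored ∧ i.2.1 = .colored) := mem_offMain.1 hi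
  have h1 := h.pairing_le (lam := lam) hlam hT hk hκ i.1.2 i.2.2
  have h2 := mul_le_mul_of_nonneg_left h1 hP.1.le
  have h3 := (abs_le.1 (h.abs_tested_colored_sub_one_le (lam := lam) e hlam hT hk i.1.2 i.2.2)).2
  rw [tested_clauseRatio hlam h.summable] at h3 ⊢
  rw [mul_sub] at h2
  have hk2 := e.small_of_pow_le (m := 2) (by norm_num)
  have ht := e.t_pos
  have hG := e.G_nonneg
  have hk8 := e.k_ge
  have h4 : 0 ≤ 2 * t - G * k ^ 2 * t ^ 2 := by nlinarith
  have h5 := mul_le_mul hP.2.1 e.gap h4 hP.1.le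
  -- Of the constant 5, two units come from the colored value, one from the error in the gap, and
  -- two from multiplying the gap by the inverse colored value, which is only `1 - O(k * t)`.
  have h6 : G * k * t * (2 * t - G * k ^ 2 * t ^ 2) ≤ 2 * (G * k ^ 2 * t ^ 2) := by
    have h7 : G * k * t * (2 * t) ≤ 2 * (G * k ^ 2 * t ^ 2) := by
      have : 0 ≤ G * k * t ^ 2 * (k - 1) :=
        mul_nonneg (by positivity) (by linarith)
      nlinarith
    have h8 : 0 ≤ G * k * t * (G * k ^ 2 * t ^ 2) := by positivity
    linarith
  linarith

theorem tsum_pairTest_abs_sub_le (h : Balanced T K a b τ β q) (h' : Balanced T K a b τ β q')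
    (e : SmallErrors k K a b τ β G t) (hlam : 0 ≤ lam) (hT : 1 ≤ T) (hk : 1 < k) (i : PairKind) :
    ∑' s, pairTest lam i s * |clauseOut lam T q s - clauseOut lam T q' s| ≤
      G * k ^ 2 * t * ∑' p, |q p - q' p| :=
  (h.tsum_abs_clauseOut_sub_le h' hlam hT hk _ _ _ _).trans
    (mul_le_mul_of_nonneg_right e.lipschitz (tsum_nonneg fun _ => abs_nonneg _))

theorem abs_pairing_sub_pairing_le (h : Balanced T K a b τ β q) (h' : Balanced T K a b τ β q')
    (e : SmallErrors k K a b τ β G t) (hlam : 0 ≤ lam) (hT : 1 ≤ T) (hk : 1 < k) (i : PairKind) :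
    |pairing lam T q i.1.1 i.1.2 i.2.1 i.2.2 - pairing lam T q' i.1.1 i.1.2 i.2.1 i.2.2| ≤
      G * k ^ 2 * t * ∑' p, |q p - q' p| := by
  refine le_trans ?_ (h.tsum_pairTest_abs_sub_le h' e hlam hT hk i)
  have s1 := (bddFn_pairTest (d := d) (k := k) hlam i).summable_mul
    (summable_clauseOut (T := T) hlam h.summable)
  have s2 := (bddFn_pairTest (d := d) (k := k) hlam i).summable_mul
    (summable_clauseOut (T := T) hlam h'.summable)
  rw [← tsum_test_clauseOut hlam h.summable, ← tsum_test_clauseOut hlam h'.summable]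
  change |∑' s, pairTest lam i s * clauseOut lam T q s -
    ∑' s, pairTest lam i s * clauseOut lam T q' s| ≤ _
  rw [← s1.tsum_sub s2]
  refine (norm_tsum_le_tsum_norm (f := fun s : HatSpin d k × HatSpin d k =>
    pairTest lam i s * clauseOut lam T q s - pairTest lam i s * clauseOut lam T q' s)
    (s1.sub s2).abs).trans (le_of_eq (tsum_congr fun s => ?_))
  rw [← mul_sub, Real.norm_eq_abs, abs_mul, abs_of_nonneg (pairTest_mem_unit hlam i s).1]

theorem abs_inv_pairing_sub_le (h : Balanced T K a b τ β q) (h' : Balanced T K a b τ β q')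
    (e : SmallErrors k K a b τ β G t) (hlam : 0 ≤ lam) (hT : 1 ≤ T) (hk : 1 < k) (i : PairKind) :
    |(pairing lam T q i.1.1 i.1.2 i.2.1 i.2.2)⁻¹ - (pairing lam T q' i.1.1 i.1.2 i.2.1 i.2.2)⁻¹| ≤
      4 * (G * k ^ 2 * t * ∑' p, |q p - q' p|) := by
  have hP := h.inv_pairing_bounds (lam := lam) e hlam hT hk i
  have hP' := h'.inv_pairing_bounds (lam := lam) e hlam hT hk i
  have hd := h'.abs_pairing_sub_pairing_le (lam := lam) h e hlam hT hk i
  simp only [abs_sub_comm (q' _)] at hd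
  have e1 := inv_sub_inv (inv_pos.1 hP.1).ne' (inv_pos.1 hP'.1).ne'
  rw [e1, div_eq_mul_inv, mul_inv, abs_mul, abs_mul, abs_of_pos hP.1, abs_of_pos hP'.1]
  have h0 : 0 ≤ G * k ^ 2 * t * ∑' p, |q p - q' p| := (abs_nonneg _).trans hd
  calc _ ≤ (G * k ^ 2 * t * ∑' p, |q p - q' p|) * (2 * 2) :=
        mul_le_mul hd (mul_le_mul hP.2.2 hP'.2.2 hP'.1.le zero_le_two)
          (mul_nonneg hP.1.le hP'.1.le) h0
    _ = _ := by ring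

theorem tsum_pairTest_abs_clauseRatio_sub_le (h : Balanced T K a b τ β q)
    (h' : Balanced T K a b τ β q') (e : SmallErrors k K a b τ β G t) (hlam : 0 ≤ lam)
    (hT : 1 ≤ T) (hk : 1 < k) (i : PairKind) :
    ∑' s, pairTest lam i s * |clauseRatio lam T q s - clauseRatio lam T q' s| ≤
      10 * (G * k ^ 2 * t * ∑' p, |q p - q' p|) := by
  have hP := h.inv_pairing_bounds (lam := lam) e hlam hT hk ((.colored, false), (.colored, true))
  have hI := h.abs_inv_pairing_sub_le (lam := lam) h' e hlam hT hk
    ((.colored, false), (.colored, true))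
  have hd := h.tsum_pairTest_abs_sub_le (lam := lam) h' e hlam hT hk i
  have hp := abs_le.1 (h'.pairing_bounds (lam := lam) e hlam hT hk i)
  have hB := bddFn_pairTest (d := d) (k := k) hlam i
  have hc := summable_clauseOut (T := T) hlam h.summable
  have hc' := summable_clauseOut (T := T) hlam h'.summable
  have s1 := (hB.summable_mul (hc.sub hc').abs).mul_left
    (pairing lam T q .colored false .colored true)⁻¹
  have s2 := (hB.summable_mul hc').mul_left |(pairing lam T q .colored false .colored true)⁻¹ -
    (pairing lam T q' .colored false .colored true)⁻¹|
  have hle : ∀ s : HatSpin d k × HatSpin d k,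
      pairTest lam i s * |clauseRatio lam T q s - clauseRatio lam T q' s| ≤
      (pairing lam T q .colored false .colored true)⁻¹ *
        (pairTest lam i s * |clauseOut lam T q s - clauseOut lam T q' s|) +
      |(pairing lam T q .colored false .colored true)⁻¹ -
        (pairing lam T q' .colored false .colored true)⁻¹| *
        (pairTest lam i s * clauseOut lam T q' s) := fun s => by
    have e1 : clauseRatio lam T q s - clauseRatio lam T q' s =
        (pairing lam T q .colored false .colored true)⁻¹ *
          (clauseOut lam T q s - clauseOut lam T q' s) +
        ((pairing lam T q .colored false .colored true)⁻¹ -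
          (pairing lam T q' .colored false .colored true)⁻¹) * clauseOut lam T q' s := by
      unfold clauseRatio; ring
    rw [e1]
    refine (mul_le_mul_of_nonneg_left (abs_add_le _ _) (pairTest_mem_unit hlam i s).1).trans ?_
    rw [abs_mul, abs_mul, abs_of_pos hP.1, abs_of_nonneg (clauseOut_nonneg hlam h'.nonneg s)]
    exact le_of_eq (by ring)
  refine (Summable.tsum_le_tsum hle (hB.summable_mul ((h.summable_clauseRatio hlam).sub
    (h'.summable_clauseRatio hlam)).abs) (s1.add s2)).trans ?_
  rw [s1.tsum_add s2, tsum_mul_left, tsum_mul_left]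
  have e2 : ∑' s, pairTest lam i s * clauseOut lam T q' s =
      pairing lam T q' i.1.1 i.1.2 i.2.1 i.2.2 := tsum_test_clauseOut hlam h'.summable _ _ _ _
  rw [e2]
  have h0 : 0 ≤ G * k ^ 2 * t * ∑' p, |q p - q' p| := (abs_nonneg _).trans
    (h.abs_pairing_sub_pairing_le (lam := lam) h' e hlam hT hk i)
  have h1 := mul_le_mul hP.2.2 hd (tsum_nonneg fun s => mul_nonneg (pairTest_mem_unit hlam i s).1
    (abs_nonneg _)) zero_le_two
  have h2 := mul_le_mul hI
    (show pairing lam T q' i.1.1 i.1.2 i.2.1 i.2.2 ≤ 2 by linarith) (by linarith) (by linarith)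
  exact le_trans (add_le_add h1 h2) (le_of_eq (by ring))

/-- The colored ratio depends on `q` through a quotient whose numerator is the discrepancy, so both
the numerator and its variation are of second order in `t`. One of the two factors `t` later pays
for the number of edges at a variable. -/
theorem abs_tested_colored_sub_le (h : Balanced T K a b τ β q)
    (h' : Balanced T K a b τ β q') (e : SmallErrors k K a b τ β G t) (hlam : 0 ≤ lam)
    (hT : 1 ≤ T) (hk : 1 < k) (x y : Bool) :
    |tested lam (clauseRatio lam T q) ((.colored, x), (.colored, y)) -
      tested lam (clauseRatio lam T q') ((.colored, x), (.colored, y))| ≤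
      3 * (G * k ^ 3 * t ^ 2 * ∑' p, |q p - q' p|) := by
  have hP := h.inv_pairing_bounds (lam := lam) e hlam hT hk ((.colored, false), (.colored, true))
  have hI := h.abs_inv_pairing_sub_le (lam := lam) h' e hlam hT hk
    ((.colored, false), (.colored, true))
  have hd := (h'.abs_discrepancy_le (lam := lam) hlam hT hk).trans e.discrepancy
  have hl := (h.abs_discrepancy_sub_le (lam := lam) h' hlam hT hk).trans
    (mul_le_mul_of_nonneg_right e.discrepancy_lipschitz (tsum_nonneg fun _ => abs_nonneg _))
  rw [h.tested_colored e hlam hT hk, h'.tested_colored e hlam hT hk, add_sub_add_left_eq_sub]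
  set P := (pairing lam T q .colored false .colored true)⁻¹
  set P' := (pairing lam T q' .colored false .colored true)⁻¹
  set Δ := pairing lam T q .colored false .colored false -
    pairing lam T q .colored false .colored true
  set Δ' := pairing lam T q' .colored false .colored false -
    pairing lam T q' .colored false .colored true
  set D := ∑' p, |q p - q' p|
  have h0 : 0 ≤ G * k ^ 3 * t ^ 2 * D := (abs_nonneg _).trans hl
  split_ifs
  · have e1 : P * Δ - P' * Δ' = P * (Δ - Δ') + (P - P') * Δ' := by ring
    rw [e1]
    refine (abs_add_le _ _).trans ?_
    rw [abs_mul, abs_mul, abs_of_pos hP.1]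
    have h1 := mul_le_mul hP.2.2 hl (abs_nonneg _) zero_le_two
    have h2 := mul_le_mul hI hd (abs_nonneg _) ((abs_nonneg _).trans hI)
    have hs := e.small
    have hk8 := e.k_ge
    have h3 : 4 * (G * k ^ 2 * t * D) * (G * k ^ 2 * t ^ 2) =
        4 * (G * k * t) * (G * k ^ 3 * t ^ 2 * D) := by ring
    have h4 : 4 * (G * k * t) * (G * k ^ 3 * t ^ 2 * D) ≤ 1 * (G * k ^ 3 * t ^ 2 * D) := by
      refine mul_le_mul_of_nonneg_right ?_ h0
      have := e.small_of_pow_le (m := 1) (by norm_num)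
      rw [pow_one] at this
      linarith
    linarith
  · rw [sub_self, abs_zero]; linarith

end Balanced

end ratio

-- Powers of numbers close to one

section powers

theorem abs_pow_sub_one_le {x η : ℝ} {n : ℕ} (hx : |x - 1| ≤ η) (hn : n * η ≤ 1) (hη : η ≤ 1) :
    |x ^ n - 1| ≤ 2 * (n * η) := by
  have hη0 : 0 ≤ η := (abs_nonneg _).trans hx
  have h1 := abs_le.1 hx
  have hn0 : 0 ≤ (n : ℝ) * η := by positivity
  rw [abs_le]
  constructor
  · have h2 := one_add_mul_le_pow (show (-2 : ℝ) ≤ -η by linarith) n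
    have h3 : (1 + -η) ^ n ≤ x ^ n := pow_le_pow_left₀ (by linarith) (by linarith) n
    linarith
  · have h2 : x ^ n ≤ Real.exp (n * η) := by
      rw [Real.exp_nat_mul]
      exact pow_le_pow_left₀ (by linarith) (by linarith [Real.add_one_le_exp η]) n
    have h3 := Real.abs_exp_sub_one_le (x := n * η) (by rwa [abs_of_nonneg hn0])
    rw [abs_of_nonneg hn0] at h3
    linarith [(abs_le.1 h3).2]

theorem abs_pow_sub_pow_le_of_near_one {x y η : ℝ} {n : ℕ} (hx : |x - 1| ≤ η) (hy : |y - 1| ≤ η)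
    (hn : n * η ≤ 1) (hη : η ≤ 1) : |x ^ n - y ^ n| ≤ 3 * n * |x - y| := by
  have hη0 : 0 ≤ η := (abs_nonneg _).trans hx
  have hx1 := abs_le.1 hx
  have hy1 := abs_le.1 hy
  have h1 := abs_pow_sub_pow_le x y n
  refine h1.trans ?_
  have h2 : max |x| |y| ^ (n - 1) ≤ 3 := by
    have h3 : max |x| |y| ≤ Real.exp η := by
      rw [abs_of_nonneg (by linarith), abs_of_nonneg (by linarith)]
      exact max_le (by linarith [Real.add_one_le_exp η]) (by linarith [Real.add_one_le_exp η])
    have h4 : ((n - 1 : ℕ) : ℝ) * η ≤ 1 := by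
      refine le_trans (mul_le_mul_of_nonneg_right ?_ hη0) hn
      exact_mod_cast Nat.sub_le n 1
    calc max |x| |y| ^ (n - 1) ≤ Real.exp η ^ (n - 1) :=
          pow_le_pow_left₀ ((abs_nonneg x).trans (le_max_left _ _)) h3 _
      _ = Real.exp ((n - 1 : ℕ) * η) := (Real.exp_nat_mul _ _).symm
      _ ≤ Real.exp 1 := Real.exp_le_exp.2 h4
      _ ≤ 3 := Real.exp_one_lt_three.le
  have h5 : 0 ≤ |x - y| * n := by positivity
  nlinarith [mul_le_mul_of_nonneg_left h2 h5]

end powers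

/-- The consequences of the choice of the density for the variable recursion. -/
structure DegreeBounds (d k : ℕ) (G t : ℝ) : Prop where
  mul_le : ((d - 1 : ℕ) : ℝ) * t ≤ k / 2
  pow_le : (1 - 2 * t + 5 * (G * k ^ 2 * t ^ 2)) ^ (d - 1 - 1) ≤ 4 * t

-- One step of belief propagation

section step

variable {d k : ℕ} {T : ℕ∞} {K a b τ β lam G t C c : ℝ} {q q' : DotSpin d k × DotSpin d k → ℝ}

theorem SmallErrors.near_one (e : SmallErrors k K a b τ β G t) (g : DegreeBounds d k G t) :
    ((d - 1 : ℕ) : ℝ) * (2 * (G * k ^ 2 * t ^ 2)) ≤ G * k ^ 3 * t ∧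
      2 * (G * k ^ 2 * t ^ 2) ≤ 1 := by
  have hG := e.G_nonneg
  have ht := e.t_pos
  have hk := e.k_ge
  constructor
  · have h1 : 0 ≤ 2 * (G * k ^ 2 * t) := by positivity
    have h2 := mul_le_mul_of_nonneg_left g.mul_le h1
    calc _ = 2 * (G * k ^ 2 * t) * (((d - 1 : ℕ) : ℝ) * t) := by ring
      _ ≤ _ := h2
      _ = _ := by ring
  · have h3 := e.small_of_pow_le (m := 2) (by norm_num)
    have h4 := e.t_small
    have h5 : 0 ≤ G * k ^ 2 * t := by positivity
    nlinarith

theorem SmallErrors.offMain_nonneg (e : SmallErrors k K a b τ β G t) :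
    0 ≤ 1 - 2 * t + 5 * (G * k ^ 2 * t ^ 2) ∧ 1 - 2 * t + 5 * (G * k ^ 2 * t ^ 2) ≤ 1 := by
  have hG := e.G_nonneg
  have ht := e.t_pos
  have hk := e.k_ge
  have h3 := e.small_of_pow_le (m := 2) (by norm_num)
  have h4 := e.t_small
  have h5 : 0 ≤ G * k ^ 2 * t ^ 2 := by positivity
  constructor <;> nlinarith

namespace Balanced

/-- The unnormalized output of belief propagation. -/
def _root_.NaeSat.pairOut (lam : ℝ) (T : ℕ∞) (q : DotSpin d k × DotSpin d k → ℝ) :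
    DotSpin d k × DotSpin d k → ℝ := varOut lam T (clauseRatio lam T q)

theorem abs_mainValue_sub_one_le (h : Balanced T K a b τ β q) (e : SmallErrors k K a b τ β G t)
    (g : DegreeBounds d k G t) (hlam : 0 ≤ lam) (hT : 1 ≤ T) (hk : 1 < k) (x y : Bool) :
    |mainValue lam (clauseRatio lam T q) x y - 1| ≤ 2 * (G * k ^ 3 * t) := by
  have h1 := e.near_one g
  have h2 := e.small
  refine (abs_pow_sub_one_le (h.abs_tested_colored_sub_one_le e hlam hT hk x y)
    (by linarith) h1.2).trans ?_
  linarith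

/-- The Lipschitz constant k^3 t^2 of the colored ratio is multiplied by d - 1, of order k/t. This
dominates everything else and is the source of the rate k^4 2^(-k). -/
theorem abs_mainValue_sub_le (h : Balanced T K a b τ β q) (h' : Balanced T K a b τ β q')
    (e : SmallErrors k K a b τ β G t) (g : DegreeBounds d k G t) (hlam : 0 ≤ lam) (hT : 1 ≤ T)
    (hk : 1 < k) (x y : Bool) :
    |mainValue lam (clauseRatio lam T q) x y - mainValue lam (clauseRatio lam T q') x y| ≤
      5 * (G * k ^ 4 * t * ∑' p, |q p - q' p|) := by
  have h1 := e.near_one g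
  have h2 := e.small
  refine (abs_pow_sub_pow_le_of_near_one (h.abs_tested_colored_sub_one_le e hlam hT hk x y)
    (h'.abs_tested_colored_sub_one_le e hlam hT hk x y) (by linarith) h1.2).trans ?_
  have h3 := h.abs_tested_colored_sub_le (lam := lam) h' e hlam hT hk x y
  have hD : 0 ≤ ∑' p, |q p - q' p| := tsum_nonneg fun _ => abs_nonneg _
  have hG := e.G_nonneg
  have ht := e.t_pos
  have h4 : 0 ≤ G * k ^ 3 * t * ∑' p, |q p - q' p| := by positivity
  have h5 : 0 ≤ G * k ^ 4 * t * ∑' p, |q p - q' p| := by positivity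
  calc 3 * ((d - 1 : ℕ) : ℝ) * _
      ≤ 3 * ((d - 1 : ℕ) : ℝ) * (3 * (G * k ^ 3 * t ^ 2 * ∑' p, |q p - q' p|)) :=
        mul_le_mul_of_nonneg_left h3 (by positivity)
    _ = 9 * (G * k ^ 3 * t * ∑' p, |q p - q' p|) * (((d - 1 : ℕ) : ℝ) * t) := by ring
    _ ≤ 9 * (G * k ^ 3 * t * ∑' p, |q p - q' p|) * (k / 2) :=
        mul_le_mul_of_nonneg_left g.mul_le (by positivity)
    _ = 9 / 2 * (G * k ^ 4 * t * ∑' p, |q p - q' p|) := by ring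
    _ ≤ _ := by linarith

theorem tsum_abs_pairOut_sub_le (h : Balanced T K a b τ β q) (h' : Balanced T K a b τ β q')
    (e : SmallErrors k K a b τ β G t) (g : DegreeBounds d k G t) (hlam : 0 ≤ lam)
    (hlam1 : lam ≤ 1) (hT : 1 ≤ T) (hk : 1 < k) :
    ∑' s, |pairOut lam T q s - pairOut lam T q' s| ≤
      1600 * (G * k ^ 4 * t * ∑' p, |q p - q' p|) := by
  have h1 := tsum_abs_varOut_sub_varOut_le (T := T) hlam hlam1 (h.summable_clauseRatio hlam)
    (h.clauseRatio_nonneg (T := T) hlam) (h'.summable_clauseRatio hlam)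
    (h'.clauseRatio_nonneg (T := T) hlam)
    (fun i hi => h.tested_offMain_le (lam := lam) e hlam hT hk hi)
    (fun i hi => h'.tested_offMain_le (lam := lam) e hlam hT hk hi)
    fun i _ => h.tsum_pairTest_abs_clauseRatio_sub_le (lam := lam) h' e hlam hT hk i
  refine h1.trans ?_
  have h2 := h.abs_mainValue_sub_le (lam := lam) h' e g hlam hT hk
  have hD : 0 ≤ ∑' p, |q p - q' p| := tsum_nonneg fun _ => abs_nonneg _
  have hG := e.G_nonneg
  have ht := e.t_pos
  have hk8 := e.k_ge
  set D := ∑' p, |q p - q' p|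
  -- The power contributes a factor of order `t`, which offsets the number of edges; the remainder
  -- is only of order k^3 t.
  have h3 : ((d - 1 : ℕ) : ℝ) * ((1 - 2 * t + 5 * (G * k ^ 2 * t ^ 2)) ^ (d - 1 - 1) *
      (10 * (G * k ^ 2 * t * D))) ≤ 20 * (G * k ^ 4 * t * D) := by
    calc _ ≤ ((d - 1 : ℕ) : ℝ) * (4 * t * (10 * (G * k ^ 2 * t * D))) := by
          gcongr; exact g.pow_le
      _ = 40 * (G * k ^ 2 * t * D) * (((d - 1 : ℕ) : ℝ) * t) := by ring
      _ ≤ 40 * (G * k ^ 2 * t * D) * (k / 2) := by gcongr; exact g.mul_le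
      _ = 20 * (G * k ^ 3 * t * D) := by ring
      _ ≤ 20 * (G * k ^ 4 * t * D) := by
          gcongr
          · linarith
          · norm_num
  have h4 : 0 ≤ G * k ^ 4 * t * D := by positivity
  simp only [Fintype.sum_bool]
  -- The constants add up to 4·4·5 + 72·20 = 1520.
  linarith [h2 true true, h2 true false, h2 false true, h2 false false]

theorem pairOut_gamma (h : Balanced T K a b τ β q)
    (e : SmallErrors k K a b τ β G ((2 : ℝ) ^ (-(k : ℝ))))
    (g : DegreeBounds d k G ((2 : ℝ) ^ (-(k : ℝ)))) (hlam : 0 ≤ lam) (hlam1 : lam ≤ 1)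
    (hT : 1 ≤ T) (hk : 1 < k) (hC : 200 ≤ C) :
    2 ≤ ∑' s, pairOut lam T q s ∧ Gamma d k T C 1 1 (normalize (pairOut lam T q)) := by
  have hs := h.summable_clauseRatio (lam := lam) (T := T) hlam
  have h0 := h.clauseRatio_nonneg (T := T) (lam := lam) hlam
  have hrest := tsum_abs_varOut_sub_huePair_le (T := T) hlam hlam1 hs h0
    fun i hi => h.tested_offMain_le (lam := lam) e hlam hT hk hi
  have hM := e.offMain_nonneg
  have hpow := g.pow_le
  have hsm := e.small
  have hov := e.overlap
  have ht := e.t_pos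
  have hts := e.t_small
  have hd : ((2 : ℝ) ^ (k : ℝ))⁻¹ = (2 : ℝ) ^ (-(k : ℝ)) := (Real.rpow_neg two_pos.le _).symm
  have hmain := h.abs_mainValue_sub_one_le (lam := lam) e g hlam hT hk
  set t : ℝ := (2 : ℝ) ^ (-(k : ℝ))
  have hM2 : (1 - 2 * t + 5 * (G * k ^ 2 * t ^ 2)) ^ (d - 1) ≤ 4 * t :=
    (pow_le_pow_of_le_one hM.1 hM.2 (Nat.sub_le (d - 1) 1)).trans hpow
  -- Here 288 = 72·4, from the remainder of the variable recursion and the bound `4 * t` on the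
  -- power. The last goal says that 2Gk^3 + 288 is at most k^9, which is `SmallErrors.overlap`.
  refine gamma_normalize (ε := 2 * (G * k ^ 3 * t)) (δ := 288 * t)
    (v := mainValue lam (clauseRatio lam T q)) (varOut_nonneg h0)
    (summable_varOut hlam hlam1 hs) (fun s => varOut_supported)
    (varOut_flip (h.clauseRatio_flip hk)) (varOut_blue_le_left hlam hlam1 hs h0)
    (varOut_blue_le_right hlam hlam1 hs h0) hmain (hrest.trans (by linarith)) (by linarith)
    (by linarith) (by change 288 * t ≤ 300 * t; linarith) ?_ hC
  rw [div_eq_mul_inv, hd]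
  nlinarith

end Balanced

/-- Both recursions are homogeneous and end with a normalization, so neither rescaling the input nor
replacing the normalized clause output by `clauseRatio` changes the result. -/
theorem BP_eq_normalize_pairOut {ρ : ℝ} (hρ : ρ ≠ 0)
    (h : Balanced T K a b τ β fun p => ρ * q p) (e : SmallErrors k K a b τ β G t)
    (hflip : ∀ p, q (p.1.add true, p.2.add true) = q p) (hlam : 0 ≤ lam) (hT : 1 ≤ T)
    (hk : 1 < k) : BP lam T q = normalize (pairOut lam T fun p => ρ * q p) := by
  have hs := h.summable_clauseRatio (lam := lam) (T := T) hlam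
  have h0 := h.clauseRatio_nonneg (T := T) (lam := lam) hlam
  have hP := (h.inv_pairing_bounds (lam := lam) e hlam hT hk ((.colored, false), (.colored, true))).1
  -- The test for opposite colors already has value one, so the normalizing constant of the clause
  -- output does not vanish.
  have hZ : 1 ≤ ∑' s, clauseRatio lam T (fun p => ρ * q p) s := by
    have h1 := h.tested_colored (lam := lam) e hlam hT hk false true
    rw [if_neg Bool.false_ne_true, add_zero] at h1
    rw [← h1]
    exact Summable.tsum_le_tsum (fun s => mul_le_of_le_one_left (h0 s)
      (pairTest_mem_unit hlam _ s).2) ((bddFn_pairTest hlam _).summable_mul hs) hs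
  have e1 : clauseRatio lam T (fun p => ρ * q p) = fun s =>
      (pairing lam T (fun p => ρ * q p) .colored false .colored true)⁻¹ * ρ ^ (k - 1) *
        clauseOut lam T q s := by
    funext s
    rw [clauseRatio, clauseOut_mul, mul_assoc]
  have e2 : normalize (clauseOut lam T q) = normalize (clauseRatio lam T fun p => ρ * q p) := by
    rw [e1, normalize_mul (mul_ne_zero hP.ne' (pow_ne_zero _ hρ))]
  have e3 : normalize (clauseRatio lam T fun p => ρ * q p) = fun s =>
      (∑' s, clauseRatio lam T (fun p => ρ * q p) s)⁻¹ *
        clauseRatio lam T (fun p => ρ * q p) s := by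
    funext s; unfold normalize; rw [div_eq_inv_mul]
  rw [BP, clauseBP_eq hk hflip, e2, e3, varBP_mul (inv_ne_zero (by linarith)), varBP_eq]
  rfl

end step

-- Explicit error bounds for large k

section numerics

open Filter

theorem mul_one_add_pow_le {r x : ℝ} {m : ℕ} (hr : 0 ≤ r) (hx : 0 ≤ x) (h : m * x ≤ 1 / 2) :
    (r * (1 + x)) ^ m ≤ 2 * r ^ m := by
  have h1 : (1 + x) ^ m ≤ Real.exp (m * x) := by
    rw [Real.exp_nat_mul]
    exact pow_le_pow_left₀ (by linarith) (by linarith [Real.add_one_le_exp x]) m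
  have h2 : Real.exp (m * x) ≤ 2 := by
    have h3 := Real.abs_exp_sub_one_le (x := m * x) (by rw [abs_of_nonneg (by positivity)]; linarith)
    rw [abs_of_nonneg (a := m * x) (by positivity)] at h3
    linarith [(abs_le.1 h3).2]
  rw [mul_pow, mul_comm 2]
  exact mul_le_mul_of_nonneg_left (h1.trans h2) (pow_nonneg hr m)

theorem half_add_pow_le {e : ℝ} {m k : ℕ} (hm : m ≤ k) (he : 0 ≤ e) (h : k * e ≤ 1 / 8) :
    (1 / 2 + e) ^ m ≤ 2 * (1 / 2) ^ m := by
  have h1 : (m : ℝ) * e ≤ k * e := mul_le_mul_of_nonneg_right (Nat.cast_le.2 hm) he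
  have := mul_one_add_pow_le (r := 1 / 2) (x := 2 * e) (m := m) (by norm_num) (by linarith)
    (by linarith)
  convert this using 2
  ring

/-- The overlap error enters through such powers only, and it is harmless as soon as `k * e` is
small. Any exponential rate c > 0 suffices, at the price of a larger threshold for k but with the
same constant 2. -/
theorem quarter_add_pow_le {e : ℝ} {m k : ℕ} (hm : m ≤ k) (he : 0 ≤ e) (h : k * e ≤ 1 / 8) :
    (1 / 4 + e) ^ m ≤ 2 * (1 / 4) ^ m := by
  have h1 : (m : ℝ) * e ≤ k * e := mul_le_mul_of_nonneg_right (Nat.cast_le.2 hm) he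
  have := mul_one_add_pow_le (r := 1 / 4) (x := 4 * e) (m := m) (by norm_num) (by linarith)
    (by linarith)
  convert this using 2
  ring

variable {k d : ℕ} {C K a b τ β t : ℝ}

theorem openBound_le (hk : 8 ≤ k) (ht : (1 / 2 : ℝ) ^ k = t) (hK : 0 ≤ K)
    (ha : ∀ m ≤ k, a ^ m ≤ 2 * (1 / 2) ^ m) : openBound (k - 1) K a ≤ 16 * (K * k * t) := by
  obtain ⟨j, rfl⟩ : ∃ j, k = j + 2 := ⟨k - 2, by omega⟩
  have h1 := ha j (by omega)
  rw [show j + 2 - 1 = j + 1 by omega, openBound, Nat.add_sub_cancel, ← ht, pow_add]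
  push_cast
  calc 2 * ((j : ℝ) + 1) * (K * a ^ j) ≤ 2 * ((j : ℝ) + 1) * (K * (2 * (1 / 2) ^ j)) := by
        gcongr
    _ ≤ 2 * ((j : ℝ) + 2) * (K * (2 * (1 / 2) ^ j)) := by gcongr; linarith
    _ = _ := by ring

theorem openLip_le (hk : 8 ≤ k) (ht : (1 / 2 : ℝ) ^ k = t)
    (ha : ∀ m ≤ k, a ^ m ≤ 2 * (1 / 2) ^ m) : openLip (k - 1) K a ≤ 32 * (K ^ 2 * k ^ 2 * t) := by
  obtain ⟨j, rfl⟩ : ∃ j, k = j + 3 := ⟨k - 3, by omega⟩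
  have h1 := ha j (by omega)
  rw [show j + 3 - 1 = j + 2 by omega, openLip, Nat.add_sub_cancel, ← ht, pow_add]
  push_cast
  calc ((j : ℝ) + 2) * (2 * ((j : ℝ) + 2) * (K ^ 2 * a ^ j)) ≤
      ((j : ℝ) + 3) * (2 * ((j : ℝ) + 3) * (K ^ 2 * (2 * (1 / 2) ^ j))) := by
        have h2 : (j : ℝ) + 2 ≤ j + 3 := by linarith
        have h3 : 0 ≤ K ^ 2 * (2 * (1 / 2 : ℝ) ^ j) := by positivity
        have h4 : K ^ 2 * a ^ j ≤ K ^ 2 * (2 * (1 / 2) ^ j) :=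
          mul_le_mul_of_nonneg_left h1 (by positivity)
        refine (mul_le_mul_of_nonneg_left (mul_le_mul_of_nonneg_left h4 (by positivity))
          (by positivity)).trans ?_
        gcongr
    _ = _ := by ring

theorem nearBound_le (hk : 8 ≤ k) (ht : (1 / 2 : ℝ) ^ k = t)
    (hb : ∀ m ≤ k, b ^ m ≤ 2 * (1 / 4) ^ m) :
    nearBound (k - 1) K b ≤ 512 * (K ^ 2 * k ^ 2 * t ^ 2) := by
  obtain ⟨j, rfl⟩ : ∃ j, k = j + 3 := ⟨k - 3, by omega⟩
  have h1 := hb j (by omega)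
  have h5 : (1 / 4 : ℝ) ^ j = ((1 / 2) ^ j) ^ 2 := by
    rw [← pow_mul, mul_comm, pow_mul]; norm_num
  rw [h5] at h1
  rw [show j + 3 - 1 = j + 2 by omega, nearBound, Nat.add_sub_cancel, ← ht, pow_add]
  push_cast
  have h4 : K ^ 2 * b ^ j ≤ K ^ 2 * (2 * ((1 / 2) ^ j) ^ 2) :=
    mul_le_mul_of_nonneg_left h1 (by positivity)
  calc 4 * ((j : ℝ) + 2) ^ 2 * (K ^ 2 * b ^ j) ≤
      4 * ((j : ℝ) + 2) ^ 2 * (K ^ 2 * (2 * ((1 / 2) ^ j) ^ 2)) :=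
        mul_le_mul_of_nonneg_left h4 (by positivity)
    _ ≤ 4 * ((j : ℝ) + 3) ^ 2 * (K ^ 2 * (2 * ((1 / 2) ^ j) ^ 2)) := by
        gcongr; linarith
    _ = _ := by ring

theorem nearLip_le (hk : 8 ≤ k) (ht : (1 / 2 : ℝ) ^ k = t) (hK : 0 ≤ K)
    (hb : ∀ m ≤ k, b ^ m ≤ 2 * (1 / 4) ^ m) :
    nearLip (k - 1) K b ≤ 2048 * (K ^ 3 * k ^ 3 * t ^ 2) := by
  obtain ⟨j, rfl⟩ : ∃ j, k = j + 4 := ⟨k - 4, by omega⟩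
  have h1 := hb j (by omega)
  have h5 : (1 / 4 : ℝ) ^ j = ((1 / 2) ^ j) ^ 2 := by
    rw [← pow_mul, mul_comm, pow_mul]; norm_num
  rw [h5] at h1
  rw [show j + 4 - 1 = j + 3 by omega, nearLip, Nat.add_sub_cancel, ← ht, pow_add]
  push_cast
  have h4 : K ^ 3 * b ^ j ≤ K ^ 3 * (2 * ((1 / 2) ^ j) ^ 2) :=
    mul_le_mul_of_nonneg_left h1 (by positivity)
  calc ((j : ℝ) + 3) * (4 * ((j : ℝ) + 3) ^ 2 * (K ^ 3 * b ^ j)) ≤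
      ((j : ℝ) + 3) * (4 * ((j : ℝ) + 3) ^ 2 * (K ^ 3 * (2 * ((1 / 2) ^ j) ^ 2))) :=
        mul_le_mul_of_nonneg_left (mul_le_mul_of_nonneg_left h4 (by positivity)) (by positivity)
    _ ≤ ((j : ℝ) + 4) * (4 * ((j : ℝ) + 4) ^ 2 * (K ^ 3 * (2 * ((1 / 2) ^ j) ^ 2))) := by
        have h2 : (j : ℝ) + 3 ≤ j + 4 := by linarith
        gcongr
    _ = _ := by ring

theorem gapError_le (hk : 8 ≤ k) (ht : (1 / 2 : ℝ) ^ k = t) (hC : 1 ≤ C) (hCt : C * t ≤ 1)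
    (ha : ∀ m ≤ k, a ^ m ≤ 2 * (1 / 2) ^ m) (hb : ∀ m ≤ k, b ^ m ≤ 2 * (1 / 4) ^ m) :
    gapError (k - 1) (1 + 2 * C) a b (C * t) ≤ 1568 * ((1 + 2 * C) ^ 2 * k ^ 2 * t ^ 2) := by
  have h1 := openBound_le (K := 1 + 2 * C) hk ht (by linarith) ha
  have h2 := nearBound_le (K := 1 + 2 * C) hk ht hb
  have ht0 : 0 < t := by rw [← ht]; positivity
  have hk1 : (1 : ℝ) ≤ k := by exact_mod_cast (show 1 ≤ k by omega)
  have h3 : ((k - 1 : ℕ) : ℝ) * a ^ (k - 1 - 1) ≤ 8 * (k * t) := by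
    have h4 := ha (k - 1 - 1) (by omega)
    have h5 : (1 / 2 : ℝ) ^ (k - 1 - 1) = 4 * t := by
      obtain ⟨j, rfl⟩ : ∃ j, k = j + 2 := ⟨k - 2, by omega⟩
      rw [← ht, pow_add, show j + 2 - 1 - 1 = j by omega]; ring
    rw [h5] at h4
    have h6 : ((k - 1 : ℕ) : ℝ) ≤ k := by exact_mod_cast Nat.sub_le k 1
    calc _ ≤ ((k - 1 : ℕ) : ℝ) * (2 * (4 * t)) := mul_le_mul_of_nonneg_left h4 (by positivity)
      _ ≤ (k : ℝ) * (2 * (4 * t)) := mul_le_mul_of_nonneg_right h6 (by positivity)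
      _ = _ := by ring
  have hK1 : 1 ≤ 1 + 2 * C := by linarith
  have hCK : C ≤ 1 + 2 * C := by linarith
  set K := 1 + 2 * C
  have hX : (k : ℝ) * t ^ 2 ≤ k ^ 2 * t ^ 2 := by
    refine mul_le_mul_of_nonneg_right ?_ (by positivity)
    nlinarith
  have h7 : C * t * openBound (k - 1) K a ≤ 16 * (K ^ 2 * k ^ 2 * t ^ 2) := by
    calc _ ≤ C * t * (16 * (K * k * t)) := mul_le_mul_of_nonneg_left h1 (by positivity)
      _ = 16 * (C * K * (k * t ^ 2)) := by ring
      _ ≤ 16 * (K * K * (k ^ 2 * t ^ 2)) := by gcongr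
      _ = _ := by ring
  have h8 : C * t * nearBound (k - 1) K b ≤ 512 * (K ^ 2 * k ^ 2 * t ^ 2) := by
    have h9 : C * t * nearBound (k - 1) K b ≤ C * t * (512 * (K ^ 2 * k ^ 2 * t ^ 2)) :=
      mul_le_mul_of_nonneg_left h2 (by positivity)
    exact h9.trans (mul_le_of_le_one_left (by positivity) hCt)
  have h10 : 2 * ((k - 1 : ℕ) : ℝ) * (C * t * a ^ (k - 1 - 1)) ≤
      16 * (K ^ 2 * k ^ 2 * t ^ 2) := by
    calc _ = 2 * C * t * (((k - 1 : ℕ) : ℝ) * a ^ (k - 1 - 1)) := by ring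
      _ ≤ 2 * C * t * (8 * (k * t)) := mul_le_mul_of_nonneg_left h3 (by positivity)
      _ = 16 * (C * (k * t ^ 2)) := by ring
      _ ≤ 16 * (K ^ 2 * (k ^ 2 * t ^ 2)) := by
        gcongr
        nlinarith
      _ = _ := by ring
  unfold gapError
  linarith

/-- Bernoulli's inequality, with (1/2)^(k - 1) = 2t; this is the main term of the gap. -/
theorem le_beta_pow (hk : 8 ≤ k) (ht : (1 / 2 : ℝ) ^ k = t) (hC : 1 ≤ C) (hCt : C * t ≤ 1) :
    2 * t - 2 * (C * k * t ^ 2) ≤ ((1 - C * t) / 2) ^ (k - 1) := by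
  have ht0 : 0 < t := by rw [← ht]; positivity
  have h1 := one_add_mul_le_pow (show (-2 : ℝ) ≤ -(C * t) by linarith) (k - 1)
  have h2 : (1 / 2 : ℝ) ^ (k - 1) = 2 * t := by
    obtain ⟨j, rfl⟩ : ∃ j, k = j + 1 := ⟨k - 1, by omega⟩
    rw [← ht, pow_succ, Nat.add_sub_cancel]; ring
  have h6 : ((k - 1 : ℕ) : ℝ) ≤ k := by exact_mod_cast Nat.sub_le k 1
  have h7 := mul_le_mul_of_nonneg_right h6 (show 0 ≤ C * t by positivity)
  have h3 : 1 - k * (C * t) ≤ (1 + -(C * t)) ^ (k - 1) := by linarith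
  rw [div_eq_mul_one_div, mul_pow, h2, sub_eq_add_neg 1 (C * t)]
  have h4 := mul_le_mul_of_nonneg_right h3 (show 0 ≤ 2 * t by linarith)
  linarith

/-- The constant in `SmallErrors`, as a function of the constant in `Gamma`. -/
def errorConst (C : ℝ) : ℝ := 10000 * (1 + 2 * C) ^ 3

/-- The cube in `errorConst` is the highest power of `1 + 2 * C` that occurs, in `nearLip`. The
factor 10000 covers the largest numerical coefficient, 4·32 + 4·2048 in the Lipschitz bound. -/
theorem smallErrors_of_le {δ : ℝ} (hk : 8 ≤ k) (ht : (1 / 2 : ℝ) ^ k = t) (hC : 1 ≤ C)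
    (hCt : k * (C * t) ≤ 1 / 16) (hδ0 : 0 ≤ δ) (hδ : k * δ ≤ 1 / 16)
    (hsmall : errorConst C * k ^ 3 * t ≤ 1 / 16)
    (hov : 2 * (errorConst C * k ^ 3) + 300 ≤ (k : ℝ) ^ 9) (ht1 : 300 * t ≤ 1) :
    SmallErrors k (1 + 2 * C) (1 / 2 + C * t) (1 / 4 + (δ + C * t)) (C * t) ((1 - C * t) / 2)
      (errorConst C) t := by
  have ht0 : 0 < t := by rw [← ht]; positivity
  have hk8 : (8 : ℝ) ≤ k := by exact_mod_cast hk
  have hCt0 : 0 ≤ C * t := by positivity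
  have hCt1 : C * t ≤ 1 := by nlinarith
  have hkt : k * t ≤ 1 := by nlinarith
  have ha : ∀ m ≤ k, (1 / 2 + C * t) ^ m ≤ 2 * (1 / 2) ^ m := fun m hm =>
    half_add_pow_le hm hCt0 (by linarith)
  have hb : ∀ m ≤ k, (1 / 4 + (δ + C * t)) ^ m ≤ 2 * (1 / 4) ^ m := fun m hm =>
    quarter_add_pow_le hm (by linarith) (by rw [mul_add]; linarith)
  have hK1 : 1 ≤ 1 + 2 * C := by linarith
  have h1 := openBound_le (K := 1 + 2 * C) hk ht (by linarith) ha
  have h2 := nearBound_le (K := 1 + 2 * C) hk ht hb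
  have h3 := openLip_le (K := 1 + 2 * C) hk ht ha
  have h4 := nearLip_le (K := 1 + 2 * C) hk ht (by linarith) hb
  have h5 := gapError_le hk ht hC hCt1 ha hb
  have h6 := le_beta_pow hk ht hC hCt1
  have hCK : C ≤ 1 + 2 * C := by linarith
  unfold errorConst at hsmall hov ⊢
  set K := 1 + 2 * C
  have hK2 : K ^ 2 ≤ K ^ 3 := pow_le_pow_right₀ hK1 (by norm_num)
  have hK3 : K ≤ K ^ 3 := by simpa using pow_le_pow_right₀ hK1 (show 1 ≤ 3 by norm_num)
  have e1 : K * k * t ≤ K ^ 3 * k * t := by gcongr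
  have e2 : K ^ 2 * k ^ 2 * t ^ 2 ≤ K ^ 3 * k ^ 2 * t ^ 2 := by gcongr
  have e3 : K ^ 3 * k ^ 2 * t ^ 2 ≤ K ^ 3 * k * t := by
    calc K ^ 3 * k ^ 2 * t ^ 2 = K ^ 3 * k * t * (k * t) := by ring
      _ ≤ _ := mul_le_of_le_one_right (by positivity) hkt
  have e4 : K ^ 2 * k ^ 2 * t ≤ K ^ 3 * k ^ 2 * t := by gcongr
  have e5 : K ^ 3 * k ^ 3 * t ^ 2 ≤ K ^ 3 * k ^ 2 * t := by
    calc K ^ 3 * k ^ 3 * t ^ 2 = K ^ 3 * k ^ 2 * t * (k * t) := by ring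
      _ ≤ _ := mul_le_of_le_one_right (by positivity) hkt
  have e6 : C * k * t ^ 2 ≤ K ^ 3 * k ^ 2 * t ^ 2 := by
    have : (k : ℝ) ≤ k ^ 2 := by nlinarith
    have : C ≤ K ^ 3 := hCK.trans hK3
    gcongr
  have p1 : 0 ≤ K ^ 3 * k * t := by positivity
  have p2 : 0 ≤ K ^ 3 * k ^ 2 * t ^ 2 := by positivity
  have p3 : 0 ≤ K ^ 3 * k ^ 2 * t := by positivity
  have p4 : 0 ≤ K ^ 3 * k ^ 3 * t ^ 2 := by positivity
  constructor
  · positivity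
  · exact ht0
  · exact hk8
  · linarith
  · linarith
  · linarith
  · linarith
  · linarith
  · exact hsmall
  · exact hov
  · exact ht1

/-- The upper bound on the density gives d t ≤ k (log 2)/2. The lower one gives 2 d t ≥ k log 2 - 4
k t log 2, so exp(-2 d t) is comparable to 2^(-k). -/
theorem degreeBounds_of_regime {G : ℝ} (ht : (2 : ℝ) ^ (-(k : ℝ)) = t) (hk : 8 ≤ k)
    (hG : 0 ≤ G) (hsmall : G * k ^ 3 * t ≤ 1 / 16) (ht1 : 300 * t ≤ 1) (hkt : k * t ≤ 1 / 16)
    (h : Regime d k) : DegreeBounds d k G t := by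
  have ht0 : 0 < t := by rw [← ht]; positivity
  have hk8 : (8 : ℝ) ≤ k := by exact_mod_cast hk
  have hp : (2 : ℝ) ^ ((k : ℝ) - 1) = 1 / (2 * t) := by
    rw [Real.rpow_sub two_pos, ← ht, Real.rpow_neg two_pos.le, Real.rpow_one]
    field_simp
  obtain ⟨h1, h2⟩ := h
  rw [hp, le_div_iff₀ (by linarith)] at h1
  rw [hp, div_le_iff₀ (by linarith)] at h2
  have hl1 := Real.log_two_gt_d9
  have hl2 := Real.log_two_lt_d9
  have h3 : (k : ℝ) * Real.log 2 - 4 * (k * t) * Real.log 2 ≤ 2 * (d * t) := by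
    have := mul_le_mul_of_nonneg_right h1 (show 0 ≤ 2 * t by linarith)
    have e : (1 / (2 * t) - 2) * Real.log 2 * k * (2 * t) =
        (k : ℝ) * Real.log 2 - 4 * (k * t) * Real.log 2 := by field_simp; ring
    linarith
  have h4 : d * t ≤ k / 2 := by
    have := mul_le_mul_of_nonneg_right h2 ht0.le
    have e : 1 / (2 * t) * Real.log 2 * k * t = k * Real.log 2 / 2 := by field_simp
    nlinarith
  have hd2 : 2 ≤ d := by
    by_contra hlt
    have h5 : (d : ℝ) ≤ 1 := by exact_mod_cast (show d ≤ 1 by omega)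
    have h6 : d * t ≤ t := mul_le_of_le_one_left ht0.le h5
    nlinarith
  refine ⟨?_, ?_⟩
  · refine (mul_le_mul_of_nonneg_right ?_ ht0.le).trans h4
    exact_mod_cast Nat.sub_le d 1
  · have hM0 : 0 ≤ 1 - 2 * t + 5 * (G * k ^ 2 * t ^ 2) := by
      have : 0 ≤ 5 * (G * k ^ 2 * t ^ 2) := by positivity
      linarith
    have h7 : 1 - 2 * t + 5 * (G * k ^ 2 * t ^ 2) ≤
        Real.exp (-(2 * t) + 5 * (G * k ^ 2 * t ^ 2)) := by
      linarith [Real.add_one_le_exp (-(2 * t) + 5 * (G * k ^ 2 * t ^ 2))]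
    have hcast : ((d - 1 - 1 : ℕ) : ℝ) = d - 2 := by
      obtain ⟨j, rfl⟩ : ∃ j, d = j + 2 := ⟨d - 2, by omega⟩
      rw [show j + 2 - 1 - 1 = j by omega]; push_cast; ring
    refine (pow_le_pow_left₀ hM0 h7 _).trans ?_
    rw [← Real.exp_nat_mul, hcast]
    -- Dropping two factors costs 4t, the lower end of the density window at most 1/4, and the
    -- second-order term at most 5/32. Together this is below 1, and e < 3 leaves room below 4.
    have h8 : ((d : ℝ) - 2) * (-(2 * t) + 5 * (G * k ^ 2 * t ^ 2)) ≤
        Real.log 2 * (-(k : ℝ)) + 1 := by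
      have h9 : (d : ℝ) * (5 * (G * k ^ 2 * t ^ 2)) ≤ 5 / 2 * (G * k ^ 3 * t) := by
        have := mul_le_mul_of_nonneg_left h4 (show 0 ≤ 5 * (G * k ^ 2 * t) by positivity)
        linarith
      have h10 : 0 ≤ 2 * (5 * (G * k ^ 2 * t ^ 2)) := by positivity
      have h11 : 4 * (k * t) * Real.log 2 ≤ 4 * (1 / 16) * 1 := by
        gcongr; linarith
      linarith
    refine (Real.exp_le_exp.2 h8).trans ?_
    rw [Real.exp_add, ← Real.rpow_def_of_pos two_pos, ht]
    nlinarith [Real.exp_one_lt_three]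

theorem half_pow_eq (k : ℕ) : (1 / 2 : ℝ) ^ k = (2 : ℝ) ^ (-(k : ℝ)) := by
  rw [Real.rpow_neg two_pos.le, Real.rpow_natCast, one_div, inv_pow]

theorem eventually_pow_mul_le (R : ℝ) (m : ℕ) {ε : ℝ} (hε : 0 < ε) :
    ∀ᶠ k : ℕ in atTop, R * k ^ m * (2 : ℝ) ^ (-(k : ℝ)) ≤ ε := by
  have h := (tendsto_pow_const_div_const_pow_of_one_lt m (r := 2) one_lt_two).const_mul R
  rw [mul_zero] at h
  filter_upwards [h.eventually (eventually_le_nhds hε)] with k hk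
  rwa [Real.rpow_neg two_pos.le, Real.rpow_natCast, mul_assoc, ← div_eq_mul_inv]

theorem eventually_overlap (R : ℝ) : ∀ᶠ k : ℕ in atTop, 2 * (R * k ^ 3) + 300 ≤ (k : ℝ) ^ 9 := by
  filter_upwards [eventually_ge_atTop (300 : ℕ), eventually_ge_atTop ⌈|R|⌉₊] with k h1 h2
  have h3 : (300 : ℝ) ≤ k := by exact_mod_cast h1
  have h4 : R ≤ k := (le_abs_self R).trans ((Nat.le_ceil _).trans (by exact_mod_cast h2))
  have h5 : 2 * (R * (k : ℝ) ^ 3) ≤ 2 * (k * k ^ 3) := by gcongr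
  have h6 : (300 : ℝ) ≤ k ^ 4 := by
    calc (300 : ℝ) ≤ k := h3
      _ = k ^ 1 := (pow_one _).symm
      _ ≤ k ^ 4 := pow_le_pow_right₀ (by linarith) (by norm_num)
  have h7 : 3 * (k : ℝ) ^ 4 ≤ k * k ^ 4 := by gcongr; linarith
  have h8 : (k : ℝ) ^ 5 ≤ k ^ 9 := pow_le_pow_right₀ (by linarith) (by norm_num)
  have e : (k : ℝ) * k ^ 4 = k ^ 5 := by ring
  have e' : (k : ℝ) * k ^ 3 = k ^ 4 := by ring
  linarith

theorem eventually_overlap_small {c : ℝ} (hc : 0 < c) :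
    ∀ᶠ k : ℕ in atTop, (k : ℝ) * ((k : ℝ) ^ 9 / (2 : ℝ) ^ (c * k)) ≤ 1 / 16 := by
  have hr : 1 < (2 : ℝ) ^ c := Real.one_lt_rpow one_lt_two hc
  have h := tendsto_pow_const_div_const_pow_of_one_lt 10 hr
  filter_upwards [h.eventually (eventually_le_nhds (show (0 : ℝ) < 1 / 16 by norm_num))] with k hk
  rw [Real.rpow_mul two_pos.le, Real.rpow_natCast, ← mul_div_assoc, ← pow_succ']
  exact hk

/-- The parameters of the problem are within the range of the estimates. -/
structure Admissible (k : ℕ) (C c : ℝ) : Prop where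
  one_lt : 1 < k
  errors : SmallErrors k (1 + 2 * C) (1 / 2 + C * (2 : ℝ) ^ (-(k : ℝ)))
    (1 / 4 + ((k : ℝ) ^ 9 / (2 : ℝ) ^ (c * k) + C * (2 : ℝ) ^ (-(k : ℝ))))
    (C * (2 : ℝ) ^ (-(k : ℝ))) ((1 - C * (2 : ℝ) ^ (-(k : ℝ))) / 2) (errorConst C)
    ((2 : ℝ) ^ (-(k : ℝ)))
  mul_le : C * (2 : ℝ) ^ (-(k : ℝ)) ≤ 1 / 4
  overlap_le : (k : ℝ) ^ 9 / (2 : ℝ) ^ (c * k) ≤ 1 / 4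
  degree : ∀ d, Regime d k → DegreeBounds d k (errorConst C) ((2 : ℝ) ^ (-(k : ℝ)))

theorem eventually_admissible (hC : 1 ≤ C) {c : ℝ} (hc : 0 < c) :
    ∀ᶠ k : ℕ in atTop, Admissible k C c := by
  filter_upwards [eventually_ge_atTop 8, eventually_pow_mul_le C 1 (ε := 1 / 16) (by norm_num),
    eventually_overlap_small hc, eventually_pow_mul_le (errorConst C) 3 (ε := 1 / 16) (by norm_num),
    eventually_overlap (errorConst C), eventually_pow_mul_le 300 0 zero_lt_one] with
    k hk h1 h2 h3 h4 h5
  rw [pow_zero, mul_one] at h5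
  rw [pow_one] at h1
  have hk8 : (8 : ℝ) ≤ k := by exact_mod_cast hk
  have hδ0 : 0 ≤ (k : ℝ) ^ 9 / (2 : ℝ) ^ (c * k) := by positivity
  have ht0 : 0 < (2 : ℝ) ^ (-(k : ℝ)) := by positivity
  have hE : 0 ≤ errorConst C := by unfold errorConst; positivity
  have h1' : (k : ℝ) * (C * (2 : ℝ) ^ (-(k : ℝ))) ≤ 1 / 16 := by linarith
  have hCt : 0 ≤ C * (2 : ℝ) ^ (-(k : ℝ)) := by positivity
  refine ⟨by omega, smallErrors_of_le hk (half_pow_eq k) hC h1' hδ0 h2 h3 h4 h5, by nlinarith,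
    by nlinarith, fun d hd => degreeBounds_of_regime rfl hk hE h3 h5 ?_ hd⟩
  nlinarith

end numerics

open Filter Topology

-- Convergence in ℓ¹

section summableSequences

variable {α : Type} {f : ℕ → α → ℝ} {g : α → ℝ}

theorem abs_le_l1norm (hg : Summable g) (a : α) : |g a| ≤ l1norm g :=
  hg.abs.le_tsum a fun _ _ => abs_nonneg _

/-- Completeness of ℓ¹: increments bounded by a geometric sequence make the sequence Cauchy in `lp _
1`. -/
theorem exists_l1_limit (hf : ∀ n, Summable (f n)) {D : ℝ}
    (hD : ∀ n, l1norm (fun a => f n a - f (n + 1) a) ≤ D * (1 / 2) ^ n) :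
    ∃ g, Summable g ∧ Tendsto (fun n => l1norm fun a => f n a - g a) atTop (𝓝 0) := by
  have hmem : ∀ {h : α → ℝ}, Summable h → Memℓp h 1 := fun hh =>
    memℓp_gen (by simpa using hh.abs)
  have hnorm : ∀ x : lp (fun _ : α => ℝ) 1, ‖x‖ = l1norm fun a => x a := fun x => by
    rw [lp.norm_eq_tsum_rpow (by simp)]
    simp [l1norm]
  let F : ℕ → lp (fun _ : α => ℝ) 1 := fun n => ⟨f n, hmem (hf n)⟩
  have hc : CauchySeq F := cauchySeq_of_le_geometric (1 / 2) D (by norm_num) fun n => by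
    rw [dist_eq_norm, hnorm]
    exact hD n
  obtain ⟨G, hG⟩ := cauchySeq_tendsto_of_complete hc
  refine ⟨fun a => G a, ?_, ?_⟩
  · have := (memℓp_gen_iff (by simp)).1 (lp.memℓp G)
    exact Summable.of_abs (by simpa using this)
  · have h := tendsto_iff_dist_tendsto_zero.1 hG
    refine h.congr fun n => ?_
    rw [dist_eq_norm, hnorm]
    rfl

theorem tendsto_apply_of_l1 (hf : ∀ n, Summable (f n)) (hg : Summable g)
    (h : Tendsto (fun n => l1norm fun a => f n a - g a) atTop (𝓝 0)) (a : α) :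
    Tendsto (fun n => f n a) atTop (𝓝 (g a)) := by
  rw [tendsto_iff_dist_tendsto_zero]
  exact squeeze_zero (fun _ => dist_nonneg)
    (fun n => abs_le_l1norm ((hf n).sub hg) a) h

theorem mass_mul_eq (w h : α → ℝ) (S : Set α) :
    mass (fun a => w a * h a) S = ∑' a, S.indicator w a * h a :=
  tsum_congr fun _ => Set.indicator_mul_left S w h

theorem tendsto_mass_of_l1 (hf : ∀ n, Summable (f n)) (hg : Summable g)
    (h : Tendsto (fun n => l1norm fun a => f n a - g a) atTop (𝓝 0)) {w : α → ℝ}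
    (hw : ∀ a, 0 ≤ w a ∧ w a ≤ 1) (S : Set α) :
    Tendsto (fun n => mass (fun a => w a * f n a) S) atTop (𝓝 (mass (fun a => w a * g a) S)) := by
  have hχ : ∀ a, 0 ≤ S.indicator w a ∧ S.indicator w a ≤ 1 := fun a => by
    by_cases ha : a ∈ S
    · rw [Set.indicator_of_mem ha]; exact hw a
    · rw [Set.indicator_of_notMem ha]; exact ⟨le_rfl, zero_le_one⟩
  have hsum : ∀ {r : α → ℝ}, Summable r → Summable fun a => S.indicator w a * r a := fun hr =>
    (bddFn_of_unit hχ).summable_mul hr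
  rw [tendsto_iff_dist_tendsto_zero]
  refine squeeze_zero (fun _ => dist_nonneg) (fun n => ?_) h
  have hd := hsum ((hf n).sub hg)
  rw [mass_mul_eq, mass_mul_eq, Real.dist_eq, ← (hsum (hf n)).tsum_sub (hsum hg)]
  simp only [← mul_sub]
  refine (norm_tsum_le_tsum_norm (f := fun a => S.indicator w a * (f n a - g a)) hd.abs).trans
    (Summable.tsum_le_tsum (fun a => ?_) hd.abs ((hf n).sub hg).abs)
  rw [Real.norm_eq_abs, abs_mul, abs_of_nonneg (hχ a).1]
  exact mul_le_of_le_one_left (abs_nonneg _) (hχ a).2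

theorem eq_of_l1norm_sub_le_half {h : α → ℝ} (hg : Summable g) (hh : Summable h)
    (hle : l1norm (fun a => g a - h a) ≤ 1 / 2 * l1norm fun a => g a - h a) : g = h := by
  funext a
  have h1 := abs_le_l1norm (hg.sub hh) a
  have h2 : |g a - h a| ≤ 0 := by linarith
  exact sub_eq_zero.1 (abs_nonpos_iff.1 h2)

end summableSequences

-- Contraction on `Gamma` and the fixed point

section fixedPoint

variable {d k : ℕ} {T : ℕ∞} {C c lam : ℝ} {q q' : DotSpin d k × DotSpin d k → ℝ}

namespace Gamma

theorem mono (h : Gamma d k T C 1 1 q) (hc : c ≤ 1) : Gamma d k T C c 1 q := by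
  refine { h with a_overlap := h.a_overlap.trans ?_ }
  have hm : 0 ≤ mass q (blueBlue d k) :=
    tsum_nonneg fun s => Set.indicator_nonneg (fun a _ => h.nonneg a) s
  gcongr
  norm_num

/-- All the quantitative conditions are equalities or weak inequalities between ℓ¹-continuous
functionals: point values and masses with weights in `[0, 1]`. The support condition passes to the
limit pointwise. -/
theorem of_tendsto {f : ℕ → DotSpin d k × DotSpin d k → ℝ} (hf : ∀ n, Gamma d k T C c 1 (f n))
    (hq : Summable q) (h : Tendsto (fun n => l1norm fun a => f n a - q a) atTop (𝓝 0)) :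
    Gamma d k T C c 1 q := by
  have hs := fun n => (hf n).hasSum_one.summable
  have hpt := tendsto_apply_of_l1 hs hq h
  have hm : ∀ S, Tendsto (fun n => mass (f n) S) atTop (𝓝 (mass q S)) := fun S => by
    simpa only [one_mul] using
      tendsto_mass_of_l1 hs hq h (w := fun _ => 1) (fun _ => ⟨zero_le_one, le_rfl⟩) S
  have ht0 : (0 : ℝ) < (2 : ℝ) ^ (-(k : ℝ)) := Real.rpow_pos_of_pos two_pos _
  have ht1 : (2 : ℝ) ^ (-(k : ℝ)) ≤ 1 := Real.rpow_le_one_of_one_le_of_nonpos one_le_two (by simp)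
  refine ⟨fun s => ge_of_tendsto' (hpt s) fun n => (hf n).nonneg s, ?_, fun s hs0 => ?_, ?_,
    le_of_tendsto_of_tendsto' (tendsto_mass_of_l1 hs hq h
      (fun _ => ⟨pow_nonneg ht0.le _, pow_le_one₀ ht0.le ht1⟩) _) ((hm _).const_mul _)
      fun n => (hf n).a_mass,
    le_of_tendsto_of_tendsto' ((hpt _).sub (hpt _)).abs ((hm _).const_mul _)
      fun n => (hf n).a_overlap,
    le_of_tendsto_of_tendsto' (hm _) ((hm _).const_mul _) fun n => (hf n).b_redFree,
    le_of_tendsto_of_tendsto' (hm _) ((hm _).const_mul _) fun n => (hf n).b_redRed,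
    fun x s => le_of_tendsto_of_tendsto' ((hpt _).const_mul _) (hpt _) fun n => (hf n).c_left x s,
    fun x s => le_of_tendsto_of_tendsto' ((hpt _).const_mul _) (hpt _) fun n => (hf n).c_right x s⟩
  · have h1 : ∀ n, mass (f n) Set.univ = 1 := fun n => by
      rw [mass, Set.indicator_univ, (hf n).hasSum_one.tsum_eq]
    have h2 := tendsto_nhds_unique (hm Set.univ) (by simp only [h1]; exact tendsto_const_nhds)
    rw [mass, Set.indicator_univ] at h2
    exact h2 ▸ hq.hasSum
  · by_contra hn
    have h1 : ∀ n, f n s = 0 := fun n => by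
      by_contra hne
      exact hn ((hf n).supported s hne)
    have h2 := hpt s
    simp only [h1] at h2
    exact hs0 (tendsto_nhds_unique tendsto_const_nhds h2).symm
  · funext s
    refine tendsto_nhds_unique (hpt s) ((((hpt s).add (hpt _)).div_const 2).congr fun n => ?_)
    exact (congrFun (hf n).symmetric s).symm

theorem BP_eq (h : Gamma d k T C c 1 q) (a : Admissible k C c) (hlam : 0 ≤ lam) (hT : 1 ≤ T)
    (hC : 200 ≤ C) :
    BP lam T q = normalize (pairOut lam T fun p => (openMass T q)⁻¹ * q p) := by
  have hC1 : 1 ≤ C := by linarith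
  exact BP_eq_normalize_pairOut (inv_ne_zero (h.openMass_pos hC1).ne')
    (h.balanced hC1 a.mul_le a.overlap_le) a.errors h.flip hlam hT a.one_lt

theorem pairOut_gamma (h : Gamma d k T C c 1 q) (a : Admissible k C c) (hd : Regime d k)
    (hlam : 0 ≤ lam) (hlam1 : lam ≤ 1) (hT : 1 ≤ T) (hC : 200 ≤ C) :
    2 ≤ ∑' s, pairOut lam T (fun p => (openMass T q)⁻¹ * q p) s ∧
      Gamma d k T C 1 1 (normalize (pairOut lam T fun p => (openMass T q)⁻¹ * q p)) :=
  (h.balanced (by linarith) a.mul_le a.overlap_le).pairOut_gamma a.errors (a.degree d hd) hlam hlam1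
    hT a.one_lt hC

theorem BP_gamma (h : Gamma d k T C c 1 q) (a : Admissible k C c) (hd : Regime d k)
    (hlam : 0 ≤ lam) (hlam1 : lam ≤ 1) (hT : 1 ≤ T) (hC : 200 ≤ C) :
    Gamma d k T C 1 1 (BP lam T q) := by
  rw [h.BP_eq a hlam hT hC]
  exact (h.pairOut_gamma a hd hlam hlam1 hT hC).2

/-- Rescaling to open mass one costs a factor `2 * (1 + 2 * C) ^ 2`. The final normalization costs
nothing, because both unnormalized outputs have total mass at least 2. -/
theorem l1norm_BP_sub_le (h : Gamma d k T C c 1 q) (h' : Gamma d k T C c 1 q')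
    (a : Admissible k C c) (hd : Regime d k) (hlam : 0 ≤ lam) (hlam1 : lam ≤ 1) (hT : 1 ≤ T)
    (hC : 200 ≤ C) :
    l1norm (fun s => BP lam T q s - BP lam T q' s) ≤
      3200 * errorConst C * (1 + 2 * C) ^ 2 * ((k : ℝ) ^ 4 / 2 ^ k) *
        l1norm fun s => q s - q' s := by
  have hC1 : 1 ≤ C := by linarith
  have b := h.balanced hC1 a.mul_le a.overlap_le
  have b' := h'.balanced hC1 a.mul_le a.overlap_le
  rw [h.BP_eq a hlam hT hC, h'.BP_eq a hlam hT hC]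
  have hE : 0 ≤ errorConst C := by unfold errorConst; positivity
  refine (tsum_abs_normalize_sub_le (summable_varOut hlam hlam1 (b.summable_clauseRatio hlam))
    (summable_varOut hlam hlam1 (b'.summable_clauseRatio hlam))
    (varOut_nonneg (b'.clauseRatio_nonneg hlam)) two_pos
    (h.pairOut_gamma a hd hlam hlam1 hT hC).1 (h'.pairOut_gamma a hd hlam hlam1 hT hC).1).trans ?_
  rw [div_self two_ne_zero, one_mul]
  refine (b.tsum_abs_pairOut_sub_le b' a.errors (a.degree d hd) hlam hlam1 hT a.one_lt).trans ?_
  have h1 := h.tsum_abs_rescale_sub_le h' hC1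
  have h2 : 0 ≤ 1600 * (errorConst C * k ^ 4 * (2 : ℝ) ^ (-(k : ℝ))) := by positivity
  have h3 := mul_le_mul_of_nonneg_left h1 h2
  rw [Real.rpow_neg two_pos.le, Real.rpow_natCast] at h3 ⊢
  unfold l1norm
  calc _ = 1600 * (errorConst C * k ^ 4 * ((2 : ℝ) ^ k)⁻¹) * _ := by ring
    _ ≤ _ := h3
    _ = _ := by ring

end Gamma

theorem trunc_of_hue_ne_zero {x : Bool} {s : DotSpin d k} (h : hue x s ≠ 0) : s.Trunc T := by
  cases s with
  | red y => exact ⟨.red y, zero_le, rfl⟩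
  | blue y => exact ⟨.blue y, zero_le, rfl⟩
  | free t => exact absurd (hue_free x t) h

theorem hue_add (x : Bool) (s : DotSpin d k) : hue x (s.add true) = hue (!x) s := by
  cases s with
  | red y => cases x <;> cases y <;> simp [DotSpin.add, Spin.addLit, hue_red, ind]
  | blue y => cases x <;> cases y <;> simp [DotSpin.add, Spin.addLit, hue_blue, ind]
  | free t => exact (hue_free _ _).trans (hue_free _ _).symm

theorem hue_blue_eq_red (x y : Bool) : hue x (.blue y : DotSpin d k) =
    hue x (.red y : DotSpin d k) := by
  rw [hue_red, hue_blue]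

/-- The equal weight on all pairs of red or blue spins is the main part with no error at all; it
serves as the starting point of the iteration. -/
theorem exists_gamma (hC : 200 ≤ C) :
    ∃ q : DotSpin d k × DotSpin d k → ℝ, Gamma d k T C 1 1 q := by
  refine ⟨_, (gamma_normalize (ε := 0) (δ := 0) (v := fun _ _ => 1) (Q := huePair fun _ _ => 1)
    (huePair_nonneg fun _ _ => zero_le_one) (hasSum_huePair _).summable (fun s hs => ?_)
    (fun s => ?_) (fun x s => ?_) (fun x s => ?_) (fun _ _ => by simp) (by simp) (by norm_num)
    zero_le_one (by positivity) (by rw [add_zero]; positivity) hC).2⟩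
  · obtain ⟨x, -, hx⟩ := Finset.exists_ne_zero_of_sum_ne_zero hs
    obtain ⟨y, -, hy⟩ := Finset.exists_ne_zero_of_sum_ne_zero hx
    rw [one_mul, mul_ne_zero_iff] at hy
    exact ⟨trunc_of_hue_ne_zero hy.1, trunc_of_hue_ne_zero hy.2⟩
  · simp only [huePair, hue_add, Fintype.sum_bool, Bool.not_true, Bool.not_false]
    ring
  · simp only [huePair, hue_blue_eq_red, le_refl]
  · simp only [huePair, hue_blue_eq_red, le_refl]

/-- Banach's argument inside the invariant closed set: successive increments of the iteration halve,
the limit stays in `Gamma`, and the contraction towards it identifies the limit as fixed. -/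
theorem exists_gamma_fixedPoint (a : Admissible k C 1) (hd : Regime d k) (hlam : 0 ≤ lam)
    (hlam1 : lam ≤ 1) (hT : 1 ≤ T) (hC : 200 ≤ C)
    (hk : 3200 * errorConst C * (1 + 2 * C) ^ 2 * ((k : ℝ) ^ 4 / 2 ^ k) ≤ 1 / 2) :
    ∃ q : DotSpin d k × DotSpin d k → ℝ, Gamma d k T C 1 1 q ∧ BP lam T q = q := by
  obtain ⟨q₀, h₀⟩ := exists_gamma (d := d) (k := k) (T := T) hC
  let f : ℕ → DotSpin d k × DotSpin d k → ℝ := fun n => (BP lam T)^[n] q₀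
  have hstep : ∀ n, f (n + 1) = BP lam T (f n) := fun n => Function.iterate_succ_apply' _ _ _
  have hf : ∀ n, Gamma d k T C 1 1 (f n) := fun n => by
    induction n with
    | zero => exact h₀
    | succ n ih => rw [hstep]; exact ih.BP_gamma a hd hlam hlam1 hT hC
  have hcon : ∀ {q q'}, Gamma d k T C 1 1 q → Gamma d k T C 1 1 q' →
      l1norm (fun s => BP lam T q s - BP lam T q' s) ≤ 1 / 2 * l1norm fun s => q s - q' s :=
    fun h h' => (h.l1norm_BP_sub_le h' a hd hlam hlam1 hT hC).trans
      (mul_le_mul_of_nonneg_right hk (tsum_nonneg fun _ => abs_nonneg _))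
  have hs := fun n => (hf n).hasSum_one.summable
  obtain ⟨q, hq, hlim⟩ := exists_l1_limit hs (D := l1norm fun s => f 0 s - f 1 s) fun n => by
    induction n with
    | zero => rw [pow_zero, mul_one]
    | succ n ih =>
      have h1 := hcon (hf n) (hf (n + 1))
      rw [← hstep, ← hstep] at h1
      rw [pow_succ]
      linarith
  have hG := Gamma.of_tendsto hf hq hlim
  refine ⟨q, hG, funext fun s => ?_⟩
  have hG' := hG.BP_gamma a hd hlam hlam1 hT hC
  have h1 : Tendsto (fun n => l1norm fun s => f (n + 1) s - BP lam T q s) atTop (𝓝 0) := by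
    refine squeeze_zero (fun n => tsum_nonneg fun _ => abs_nonneg _) (fun n => ?_)
      (by simpa using hlim.const_mul (1 / 2))
    rw [hstep]
    exact hcon (hf n) hG
  exact tendsto_nhds_unique
    (tendsto_apply_of_l1 (fun n => hs (n + 1)) hG'.hasSum_one.summable h1 s)
    ((tendsto_apply_of_l1 hs hq hlim s).comp (tendsto_add_atTop_nat 1))

theorem eventually_contraction (C : ℝ) : ∀ᶠ k : ℕ in atTop,
    3200 * errorConst C * (1 + 2 * C) ^ 2 * ((k : ℝ) ^ 4 / 2 ^ k) ≤ 1 / 2 := by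
  filter_upwards [eventually_pow_mul_le (3200 * errorConst C * (1 + 2 * C) ^ 2) 4
    (ε := 1 / 2) (by norm_num)] with k hk
  rwa [Real.rpow_neg two_pos.le, Real.rpow_natCast, mul_assoc, ← div_eq_mul_inv] at hk

end fixedPoint

end

end NaeSat

-- The proposition

theorem propositionp :
    ∃ C₀ : ℝ, 0 < C₀ ∧ ∀ C : ℝ, C₀ ≤ C →
      ∃ (A : ℝ) (k₁ : ℕ),
        (∀ k d : ℕ, k₁ ≤ k → NaeSat.Regime d k →
          ∀ (lam : ℝ) (T : ℕ∞), 0 ≤ lam → lam ≤ 1 → 1 ≤ T →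
            ∃! q : NaeSat.DotSpin d k × NaeSat.DotSpin d k → ℝ,
              NaeSat.Gamma d k T C 1 1 q ∧ NaeSat.BP lam T q = q) ∧
        ∀ c : ℝ, 0 < c → c ≤ 1 →
          ∃ k₀ : ℕ, k₁ ≤ k₀ ∧
            ∀ k d : ℕ, k₀ ≤ k → NaeSat.Regime d k →
              ∀ (lam : ℝ) (T : ℕ∞), 0 ≤ lam → lam ≤ 1 → 1 ≤ T →
                ∀ qstar : NaeSat.DotSpin d k × NaeSat.DotSpin d k → ℝ,
                  NaeSat.Gamma d k T C 1 1 qstar → NaeSat.BP lam T qstar = qstar →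
                    (∀ q : NaeSat.DotSpin d k × NaeSat.DotSpin d k → ℝ,
                      NaeSat.Gamma d k T C c 1 q →
                        NaeSat.Gamma d k T C 1 1 (NaeSat.BP lam T q) ∧
                        NaeSat.l1norm (fun s => NaeSat.BP lam T q s - qstar s) ≤
                          A * ((k : ℝ) ^ 4 / 2 ^ k) * NaeSat.l1norm (fun s => q s - qstar s)) ∧
                    ∀ q : NaeSat.DotSpin d k × NaeSat.DotSpin d k → ℝ,
                      NaeSat.Gamma d k T C c 1 q → NaeSat.BP lam T q = q → q = qstar := by
  -- The value required by `gamma_normalize`, whose strongest demand is 320 ≤ 2C.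
  refine ⟨200, by norm_num, fun C hC => ?_⟩
  have hC1 : 1 ≤ C := by linarith
  have key : ∀ c : ℝ, 0 < c → ∃ k₀ : ℕ, ∀ k, k₀ ≤ k → NaeSat.Admissible k C c ∧
      3200 * NaeSat.errorConst C * (1 + 2 * C) ^ 2 * ((k : ℝ) ^ 4 / 2 ^ k) ≤ 1 / 2 := fun c hc =>
    Filter.eventually_atTop.1
      ((NaeSat.eventually_admissible hC1 hc).and (NaeSat.eventually_contraction C))
  have unique : ∀ {c : ℝ} {k d : ℕ}, NaeSat.Admissible k C c →
      3200 * NaeSat.errorConst C * (1 + 2 * C) ^ 2 * ((k : ℝ) ^ 4 / 2 ^ k) ≤ 1 / 2 →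
      NaeSat.Regime d k → ∀ {lam : ℝ} {T : ℕ∞}, 0 ≤ lam → lam ≤ 1 → 1 ≤ T →
      ∀ {q q' : NaeSat.DotSpin d k × NaeSat.DotSpin d k → ℝ}, NaeSat.Gamma d k T C c 1 q →
        NaeSat.Gamma d k T C c 1 q' → NaeSat.BP lam T q = q → NaeSat.BP lam T q' = q' →
        q = q' := by
    intro c k d a hk hd lam T hlam hlam1 hT q q' h h' e e'
    refine NaeSat.eq_of_l1norm_sub_le_half h.hasSum_one.summable h'.hasSum_one.summable ?_
    have h1 := h.l1norm_BP_sub_le h' a hd hlam hlam1 hT hC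
    rw [e, e'] at h1
    exact h1.trans (mul_le_mul_of_nonneg_right hk (tsum_nonneg fun _ => abs_nonneg _))
  obtain ⟨k₁, h₁⟩ := key 1 one_pos
  -- The rate and the first threshold are fixed before `c` is chosen, the threshold being that of
  -- the case c = 1.
  refine ⟨3200 * NaeSat.errorConst C * (1 + 2 * C) ^ 2, k₁,
    fun k d hk hd lam T hlam hlam1 hT => ?_, fun c hc hc1 => ?_⟩
  · obtain ⟨a, hcon⟩ := h₁ k hk
    obtain ⟨q, hq, hfix⟩ := NaeSat.exists_gamma_fixedPoint a hd hlam hlam1 hT hC hcon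
    exact ⟨q, ⟨hq, hfix⟩, fun q' h => unique a hcon hd hlam hlam1 hT h.1 hq h.2 hfix⟩
  · obtain ⟨k₀, h₀⟩ := key c hc
    refine ⟨max k₁ k₀, le_max_left _ _, fun k d hk hd lam T hlam hlam1 hT qstar hs hfix => ?_⟩
    obtain ⟨a, hcon⟩ := h₀ k ((le_max_right _ _).trans hk)
    refine ⟨fun q hq => ⟨hq.BP_gamma a hd hlam hlam1 hT hC, ?_⟩, fun q hq hfq =>
      unique a hcon hd hlam hlam1 hT hq (hs.mono hc1) hfq hfix⟩
    -- The fixed point lies in the smaller set and hence in the larger one, so the contraction on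
    -- the larger set applies to it and `q`.
    have h1 := hq.l1norm_BP_sub_le (hs.mono hc1) a hd hlam hlam1 hT hC
    rwa [hfix] at h1
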